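/- **Setting.** Let $G$ be a finite-dimensional real Lie group, $H\subset G$ a closed connected subgroup, $\mathfrak h\subset\mathfrak g$ their Lie algebras and $X=G/H$. Let $E_0\to X$ be a locally trivial bundle of $\mathbb Z$-graded manifolds with typical fibre $F$, on which $G$ acts smoothly by bundle morphisms covering the canonical action on $X$. Let $E\to T[1]X$ be the pullback of $E_0$ along $T[1]X\to X$; functions on $E$ are the horizontal forms on $E_0$. Let $(E,Q,T[1]X)$ be a homogeneous standard gauge PDE: $Q=\nabla+q$ is a vector field on $E$ of degree $1$ with $Q^2=0$, invariant under the induced action of $G$, where $\nabla$ has form degree $1$ and is determined by a connection of $E_0\to X$ (in particular $Q$ projects to the de Rham vector field of $T[1]X$), and $q$ is vertical, of form degree $0$ and ghost degree $1$; in coordinates $Q=\theta^\mu\big(\partial_{x^\mu}+\Gamma^A_\mu(x,\psi)\,\partial_{\psi^A}\big)+q^A(x,\psi)\,\partial_{\psi^A}$. Identify $F$ with the fibre of $E_0$ over $[e]$ by a local trivialization around $[e]$. For $a\in\mathfrak g$ let $\rho(a)$ be the fundamental vector field on $E_0$, tangent to $\exp(-ta)\,p$ at $t=0$, and let $\rho_F(a)$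 be the restriction to $F$ of its vertical part with respect to the connection. Assume that the connection has the Maurer–Cartan form: for every smooth local section $\sigma$ of $G\to G/H$, in the local trivialization $(x,f)\mapsto \sigma(x)f$ of $E_0$, the horizontal distribution is generated by $$\frac{\partial}{\partial x^\mu}+\omega_\mu^\alpha\,\rho_F(t_\alpha),$$ where $t_\alpha$ is a basis of $\mathfrak g$ and $\omega_\mu^\alpha dx^\mu$ are the components of the pullback by $\sigma$ of the left-invariant Maurer–Cartan form of $G$. **Proposition.** The vector field $q$ restricts to a vector field $q_F$ on $F$ of degree $1$ with $q_F^2=0$, and $$Q=\mathrm d_G+\omega^\alpha\rho_F(t_\alpha)+q_F,$$ where $\omega^\alpha$ are the components of the left-invariant Maurer–Cartan form of $G$, maps functions of total degree $d$ on $T[1]G\times F$ to functions of total degree $d+1$ and satisfies $Q^2=0$. The gauge PDE $(E,Q,T[1]X)$ is the quotient of $(T[1]G\times F,Q)$ by the map $T[1]G\times F\to E$ induced by $(g,f)\mapsto gf$ and by the differential of $G\to G/H$. That is: the body of $E$ is the quotient of the body of $G\times F$, as a topological space, by the relation $(gh,f)\sim(g,hf)$, $h\in H$; and over every open subset of the body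 of $E$ the pullback of functions on $E$ to functions on $T[1]G\times F$ is well defined, injective, multiplicative, intertwines the two vector fields $Q$, and has as its image exactly the functions annihilated by $$\hat l(t)+\rho_F(t)\qquad\text{and}\qquad I_{l(t)}\qquad\text{for all } t\in\mathfrak h,$$ where $l(t)$ is the left-invariant vector field of $t$, $\hat l(t)$ is its lift to $T[1]G$ (the Lie derivative of forms along $l(t)$), and $I_{l(t)}$ is the contraction of forms with $l(t)$. -/

import Mathlib

universe u v

open scoped Manifold ContDiff Topology
open TopologicalSpace

set_option linter.unusedSectionVars false

noncomputable section

namespace GradedGeom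

/-! ## Graded manifolds -/

/-- A sheaf of `ℤ`-graded, graded-commutative real algebras on a topological space. The parity of
a homogeneous function is its degree modulo two. The total algebra of an open set is the direct sum
of its homogeneous parts, and gluing is required for homogeneous sections of a fixed degree. -/
structure GradedSheaf (M : Type u) [TopologicalSpace M] where
  O : Opens M → Type u
  [ring : ∀ U, Ring (O U)]
  [algebra : ∀ U, Algebra ℝ (O U)]
  /-- the functions of ghost degree `k` -/
  gr : ∀ U, ℤ → Submodule ℝ (O U)
  one_mem : ∀ U, (1 : O U) ∈ gr U 0
  mul_mem : ∀ U i j f g, f ∈ gr U i → g ∈ gr U j → f * g ∈ gr U (i + j)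
  internal : ∀ U, DirectSum.IsInternal (gr U)
  comm : ∀ U i j f g, f ∈ gr U i → g ∈ gr U j → f * g = (i * j).negOnePow • (g * f)
  res : ∀ {U V : Opens M}, U ≤ V → O V →ₐ[ℝ] O U
  res_mem : ∀ {U V : Opens M} (h : U ≤ V) k f, f ∈ gr V k → res h f ∈ gr U k
  res_self : ∀ {U : Opens M} (h : U ≤ U) f, res h f = f
  res_res : ∀ {U V W : Opens M} (h : U ≤ V) (h' : V ≤ W) f, res h (res h' f) = res (h.trans h') f
  locality : ∀ (V : Opens M) k f g, f ∈ gr V k → g ∈ gr V k →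
    (∀ p ∈ V, ∃ (U : Opens M) (h : U ≤ V), p ∈ U ∧ res h f = res h g) → f = g
  gluing : ∀ (V : Opens M) (U : V → Opens M) (hU : ∀ p, U p ≤ V) (_ : ∀ p : V, p.1 ∈ U p)
    (k : ℤ) (f : ∀ p, O (U p)), (∀ p, f p ∈ gr (U p) k) →
    (∀ p q, res (inf_le_left : U p ⊓ U q ≤ U p) (f p) = res inf_le_right (f q)) →
    ∃ g ∈ gr V k, ∀ p, res (hU p) g = f p

attribute [instance] GradedSheaf.ring GradedSheaf.algebra

section Charts

variable {M : Type u} [TopologicalSpace M]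

/-- The open set `{p | (n, p) ∈ W}`. -/
def slice {N : Type*} [TopologicalSpace N] (W : Opens (N × M)) (n : N) : Opens M :=
  ⟨{p | (n, p) ∈ W}, W.isOpen.preimage (by fun_prop)⟩

/-- Total degree of a multi-index of graded coordinates. -/
def mdeg {A : Type*} (deg : A → ℤ) (m : A →₀ ℕ) : ℤ := m.sum fun a n => n * deg a

/-- A multi-index is admissible if every odd coordinate occurs at most once. -/
def Admissible {A : Type*} (deg : A → ℤ) (m : A →₀ ℕ) : Prop := ∀ a, Odd (deg a) → m a ≤ 1

/-- The sign in `ξ^m * ξ^m' = sign • ξ^(m + m')` for the increasingly ordered monomials. -/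
def koszulSign {A : Type*} [LinearOrder A] (deg : A → ℤ) (m m' : A →₀ ℕ) : ℤ :=
  (-1) ^ ∑ a ∈ m.support, ∑ b ∈ m'.support,
    if b < a ∧ Odd (deg a) ∧ Odd (deg b) then m a * m' b else 0

/-- Coefficient functions `u n m p` (parameter `n`, multi-index `m`, body point `p`) are
jointly smooth near `(n₀, p₀)` with respect to the body coordinates `x`: near that point they are
smooth functions of `n` and of finitely many of the coordinates `x`, and only finitely many of the
graded coordinates occur. If there are finitely many coordinates, this is ordinary
smoothness of all the coefficients. -/
def SmoothGerm {N EN HN : Type*} [NormedAddCommGroup EN] [NormedSpace ℝ EN]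
    [TopologicalSpace HN] (I : ModelWithCorners ℝ EN HN) [TopologicalSpace N] [ChartedSpace HN N]
    {B A : Type*} (x : M → B → ℝ) (u : N → (A →₀ ℕ) → M → ℝ) (q : N × M) : Prop :=
  ∃ (J : Finset B) (A' : Finset A) (h : (A →₀ ℕ) → N × (J → ℝ) → ℝ) (V : Set (N × (J → ℝ))),
    IsOpen V ∧ (q.1, fun j : J => x q.2 j) ∈ V ∧
    (∀ m, ContMDiffOn (I.prod 𝓘(ℝ, J → ℝ)) 𝓘(ℝ, ℝ) ∞ (h m) V) ∧
    (∀ m, ¬ m.support ⊆ A' → h m = 0) ∧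
    ∀ᶠ r in 𝓝 q, ∀ m, u r.1 m r.2 = h m (r.1, fun j : J => x r.2 j)

/-- A coordinate chart: an isomorphism of the sheaf over an open set `dom` with the sheaf of
graded algebras of formal power series `∑ u_m(x) ξ^m` in coordinates `ξ^a` of nonzero degree `deg a`
(odd ones anticommuting), whose coefficients `u_m` are smooth functions of the body coordinates `x`.
`coef W h f m p` is the coefficient of `ξ^m` in `f`, evaluated at `p` and extended by zero
outside `W`. -/
structure GradedChart (S : GradedSheaf M) where
  dom : Opens M
  B : Type u
  A : Type u
  [order : LinearOrder A]
  deg : A → ℤ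
  deg_ne : ∀ a, deg a ≠ 0
  x : M → B → ℝ
  isOpenEmbedding : Topology.IsOpenEmbedding fun p : dom => x p
  coef : ∀ W : Opens M, W ≤ dom → S.O W →ₗ[ℝ] ((A →₀ ℕ) → M → ℝ)
  coef_off : ∀ W h f m p, p ∉ W → coef W h f m p = 0
  coef_res : ∀ W h W' (h' : W' ≤ W) f m, ∀ p ∈ W',
    coef W' (h'.trans h) (S.res h' f) m p = coef W h f m p
  coef_adm : ∀ W h f m, ¬ Admissible deg m → coef W h f m = 0
  coef_deg : ∀ W h k, ∀ f ∈ S.gr W k, ∀ m, mdeg deg m ≠ k → coef W h f m = 0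
  coef_one : ∀ W h m, ∀ p ∈ W, coef W h 1 m p = if m = 0 then 1 else 0
  coef_mul : ∀ W h f g m, Admissible deg m → ∀ p ∈ W, coef W h (f * g) m p =
    ∑ r ∈ Finset.HasAntidiagonal.antidiagonal m,
      (koszulSign deg r.1 r.2 : ℝ) * coef W h f r.1 p * coef W h g r.2 p
  coef_smooth : ∀ W h k, ∀ f ∈ S.gr W k, ∀ p ∈ W,
    SmoothGerm 𝓘(ℝ, Fin 0 → ℝ) x (fun _ : Fin 0 → ℝ => coef W h f) (0, p)
  coef_injective : ∀ W h f, coef W h f = 0 → f = 0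
  coef_surjective : ∀ W h k (u : (A →₀ ℕ) → M → ℝ),
    (∀ m, ¬ Admissible deg m ∨ mdeg deg m ≠ k → u m = 0) → (∀ m, ∀ p ∉ W, u m p = 0) →
    (∀ p ∈ W, SmoothGerm 𝓘(ℝ, Fin 0 → ℝ) x (fun _ : Fin 0 → ℝ => u) (0, p)) →
    ∃ f ∈ S.gr W k, coef W h f = u

attribute [instance] GradedChart.order

variable {S : GradedSheaf M}

/-- Coefficients of the restriction of `f` to the chart domain. -/
def GradedChart.cf (c : GradedChart S) (W : Opens M) (f : S.O W) : (c.A →₀ ℕ) → M → ℝ :=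
  c.coef (W ⊓ c.dom) inf_le_right (S.res inf_le_left f)

/-- A family `n ↦ s n` of functions has jointly smooth coefficients in the chart near `q`. -/
def GradedChart.SmoothFamAt (c : GradedChart S) {N EN HN : Type*} [NormedAddCommGroup EN]
    [NormedSpace ℝ EN] [TopologicalSpace HN] (I : ModelWithCorners ℝ EN HN) [TopologicalSpace N]
    [ChartedSpace HN N] (W : Opens (N × M)) (s : ∀ n, S.O (slice W n)) (q : N × M) : Prop :=
  SmoothGerm I c.x (fun n m p => c.cf (slice W n) (s n) m p) q

end Charts

/-- A `ℤ`-graded manifold: a Hausdorff second countable space (the body) with a sheaf of graded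
algebras and an atlas of compatible charts. Both the number of coordinates of degree zero and
the number of the other coordinates may be finite or infinite. -/
structure GradedManifold where
  carrier : Type u
  [top : TopologicalSpace carrier]
  [t2 : T2Space carrier]
  [sc : SecondCountableTopology carrier]
  sheaf : GradedSheaf carrier
  atlas : Set (GradedChart sheaf)
  cover : ∀ p, ∃ c ∈ atlas, p ∈ c.dom
  compat : ∀ c ∈ atlas, ∀ c' ∈ atlas, ∀ (d : ℕ) (W : Opens ((Fin d → ℝ) × carrier)) (k : ℤ)
    (s : ∀ n, sheaf.O (slice W n)), (∀ n, s n ∈ sheaf.gr (slice W n) k) →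
    ∀ q ∈ W, q.2 ∈ c.dom → q.2 ∈ c'.dom →
    c.SmoothFamAt 𝓘(ℝ, Fin d → ℝ) W s q → c'.SmoothFamAt 𝓘(ℝ, Fin d → ℝ) W s q

attribute [instance] GradedManifold.top GradedManifold.t2 GradedManifold.sc

namespace GradedManifold

variable (M : GradedManifold.{u})

/-- Functions on an open set of the body. -/
abbrev O (U : Opens M.carrier) : Type _ := M.sheaf.O U

variable {M}

abbrev gr (U : Opens M.carrier) (k : ℤ) : Submodule ℝ (M.O U) := M.sheaf.gr U k

abbrev res {U V : Opens M.carrier} (h : U ≤ V) : M.O V →ₐ[ℝ] M.O U := M.sheaf.res h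

section Families

variable {N EN HN : Type*} [NormedAddCommGroup EN] [NormedSpace ℝ EN] [TopologicalSpace HN]
  [TopologicalSpace N] [ChartedSpace HN N]

variable (M) in
/-- Families `n ↦ s n` of functions on the slices of an open set `W` of `N × M`, with pointwise
algebra structure. A function on an open set of the product of an ordinary manifold `N` with a
graded manifold `M` is such a family which is smooth, see `IsSmoothFam`. -/
abbrev Fam (W : Opens (N × M.carrier)) : Type _ := ∀ n, M.O (slice W n)

/-- `s` is a function of degree `k` on the open set `W` of the graded manifold `N × M`. -/
def IsSmoothFam (I : ModelWithCorners ℝ EN HN) (W : Opens (N × M.carrier)) (k : ℤ)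
    (s : M.Fam W) : Prop :=
  (∀ n, s n ∈ M.gr (slice W n) k) ∧
    ∀ c ∈ M.atlas, ∀ q ∈ W, q.2 ∈ c.dom → c.SmoothFamAt I W s q

/-- `t` is the derivative at `n` of the family `s` along the tangent vector `v` of `N`. -/
def HasFamDeriv (I : ModelWithCorners ℝ EN HN) (W : Opens (N × M.carrier)) (s : M.Fam W) (n : N)
    (v : TangentSpace I n) (t : M.O (slice W n)) : Prop :=
  ∀ c ∈ M.atlas, ∀ p, (n, p) ∈ W → p ∈ c.dom → ∀ m,
    c.cf (slice W n) t m p =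
      mfderiv I 𝓘(ℝ, ℝ) (fun n' => c.cf (slice W n') (s n') m p) n v

open Classical in
/-- The derivative at `n` of the family `s` along the tangent vector `v` of `N`. -/
def famDeriv (I : ModelWithCorners ℝ EN HN) (W : Opens (N × M.carrier)) (s : M.Fam W) (n : N)
    (v : TangentSpace I n) : M.O (slice W n) :=
  if h : ∃ t, HasFamDeriv I W s n v t then h.choose else 0

end Families

end GradedManifold

open GradedManifold

/-- A vector field of degree `d` on a graded manifold: a graded derivation of the sheaf of functions.
It acts on functions of `ℝ^n × M` parameter-wise. -/
structure VField (M : GradedManifold.{u}) (d : ℤ) where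
  D : ∀ U, M.O U →ₗ[ℝ] M.O U
  D_res : ∀ {U V : Opens M.carrier} (h : U ≤ V) f, D U (M.res h f) = M.res h (D V f)
  D_mem : ∀ U k, ∀ f ∈ M.gr U k, D U f ∈ M.gr U (k + d)
  leibniz : ∀ U k, ∀ f ∈ M.gr U k, ∀ g,
    D U (f * g) = D U f * g + (d * k).negOnePow • (f * D U g)
  smooth : ∀ (n : ℕ) (W : Opens ((Fin n → ℝ) × M.carrier)) k (s : M.Fam W),
    IsSmoothFam 𝓘(ℝ, Fin n → ℝ) W k s →
    IsSmoothFam 𝓘(ℝ, Fin n → ℝ) W (k + d) fun r => D (slice W r) (s r)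

/-- The open set of all `(n, (x, y))` with `(x, y) ∈ D` and `(n, φ (x, y)) ∈ W`. -/
def pullOpens {P N M M' : Type*} [TopologicalSpace P] [TopologicalSpace N] [TopologicalSpace M]
    [TopologicalSpace M'] (D : Opens (N × M)) (φ : N × M → M') (hφ : ContinuousOn φ D)
    (W : Opens (P × M')) : Opens ((P × N) × M) :=
  ⟨{r | (r.1.2, r.2) ∈ D ∧ (r.1.1, φ (r.1.2, r.2)) ∈ W}, by
    have h1 : IsOpen {r : (P × N) × M | (r.1.2, r.2) ∈ D} := D.isOpen.preimage (by fun_prop)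
    have h2 : ContinuousOn (fun r : (P × N) × M => (r.1.1, φ (r.1.2, r.2)))
        {r : (P × N) × M | (r.1.2, r.2) ∈ D} :=
      ContinuousOn.prodMk (by fun_prop) (hφ.comp (by fun_prop) fun r hr => hr)
    exact h2.isOpen_inter_preimage h1 W.isOpen⟩

/-- A morphism of graded manifolds to `M'` from an open set `dom` of the product of an ordinary
manifold `N` and a graded manifold `M`. `pull n U W h` is the pullback of functions along the
restriction `{n} × W → U`. The pullback of a smooth function, also one that depends
smoothly on additional parameters, is smooth. -/
structure ParamMap (EN N : Type*) [NormedAddCommGroup EN] [NormedSpace ℝ EN]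
    [TopologicalSpace N] [ChartedSpace EN N]
    (M : GradedManifold.{u}) (M' : GradedManifold.{v}) where
  dom : Opens (N × M.carrier)
  toFun : N × M.carrier → M'.carrier
  cont : ContinuousOn toFun dom
  pull : ∀ (n : N) (U : Opens M'.carrier) (W : Opens M.carrier),
    (∀ y ∈ W, (n, y) ∈ dom ∧ toFun (n, y) ∈ U) → M'.O U →ₐ[ℝ] M.O W
  pull_mem : ∀ n U W h k, ∀ f ∈ M'.gr U k, pull n U W h f ∈ M.gr W k
  res_pull : ∀ n U W h W' (hW : W' ≤ W) f,
    M.res hW (pull n U W h f) = pull n U W' (fun y hy => h y (hW hy)) f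
  pull_res : ∀ n U U' W (hU : U' ≤ U) h f,
    pull n U' W h (M'.res hU f) = pull n U W (fun y hy => ⟨(h y hy).1, hU (h y hy).2⟩) f
  smooth : ∀ (d : ℕ) (W : Opens ((Fin d → ℝ) × M'.carrier)) k (s : M'.Fam W),
    IsSmoothFam 𝓘(ℝ, Fin d → ℝ) W k s →
    IsSmoothFam (𝓘(ℝ, Fin d → ℝ).prod 𝓘(ℝ, EN)) (pullOpens dom toFun cont W) k
      fun r => pull r.2 (slice W r.1) (slice (pullOpens dom toFun cont W) r) (fun _ hy => hy)
        (s r.1)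

namespace ParamMap

variable {EN N : Type*} [NormedAddCommGroup EN] [NormedSpace ℝ EN] [TopologicalSpace N]
  [ChartedSpace EN N] {M : GradedManifold.{u}} {M' : GradedManifold.{v}}

/-- Pullback of families depending on additional parameters. -/
def pullFam (φ : ParamMap EN N M M') {P : Type*} [TopologicalSpace P]
    (W : Opens (P × M'.carrier)) (s : M'.Fam W) : M.Fam (pullOpens φ.dom φ.toFun φ.cont W) :=
  fun r => φ.pull r.2 (slice W r.1) (slice (pullOpens φ.dom φ.toFun φ.cont W) r)
    (fun _ hy => hy) (s r.1)

end ParamMap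

/-! ## Vector fields on ordinary manifolds and forms -/

/-- Smooth vector fields on an ordinary manifold. -/
abbrev Vect (E M : Type*) [NormedAddCommGroup E] [NormedSpace ℝ E] [TopologicalSpace M]
    [ChartedSpace E M] [IsManifold 𝓘(ℝ, E) ∞ M] : Type _ :=
  Cₛ^∞⟮𝓘(ℝ, E); E, (TangentSpace 𝓘(ℝ, E) : M → Type _)⟯

/-- The Lie bracket of smooth vector fields. -/
def Vect.bracket {E M : Type*} [NormedAddCommGroup E] [NormedSpace ℝ E] [FiniteDimensional ℝ E]
    [TopologicalSpace M] [ChartedSpace E M] [IsManifold 𝓘(ℝ, E) ∞ M] (v w : Vect E M) :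
    Vect E M where
  toFun := VectorField.mlieBracket 𝓘(ℝ, E) v w
  contMDiff_toFun := by
    have : CompleteSpace E := FiniteDimensional.complete ℝ E
    have : IsManifold 𝓘(ℝ, E) (((⊤ : ℕ∞) : WithTop ℕ∞) + 1) M := by
      simpa using (inferInstance : IsManifold 𝓘(ℝ, E) ∞ M)
    have : IsManifold 𝓘(ℝ, E) (minSmoothness ℝ 2) M := by
      simpa using (inferInstance : IsManifold 𝓘(ℝ, E) 2 M)
    have : IsManifold 𝓘(ℝ, E) (minSmoothness ℝ 3) M := by
      simpa using (inferInstance : IsManifold 𝓘(ℝ, E) 3 M)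
    intro x
    exact ContMDiffAt.mlieBracket_vectorField (m := ⊤) (n := ⊤) (v.contMDiff x) (w.contMDiff x)
      (by simp)

/-- Sequences `α p` of functions of `p` vector fields in `X` with values in `R`. A differential form
of mixed form degree is such a sequence which is multilinear over the functions and alternating. -/
abbrev PreForm (X R : Type*) : Type _ := ∀ p : ℕ, (Fin p → X) → R

namespace PreForm

variable {X R : Type*}

section

variable [AddCommGroup R]

/-- `∑ i, (-1)^i D_{v i} (α (v 0, …, omit v i, …, v n))`, the operator `θ^μ D_μ`. -/
def altSum (D : X → R → R) (α : PreForm X R) : PreForm X R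
  | 0, _ => 0
  | n + 1, v => ∑ i : Fin (n + 1), (-1 : ℤ) ^ (i : ℕ) • D (v i) (α n (i.removeNth v))

/-- `∑ i < j, (-1)^(i+j) α ([v i, v j], v 0, …, omit v i, …, omit v j, …)`. -/
def bracketSum (br : X → X → X) (α : PreForm X R) : PreForm X R
  | 0, _ => 0
  | 1, _ => 0
  | n + 2, v => ∑ j : Fin (n + 2), ∑ i : Fin (n + 1), if i.castSucc < j then
      (-1 : ℤ) ^ ((i : ℕ) + j) •
        α (n + 1) (Fin.cons (br (v i.castSucc) (v j)) (i.removeNth (j.removeNth v)))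
    else 0

/-- The exterior covariant derivative for the derivative `D`, by the Cartan–Koszul formula. -/
def extDer (br : X → X → X) (D : X → R → R) (α : PreForm X R) : PreForm X R :=
  altSum D α + bracketSum br α

/-- Extension of an operator `q` of odd degree on coefficients to forms: it anticommutes with
the multiplication by one-forms. -/
def oddExt (q : R → R) (α : PreForm X R) : PreForm X R :=
  fun p v => (-1 : ℤ) ^ p • q (α p v)

/-- Extension of an operator of even degree on coefficients to forms. -/
def evenExt (q : R → R) (α : PreForm X R) : PreForm X R := fun p v => q (α p v)

/-- Contraction with the vector field `l`. -/
def contract (l : X) (α : PreForm X R) : PreForm X R := fun p v => α (p + 1) (Fin.cons l v)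

open Classical in
/-- The Lie derivative of forms along the vector field `l`. -/
def lieDer (br : X → X → X) (D : X → R → R) (l : X) (α : PreForm X R) : PreForm X R :=
  fun p v => D l (α p v) - ∑ i, α p (Function.update v i (br l (v i)))

end

/-- The graded wedge product `α β`, where `α` has total degree `d`. -/
def mul [Ring R] [Algebra ℝ R] (d : ℤ) (α β : PreForm X R) : PreForm X R := fun n v =>
  ∑ r ∈ (Finset.HasAntidiagonal.antidiagonal n).attach,
    ((d - r.1.1) * r.1.2).negOnePow • ((r.1.1.factorial * r.1.2.factorial : ℝ)⁻¹ •
      ∑ σ : Equiv.Perm (Fin n), (Equiv.Perm.sign σ : ℤˣ) •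
        (α r.1.1 (fun i => v (σ (Fin.cast (Finset.HasAntidiagonal.mem_antidiagonal.1 r.2) (Fin.castAdd _ i)))) *
          β r.1.2 (fun i => v (σ (Fin.cast (Finset.HasAntidiagonal.mem_antidiagonal.1 r.2) (Fin.natAdd _ i))))))

end PreForm

/-! ## Graded bundles over an ordinary manifold -/

section Bundles

variable (EX X : Type*) [NormedAddCommGroup EX] [NormedSpace ℝ EX] [TopologicalSpace X]
  [ChartedSpace EX X] [IsManifold 𝓘(ℝ, EX) ∞ X] (F : GradedManifold.{u}) (E : GradedManifold.{v})

/-- A graded manifold `E` together with a morphism `E → X` to an ordinary manifold, given by the map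
of bodies and the pullback of smooth functions. -/
structure GradedOver where
  proj : E.carrier → X
  continuous_proj : Continuous proj
  pull : C^∞⟮𝓘(ℝ, EX), X; ℝ⟯ →ₐ[ℝ] E.O ⊤
  pull_mem : ∀ f, pull f ∈ E.gr ⊤ 0

variable {EX X E}

/-- The pullback of a smooth function on the base, restricted to `U`. -/
def GradedOver.fn (π : GradedOver EX X E) (U : Opens E.carrier)
    (f : C^∞⟮𝓘(ℝ, EX), X; ℝ⟯) : E.O U := E.res le_top (π.pull f)

/-- A local trivialization with typical fibre `F`: an isomorphism of graded manifolds
`base × F → proj⁻¹ base` over `base ⊆ X`. -/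
structure LocalTriv (π : GradedOver EX X E) where
  base : Opens X
  map : ParamMap EX X F E
  mem_dom : ∀ x y, (x, y) ∈ map.dom ↔ x ∈ base
  proj_map : ∀ x y, x ∈ base → π.proj (map.toFun (x, y)) = x
  bijective : ∀ b, π.proj b ∈ base → ∃! y, map.toFun (π.proj b, y) = b
  isOpen_image : ∀ Y : Set (X × F.carrier), IsOpen Y → Y ⊆ map.dom → IsOpen (map.toFun '' Y)
  pull_fn : ∀ x U W h f, x ∈ base → map.pull x U W h (π.fn U f) = algebraMap ℝ (F.O W) (f x)
  iso : ∀ (d : ℕ) (W : Opens ((Fin d → ℝ) × E.carrier)), (∀ r ∈ W, π.proj r.2 ∈ base) →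
    ∀ k (s' : F.Fam (pullOpens map.dom map.toFun map.cont W)),
    IsSmoothFam (𝓘(ℝ, Fin d → ℝ).prod 𝓘(ℝ, EX)) _ k s' →
    ∃! s : E.Fam W, IsSmoothFam 𝓘(ℝ, Fin d → ℝ) W k s ∧ map.pullFam W s = s'

variable (EX X E)

/-- A locally trivial graded fibre bundle with typical fibre `F`. -/
structure GradedBundle extends GradedOver EX X E where
  locally_trivial : ∀ x, ∃ T : LocalTriv F toGradedOver, x ∈ T.base

variable {EX X E F}

/-- Functions of total degree `d` on the pullback of the bundle along `T[1]X → X`, over the open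
set `U` of the body: horizontal forms. The component of form degree `p` is an alternating map which
is multilinear over the smooth functions of `X`, with values of ghost degree `d - p`. -/
def IsHorizontalForm (π : GradedOver EX X E) (U : Opens E.carrier) (d : ℤ)
    (α : PreForm (Vect EX X) (E.O U)) : Prop :=
  (∀ (p : ℕ) v, α p v ∈ E.gr U (d - p)) ∧
  (∀ p v i w w', α p (Function.update v i (w + w')) =
    α p (Function.update v i w) + α p (Function.update v i w')) ∧
  (∀ p v i w w' (f : C^∞⟮𝓘(ℝ, EX), X; ℝ⟯), (∀ x, w' x = f x • w x) →
    α p (Function.update v i w') = π.fn U f * α p (Function.update v i w)) ∧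
  (∀ p v i j, i ≠ j → v i = v j → α p v = 0)

/-- A (not necessarily flat) connection on the bundle, as a lift of vector fields of the base
to degree zero vector fields of the total space, linear over the functions of the base. -/
structure Connection (π : GradedOver EX X E) where
  cov : Vect EX X → VField E 0
  cov_add : ∀ v w U f, (cov (v + w)).D U f = (cov v).D U f + (cov w).D U f
  cov_smul : ∀ v w (h : C^∞⟮𝓘(ℝ, EX), X; ℝ⟯), (∀ x, w x = h x • v x) →
    ∀ U f, (cov w).D U f = π.fn U h * (cov v).D U f
  cov_fn : ∀ v (h h' : C^∞⟮𝓘(ℝ, EX), X; ℝ⟯),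
    (∀ x, h' x = mfderiv 𝓘(ℝ, EX) 𝓘(ℝ, ℝ) h x (v x)) →
    ∀ U, (cov v).D U (π.fn U h) = π.fn U h'

/-- The vector field `∇ + q` on the pullback of the bundle to `T[1]X`, acting on horizontal forms.
In coordinates it is `θ^μ (∂_μ + Γ_μ^A ∂_A) + q^A ∂_A`. -/
def totalQ [FiniteDimensional ℝ EX] {π : GradedOver EX X E} (nabla : Connection π)
    (q : VField E 1) (U : Opens E.carrier) (α : PreForm (Vect EX X) (E.O U)) :
    PreForm (Vect EX X) (E.O U) :=
  PreForm.extDer Vect.bracket (fun v => (nabla.cov v).D U) α + PreForm.oddExt (q.D U) α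

end Bundles

/-- A standard gauge PDE over `X`, with total space the pullback of `E → X` to `T[1]X`:
`Q = ∇ + q` with `∇` of form degree one, determined by a connection of `E → X`, and with a vertical
vector field `q` of ghost degree one. That `Q` projects to the de Rham vector field of `T[1]X` is
contained in the condition on `∇` that it lifts the vector fields of `X`. -/
structure StandardGPDE (EX X : Type*) [NormedAddCommGroup EX] [NormedSpace ℝ EX]
    [FiniteDimensional ℝ EX] [TopologicalSpace X] [ChartedSpace EX X]
    [IsManifold 𝓘(ℝ, EX) ∞ X] (F : GradedManifold.{u}) (E : GradedManifold.{v}) extends GradedBundle EX X F E where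
  nabla : Connection toGradedOver
  q : VField E 1
  q_vertical : ∀ U f, q.D U (toGradedOver.fn U f) = 0
  Q_sq : ∀ U d α, IsHorizontalForm toGradedOver U d α →
    totalQ nabla q U (totalQ nabla q U α) = 0

/-! ## Homogeneous gauge PDEs -/

section Homogeneous

variable (EG : Type*) {G : Type*} [NormedAddCommGroup EG] [NormedSpace ℝ EG]
  [FiniteDimensional ℝ EG] [TopologicalSpace G] [ChartedSpace EG G] [Group G]
  [LieGroup 𝓘(ℝ, EG) ∞ G]
  (EX : Type*) [NormedAddCommGroup EX] [NormedSpace ℝ EX] [FiniteDimensional ℝ EX]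
  (H : Subgroup G) [ChartedSpace EX (G ⧸ H)] [IsManifold 𝓘(ℝ, EX) ∞ (G ⧸ H)]
  (F : GradedManifold.{u}) (E : GradedManifold.{v})

/-- A smooth action of `G` on a graded manifold over `G ⧸ H`, by bundle morphisms that cover the
canonical action on `G ⧸ H`. -/
structure BundleAction (π : GradedOver EX (G ⧸ H) E) where
  act : ParamMap EG G E E
  dom_eq : act.dom = ⊤
  one_act : ∀ b, act.toFun (1, b) = b
  mul_act : ∀ g g' b, act.toFun (g * g', b) = act.toFun (g, act.toFun (g', b))
  proj_act : ∀ g b, π.proj (act.toFun (g, b)) = g • π.proj b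
  pull_one : ∀ U W h (h' : W ≤ U) f, act.pull 1 U W h f = E.res h' f
  pull_mul : ∀ g g' U U' W h h₁ h₂ f,
    act.pull (g * g') U W h f = act.pull g' U' W h₁ (act.pull g U U' h₂ f)
  pull_fn : ∀ g U W h (f f' : C^∞⟮𝓘(ℝ, EX), G ⧸ H; ℝ⟯), (∀ x, f' x = f (g • x)) →
    act.pull g U W h (π.fn U f) = π.fn W f'

variable {EG EX H F E}

namespace BundleAction

variable {π : GradedOver EX (G ⧸ H) E} (a : BundleAction EG EX H E π)

theorem continuous_act : Continuous a.act.toFun := by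
  have h := a.act.cont
  rw [a.dom_eq] at h
  exact continuousOn_univ.1 h

/-- The open set `g⁻¹ U`. -/
def preimage (g : G) (U : Opens E.carrier) : Opens E.carrier :=
  ⟨{b | a.act.toFun (g, b) ∈ U}, U.isOpen.preimage (a.continuous_act.comp (by fun_prop))⟩

/-- The pullback `g^* : C^∞(U) → C^∞(g⁻¹ U)`. -/
def pull (g : G) (U : Opens E.carrier) : E.O U →ₐ[ℝ] E.O (a.preimage g U) :=
  a.act.pull g U (a.preimage g U) fun y hy => ⟨by rw [a.dom_eq]; trivial, hy⟩

/-- `α' = g^* α` for the action on horizontal forms which extends the action on `E` and covers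
the canonical action of `G` on `T[1](G ⧸ H)`. -/
def IsFormPull (g : G) (U : Opens E.carrier) (α : PreForm (Vect EX (G ⧸ H)) (E.O U))
    (α' : PreForm (Vect EX (G ⧸ H)) (E.O (a.preimage g U))) : Prop :=
  ∀ (p : ℕ) (v' v : Fin p → Vect EX (G ⧸ H)),
    (∀ i x, v i (g • x) = mfderiv 𝓘(ℝ, EX) 𝓘(ℝ, EX) (fun z : G ⧸ H => g • z) x (v' i x)) →
    α' p v' = a.pull g U (α p v)

/-- `{(g, b) | g b ∈ U}` -/
def actOpens (U : Opens E.carrier) : Opens (G × E.carrier) :=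
  ⟨a.act.toFun ⁻¹' U, U.isOpen.preimage a.continuous_act⟩

/-- The pullback of a function along the action map, a function on an open set of `G × E`. -/
def actFam (U : Opens E.carrier) (f : E.O U) : E.Fam (a.actOpens U) := fun g => a.pull g U f

/-- The fundamental vector field `ρ(t)` applied to `f`: the derivative of `f (exp(-s t) b)`
with respect to `s` at `s = 0`. -/
def fundamental (t : GroupLieAlgebra 𝓘(ℝ, EG) G) (U : Opens E.carrier) (f : E.O U) : E.O U :=
  E.res (fun b hb => show a.act.toFun (1, b) ∈ U by rw [a.one_act]; exact hb)
    (famDeriv 𝓘(ℝ, EG) (a.actOpens U) (a.actFam U f) 1 (-t))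

end BundleAction

variable (EG EX H F E)

/-- A homogeneous standard gauge PDE over `G ⧸ H`: the underlying bundle is homogeneous, and `Q` is
invariant under the action of `G` extended to the pullback of the bundle to `T[1](G ⧸ H)`. -/
structure HomogeneousGPDE extends StandardGPDE EX (G ⧸ H) F E where
  action : BundleAction EG EX H E toGradedOver
  Q_invariant : ∀ g U d α α', IsHorizontalForm toGradedOver U d α →
    IsHorizontalForm toGradedOver (action.preimage g U) d α' → action.IsFormPull g U α α' →
    action.IsFormPull g U (totalQ nabla q U α) (totalQ nabla q (action.preimage g U) α')

variable {EG EX H F E}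

/-- The left-invariant vector field `l(t)` on `G`. -/
def leftInvariant (t : GroupLieAlgebra 𝓘(ℝ, EG) G) : Vect EG G where
  toFun := mulInvariantVectorField t
  contMDiff_toFun := by
    let fg : G → TangentBundle 𝓘(ℝ, EG) G := fun g => Bundle.TotalSpace.mk' EG g 0
    have sfg : ContMDiff 𝓘(ℝ, EG) 𝓘(ℝ, EG).tangent ∞ fg := Bundle.contMDiff_zeroSection _ _
    let fv : G → TangentBundle 𝓘(ℝ, EG) G := fun _ => Bundle.TotalSpace.mk' EG 1 t
    have sfv : ContMDiff 𝓘(ℝ, EG) 𝓘(ℝ, EG).tangent ∞ fv := contMDiff_const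
    let F₂ := (equivTangentBundleProd 𝓘(ℝ, EG) G 𝓘(ℝ, EG) G).symm
    let F₃ := tangentMap (𝓘(ℝ, EG).prod 𝓘(ℝ, EG)) 𝓘(ℝ, EG) (fun p : G × G => p.1 * p.2)
    have S₃ : ContMDiff (𝓘(ℝ, EG).prod 𝓘(ℝ, EG)).tangent 𝓘(ℝ, EG).tangent ∞ F₃ :=
      ContMDiff.contMDiff_tangentMap (n := ∞) (contMDiff_mul 𝓘(ℝ, EG) ∞) (by simp)
    have S := (S₃.comp (contMDiff_equivTangentBundleProd_symm (n := ∞))).comp (sfg.prodMk sfv)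
    convert! S with g
    · simp [F₃, fg, fv]
    · simp only [Function.comp_apply, tangentMap, F₃, fg, fv]
      rw [mfderiv_prod_eq_add_apply
        ((contMDiff_mul 𝓘(ℝ, EG) ∞).mdifferentiableAt (by simp))]
      change mulInvariantVectorField t g =
        mfderiv 𝓘(ℝ, EG) 𝓘(ℝ, EG) (fun z : G => z * 1) g (0 : EG) +
          mfderiv 𝓘(ℝ, EG) 𝓘(ℝ, EG) (fun z : G => g * z) 1 t
      erw [map_zero, zero_add]
      rfl

/-- The left-invariant Maurer–Cartan form of `G`. -/
def maurerCartan (g : G) (v : TangentSpace 𝓘(ℝ, EG) g) : GroupLieAlgebra 𝓘(ℝ, EG) G :=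
  mfderiv 𝓘(ℝ, EG) 𝓘(ℝ, EG) (fun z : G => g⁻¹ * z) g v

variable (EG) in
/-- The Lie algebra of the subgroup `H`: velocities at the identity of smooth curves in `H`. -/
def subgroupLie (H : Subgroup G) : Set (GroupLieAlgebra 𝓘(ℝ, EG) G) :=
  {t | ∃ γ : ℝ → G, ContMDiff 𝓘(ℝ, ℝ) 𝓘(ℝ, EG) ∞ γ ∧ γ 0 = 1 ∧ (∀ s, γ s ∈ H) ∧
    mfderiv 𝓘(ℝ, ℝ) 𝓘(ℝ, EG) γ 0 (1 : ℝ) = t}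

/-! ### The orbit map `G × F → E` of the fibre over `[e]` -/

namespace HomogeneousGPDE

variable (S : HomogeneousGPDE EG EX H F E) (T : LocalTriv F S.toGradedOver)
  (hT : (QuotientGroup.mk 1 : G ⧸ H) ∈ T.base)

/-- The identification `ι` of `F` with the fibre over `[e]`, by a trivialization around `[e]`. -/
def fibre (y : F.carrier) : E.carrier := T.map.toFun (QuotientGroup.mk 1, y)

/-- The body `(g, y) ↦ g ι(y)` of the orbit map `G × F → E`. -/
def orbit (r : G × F.carrier) : E.carrier := S.action.act.toFun (r.1, S.fibre T r.2)

/-- The restriction `ι^*` of functions to the fibre over `[e]`. -/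
def fibrePull (U : Opens E.carrier) (W : Opens F.carrier) (h : ∀ y ∈ W, S.fibre T y ∈ U) :
    E.O U →ₐ[ℝ] F.O W :=
  T.map.pull (QuotientGroup.mk 1) U W fun y hy => ⟨(T.mem_dom _ _).2 hT, h y hy⟩

/-- The pullback of functions by `W → U`, `y ↦ g ι(y)`. -/
def orbitPull (g : G) (U : Opens E.carrier) (W : Opens F.carrier)
    (h : ∀ y ∈ W, S.orbit T (g, y) ∈ U) : E.O U →ₐ[ℝ] F.O W :=
  (S.fibrePull T hT (S.action.preimage g U) W h).comp (S.action.pull g U)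

theorem continuous_fibre (hT : (QuotientGroup.mk 1 : G ⧸ H) ∈ T.base) : Continuous (S.fibre T) :=
  T.map.cont.comp_continuous (by fun_prop) fun _ => (T.mem_dom _ _).2 hT

theorem continuous_orbit (hT : (QuotientGroup.mk 1 : G ⧸ H) ∈ T.base) : Continuous (S.orbit T) :=
  S.action.continuous_act.comp
    (continuous_fst.prodMk ((S.continuous_fibre T hT).comp continuous_snd))

/-- The preimage in `G × F` of an open set of the body of `E`. -/
def orbitOpens (U : Opens E.carrier) : Opens (G × F.carrier) :=
  ⟨S.orbit T ⁻¹' U, U.isOpen.preimage (S.continuous_orbit T hT)⟩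

/-- `ρF` is the action of the Lie algebra of `G` on the fibre `F` over `[e]` by the vertical parts
of the fundamental vector fields: `ρF t` is the restriction to the fibre of `ρ(t) - ∇_w`, where `w`
is a vector field on `G ⧸ H` which coincides at `[e]` with the fundamental one, that is, with
the velocity of `exp(-s t) [e]` at `s = 0`. -/
def IsFibreAction (ρF : GroupLieAlgebra 𝓘(ℝ, EG) G → VField F 0) : Prop :=
  ∀ t U W (h : ∀ y ∈ W, S.fibre T y ∈ U) k, ∀ f ∈ E.gr U k, ∀ w : Vect EX (G ⧸ H),
    w (QuotientGroup.mk 1) =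
      mfderiv 𝓘(ℝ, EG) 𝓘(ℝ, EX) (QuotientGroup.mk : G → G ⧸ H) 1 (-t) →
    (ρF t).D W (S.fibrePull T hT U W h f) =
      S.fibrePull T hT U W h (S.action.fundamental t U f - (S.nabla.cov w).D U f)

/-- `qF` is the restriction of the vertical vector field `q` to the fibre over `[e]`. -/
def IsFibreQ (qF : VField F 1) : Prop :=
  ∀ U W (h : ∀ y ∈ W, S.fibre T y ∈ U) f,
    qF.D W (S.fibrePull T hT U W h f) = S.fibrePull T hT U W h (S.q.D U f)

/-- The open set of `(x, y)` with `x ∈ V` and `σ(x) ι(y) ∈ U`. -/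
def sectionOpens (V : Opens (G ⧸ H)) (σ : G ⧸ H → G) (hσ : ContinuousOn σ V)
    (U : Opens E.carrier) : Opens ((G ⧸ H) × F.carrier) :=
  ⟨{r | r.1 ∈ V ∧ S.orbit T (σ r.1, r.2) ∈ U}, by
    have h1 : IsOpen {r : (G ⧸ H) × F.carrier | r.1 ∈ V} := V.isOpen.preimage continuous_fst
    have h2 : ContinuousOn (fun r : (G ⧸ H) × F.carrier => S.orbit T (σ r.1, r.2))
        {r | r.1 ∈ V} :=
      (S.continuous_orbit T hT).comp_continuousOn
        ((hσ.comp continuousOn_fst fun r hr => hr).prodMk continuousOn_snd)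
    exact h2.isOpen_inter_preimage h1 U.isOpen⟩

/-- The connection has the Maurer–Cartan form: for every smooth local section `σ` of
`G → G ⧸ H` over an open set `V`, in the local trivialization `(x, y) ↦ σ(x) ι(y)`, the
covariant derivative is `∇_v = v^μ (∂_μ + ω_μ^α ρF(t_α))`, where `ω` is the pullback by `σ` of the
left-invariant Maurer–Cartan form of `G`. -/
def HasMaurerCartanForm (ρF : GroupLieAlgebra 𝓘(ℝ, EG) G → VField F 0) : Prop :=
  ∀ (V : Opens (G ⧸ H)) (σ : G ⧸ H → G) (hσ : ContMDiffOn 𝓘(ℝ, EX) 𝓘(ℝ, EG) ∞ σ V),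
    (∀ x ∈ V, (QuotientGroup.mk (σ x) : G ⧸ H) = x) →
    ∀ U k, ∀ f ∈ E.gr U k, ∀ (v : Vect EX (G ⧸ H)), ∀ x ∈ V,
      let W := S.sectionOpens T hT V σ hσ.continuousOn U
      let s : F.Fam W := fun z => S.orbitPull T hT (σ z) U (slice W z) (fun _ hy => hy.2) f
      S.orbitPull T hT (σ x) U (slice W x) (fun _ hy => hy.2) ((S.nabla.cov v).D U f) =
        famDeriv 𝓘(ℝ, EX) W s x (v x) +
          (ρF (maurerCartan (σ x) (mfderiv 𝓘(ℝ, EX) 𝓘(ℝ, EG) σ x (v x)))).D (slice W x) (s x)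

end HomogeneousGPDE

/-! ### The graded manifold `T[1]G × F` -/

/-- Functions of total degree `d` on `T[1]G × F`, over the open set `W` of the body `G × F`:
differential forms on `G` whose components of form degree `p` have as values functions on
`G × F` of ghost degree `d - p`. -/
def IsProdForm (W : Opens (G × F.carrier)) (d : ℤ) (β : PreForm (Vect EG G) (F.Fam W)) : Prop :=
  (∀ (p : ℕ) v, IsSmoothFam 𝓘(ℝ, EG) W (d - p) (β p v)) ∧
  (∀ p v i w w', β p (Function.update v i (w + w')) =
    β p (Function.update v i w) + β p (Function.update v i w')) ∧
  (∀ p v i w w' (f : C^∞⟮𝓘(ℝ, EG), G; ℝ⟯), (∀ x, w' x = f x • w x) →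
    ∀ g, β p (Function.update v i w') g = f g • β p (Function.update v i w) g) ∧
  (∀ p v i j, i ≠ j → v i = v j → β p v = 0)

/-- The derivative of functions on `G × F` along a vector field on `G`. -/
def dirDeriv (W : Opens (G × F.carrier)) (v : Vect EG G) (s : F.Fam W) : F.Fam W :=
  fun g => famDeriv 𝓘(ℝ, EG) W s g (v g)

/-- The action on functions on `G × F` of a linear map `D` for every open set of `F`. -/
def fibrewise (D : ∀ U, F.O U →ₗ[ℝ] F.O U) (W : Opens (G × F.carrier)) (s : F.Fam W) : F.Fam W :=
  fun g => D (slice W g) (s g)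

/-- The de Rham vector field `d_G`. -/
def dG (W : Opens (G × F.carrier)) (β : PreForm (Vect EG G) (F.Fam W)) :
    PreForm (Vect EG G) (F.Fam W) :=
  PreForm.extDer Vect.bracket (dirDeriv W) β

/-- The vector field `ω^α ρF(t_α)`, with `ω` the Maurer–Cartan form of `G`. -/
def mcAction (ρF : GroupLieAlgebra 𝓘(ℝ, EG) G → VField F 0) (W : Opens (G × F.carrier))
    (β : PreForm (Vect EG G) (F.Fam W)) : PreForm (Vect EG G) (F.Fam W) :=
  PreForm.altSum (fun v s g => (ρF (maurerCartan g (v g))).D (slice W g) (s g)) β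

/-- The vector field `Q = d_G + ω^α ρF(t_α) + qF` on `T[1]G × F`. -/
def prodQ (ρF : GroupLieAlgebra 𝓘(ℝ, EG) G → VField F 0) (qF : VField F 1)
    (W : Opens (G × F.carrier)) (β : PreForm (Vect EG G) (F.Fam W)) :
    PreForm (Vect EG G) (F.Fam W) :=
  dG W β + mcAction ρF W β + PreForm.oddExt (fibrewise qF.D W) β

/-- `β` is annihilated by `l̂(t) + ρF(t)` and by `I_{l(t)}` for all `t` in the Lie algebra of `H`. -/
def IsBasic (H : Subgroup G) (ρF : GroupLieAlgebra 𝓘(ℝ, EG) G → VField F 0)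
    (W : Opens (G × F.carrier)) (β : PreForm (Vect EG G) (F.Fam W)) : Prop :=
  ∀ t ∈ subgroupLie EG H,
    PreForm.lieDer Vect.bracket (dirDeriv W) (leftInvariant t) β +
      PreForm.evenExt (fibrewise (ρF t).D W) β = 0 ∧
    PreForm.contract (leftInvariant t) β = 0

namespace HomogeneousGPDE

variable (S : HomogeneousGPDE EG EX H F E) (T : LocalTriv F S.toGradedOver)
  (hT : (QuotientGroup.mk 1 : G ⧸ H) ∈ T.base)

/-- `β` is the pullback of the horizontal form `α` by the map `T[1]G × F → E` induced by the orbit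
map `G × F → E` and by the differential of `G → G ⧸ H`. -/
def IsOrbitPullback (U : Opens E.carrier) (α : PreForm (Vect EX (G ⧸ H)) (E.O U))
    (β : PreForm (Vect EG G) (F.Fam (S.orbitOpens T hT U))) : Prop :=
  ∀ (p : ℕ) (g : G) (v : Fin p → Vect EG G) (w : Fin p → Vect EX (G ⧸ H)),
    (∀ i, w i (QuotientGroup.mk g) =
      mfderiv 𝓘(ℝ, EG) 𝓘(ℝ, EX) (QuotientGroup.mk : G → G ⧸ H) g (v i g)) →
    β p v g = S.orbitPull T hT g U (slice (S.orbitOpens T hT U) g) (fun _ hy => hy) (α p w)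

/-- `(E, Q)` is the quotient of `(T[1]G × F, Q)` by the orbit map: on bodies, `E` is the quotient of
`G × F` by the right action of `H`, that is, by `(g h, y) ∼ (g, h y)`; over every open set
of the body of `E`, the pullback of functions exists, is injective and multiplicative,
has as image the functions that are annihilated by `l̂(t) + ρF(t)` and `I_{l(t)}` for `t` in the Lie
algebra of `H`, and intertwines the vector fields `Q`. -/
structure IsQuotient (ρF : GroupLieAlgebra 𝓘(ℝ, EG) G → VField F 0) (qF : VField F 1) : Prop where
  isQuotientMap : Topology.IsQuotientMap (S.orbit T)
  orbit_eq_iff : ∀ g g' y y', S.orbit T (g, y) = S.orbit T (g', y') ↔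
    ∃ h ∈ H, g' = g * h ∧ S.fibre T y = S.action.act.toFun (h, S.fibre T y')
  exists_pullback : ∀ U d α, IsHorizontalForm S.toGradedOver U d α →
    ∃! β, IsProdForm (S.orbitOpens T hT U) d β ∧ S.IsOrbitPullback T hT U α β
  injective : ∀ U d α α' β, IsHorizontalForm S.toGradedOver U d α →
    IsHorizontalForm S.toGradedOver U d α' → S.IsOrbitPullback T hT U α β →
    S.IsOrbitPullback T hT U α' β → α = α'
  range_eq : ∀ U d β, IsProdForm (S.orbitOpens T hT U) d β →
    ((∃ α, IsHorizontalForm S.toGradedOver U d α ∧ S.IsOrbitPullback T hT U α β) ↔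
      IsBasic H ρF (S.orbitOpens T hT U) β)
  map_mul : ∀ U d d' α α' β β', IsHorizontalForm S.toGradedOver U d α →
    IsHorizontalForm S.toGradedOver U d' α' →
    IsProdForm (S.orbitOpens T hT U) d β → IsProdForm (S.orbitOpens T hT U) d' β' →
    S.IsOrbitPullback T hT U α β → S.IsOrbitPullback T hT U α' β' →
    S.IsOrbitPullback T hT U (PreForm.mul d α α') (PreForm.mul d β β')
  map_Q : ∀ U d α β, IsHorizontalForm S.toGradedOver U d α →
    IsProdForm (S.orbitOpens T hT U) d β → S.IsOrbitPullback T hT U α β →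
    S.IsOrbitPullback T hT U (totalQ S.nabla S.q U α) (prodQ ρF qF (S.orbitOpens T hT U) β)

end HomogeneousGPDE

end Homogeneous

end GradedGeom

end

/-!
The homogeneous gauge PDE on `E` is recovered from `G × F` through the orbit map
`(g, y) ↦ g ι(y)`, where `ι` is the inclusion of `F` as the fibre over the identity coset. For fixed
`g` this is the embedding of `F` as the fibre over `[g]`, and a function on `E` pulls back to a family
of functions on `F` with parameter `g ∈ G`. The statement consists of one differential identity for
such families and of a descent argument.

**Families.** A graded manifold is only given by its functions, so a smooth family has to be
differentiated with respect to its parameter through Hadamard's lemma, `IsSmoothFam.hadamard`: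
near a point, `s r = s a + ∑ j, (r j - a j) • w j r` with smooth families `w j`. Hence smooth families
have derivatives (`IsSmoothFam.hasFamDeriv`), and every operator that is linear, local and preserves
smooth families commutes with these derivatives (`LocalOp.hasFamDeriv`): one applies it to the
expansion. Vector fields and pullbacks are operators of this kind. For the same reason a vertical
vector field restricts to every fibre of a trivialization (`LocalTriv.exists_restrict`), which
provides `q_F`.

**Structure equations.** The components of `Q² = 0` say that `q² = 0`, that `q` commutes with the
covariant derivatives `∇_w`, and that `∇` is flat (`q_q_of_mem`, `cov_q`, `cov_cov`); the invariance of
`Q` splits into those of `q` and `∇` (`q_pull`, `cov_pull`). By equivariance, the definition of `ρ_F` at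
the identity propagates to all of `G` and gives the identity `IsFibreAction.orbitPull_cov`: if `v` is a
tangent vector at `g` that projects to `w` at `[g]`, then the pullback of `∇_w f` to `{g} × F` is the
derivative of the pullback of `f` along `v`, plus `ρ_F` of the Maurer–Cartan form of `v` applied to the
pullback. This also shows that the connection takes the Maurer–Cartan form in the trivialization
given by a local section.

**The vector field on `T[1]G × F`.** The right hand side of this identity is a covariant derivative
`covDeriv` on functions of `G × F`. It is flat (`IsFibreAction.isFlat`), since `ρ_F` represents the
brackets of left-invariant vector fields (`IsFibreAction.lie`), and it commutes with `q_F`. Now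
`Q = d_G + ω^α ρ_F(t_α) + q_F` is the exterior covariant derivative of `covDeriv` plus the extension of
`q_F` to forms (`prodQ_eq`). Both anticommuting summands square to zero by the Cartan calculus, which is
developed for modules with a covariant derivative (`CovModule`): contraction with a vector field turns
an identity for forms into one of lower degree, so that `d² = 0` follows by induction from Cartan's
formula. This proves `IsFibreQ.prodQ_prodQ`. The pullback of a form is given on projectable vector
fields by pullbacks of functions, and brackets of projectable fields project to brackets; hence
`IsFibreAction.orbitPull_cov` implies that it intertwines the two vector fields
(`IsOrbitPullback.totalQ`).

**The quotient.** The orbit map is surjective with continuous local sections, and its fibres are the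
orbits of `H` (`isQuotientMap_orbit`, `orbit_eq_orbit_iff`). Functions on `E` are determined by their
restrictions to the fibres of a trivialization, whence the injectivity of the pullback
(`eq_of_orbitPull`). For `t ∈ 𝔥`, the field `l(t)` projects to zero, so the pullback of a function is
annihilated by the covariant derivative along `l(t)`, and the pullback of a form is basic
(`IsOrbitPullback.isBasic`).

Conversely, the values of a basic form on lifts of vector fields of `G ⧸ H` are families annihilated by
the covariant derivatives along `𝔥`. Such a family is the pullback of a function along a local section of
`G → G ⧸ H`, because the orbit map over a section is a trivialization. That it agrees with
the pullback of this function everywhere is the statement that it vanishes on `g H` if it vanishes at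
`g`. As `H` is connected, it is generated by the end points of smooth curves in `H`
(`le_of_smooth_curves`); along such a curve `γ`, the functions `(γ(r)⁻¹)^* s(g γ(r))` on the fibre have
derivative zero and are therefore constant (`IsFibreAction.eq_zero_of_curve`). This uses that the
Lie algebra of `H`, given by velocities of curves, is the kernel of the differential of the
projection (`mem_subgroupLie_iff`), and that on this kernel `ρ_F` is the fundamental vector field
itself. The local functions glue (`IsFibreAction.exists_orbitFam_eq`), and so do the forms
(`IsBasic.exists_isOrbitPullback`).
-/


noncomputable section

namespace GradedGeom

universe w

/-! ### Hadamard's lemma with parameters -/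

section Hadamard

open MeasureTheory Set

variable {Z : Type*} [NormedAddCommGroup Z] [NormedSpace ℝ Z] [FiniteDimensional ℝ Z]

/-- Differentiation under the integral sign over a compact interval. -/
theorem hasFDerivAt_parametric_integral {K : ℝ × Z → ℝ} {Ω : Set (ℝ × Z)} (hΩ : IsOpen Ω)
    (hK : ContDiffOn ℝ 1 K Ω) {z : Z} (hz : ∀ t ∈ Icc (0 : ℝ) 1, (t, z) ∈ Ω) :
    IntervalIntegrable (fun t => (fderiv ℝ K (t, z)).comp (.inr ℝ ℝ Z)) volume 0 1 ∧
    HasFDerivAt (fun z => ∫ t in (0 : ℝ)..1, K (t, z))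
      (∫ t in (0 : ℝ)..1, (fderiv ℝ K (t, z)).comp (.inr ℝ ℝ Z)) z := by
  have hdiff : ∀ p ∈ Ω, DifferentiableAt ℝ K p := fun p hp =>
    (hK.differentiableOn (by simp)).differentiableAt (hΩ.mem_nhds hp)
  have hcont : ContinuousOn (fderiv ℝ K) Ω := hK.continuousOn_fderiv_of_isOpen hΩ le_rfl
  -- by compactness of the interval, one ball of parameters around `z` stays inside `Ω`, and the
  -- derivative of `K` is bounded there
  have htube : ∀ᶠ z' in 𝓝 z, ∀ t ∈ Icc (0 : ℝ) 1, (t, z') ∈ Ω := by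
    refine isCompact_Icc.eventually_forall_of_forall_eventually fun t ht => ?_
    have : Filter.Tendsto (fun q : Z × ℝ => (q.2, q.1)) (𝓝 (z, t)) (𝓝 (t, z)) :=
      (continuous_snd.prodMk continuous_fst).tendsto _
    exact this (hΩ.mem_nhds (hz t ht))
  obtain ⟨ε, hε, hball⟩ := Metric.nhds_basis_closedBall.mem_iff.1 htube
  have hsub : Icc (0 : ℝ) 1 ×ˢ Metric.closedBall z ε ⊆ Ω := fun q hq => hball hq.2 q.1 hq.1
  have hc : IsCompact (Icc (0 : ℝ) 1 ×ˢ Metric.closedBall z ε) :=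
    isCompact_Icc.prod (isCompact_closedBall z ε)
  obtain ⟨C, hC⟩ := hc.exists_bound_of_continuousOn (hcont.mono hsub)
  have hsl : ∀ z' ∈ Metric.closedBall z ε, ContinuousOn (fun t : ℝ => (t, z')) (uIcc (0 : ℝ) 1) :=
    fun z' _ => by fun_prop
  have hmaps : ∀ z' ∈ Metric.closedBall z ε, MapsTo (fun t : ℝ => (t, z')) (uIcc (0 : ℝ) 1) Ω := by
    intro z' hz' t ht
    rw [uIcc_of_le zero_le_one] at ht
    exact hball hz' t ht
  have hz0 : z ∈ Metric.closedBall z ε := Metric.mem_closedBall_self hε.le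
  have hcont' : ContinuousOn (fun t => (fderiv ℝ K (t, z)).comp (.inr ℝ ℝ Z)) (uIcc (0 : ℝ) 1) :=
    (hcont.comp (hsl z hz0) (hmaps z hz0)).clm_comp continuousOn_const
  refine ⟨hcont'.intervalIntegrable, ?_⟩
  refine intervalIntegral.hasFDerivAt_integral_of_dominated_of_fderiv_le
    (F' := fun z t => (fderiv ℝ K (t, z)).comp (.inr ℝ ℝ Z))
    (bound := fun _ => C * ‖ContinuousLinearMap.inr ℝ ℝ Z‖)
    (Metric.closedBall_mem_nhds z hε) ?_ ?_ ?_ ?_ ?_ ?_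
  · filter_upwards [Metric.closedBall_mem_nhds z hε] with z' hz'
    exact ((hK.continuousOn.comp (hsl z' hz') (hmaps z' hz')).mono
      uIoc_subset_uIcc).aestronglyMeasurable measurableSet_uIoc
  · exact (hK.continuousOn.comp (hsl z hz0) (hmaps z hz0)).intervalIntegrable
  · exact (hcont'.mono uIoc_subset_uIcc).aestronglyMeasurable measurableSet_uIoc
  · refine Filter.Eventually.of_forall fun t ht z' hz' => ?_
    have ht' := uIoc_subset_uIcc ht
    rw [uIcc_of_le zero_le_one] at ht'
    exact (ContinuousLinearMap.opNorm_comp_le _ _).trans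
      (mul_le_mul_of_nonneg_right (hC (t, z') ⟨ht', hz'⟩) (norm_nonneg _))
  · exact intervalIntegrable_const
  · refine Filter.Eventually.of_forall fun t ht z' hz' => ?_
    have ht' := hmaps z' hz' (uIoc_subset_uIcc ht)
    exact (hdiff _ ht').hasFDerivAt.comp z' (hasFDerivAt_prodMk_right t z')

/-- An integral over `[0, 1]` of a function that is smooth near `[0, 1] × V` depends smoothly on
the parameter in `V`. -/
theorem contDiffOn_parametric_integral {V : Set Z} (hV : IsOpen V) {Ω : Set (ℝ × Z)}
    (hΩ : IsOpen Ω) (hsub : ∀ z ∈ V, ∀ t ∈ Icc (0 : ℝ) 1, (t, z) ∈ Ω) {K : ℝ × Z → ℝ}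
    (hK : ContDiffOn ℝ ∞ K Ω) : ContDiffOn ℝ ∞ (fun z => ∫ t in (0 : ℝ)..1, K (t, z)) V := by
  rw [contDiffOn_infty]
  intro n
  induction n generalizing K with
  | zero =>
    refine contDiffOn_zero.2 fun z hz => ?_
    exact (hasFDerivAt_parametric_integral hΩ (hK.of_le (by simp))
      (hsub z hz)).2.continuousAt.continuousWithinAt
  | succ n ih =>
    have hd : ∀ z ∈ V, _ := fun z hz =>
      hasFDerivAt_parametric_integral hΩ (hK.of_le (by simp)) (hsub z hz)
    have := (contDiffOn_succ_iff_fderiv_apply (𝕜 := ℝ) (n := n)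
      (f := fun z => ∫ t in (0 : ℝ)..1, K (t, z)) hV.uniqueDiffOn).2
    push_cast
    refine this ⟨fun z hz => (hd z hz).2.differentiableAt.differentiableWithinAt, by simp,
      fun y => ?_⟩
    have hK' : ContDiffOn ℝ ∞ (fun q => fderiv ℝ K q (0, y)) Ω :=
      ((contDiffOn_infty_iff_fderiv_of_isOpen hΩ).1 hK).2.clm_apply contDiffOn_const
    refine (ih hK').congr fun z hz => ?_
    rw [fderivWithin_of_isOpen hV hz, (hd z hz).2.fderiv,
      ContinuousLinearMap.intervalIntegral_apply (hd z hz).1]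
    simp

/-- Hadamard's lemma for a function that depends smoothly on parameters. -/
theorem hadamard {d : ℕ} {Y : Type*} [NormedAddCommGroup Y] [NormedSpace ℝ Y]
    [FiniteDimensional ℝ Y] {a : Fin d → ℝ} {ε : ℝ} {B : Set Y} (hB : IsOpen B)
    {h : (Fin d → ℝ) × Y → ℝ} (hh : ContDiffOn ℝ ∞ h (Metric.ball a ε ×ˢ B)) :
    ∃ w : Fin d → (Fin d → ℝ) × Y → ℝ,
      (∀ j, ContDiffOn ℝ ∞ (w j) (Metric.ball a ε ×ˢ B)) ∧ (h = 0 → ∀ j, w j = 0) ∧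
      ∀ r ∈ Metric.ball a ε, ∀ y ∈ B, h (r, y) = h (a, y) + ∑ j, (r j - a j) * w j (r, y) := by
  have hO : IsOpen (Metric.ball a ε ×ˢ B) := Metric.isOpen_ball.prod hB
  -- the quotients are the integrals of the partial derivatives along the segment `φ (·, z)` from
  -- `a` to the first component of `z`
  let φ : ℝ × ((Fin d → ℝ) × Y) → (Fin d → ℝ) × Y := fun q => (a + q.1 • (q.2.1 - a), q.2.2)
  have hφ : ContDiff ℝ ∞ φ := by fun_prop
  have hdiff : ∀ p ∈ Metric.ball a ε ×ˢ B, DifferentiableAt ℝ h p := fun p hp =>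
    (hh.differentiableOn (by simp)).differentiableAt (hO.mem_nhds hp)
  have hmem : ∀ z ∈ Metric.ball a ε ×ˢ B, ∀ t ∈ Icc (0 : ℝ) 1,
      φ (t, z) ∈ Metric.ball a ε ×ˢ B := by
    intro z hz t ht
    refine ⟨?_, hz.2⟩
    have := (convex_ball a ε) (Metric.mem_ball_self (Metric.pos_of_mem_ball hz.1)) hz.1
      (sub_nonneg.2 ht.2) ht.1 (by ring)
    convert this using 1
    simp only [φ]
    module
  have hΩ : IsOpen (φ ⁻¹' (Metric.ball a ε ×ˢ B)) := hO.preimage hφ.continuous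
  let D : Fin d → (Fin d → ℝ) × Y → ℝ := fun j q => fderiv ℝ h q (Pi.single j 1, 0)
  have hD : ∀ j, ContDiffOn ℝ ∞ (D j) (Metric.ball a ε ×ˢ B) := fun j =>
    ((contDiffOn_infty_iff_fderiv_of_isOpen hO).1 hh).2.clm_apply contDiffOn_const
  have hDφ : ∀ j, ContDiffOn ℝ ∞ (fun q => D j (φ q)) (φ ⁻¹' (Metric.ball a ε ×ˢ B)) := fun j =>
    (hD j).comp hφ.contDiffOn fun q hq => hq
  have hline : ∀ z ∈ Metric.ball a ε ×ˢ B, ∀ j,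
      ContinuousOn (fun t : ℝ => D j (φ (t, z))) (uIcc 0 1) := by
    intro z hz j
    refine (hDφ j).continuousOn.comp (by fun_prop) fun t ht => ?_
    rw [uIcc_of_le zero_le_one] at ht
    exact hmem z hz t ht
  refine ⟨fun j z => ∫ t in (0 : ℝ)..1, D j (φ (t, z)), fun j => ?_, ?_, fun r hr y hy => ?_⟩
  · exact contDiffOn_parametric_integral hO hΩ hmem (hDφ j)
  · rintro rfl j
    funext z
    simp [D]
  · have hz : (r, y) ∈ Metric.ball a ε ×ˢ B := ⟨hr, hy⟩
    have hsum : ∀ q, fderiv ℝ h q (r - a, 0) = ∑ j, (r j - a j) * D j q := by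
      intro q
      have hv : fderiv ℝ h q (r - a, 0) = ((fderiv ℝ h q).comp (.inl ℝ _ Y)).toLinearMap (r - a) := by simp
      rw [hv, LinearMap.pi_apply_eq_sum_univ]
      refine Finset.sum_congr rfl fun j _ => ?_
      have : (fun i => if j = i then (1 : ℝ) else 0) = Pi.single j 1 := by
        ext i
        simp [Pi.single_apply, eq_comm]
      simp [D, this]
    -- fundamental theorem of calculus along the segment
    have hF := intervalIntegral.integral_eq_sub_of_hasDerivAt (a := (0 : ℝ)) (b := 1)
      (f := fun t => h (φ (t, (r, y)))) (f' := fun t => ∑ j, (r j - a j) * D j (φ (t, (r, y))))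
      (fun t ht => ?_) ?_
    · have hI : ∀ j ∈ Finset.univ, IntervalIntegrable
          (fun t => (r j - a j) * D j (φ (t, (r, y)))) volume 0 1 := fun j _ =>
        (continuousOn_const.mul (hline _ hz j)).intervalIntegrable
      rw [intervalIntegral.integral_finsetSum hI] at hF
      simp only [intervalIntegral.integral_const_mul] at hF
      rw [hF]
      simp [φ]
    · rw [uIcc_of_le zero_le_one] at ht
      rw [← hsum]
      have h1 : HasDerivAt (fun t => φ (t, (r, y))) (r - a, 0) t := by
        have : HasDerivAt (fun t : ℝ => a + t • (r - a)) (r - a) t := by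
          simpa using ((hasDerivAt_id t).smul_const (r - a)).const_add a
        exact this.prodMk (hasDerivAt_const t y)
      exact (hdiff _ (hmem _ hz t ht)).hasFDerivAt.comp_hasDerivAt t h1
    · exact (continuousOn_finsetSum _ fun j _ =>
        continuousOn_const.mul (hline _ hz j)).intervalIntegrable

end Hadamard

/-! ### Functions on graded manifolds and their coefficients -/

namespace GradedChart

variable {M : Type u} [TopologicalSpace M] {S : GradedSheaf M} (c : GradedChart S)

theorem cf_off {U : Opens M} (f : S.O U) (m : c.A →₀ ℕ) {p : M} (hp : p ∉ U ∨ p ∉ c.dom) :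
    c.cf U f m p = 0 :=
  c.coef_off _ _ _ _ _ fun h => hp.elim (· h.1) (· h.2)

theorem cf_res {U V : Opens M} (h : U ≤ V) (f : S.O V) (m : c.A →₀ ℕ) {p : M} (hp : p ∈ U) :
    c.cf U (S.res h f) m p = c.cf V f m p := by
  by_cases hd : p ∈ c.dom
  · have := c.coef_res (V ⊓ c.dom) inf_le_right (U ⊓ c.dom) (inf_le_inf_right _ h)
      (S.res inf_le_left f) m p ⟨hp, hd⟩
    rw [S.res_res] at this
    rw [cf, cf, S.res_res]
    exact this
  · rw [cf_off _ _ _ (Or.inr hd), cf_off _ _ _ (Or.inr hd)]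

theorem cf_zero (U : Opens M) (m : c.A →₀ ℕ) (p : M) : c.cf U 0 m p = 0 := by simp [cf]

theorem cf_add {U : Opens M} (f g : S.O U) (m : c.A →₀ ℕ) (p : M) :
    c.cf U (f + g) m p = c.cf U f m p + c.cf U g m p := by simp [cf]

theorem cf_sub {U : Opens M} (f g : S.O U) (m : c.A →₀ ℕ) (p : M) :
    c.cf U (f - g) m p = c.cf U f m p - c.cf U g m p := by simp [cf]

theorem cf_smul {U : Opens M} (a : ℝ) (f : S.O U) (m : c.A →₀ ℕ) (p : M) :
    c.cf U (a • f) m p = a * c.cf U f m p := by simp [cf]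

theorem cf_sum {U : Opens M} {ι : Type*} (t : Finset ι) (f : ι → S.O U) (m : c.A →₀ ℕ) (p : M) :
    c.cf U (∑ i ∈ t, f i) m p = ∑ i ∈ t, c.cf U (f i) m p := by simp [cf]

theorem cf_of_not_mem_degree {U : Opens M} {k : ℤ} {f : S.O U} (hf : f ∈ S.gr U k) {m : c.A →₀ ℕ}
    (hm : ¬ (Admissible c.deg m ∧ mdeg c.deg m = k)) (p : M) : c.cf U f m p = 0 := by
  rcases not_and_or.1 hm with h | h
  · rw [cf, c.coef_adm _ _ _ _ h]; rfl
  · rw [cf, c.coef_deg _ _ k _ (S.res_mem _ _ _ hf) _ h]; rfl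

/-- In the domain of a chart a function is determined by its coefficients. -/
theorem eq_of_cf {U : Opens M} (hU : U ≤ c.dom) {f g : S.O U}
    (h : ∀ p ∈ U, ∀ m, c.cf U f m p = c.cf U g m p) : f = g := by
  have key : S.res (inf_le_left : U ⊓ c.dom ≤ U) (f - g) = 0 := by
    refine c.coef_injective _ inf_le_right _ ?_
    funext m p
    by_cases hp : p ∈ U
    · exact (c.cf_sub f g m p).trans (sub_eq_zero.2 (h p hp m))
    · exact c.coef_off _ _ _ _ _ fun hp' => hp hp'.1
  have h2 : S.res (le_inf le_rfl hU) (S.res (inf_le_left : U ⊓ c.dom ≤ U) (f - g)) = f - g := by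
    rw [S.res_res, S.res_self]
  rw [key, map_zero] at h2
  exact (sub_eq_zero.1 h2.symm)

end GradedChart

namespace GradedManifold

variable {M : GradedManifold.{u}}

theorem res_res' {U V W : Opens M.carrier} (h : U ≤ V) (h' : V ≤ W) (f : M.O W) :
    M.res h (M.res h' f) = M.res (h.trans h') f := M.sheaf.res_res h h' f

theorem res_self' {U : Opens M.carrier} (h : U ≤ U) (f : M.O U) : M.res h f = f :=
  M.sheaf.res_self h f

/-- Every function is a finite sum of homogeneous ones. -/
theorem homogeneous_induction {U : Opens M.carrier} {P : M.O U → Prop} (f : M.O U)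
    (h0 : P 0) (hadd : ∀ f g, P f → P g → P (f + g)) (h : ∀ k, ∀ f ∈ M.gr U k, P f) : P f := by
  have htop : f ∈ ⨆ k, M.gr U k := by
    rw [(M.sheaf.internal U).submodule_iSup_eq_top]; trivial
  exact Submodule.iSup_induction _ (motive := P) htop h h0 hadd

theorem eq_of_cf_gr {U : Opens M.carrier} {k : ℤ} {f g : M.O U} (hf : f ∈ M.gr U k)
    (hg : g ∈ M.gr U k)
    (h : ∀ c ∈ M.atlas, ∀ p ∈ U, p ∈ c.dom → ∀ m, c.cf U f m p = c.cf U g m p) : f = g := by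
  refine M.sheaf.locality U k f g hf hg fun p hp => ?_
  obtain ⟨c, hc, hpc⟩ := M.cover p
  refine ⟨U ⊓ c.dom, inf_le_left, ⟨hp, hpc⟩, c.eq_of_cf inf_le_right fun p' hp' m => ?_⟩
  rw [c.cf_res _ _ _ hp', c.cf_res _ _ _ hp']
  exact h c hc p' hp'.1 hp'.2 m

/-- A function is determined by its coefficients in the charts. -/
theorem eq_of_cf {U : Opens M.carrier} {f g : M.O U}
    (h : ∀ c ∈ M.atlas, ∀ p ∈ U, p ∈ c.dom → ∀ m, c.cf U f m p = c.cf U g m p) : f = g := by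
  classical
  obtain ⟨x, hx⟩ := (M.sheaf.internal U).2 (f - g)
  suffices x = 0 by
    rw [this, map_zero] at hx
    exact (sub_eq_zero.1 hx.symm)
  ext k : 1
  refine Subtype.ext (eq_of_cf_gr (x k).2 (Submodule.zero_mem (M.gr U k)) fun c hc p hp hpc m => ?_)
  change _ = c.cf U 0 m p
  rw [c.cf_zero]
  by_cases hm : mdeg c.deg m = k
  · have h1 : c.cf U (f - g) m p = 0 := by rw [c.cf_sub, h c hc p hp hpc, sub_self]
    rw [← hx, DirectSum.coeAddMonoidHom_eq_dfinsuppSum, DFinsupp.sum, c.cf_sum,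
      Finset.sum_eq_single k] at h1
    · exact h1
    · intro j _ hj
      exact c.cf_of_not_mem_degree (x j).2 (fun h' => hj (h'.2.symm.trans hm)) p
    · intro hk
      rw [DFinsupp.notMem_support_iff.1 hk]
      exact c.cf_zero _ _ _
  · exact c.cf_of_not_mem_degree (x k).2 (fun h' => hm h'.2) p

/-- Functions with prescribed coefficients exist if they exist locally. -/
theorem exists_of_local_cf {U : Opens M.carrier} {k : ℤ}
    (C : ∀ c : GradedChart M.sheaf, (c.A →₀ ℕ) → M.carrier → ℝ)
    (h : ∀ p ∈ U, ∃ U' ≤ U, p ∈ U' ∧ ∃ t ∈ M.gr U' k, ∀ c ∈ M.atlas, ∀ p' ∈ U', p' ∈ c.dom →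
      ∀ m, c.cf U' t m p' = C c m p') :
    ∃ t ∈ M.gr U k, ∀ c ∈ M.atlas, ∀ p ∈ U, p ∈ c.dom → ∀ m, c.cf U t m p = C c m p := by
  choose! V hV hpV t ht htC using h
  obtain ⟨g, hg, hgt⟩ := M.sheaf.gluing U (fun p => V p) (fun p => hV p p.2) (fun p => hpV p p.2) k
    (fun p => t p) (fun p => ht p p.2) fun p q => by
      refine eq_of_cf fun c hc p' hp' hpc m => ?_
      rw [c.cf_res _ _ _ hp', c.cf_res _ _ _ hp', htC p p.2 c hc p' hp'.1 hpc,
        htC q q.2 c hc p' hp'.2 hpc]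
  refine ⟨g, hg, fun c hc p hp hpc m => ?_⟩
  rw [← c.cf_res (hV p hp) g m (hpV p hp)]
  have := hgt ⟨p, hp⟩
  simp only at this
  rw [this]
  exact htC p hp c hc p (hpV p hp) hpc m

theorem mem_gr_of_local {U : Opens M.carrier} {k : ℤ} {f : M.O U}
    (h : ∀ p ∈ U, ∃ U', ∃ hU : U' ≤ U, p ∈ U' ∧ M.res hU f ∈ M.gr U' k) : f ∈ M.gr U k := by
  obtain ⟨t, ht, htf⟩ := exists_of_local_cf (U := U) (k := k) (fun c m p => c.cf U f m p)
    fun p hp => by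
      obtain ⟨U', hU, hp', hf⟩ := h p hp
      exact ⟨U', hU, hp', _, hf, fun c _ p' hp' _ m => c.cf_res _ _ _ hp'⟩
  rwa [← eq_of_cf htf]

/-- Functions agree if they agree locally. -/
theorem eq_of_local {U : Opens M.carrier} {f g : M.O U}
    (h : ∀ p ∈ U, ∃ U', ∃ hU : U' ≤ U, p ∈ U' ∧ M.res hU f = M.res hU g) : f = g := by
  refine eq_of_cf fun c _ p hp _ m => ?_
  obtain ⟨U', hU, hp', hfg⟩ := h p hp
  rw [← c.cf_res hU f m hp', hfg, c.cf_res hU g m hp']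

end GradedManifold

/-! ### Smooth families of functions -/

section Germs

variable {M : Type u}  [TopologicalSpace M] {B A : Type*} {x : M → B → ℝ}
  {N EN HN : Type*} [NormedAddCommGroup EN] [NormedSpace ℝ EN]
  [TopologicalSpace HN] {I : ModelWithCorners ℝ EN HN} [TopologicalSpace N] [ChartedSpace HN N]
  {N' EN' HN' : Type*} [NormedAddCommGroup EN'] [NormedSpace ℝ EN']
  [TopologicalSpace HN'] {I' : ModelWithCorners ℝ EN' HN'} [TopologicalSpace N']
  [ChartedSpace HN' N']
  {u₁ u₂ : N → (A →₀ ℕ) → M → ℝ}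

/-- Reparametrization of a germ along a smooth map of the parameter spaces. -/
theorem SmoothGerm.comp {u' : N' → (A →₀ ℕ) → M → ℝ} {φ : N' → N} {Ω : Set N'} (hΩ : IsOpen Ω)
    (hφ : ContMDiffOn I' I ∞ φ Ω) {n' : N'} {p : M} (hn' : n' ∈ Ω)
    (h : SmoothGerm I x u₁ (φ n', p))
    (hu : ∀ᶠ r in 𝓝 (n', p), ∀ m, u' r.1 m r.2 = u₁ (φ r.1) m r.2) :
    SmoothGerm I' x u' (n', p) := by
  obtain ⟨J, A', h, V, hV, hqV, hh, hA, hev⟩ := h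
  have hc : ContinuousOn (fun r : N' × (J → ℝ) => (φ r.1, r.2)) (Ω ×ˢ Set.univ) :=
    (hφ.continuousOn.comp continuousOn_fst fun r hr => hr.1).prodMk continuousOn_snd
  refine ⟨J, A', fun m r => h m (φ r.1, r.2),
    Ω ×ˢ Set.univ ∩ (fun r : N' × (J → ℝ) => (φ r.1, r.2)) ⁻¹' V,
    hc.isOpen_inter_preimage (hΩ.prod isOpen_univ) hV, ⟨⟨hn', trivial⟩, hqV⟩, fun m => ?_,
    fun m hm => by simp only [hA m hm]; rfl, ?_⟩
  · refine (hh m).comp ?_ fun r hr => hr.2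
    exact (hφ.comp contMDiffOn_fst fun r hr => hr.1.1).prodMk contMDiffOn_snd
  · have ht : Filter.Tendsto (fun r : N' × M => (φ r.1, r.2)) (𝓝 (n', p)) (𝓝 (φ n', p)) := by
      have : ContinuousAt (fun r : N' × M => (φ r.1, r.2)) (n', p) :=
        ((hφ.continuousOn.continuousAt (hΩ.mem_nhds hn')).comp (x := (n', p))
          continuousAt_fst).prodMk continuousAt_snd
      exact this
    filter_upwards [ht.eventually hev, hu] with r h1 h2 m
    rw [h2 m, h1 m]

theorem SmoothGerm.congr {q : N × M} (h : SmoothGerm I x u₁ q)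
    (hu : ∀ᶠ r in 𝓝 q, ∀ m, u₂ r.1 m r.2 = u₁ r.1 m r.2) : SmoothGerm I x u₂ q :=
  SmoothGerm.comp (φ := id) isOpen_univ contMDiff_id.contMDiffOn trivial h hu

theorem SmoothGerm.zero (q : N × M) : SmoothGerm I x (fun _ (_ : A →₀ ℕ) _ => 0) q :=
  ⟨∅, ∅, fun _ _ => 0, Set.univ, isOpen_univ, trivial, fun _ => contMDiffOn_const,
    fun _ _ => rfl, by simp⟩

theorem SmoothGerm.add {q : N × M} (h₁ : SmoothGerm I x u₁ q) (h₂ : SmoothGerm I x u₂ q) :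
    SmoothGerm I x (fun n m p => u₁ n m p + u₂ n m p) q := by
  classical
  obtain ⟨J₁, A₁, h₁, V₁, hV₁, hqV₁, hh₁, hA₁, hev₁⟩ := h₁
  obtain ⟨J₂, A₂, h₂, V₂, hV₂, hqV₂, hh₂, hA₂, hev₂⟩ := h₂
  let R₁ : N × (↥(J₁ ∪ J₂) → ℝ) → N × (J₁ → ℝ) :=
    fun r => (r.1, fun j => r.2 ⟨j, Finset.mem_union_left _ j.2⟩)
  let R₂ : N × (↥(J₁ ∪ J₂) → ℝ) → N × (J₂ → ℝ) :=
    fun r => (r.1, fun j => r.2 ⟨j, Finset.mem_union_right _ j.2⟩)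
  have hρ₁ : ContDiff ℝ ∞ fun (y : ↥(J₁ ∪ J₂) → ℝ) (j : J₁) =>
      y ⟨j, Finset.mem_union_left _ j.2⟩ := by fun_prop
  have hR₁ : ContMDiff (I.prod 𝓘(ℝ, ↥(J₁ ∪ J₂) → ℝ)) (I.prod 𝓘(ℝ, J₁ → ℝ)) ∞ R₁ :=
    contMDiff_fst.prodMk ((contMDiff_iff_contDiff.2 hρ₁).comp contMDiff_snd)
  have hρ₂ : ContDiff ℝ ∞ fun (y : ↥(J₁ ∪ J₂) → ℝ) (j : J₂) =>
      y ⟨j, Finset.mem_union_right _ j.2⟩ := by fun_prop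
  have hR₂ : ContMDiff (I.prod 𝓘(ℝ, ↥(J₁ ∪ J₂) → ℝ)) (I.prod 𝓘(ℝ, J₂ → ℝ)) ∞ R₂ :=
    contMDiff_fst.prodMk ((contMDiff_iff_contDiff.2 hρ₂).comp contMDiff_snd)
  refine ⟨J₁ ∪ J₂, A₁ ∪ A₂, fun m r => h₁ m (R₁ r) + h₂ m (R₂ r), R₁ ⁻¹' V₁ ∩ R₂ ⁻¹' V₂,
    (hV₁.preimage hR₁.continuous).inter (hV₂.preimage hR₂.continuous), ⟨hqV₁, hqV₂⟩, fun m => ?_,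
    fun m hm => ?_, ?_⟩
  · exact ((hh₁ m).comp hR₁.contMDiffOn fun r hr => hr.1).add
      ((hh₂ m).comp hR₂.contMDiffOn fun r hr => hr.2)
  · funext r
    simp [hA₁ m fun h => hm (h.trans Finset.subset_union_left),
      hA₂ m fun h => hm (h.trans Finset.subset_union_right)]
  · filter_upwards [hev₁, hev₂] with r e₁ e₂ m
    rw [e₁, e₂]

theorem SmoothGerm.smul {f : N → ℝ} {Ω : Set N} (hΩ : IsOpen Ω) (hf : ContMDiffOn I 𝓘(ℝ, ℝ) ∞ f Ω)
    {q : N × M} (hq : q.1 ∈ Ω) (h₁ : SmoothGerm I x u₁ q) :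
    SmoothGerm I x (fun n m p => f n * u₁ n m p) q := by
  obtain ⟨J, A', h, V, hV, hqV, hh, hA, hev⟩ := h₁
  refine ⟨J, A', fun m r => f r.1 * h m r, (Ω ×ˢ Set.univ) ∩ V,
    (hΩ.prod isOpen_univ).inter hV, ⟨⟨hq, trivial⟩, hqV⟩, fun m => ?_, fun m hm => ?_, ?_⟩
  · exact (hf.comp contMDiffOn_fst fun r hr => hr.1.1).mul ((hh m).mono fun r hr => hr.2)
  · funext r; simp [hA m hm]
  · filter_upwards [hev] with r e m
    rw [e]

/-- The coefficients of a smooth germ are smooth functions of the parameter. -/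
theorem SmoothGerm.contMDiffAt {n : N} {p : M} (h : SmoothGerm I x u₁ (n, p)) (m : A →₀ ℕ) :
    ContMDiffAt I 𝓘(ℝ, ℝ) ∞ (fun n' => u₁ n' m p) n := by
  obtain ⟨J, A', h, V, hV, hqV, hh, hA, hev⟩ := h
  have h1 : ContMDiffAt I 𝓘(ℝ, ℝ) ∞ (fun n' => h m (n', fun j : J => x p j)) n :=
    ((hh m).contMDiffAt (hV.mem_nhds hqV)).comp n (contMDiffAt_id.prodMk contMDiffAt_const)
  refine h1.congr_of_eventuallyEq ?_
  have ht : Filter.Tendsto (fun n' : N => (n', p)) (𝓝 n) (𝓝 (n, p)) :=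
    (Continuous.prodMk_left p).tendsto n
  filter_upwards [ht.eventually hev] with n' e
  exact e m

end Germs

namespace GradedManifold

section Families

variable {M : GradedManifold.{u}}
  {N EN HN : Type*} [NormedAddCommGroup EN] [NormedSpace ℝ EN]
  [TopologicalSpace HN] {I : ModelWithCorners ℝ EN HN} [TopologicalSpace N] [ChartedSpace HN N]
  {N' EN' HN' : Type*} [NormedAddCommGroup EN'] [NormedSpace ℝ EN']
  [TopologicalSpace HN'] {I' : ModelWithCorners ℝ EN' HN'} [TopologicalSpace N']
  [ChartedSpace HN' N']

theorem slice_le_slice {φ : N' → N} {W : Opens (N × M.carrier)} {W' : Opens (N' × M.carrier)}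
    (h : ∀ q ∈ W', (φ q.1, q.2) ∈ W) (n' : N') : slice W' n' ≤ slice W (φ n') :=
  fun p hp => h (n', p) hp

/-- The pullback of a family of functions along a map `φ` of the parameters, restricted to an open
set `W'` that `φ × id` maps to `W`. -/
def pbFam (φ : N' → N) {W : Opens (N × M.carrier)} {W' : Opens (N' × M.carrier)}
    (h : ∀ q ∈ W', (φ q.1, q.2) ∈ W) (s : M.Fam W) : M.Fam W' :=
  fun n' => M.res (slice_le_slice h n') (s (φ n'))

theorem slice_mono {W W' : Opens (N × M.carrier)} (h : W' ≤ W) (n : N) : slice W' n ≤ slice W n :=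
  fun _ hp => h hp

theorem IsSmoothFam.pb {k : ℤ} {φ : N' → N} {W : Opens (N × M.carrier)}
    {W' : Opens (N' × M.carrier)} {s : M.Fam W} (hs : IsSmoothFam I W k s) {Ω : Set N'}
    (hΩ : IsOpen Ω) (hφ : ContMDiffOn I' I ∞ φ Ω) (hW' : ∀ q ∈ W', q.1 ∈ Ω)
    (h : ∀ q ∈ W', (φ q.1, q.2) ∈ W) : IsSmoothFam I' W' k (pbFam φ h s) := by
  refine ⟨fun n' => M.sheaf.res_mem _ _ _ (hs.1 _), fun c hc q hq hqc => ?_⟩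
  refine SmoothGerm.comp hΩ hφ (hW' q hq) (hs.2 c hc (φ q.1, q.2) (h q hq) hqc) ?_
  filter_upwards [W'.isOpen.mem_nhds hq] with r hr m
  exact c.cf_res _ _ _ hr

theorem IsSmoothFam.res {k : ℤ} {W W' : Opens (N × M.carrier)} {s : M.Fam W}
    (hs : IsSmoothFam I W k s) (h : W' ≤ W) :
    IsSmoothFam I W' k fun n => M.res (slice_mono h n) (s n) :=
  hs.pb (φ := id) isOpen_univ contMDiff_id.contMDiffOn (fun _ _ => trivial) fun _ hq => h hq

theorem isSmoothFam_of_local {k : ℤ} {W : Opens (N × M.carrier)} {s : M.Fam W}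
    (h : ∀ q ∈ W, ∃ W', ∃ hW : W' ≤ W, q ∈ W' ∧
      IsSmoothFam I W' k fun n => M.res (slice_mono hW n) (s n)) : IsSmoothFam I W k s := by
  refine ⟨fun n => mem_gr_of_local fun p hp => ?_, fun c hc q hq hqc => ?_⟩
  · obtain ⟨W', hW, hq, hs⟩ := h (n, p) hp
    exact ⟨slice W' n, slice_mono hW n, hq, hs.1 n⟩
  · obtain ⟨W', hW, hq', hs⟩ := h q hq
    refine (hs.2 c hc q hq' hqc).congr ?_
    filter_upwards [W'.isOpen.mem_nhds hq'] with r hr m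
    exact (c.cf_res _ _ _ hr).symm

theorem IsSmoothFam.zero (k : ℤ) (W : Opens (N × M.carrier)) :
    IsSmoothFam I W k (0 : M.Fam W) := by
  refine ⟨fun n => Submodule.zero_mem _, fun c _ q _ _ => (SmoothGerm.zero q).congr ?_⟩
  exact Filter.Eventually.of_forall fun r m => c.cf_zero _ _ _

theorem IsSmoothFam.add {k : ℤ} {W : Opens (N × M.carrier)} {s t : M.Fam W}
    (hs : IsSmoothFam I W k s) (ht : IsSmoothFam I W k t) : IsSmoothFam I W k (s + t) := by
  refine ⟨fun n => Submodule.add_mem _ (hs.1 n) (ht.1 n), fun c hc q hq hqc =>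
    ((hs.2 c hc q hq hqc).add (ht.2 c hc q hq hqc)).congr ?_⟩
  exact Filter.Eventually.of_forall fun r m => c.cf_add _ _ _ _

theorem IsSmoothFam.smul {k : ℤ} {W : Opens (N × M.carrier)} {s : M.Fam W}
    (hs : IsSmoothFam I W k s) {f : N → ℝ} {Ω : Set N} (hΩ : IsOpen Ω)
    (hf : ContMDiffOn I 𝓘(ℝ, ℝ) ∞ f Ω) (hW : ∀ q ∈ W, q.1 ∈ Ω) :
    IsSmoothFam I W k fun n => f n • s n := by
  refine ⟨fun n => Submodule.smul_mem _ _ (hs.1 n), fun c hc q hq hqc =>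
    ((hs.2 c hc q hq hqc).smul hΩ hf (hW q hq)).congr ?_⟩
  exact Filter.Eventually.of_forall fun r m => c.cf_smul _ _ _ _

theorem IsSmoothFam.const_smul {k : ℤ} {W : Opens (N × M.carrier)} {s : M.Fam W}
    (hs : IsSmoothFam I W k s) (a : ℝ) : IsSmoothFam I W k fun n => a • s n :=
  hs.smul isOpen_univ contMDiffOn_const fun _ _ => trivial

theorem IsSmoothFam.neg {k : ℤ} {W : Opens (N × M.carrier)} {s : M.Fam W}
    (hs : IsSmoothFam I W k s) : IsSmoothFam I W k (-s) := by
  have := hs.const_smul (-1)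
  simp only [neg_smul, one_smul] at this
  exact this

theorem IsSmoothFam.sub {k : ℤ} {W : Opens (N × M.carrier)} {s t : M.Fam W}
    (hs : IsSmoothFam I W k s) (ht : IsSmoothFam I W k t) : IsSmoothFam I W k (s - t) := by
  rw [sub_eq_add_neg]; exact hs.add ht.neg

theorem IsSmoothFam.sum {k : ℤ} {W : Opens (N × M.carrier)} {ι : Type*} (t : Finset ι)
    {s : ι → M.Fam W} (hs : ∀ i ∈ t, IsSmoothFam I W k (s i)) :
    IsSmoothFam I W k (∑ i ∈ t, s i) := by
  classical
  induction t using Finset.induction_on with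
  | empty => exact IsSmoothFam.zero k W
  | insert i t hi ih =>
    rw [Finset.sum_insert hi]
    exact (hs i (Finset.mem_insert_self _ _)).add
      (ih fun j hj => hs j (Finset.mem_insert_of_mem hj))

theorem IsSmoothFam.contMDiffAt {k : ℤ} {W : Opens (N × M.carrier)} {s : M.Fam W}
    (hs : IsSmoothFam I W k s) {c : GradedChart M.sheaf} (hc : c ∈ M.atlas) {n : N} {p : M.carrier}
    (h : (n, p) ∈ W) (hp : p ∈ c.dom) (m : c.A →₀ ℕ) :
    ContMDiffAt I 𝓘(ℝ, ℝ) ∞ (fun n' => c.cf (slice W n') (s n') m p) n :=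
  SmoothGerm.contMDiffAt (hs.2 c hc (n, p) h hp) m

theorem IsSmoothFam.mdifferentiableAt {k : ℤ} {W : Opens (N × M.carrier)} {s : M.Fam W}
    (hs : IsSmoothFam I W k s) {c : GradedChart M.sheaf} (hc : c ∈ M.atlas) {n : N} {p : M.carrier}
    (h : (n, p) ∈ W) (hp : p ∈ c.dom) (m : c.A →₀ ℕ) :
    MDifferentiableAt I 𝓘(ℝ, ℝ) (fun n' => c.cf (slice W n') (s n') m p) n :=
  (hs.contMDiffAt hc h hp m).mdifferentiableAt (by simp)

/-- In the domain of a chart it is enough to check smoothness in this chart. -/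
theorem isSmoothFam_of_chart {d : ℕ} {k : ℤ} {W : Opens ((Fin d → ℝ) × M.carrier)} {s : M.Fam W}
    {c : GradedChart M.sheaf} (hc : c ∈ M.atlas) (hW : ∀ q ∈ W, q.2 ∈ c.dom)
    (hs : ∀ n, s n ∈ M.gr (slice W n) k)
    (h : ∀ q ∈ W, c.SmoothFamAt 𝓘(ℝ, Fin d → ℝ) W s q) : IsSmoothFam 𝓘(ℝ, Fin d → ℝ) W k s :=
  ⟨hs, fun c' hc' q hq hqc => M.compat c hc c' hc' d W k s hs q hq (hW q hq) hqc (h q hq)⟩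

/-- Hadamard's lemma for families of functions. The compatibility of the charts makes the
quotients, which are constructed in one chart, smooth in all charts. -/
theorem IsSmoothFam.hadamard {d : ℕ} {W : Opens ((Fin d → ℝ) × M.carrier)} {k : ℤ} {s : M.Fam W}
    (hs : IsSmoothFam 𝓘(ℝ, Fin d → ℝ) W k s) {a : Fin d → ℝ} {p : M.carrier} (hap : (a, p) ∈ W) :
    ∃ (W' : Opens ((Fin d → ℝ) × M.carrier)) (hW' : W' ≤ W) (hW'' : ∀ r, slice W' r ≤ slice W' a)
      (w : Fin d → M.Fam W'), (a, p) ∈ W' ∧ (∀ j, IsSmoothFam 𝓘(ℝ, Fin d → ℝ) W' k (w j)) ∧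
      ∀ r, M.res (slice_mono hW' r) (s r) =
        M.res ((hW'' r).trans (slice_mono hW' a)) (s a) + ∑ j, (r j - a j) • w j r := by
  classical
  obtain ⟨c, hc, hpc⟩ := M.cover p
  obtain ⟨J, A', h, V, hV, hqV, hh, hA, hev⟩ := hs.2 c hc (a, p) hap hpc
  -- smallness: a product neighbourhood on which the germ representation holds
  have hxc : ContinuousOn (fun p' : M.carrier => fun j : J => c.x p' j) c.dom := by
    rw [continuousOn_iff_continuous_domRestrict]
    have := c.isOpenEmbedding.continuous
    exact continuous_pi fun j => (continuous_apply (j : c.B)).comp this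
  obtain ⟨ε₀, hε₀, hball₀⟩ := Metric.isOpen_iff.1 hV _ hqV
  have hxU : ∀ᶠ p' in 𝓝 p, (fun j : J => c.x p' j) ∈ Metric.ball (fun j : J => c.x p j) ε₀ :=
    (hxc.continuousAt (c.dom.isOpen.mem_nhds hpc)).preimage_mem_nhds (Metric.ball_mem_nhds _ hε₀)
  have hall := (hev.and (W.isOpen.mem_nhds hap))
  rw [nhds_prod_eq, Filter.eventually_prod_iff] at hall
  obtain ⟨pa, hpa, pb, hpb, hab⟩ := hall
  obtain ⟨ε₁, hε₁, hball₁⟩ := Metric.mem_nhds_iff.1 hpa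
  obtain ⟨U, hUsub, hUo, hpU⟩ := mem_nhds_iff.1 (hpb.and (hxU.and (c.dom.isOpen.mem_nhds hpc)))
  set ε := min ε₀ ε₁ with hε
  have hε_pos : 0 < ε := lt_min hε₀ hε₁
  set W' : Opens ((Fin d → ℝ) × M.carrier) := ⟨Metric.ball a ε ×ˢ U, Metric.isOpen_ball.prod hUo⟩
    with hW'def
  have hmemW' : ∀ q, q ∈ W' ↔ q.1 ∈ Metric.ball a ε ∧ q.2 ∈ U := fun q => Iff.rfl
  have hprop : ∀ q ∈ W', (∀ m, c.cf (slice W q.1) (s q.1) m q.2 =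
      h m (q.1, fun j : J => c.x q.2 j)) ∧ q ∈ W := fun q hq =>
    hab (hball₁ (Metric.ball_subset_ball (min_le_right _ _) hq.1)) (hUsub hq.2).1
  have hW' : W' ≤ W := fun q hq => (hprop q hq).2
  have hW'' : ∀ q ∈ W', (a, q.2) ∈ W' := fun q hq => ⟨Metric.mem_ball_self hε_pos, hq.2⟩
  have hUdom : ∀ q ∈ W', q.2 ∈ c.dom := fun q hq => (hUsub hq.2).2.2
  have hUball : ∀ q ∈ W', (fun j : J => c.x q.2 j) ∈ Metric.ball (fun j : J => c.x p j) ε₀ :=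
    fun q hq => (hUsub hq.2).2.1
  -- discard the coefficients of the wrong degree
  let h' : (c.A →₀ ℕ) → (Fin d → ℝ) × (J → ℝ) → ℝ := fun m =>
    if Admissible c.deg m ∧ mdeg c.deg m = k then h m else 0
  set B := Metric.ball (fun j : J => c.x p j) ε₀ with hB
  have hcd : ∀ m, ContDiffOn ℝ ∞ (h' m) (Metric.ball a ε ×ˢ B) := by
    intro m
    by_cases hm : Admissible c.deg m ∧ mdeg c.deg m = k
    · simp only [h', if_pos hm]
      have h1 := hh m
      rw [← modelWithCornersSelf_prod, chartedSpaceSelf_prod] at h1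
      refine (contMDiffOn_iff_contDiffOn.1 h1).mono fun z hz => hball₀ ?_
      rw [← ball_prod_same]
      exact ⟨Metric.ball_subset_ball (min_le_left _ _) hz.1, hz.2⟩
    · simp only [h', if_neg hm]
      exact contDiffOn_const
  have hcf : ∀ q ∈ W', ∀ m, c.cf (slice W q.1) (s q.1) m q.2 =
      h' m (q.1, fun j : J => c.x q.2 j) := by
    intro q hq m
    by_cases hm : Admissible c.deg m ∧ mdeg c.deg m = k
    · simp only [h', if_pos hm]
      exact (hprop q hq).1 m
    · simp only [h', if_neg hm]
      exact c.cf_of_not_mem_degree (hs.1 _) hm _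
  choose w hw hw0 hwh using fun m => GradedGeom.hadamard (Metric.isOpen_ball) (hcd m)
  -- the quotients, first as coefficient functions
  let κ : Fin d → (Fin d → ℝ) → (c.A →₀ ℕ) → M.carrier → ℝ := fun j r m p' =>
    if (r, p') ∈ W' then w m j (r, fun j : J => c.x p' j) else 0
  have hκgerm : ∀ j, ∀ q ∈ W', SmoothGerm 𝓘(ℝ, Fin d → ℝ) c.x (κ j) q := by
    intro j q hq
    refine ⟨J, A', fun m => w m j, Metric.ball a ε ×ˢ B, Metric.isOpen_ball.prod Metric.isOpen_ball,
      ⟨hq.1, hUball q hq⟩, fun m => ?_, fun m hm => hw0 m ?_ j, ?_⟩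
    · rw [← modelWithCornersSelf_prod, chartedSpaceSelf_prod]
      exact contMDiffOn_iff_contDiffOn.2 (hw m j)
    · simp only [h', hA m hm, ite_self]
    · filter_upwards [W'.isOpen.mem_nhds hq] with r hr m
      exact if_pos hr
  have hdom : ∀ r, slice W' r ≤ c.dom := fun r p' hp' => hUdom (r, p') hp'
  have hex : ∀ j r, ∃ f ∈ M.gr (slice W' r) k, c.coef (slice W' r) (hdom r) f = κ j r := by
    intro j r
    refine c.coef_surjective (slice W' r) (hdom r) k (κ j r) (fun m hm => ?_) (fun m p' hp' => ?_)
      fun p' hp' => ?_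
    · have h0 : h' m = 0 := if_neg (by tauto)
      funext p'
      simp only [κ, hw0 m h0 j]
      simp
    · exact if_neg hp'
    · exact SmoothGerm.comp (φ := fun _ => r) isOpen_univ contMDiffOn_const trivial
        (hκgerm j (r, p') hp') (Filter.Eventually.of_forall fun _ _ => rfl)
  choose f hf hfκ using hex
  have hfcf : ∀ j r p', (r, p') ∈ W' → ∀ m, c.cf (slice W' r) (f j r) m p' =
      w m j (r, fun j : J => c.x p' j) := by
    intro j r p' hp' m
    have h1 := c.coef_res (slice W' r) (hdom r) (slice W' r ⊓ c.dom) inf_le_left (f j r) m p'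
      ⟨hp', hdom r hp'⟩
    rw [hfκ] at h1
    exact h1.trans (if_pos hp')
  refine ⟨W', hW', fun r p' hp' => hW'' (r, p') hp', f, ⟨Metric.mem_ball_self hε_pos, hpU⟩, fun j => ?_, fun r => ?_⟩
  · refine isSmoothFam_of_chart hc hUdom (hf j) fun q hq => (hκgerm j q hq).congr ?_
    filter_upwards [W'.isOpen.mem_nhds hq] with r hr m
    exact (hfcf j r.1 r.2 hr m).trans (if_pos hr).symm
  · refine c.eq_of_cf (hdom r) fun p' hp' m => ?_
    rw [c.cf_res _ _ _ hp', c.cf_add, c.cf_res _ _ _ hp', c.cf_sum]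
    simp only [c.cf_smul, hfcf _ r p' hp']
    rw [hcf (r, p') hp', hcf (a, p') (hW'' (r, p') hp')]
    exact hwh m r hp'.1 _ (hUball (r, p') hp')

end Families
end GradedManifold

/-! ### Local coordinates and derivatives of functions on ordinary manifolds -/

section Coordinates

variable {N EN HN : Type*} [NormedAddCommGroup EN] [NormedSpace ℝ EN]
  [TopologicalSpace HN] (I : ModelWithCorners ℝ EN HN) [TopologicalSpace N] [ChartedSpace HN N]

/-- Smooth coordinates `χ` with values in some `ℝ^d` on a neighbourhood `Ω` of `n`, with the smooth
inverse `ψ` on the open set `B` of values. -/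
structure LocalCoords (n : N) where
  d : ℕ
  ψ : (Fin d → ℝ) → N
  χ : N → Fin d → ℝ
  Ω : Set N
  B : Set (Fin d → ℝ)
  isOpen_Ω : IsOpen Ω
  isOpen_B : IsOpen B
  mem : n ∈ Ω
  smooth_ψ : ContMDiffOn 𝓘(ℝ, Fin d → ℝ) I ∞ ψ B
  smooth_χ : ContMDiffOn I 𝓘(ℝ, Fin d → ℝ) ∞ χ Ω
  mapsTo_χ : Set.MapsTo χ Ω B
  mapsTo_ψ : Set.MapsTo ψ B Ω
  ψ_χ : ∀ x ∈ Ω, ψ (χ x) = x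
  χ_ψ : ∀ r ∈ B, χ (ψ r) = r

/-- The derivative of a vector valued function `f` at `n` along the tangent vector `v`. -/
def dirD {Y : Type*} [NormedAddCommGroup Y] [NormedSpace ℝ Y] (f : N → Y) (n : N)
    (v : TangentSpace I n) : Y := mfderiv I 𝓘(ℝ, Y) f n v

theorem dirD_congr {Y : Type*} [NormedAddCommGroup Y] [NormedSpace ℝ Y] {f g : N → Y} {n : N}
    (h : f =ᶠ[𝓝 n] g) (v : TangentSpace I n) : dirD I f n v = dirD I g n v := by
  have h1 := h.mfderiv_eq (I := I) (I' := 𝓘(ℝ, Y))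
  unfold dirD
  rw [h1]
  rfl

theorem dirD_eq_fderiv {Z Y : Type*} [NormedAddCommGroup Z] [NormedSpace ℝ Z]
    [NormedAddCommGroup Y] [NormedSpace ℝ Y] (f : Z → Y) (z e : Z) :
    dirD 𝓘(ℝ, Z) f z e = fderiv ℝ f z e := by
  unfold dirD
  rw [mfderiv_eq_fderiv]
  rfl

variable [FiniteDimensional ℝ EN] [I.Boundaryless] [IsManifold I ∞ N]

/-- Charts provide local coordinates, after an identification of the model space with `ℝ^d`. -/
theorem LocalCoords.nonempty (n : N) : Nonempty (LocalCoords I n) := by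
  let L := (Module.finBasis ℝ EN).equivFunL
  let e := extChartAt I n
  refine ⟨{
    d := Module.finrank ℝ EN
    ψ := fun r => e.symm (L.symm r)
    χ := fun x => L (e x)
    Ω := e.source
    B := L.symm ⁻¹' e.target
    isOpen_Ω := isOpen_extChartAt_source n
    isOpen_B := (isOpen_extChartAt_target n).preimage L.symm.continuous
    mem := mem_extChartAt_source n
    smooth_ψ := ?_
    smooth_χ := ?_
    mapsTo_χ := fun x hx => by simpa using e.map_source hx
    mapsTo_ψ := fun r hr => e.map_target hr
    ψ_χ := fun x hx => by simpa using e.left_inv hx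
    χ_ψ := fun r hr => by rw [e.right_inv hr]; simp }⟩
  · exact (contMDiffOn_extChartAt_symm n).comp
      (contMDiff_iff_contDiff.2 L.symm.contDiff).contMDiffOn fun r hr => hr
  · have : ContMDiffOn I 𝓘(ℝ, EN) ∞ e e.source := by
      rw [extChartAt_source]; exact contMDiffOn_extChartAt
    exact (contMDiff_iff_contDiff.2 L.contDiff).comp_contMDiffOn this

variable {I}

/-- The derivative of a smooth function along a smooth vector field is smooth. -/
theorem contMDiffOn_dirD {Y : Type*} [NormedAddCommGroup Y] [NormedSpace ℝ Y]
    {f : N → Y} {Ω : Set N} (hΩ : IsOpen Ω) (hf : ContMDiffOn I 𝓘(ℝ, Y) ∞ f Ω)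
    {v : ∀ n : N, TangentSpace I n}
    (hv : ContMDiff I I.tangent ∞ fun n => (⟨n, v n⟩ : TangentBundle I N)) :
    ContMDiffOn I 𝓘(ℝ, Y) ∞ (fun n => dirD I f n (v n)) Ω := by
  have h1 := hf.contMDiffOn_tangentMapWithin (m := ∞) (by simp) hΩ.uniqueMDiffOn
  have h2 : ContMDiffOn I 𝓘(ℝ, Y).tangent ∞
      (fun n => tangentMapWithin I 𝓘(ℝ, Y) f Ω (⟨n, v n⟩ : TangentBundle I N)) Ω :=
    h1.comp hv.contMDiffOn fun n hn => hn
  refine ((contMDiff_snd_tangentBundle_modelSpace Y 𝓘(ℝ, Y)).comp_contMDiffOn h2).congr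
    fun n hn => ?_
  have h3 := mfderivWithin_of_isOpen (I := I) (I' := 𝓘(ℝ, Y)) (f := f) hΩ hn
  change mfderiv I 𝓘(ℝ, Y) f n (v n) = mfderivWithin I 𝓘(ℝ, Y) f Ω n (v n)
  rw [h3]

end Coordinates

namespace GradedManifold

variable {M : GradedManifold.{u}}

/-! ### Derivatives of families with respect to the parameter -/

section Derivative

variable {N EN HN : Type*} [NormedAddCommGroup EN] [NormedSpace ℝ EN]
  [TopologicalSpace HN] {I : ModelWithCorners ℝ EN HN} [TopologicalSpace N] [ChartedSpace HN N]
  {N' EN' HN' : Type*} [NormedAddCommGroup EN'] [NormedSpace ℝ EN']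
  [TopologicalSpace HN'] {I' : ModelWithCorners ℝ EN' HN'} [TopologicalSpace N']
  [ChartedSpace HN' N'] {k : ℤ}

theorem HasFamDeriv.unique {W : Opens (N × M.carrier)} {s : M.Fam W} {n : N}
    {v : TangentSpace I n} {t t' : M.O (slice W n)} (h : HasFamDeriv I W s n v t)
    (h' : HasFamDeriv I W s n v t') : t = t' :=
  eq_of_cf fun c hc p hp hpc m => (h c hc p hp hpc m).trans (h' c hc p hp hpc m).symm

theorem HasFamDeriv.famDeriv_eq {W : Opens (N × M.carrier)} {s : M.Fam W} {n : N}
    {v : TangentSpace I n} {t : M.O (slice W n)} (h : HasFamDeriv I W s n v t) :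
    famDeriv I W s n v = t := by
  have hex : ∃ t, HasFamDeriv I W s n v t := ⟨t, h⟩
  rw [famDeriv, dif_pos hex]
  exact hex.choose_spec.unique h

/-- The derivative depends only on the germ of the coefficients. -/
theorem HasFamDeriv.congr {W W' : Opens (N × M.carrier)} {s : M.Fam W} {s' : M.Fam W'} {n : N}
    {v : TangentSpace I n} {t : M.O (slice W n)} (ht : HasFamDeriv I W s n v t)
    (hle : slice W' n ≤ slice W n)
    (h : ∀ p ∈ slice W' n, ∀ᶠ n' in 𝓝 n, ∀ c ∈ M.atlas, ∀ m,
      c.cf (slice W' n') (s' n') m p = c.cf (slice W n') (s n') m p) :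
    HasFamDeriv I W' s' n v (M.res hle t) := by
  intro c hc p hp hpc m
  rw [c.cf_res hle t m hp, ht c hc p (hle hp) hpc m]
  refine (dirD_congr I ?_ v).symm
  filter_upwards [h p hp] with n' h'
  exact h' c hc m

theorem HasFamDeriv.res {W W' : Opens (N × M.carrier)} {s : M.Fam W} {n : N}
    {v : TangentSpace I n} {t : M.O (slice W n)} (ht : HasFamDeriv I W s n v t) (hW : W' ≤ W) :
    HasFamDeriv I W' (fun n => M.res (slice_mono hW n) (s n)) n v (M.res (slice_mono hW n) t) := by
  refine ht.congr _ fun p hp => ?_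
  have hc : Continuous fun n' : N => (n', p) := by fun_prop
  filter_upwards [hc.continuousAt.preimage_mem_nhds (W'.isOpen.mem_nhds hp)] with n' hn' c _ m
  exact c.cf_res _ _ _ hn'

/-- Chain rule for families that are pulled back along a map of the parameter spaces. -/
theorem HasFamDeriv.pb {W : Opens (N × M.carrier)} {W' : Opens (N' × M.carrier)} {s : M.Fam W}
    (hs : IsSmoothFam I W k s) {φ : N' → N} {n' : N'} (hφ : MDifferentiableAt I' I φ n')
    (h : ∀ q ∈ W', (φ q.1, q.2) ∈ W) {v : TangentSpace I' n'} {t : M.O (slice W (φ n'))}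
    (ht : HasFamDeriv I W s (φ n') (mfderiv I' I φ n' v) t) :
    HasFamDeriv I' W' (pbFam φ h s) n' v (M.res (slice_le_slice h n') t) := by
  intro c hc p hp hpc m
  rw [c.cf_res _ t m hp, ht c hc p (h (n', p) hp) hpc m]
  have h1 : (fun n'' => c.cf (slice W' n'') (pbFam φ h s n'') m p) =ᶠ[𝓝 n']
      (fun n => c.cf (slice W n) (s n) m p) ∘ φ := by
    have hc : Continuous fun n' : N' => (n', p) := by fun_prop
    filter_upwards [hc.continuousAt.preimage_mem_nhds (W'.isOpen.mem_nhds hp)] with n'' hn''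
    exact c.cf_res _ _ _ hn''
  rw [h1.mfderiv_eq, mfderiv_comp n' (hs.mdifferentiableAt hc (h (n', p) hp) hpc m) hφ]
  rfl

theorem HasFamDeriv.add_vec {W : Opens (N × M.carrier)} {s : M.Fam W} {n : N}
    {v v' : TangentSpace I n} {t t' : M.O (slice W n)} (h : HasFamDeriv I W s n v t)
    (h' : HasFamDeriv I W s n v' t') : HasFamDeriv I W s n (v + v') (t + t') := by
  intro c hc p hp hpc m
  rw [c.cf_add, h c hc p hp hpc m, h' c hc p hp hpc m, map_add]
  rfl

theorem HasFamDeriv.smul_vec {W : Opens (N × M.carrier)} {s : M.Fam W} {n : N}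
    {v : TangentSpace I n} {t : M.O (slice W n)} (h : HasFamDeriv I W s n v t) (a : ℝ) :
    HasFamDeriv I W s n (a • v) (a • t) := by
  intro c hc p hp hpc m
  rw [c.cf_smul, h c hc p hp hpc m, map_smul]
  rfl

theorem HasFamDeriv.zero_vec (W : Opens (N × M.carrier)) (s : M.Fam W) (n : N) :
    HasFamDeriv I W s n 0 0 := by
  intro c hc p hp hpc m
  rw [c.cf_zero, map_zero]
  rfl

theorem HasFamDeriv.sum_vec {W : Opens (N × M.carrier)} {s : M.Fam W} {n : N} {ι : Type*}
    (F : Finset ι) {v : ι → TangentSpace I n} {t : ι → M.O (slice W n)}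
    (h : ∀ i ∈ F, HasFamDeriv I W s n (v i) (t i)) :
    HasFamDeriv I W s n (∑ i ∈ F, v i) (∑ i ∈ F, t i) := by
  classical
  induction F using Finset.induction_on with
  | empty => exact HasFamDeriv.zero_vec W s n
  | insert i F hi ih =>
    rw [Finset.sum_insert hi, Finset.sum_insert hi]
    exact (h i (Finset.mem_insert_self _ _)).add_vec
      (ih fun j hj => h j (Finset.mem_insert_of_mem hj))

theorem HasFamDeriv.add {W : Opens (N × M.carrier)} {s s' : M.Fam W} {k' : ℤ}
    (hs : IsSmoothFam I W k s) (hs' : IsSmoothFam I W k' s') {n : N}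
    {v : TangentSpace I n} {t t' : M.O (slice W n)} (h : HasFamDeriv I W s n v t)
    (h' : HasFamDeriv I W s' n v t') : HasFamDeriv I W (s + s') n v (t + t') := by
  intro c hc p hp hpc m
  rw [c.cf_add, h c hc p hp hpc m, h' c hc p hp hpc m]
  have := mfderiv_add (hs.mdifferentiableAt hc hp hpc m) (hs'.mdifferentiableAt hc hp hpc m)
  have h2 : (fun n' => c.cf (slice W n') ((s + s') n') m p) =
    (fun n' => c.cf (slice W n') (s n') m p) + fun n' => c.cf (slice W n') (s' n') m p := by
    funext n'; exact c.cf_add _ _ _ _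
  rw [h2, this]
  rfl

/-- The Leibniz rule for the multiplication of a family by a function of the parameter. -/
theorem HasFamDeriv.smul {W : Opens (N × M.carrier)} {s : M.Fam W}
    (hs : IsSmoothFam I W k s) {n : N} {f : N → ℝ} (hf : MDifferentiableAt I 𝓘(ℝ, ℝ) f n)
    {v : TangentSpace I n} {t : M.O (slice W n)} (h : HasFamDeriv I W s n v t) :
    HasFamDeriv I W (fun n' => f n' • s n') n v
      (dirD I f n v • s n + f n • t) := by
  intro c hc p hp hpc m
  rw [c.cf_add, c.cf_smul, c.cf_smul, h c hc p hp hpc m]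
  have h2 : (fun n' => c.cf (slice W n') (f n' • s n') m p) =
    f * fun n' => c.cf (slice W n') (s n') m p := by
    funext n'; exact c.cf_smul _ _ _ _
  have h3 := (hf.hasMFDerivAt.mul (hs.mdifferentiableAt hc hp hpc m).hasMFDerivAt).mfderiv
  rw [h2, h3]
  refine Eq.trans (add_comm _ _) (congrArg₂ (· + ·) rfl ?_)
  exact mul_comm _ _

/-- The derivative of a family that satisfies Hadamard's lemma at `a`. -/
theorem hasFamDeriv_of_expansion {d : ℕ} {W : Opens ((Fin d → ℝ) × M.carrier)} {s : M.Fam W}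
    {a : Fin d → ℝ} {e : Fin d → ℝ} {t : M.O (slice W a)}
    (h : ∀ p, (a, p) ∈ W → ∃ (W' : Opens ((Fin d → ℝ) × M.carrier)) (hW' : W' ≤ W)
      (hW'' : ∀ r, slice W' r ≤ slice W' a) (w : Fin d → M.Fam W'), (a, p) ∈ W' ∧
      (∀ j, IsSmoothFam 𝓘(ℝ, Fin d → ℝ) W' k (w j)) ∧
      (∀ r, M.res (slice_mono hW' r) (s r) =
        M.res ((hW'' r).trans (slice_mono hW' a)) (s a) + ∑ j, (r j - a j) • w j r) ∧
      M.res (slice_mono hW' a) t = ∑ j, e j • w j a) :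
    HasFamDeriv 𝓘(ℝ, Fin d → ℝ) W s a e t := by
  intro c hc p hp hpc m
  obtain ⟨W', hW', hW'', w, hap, hw, hexp, ht⟩ := h p hp
  have hwd : ∀ j, DifferentiableAt ℝ (fun r => c.cf (slice W' r) (w j r) m p) a := fun j =>
    mdifferentiableAt_iff_differentiableAt.1 ((hw j).mdifferentiableAt hc hap hpc m)
  have h1 : (fun r => c.cf (slice W r) (s r) m p) =ᶠ[𝓝 a] fun r => c.cf (slice W a) (s a) m p +
      ∑ j, (r j - a j) * c.cf (slice W' r) (w j r) m p := by
    have hcont : Continuous fun r : Fin d → ℝ => (r, p) := by fun_prop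
    filter_upwards [hcont.continuousAt.preimage_mem_nhds (W'.isOpen.mem_nhds hap)] with r hr
    have := congrArg (fun f => c.cf (slice W' r) f m p) (hexp r)
    simp only [c.cf_res _ _ _ (show p ∈ slice W' r from hr), c.cf_add, c.cf_sum, c.cf_smul] at this
    exact this
  -- by Hadamard's expansion the derivative of each coefficient at `a` is the value of the
  -- quotients at `a`
  have h2 : HasFDerivAt (fun r => c.cf (slice W a) (s a) m p +
      ∑ j, (r j - a j) * c.cf (slice W' r) (w j r) m p)
      (∑ j, c.cf (slice W' a) (w j a) m p •
        (ContinuousLinearMap.proj j : (Fin d → ℝ) →L[ℝ] ℝ)) a := by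
    refine HasFDerivAt.const_add _ (HasFDerivAt.fun_sum fun j _ => ?_)
    have h3 : HasFDerivAt (fun r : Fin d → ℝ => r j - a j)
      (ContinuousLinearMap.proj (R := ℝ) (φ := fun _ : Fin d => ℝ) j) a :=
      (ContinuousLinearMap.proj (R := ℝ) (φ := fun _ : Fin d => ℝ) j).hasFDerivAt.sub_const _
    have h4 := h3.mul (hwd j).hasFDerivAt
    simp only [sub_self, zero_smul, zero_add] at h4
    exact h4
  refine Eq.trans ?_ ((dirD_congr _ h1 e).trans (dirD_eq_fderiv _ a e)).symm
  rw [h2.fderiv, ← c.cf_res (slice_mono hW' a) t m hap, ht,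
    c.cf_sum, sum_apply]
  exact Finset.sum_congr rfl fun j _ => by simp [c.cf_smul, mul_comm]

/-- A smooth family over `ℝ^d` has derivatives. -/
theorem exists_hasFamDeriv_of_euclidean {d : ℕ} {W : Opens ((Fin d → ℝ) × M.carrier)}
    {s : M.Fam W} (hs : IsSmoothFam 𝓘(ℝ, Fin d → ℝ) W k s) (a e : Fin d → ℝ) :
    ∃ t ∈ M.gr (slice W a) k, HasFamDeriv 𝓘(ℝ, Fin d → ℝ) W s a e t := by
  refine exists_of_local_cf (M := M) (U := slice W a) (k := k)
    (fun c m p => mfderiv 𝓘(ℝ, Fin d → ℝ) 𝓘(ℝ, ℝ) (fun n' => c.cf (slice W n') (s n') m p) a e) ?_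
  intro p hp
  obtain ⟨W', hW', hW'', w, hap, hw, hexp⟩ := hs.hadamard hp
  refine ⟨slice W' a, slice_mono hW' a, hap, ∑ j, e j • w j a, Submodule.sum_mem _ fun j _ =>
    Submodule.smul_mem _ _ ((hw j).1 a), fun c hc p' hp' hpc m => ?_⟩
  have h1 : HasFamDeriv 𝓘(ℝ, Fin d → ℝ) W' (fun r => M.res (slice_mono hW' r) (s r)) a e
      (∑ j, e j • w j a) := by
    refine hasFamDeriv_of_expansion (k := k) fun p' hp' => ⟨W', le_rfl, hW'', w, hp', hw, fun r => ?_, ?_⟩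
    · rw [res_self', hexp, res_res']
    · rw [res_self']
  rw [h1 c hc p' hp' hpc m]
  refine dirD_congr 𝓘(ℝ, Fin d → ℝ) ?_ e
  have hcont : Continuous fun r : Fin d → ℝ => (r, p') := by fun_prop
  filter_upwards [hcont.continuousAt.preimage_mem_nhds (W'.isOpen.mem_nhds hp')] with r hr
  exact c.cf_res _ _ _ hr

/-- The open set `W ∩ (Ω × M)`. -/
def restrictParam (W : Opens (N × M.carrier)) (Ω : Set N) (hΩ : IsOpen Ω) : Opens (N × M.carrier) :=
  ⟨{q | q.1 ∈ Ω} ∩ W, (hΩ.preimage continuous_fst).inter W.isOpen⟩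

/-- The preimage of `W` in `B × M` under `ψ × id`. -/
def pullParam (W : Opens (N × M.carrier)) (ψ : N' → N) (B : Set N') (hB : IsOpen B)
    (hψ : ContinuousOn ψ B) : Opens (N' × M.carrier) :=
  ⟨{q | q.1 ∈ B} ∩ (fun q => (ψ q.1, q.2)) ⁻¹' W,
    ContinuousOn.isOpen_inter_preimage
      ((hψ.comp continuousOn_fst fun _ hq => hq).prodMk continuousOn_snd)
      (hB.preimage continuous_fst) W.isOpen⟩

variable [FiniteDimensional ℝ EN] [I.Boundaryless] [IsManifold I ∞ N]

section LocalCoords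

variable {n : N} (C : LocalCoords I n) (W : Opens (N × M.carrier))

/-- The domain of a family in local coordinates of the parameter space. -/
def _root_.GradedGeom.LocalCoords.dom : Opens ((Fin C.d → ℝ) × M.carrier) :=
  pullParam W C.ψ C.B C.isOpen_B C.smooth_ψ.continuousOn

theorem _root_.GradedGeom.LocalCoords.mem_of_mem_dom :
    ∀ q ∈ C.dom W, (C.ψ q.1, q.2) ∈ W := fun _ hq => hq.2

/-- A family in local coordinates of the parameter space. -/
def _root_.GradedGeom.LocalCoords.fam (s : M.Fam W) : M.Fam (C.dom W) :=
  pbFam C.ψ (C.mem_of_mem_dom W) s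

theorem _root_.GradedGeom.LocalCoords.fam_smooth {s : M.Fam W} (hs : IsSmoothFam I W k s) :
    IsSmoothFam 𝓘(ℝ, Fin C.d → ℝ) (C.dom W) k (C.fam W s) :=
  hs.pb C.isOpen_B C.smooth_ψ (fun q (hq : q ∈ C.dom W) => hq.1) _

/-- The part of `W` over the coordinate neighbourhood. -/
def _root_.GradedGeom.LocalCoords.cut : Opens (N × M.carrier) := restrictParam W C.Ω C.isOpen_Ω

theorem _root_.GradedGeom.LocalCoords.cut_le : C.cut W ≤ W := fun _ hq => hq.2

theorem _root_.GradedGeom.LocalCoords.mem_dom : ∀ q ∈ C.cut W, (C.χ q.1, q.2) ∈ C.dom W := fun q hq =>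
  ⟨C.mapsTo_χ hq.1, by
    change (C.ψ (C.χ q.1), q.2) ∈ W
    rw [C.ψ_χ _ hq.1]
    exact hq.2⟩

/-- A family is recovered from its expression in coordinates. -/
theorem _root_.GradedGeom.LocalCoords.pb_fam (s : M.Fam W) :
    pbFam C.χ (C.mem_dom W) (C.fam W s) =
      fun n => M.res (slice_mono (C.cut_le W) n) (s n) := by
  funext n'
  refine eq_of_cf fun c hc p hp hpc m => ?_
  have h1 : p ∈ slice (C.dom W) (C.χ n') := C.mem_dom W (n', p) hp
  rw [pbFam, c.cf_res _ _ _ hp, c.cf_res _ _ _ hp, LocalCoords.fam, pbFam, c.cf_res _ _ _ h1,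
    C.ψ_χ n' hp.1]

end LocalCoords

/-- Smooth families are differentiable: in local coordinates of the parameter space this is the
Hadamard lemma for families, and derivatives pull back along the coordinates. -/
theorem exists_hasFamDeriv {W : Opens (N × M.carrier)} {s : M.Fam W} (hs : IsSmoothFam I W k s)
    (n : N) (v : TangentSpace I n) :
    ∃ t ∈ M.gr (slice W n) k, HasFamDeriv I W s n v t := by
  obtain ⟨C⟩ := LocalCoords.nonempty I n
  obtain ⟨t, ht, htd⟩ := exists_hasFamDeriv_of_euclidean (C.fam_smooth W hs) (C.χ n)
    (mfderiv I 𝓘(ℝ, Fin C.d → ℝ) C.χ n v)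
  have h1 := HasFamDeriv.pb (C.fam_smooth W hs) ((C.smooth_χ.contMDiffAt
    (C.isOpen_Ω.mem_nhds C.mem)).mdifferentiableAt (by simp)) (C.mem_dom W) htd
  rw [C.pb_fam] at h1
  have hle : slice W n ≤ slice (C.cut W) n := fun p hp => ⟨C.mem, hp⟩
  refine ⟨_, M.sheaf.res_mem hle _ _ (M.sheaf.res_mem _ _ _ ht), h1.congr hle fun p hp => ?_⟩
  have hcont : Continuous fun r : N => (r, p) := by fun_prop
  filter_upwards [hcont.continuousAt.preimage_mem_nhds ((C.cut W).isOpen.mem_nhds (hle hp))]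
    with n' hn' c hc m
  exact (c.cf_res _ _ _ hn').symm

theorem IsSmoothFam.hasFamDeriv {W : Opens (N × M.carrier)} {s : M.Fam W}
    (hs : IsSmoothFam I W k s) (n : N) (v : TangentSpace I n) :
    HasFamDeriv I W s n v (famDeriv I W s n v) := by
  obtain ⟨t, _, ht⟩ := exists_hasFamDeriv hs n v
  rwa [ht.famDeriv_eq]

theorem IsSmoothFam.famDeriv_mem {W : Opens (N × M.carrier)} {s : M.Fam W}
    (hs : IsSmoothFam I W k s) (n : N) (v : TangentSpace I n) :
    famDeriv I W s n v ∈ M.gr (slice W n) k := by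
  obtain ⟨t, ht', ht⟩ := exists_hasFamDeriv hs n v
  rwa [ht.famDeriv_eq]

/-- Partial derivatives of smooth families are smooth. -/
theorem IsSmoothFam.partial {d : ℕ} {W : Opens ((Fin d → ℝ) × M.carrier)}
    {s : M.Fam W} (hs : IsSmoothFam 𝓘(ℝ, Fin d → ℝ) W k s) (e : Fin d → ℝ) :
    IsSmoothFam 𝓘(ℝ, Fin d → ℝ) W k fun r => famDeriv 𝓘(ℝ, Fin d → ℝ) W s r e := by
  refine ⟨fun r => hs.famDeriv_mem r e, fun c hc q hq hqc => ?_⟩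
  obtain ⟨J, A', h, V, hV, hqV, hh, hA, hev⟩ := hs.2 c hc q hq hqc
  have hcd : ∀ m, ContDiffOn ℝ ∞ (h m) V := by
    intro m
    have h1 := hh m
    rw [← modelWithCornersSelf_prod, chartedSpaceSelf_prod] at h1
    exact contMDiffOn_iff_contDiffOn.1 h1
  -- the smooth representative of the coefficients is replaced by its partial derivative
  refine ⟨J, A', fun m z => fderiv ℝ (h m) z (e, 0), V, hV, hqV, fun m => ?_, fun m hm => ?_, ?_⟩
  · rw [← modelWithCornersSelf_prod, chartedSpaceSelf_prod]
    exact contMDiffOn_iff_contDiffOn.2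
      (((contDiffOn_infty_iff_fderiv_of_isOpen hV).1 (hcd m)).2.clm_apply contDiffOn_const)
  · funext z
    simp [hA m hm]
  · have hxc : ContinuousAt (fun r : (Fin d → ℝ) × M.carrier => (r.1, fun j : J => c.x r.2 j)) q := by
      refine continuousAt_fst.prodMk (continuousAt_pi.2 fun j => ?_)
      have h1 : ContinuousOn c.x c.dom := by
        rw [continuousOn_iff_continuous_domRestrict]
        exact c.isOpenEmbedding.continuous
      exact (continuous_apply (j : c.B)).continuousAt.comp
        ((h1.continuousAt (c.dom.isOpen.mem_nhds hqc)).comp continuousAt_snd)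
    filter_upwards [hev.eventually_nhds, W.isOpen.mem_nhds hq,
      (c.dom.isOpen.preimage continuous_snd).mem_nhds hqc, hxc.preimage_mem_nhds
      (hV.mem_nhds hqV)] with r hr hrW hrc hrV m
    have h2 : (fun r' => c.cf (slice W r') (s r') m r.2) =ᶠ[𝓝 r.1]
        fun r' => h m (r', fun j : J => c.x r.2 j) := by
      have hcont : Continuous fun r' : Fin d → ℝ => (r', r.2) := by fun_prop
      filter_upwards [hcont.continuousAt.eventually hr] with r' hr'
      exact hr' m
    refine (hs.hasFamDeriv r.1 e c hc r.2 hrW hrc m).trans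
      ((dirD_congr _ h2 e).trans ((dirD_eq_fderiv _ r.1 e).trans ?_))
    have h3 : HasFDerivAt (h m) (fderiv ℝ (h m) (r.1, fun j : J => c.x r.2 j))
        (r.1, fun j : J => c.x r.2 j) :=
      (((hcd m).differentiableOn (by simp)).differentiableAt (hV.mem_nhds hrV)).hasFDerivAt
    have h4 := HasFDerivAt.comp (g := h m) r.1 h3
      (hasFDerivAt_prodMk_left (𝕜 := ℝ) r.1 (fun j : J => c.x r.2 j))
    refine (congrArg (fun L => L e) h4.fderiv).trans ?_
    simp

/-- The derivative of a smooth family along a smooth vector field of the parameter space is a smooth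
family. -/
theorem IsSmoothFam.famDeriv {W : Opens (N × M.carrier)} {s : M.Fam W}
    (hs : IsSmoothFam I W k s) {v : ∀ n : N, TangentSpace I n}
    (hv : ContMDiff I I.tangent ∞ fun n => (⟨n, v n⟩ : TangentBundle I N)) :
    IsSmoothFam I W k fun n => famDeriv I W s n (v n) := by
  refine isSmoothFam_of_local fun q hq => ?_
  -- in coordinates `χ` of the parameter space, the derivative is the combination of the partial
  -- derivatives with the components of the vector field as coefficients
  obtain ⟨C⟩ := LocalCoords.nonempty I q.1
  refine ⟨C.cut W, C.cut_le W, ⟨C.mem, hq⟩, ?_⟩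
  have hcoef : ContMDiffOn I 𝓘(ℝ, Fin C.d → ℝ) ∞
      (fun n => dirD I C.χ n (v n)) C.Ω :=
    contMDiffOn_dirD C.isOpen_Ω C.smooth_χ hv
  have hterm : ∀ j, IsSmoothFam I (C.cut W) k fun n =>
      (dirD I C.χ n (v n) : Fin C.d → ℝ) j •
        pbFam C.χ (C.mem_dom W)
          (fun r => GradedManifold.famDeriv 𝓘(ℝ, Fin C.d → ℝ) (C.dom W) (C.fam W s) r
            (Pi.single j 1)) n := by
    intro j
    have h1 : IsSmoothFam I (C.cut W) k (pbFam C.χ (C.mem_dom W)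
          (fun r => GradedManifold.famDeriv 𝓘(ℝ, Fin C.d → ℝ) (C.dom W) (C.fam W s) r
            (Pi.single j 1))) :=
      ((C.fam_smooth W hs).partial (Pi.single j 1)).pb C.isOpen_Ω C.smooth_χ
        (fun q (hq : q ∈ C.cut W) => hq.1) _
    refine h1.smul C.isOpen_Ω ?_ fun q (hq : q ∈ C.cut W) => hq.1
    exact (contMDiff_iff_contDiff.2 (contDiff_apply ℝ ℝ j)).comp_contMDiffOn hcoef
  convert IsSmoothFam.sum Finset.univ fun j _ => hterm j using 1
  funext n
  rw [Finset.sum_apply]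
  by_cases hn : n ∈ C.Ω
  · have h1 := ((hs.hasFamDeriv n (v n)).res (C.cut_le W))
    let ξ : Fin C.d → ℝ := dirD I C.χ n (v n)
    have h2 : HasFamDeriv 𝓘(ℝ, Fin C.d → ℝ) (C.dom W) (C.fam W s) (C.χ n) ξ (∑ j, ξ j •
        GradedManifold.famDeriv 𝓘(ℝ, Fin C.d → ℝ) (C.dom W) (C.fam W s) (C.χ n)
          (Pi.single j 1)) := by
      have h3 := HasFamDeriv.sum_vec (I := 𝓘(ℝ, Fin C.d → ℝ)) Finset.univ fun j _ =>
        ((C.fam_smooth W hs).hasFamDeriv (C.χ n) (Pi.single j 1)).smul_vec (ξ j)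
      exact (congrArg (fun z => HasFamDeriv 𝓘(ℝ, Fin C.d → ℝ) (C.dom W) (C.fam W s) (C.χ n) z _)
        (pi_eq_sum_univ' ξ)).mpr h3
    have h4 := HasFamDeriv.pb (C.fam_smooth W hs) ((C.smooth_χ.contMDiffAt
      (C.isOpen_Ω.mem_nhds hn)).mdifferentiableAt (by simp)) (C.mem_dom W) h2
    rw [C.pb_fam] at h4
    rw [h1.unique h4, map_sum]
    refine Finset.sum_congr rfl fun j _ => ?_
    rw [map_smul]
    rfl
  · refine eq_of_cf fun c hc p hp => absurd hp.1 hn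

end Derivative

end GradedManifold

/-! ### Local operators on functions -/

open GradedManifold

/-- A linear operator from functions on `M` to functions on `M'` which is local over a continuous map
of the bodies defined on `dom`, and which maps smooth families to smooth families. Vector
fields and pullbacks of functions are of this kind. -/
structure LocalOp (M : GradedManifold.{u}) (M' : GradedManifold.{v}) (d : ℤ) where
  dom : Opens M'.carrier
  body : M'.carrier → M.carrier
  cont : ContinuousOn body dom
  D : ∀ (U : Opens M.carrier) (Y : Opens M'.carrier), (∀ y ∈ Y, y ∈ dom ∧ body y ∈ U) →
    M.O U →ₗ[ℝ] M'.O Y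
  res_D : ∀ U Y h Y' (hY : Y' ≤ Y) f, M'.res hY (D U Y h f) = D U Y' (fun y hy => h y (hY hy)) f
  D_res : ∀ U U' Y (hU : U' ≤ U) h f,
    D U' Y h (M.res hU f) = D U Y (fun y hy => ⟨(h y hy).1, hU (h y hy).2⟩) f
  smooth : ∀ (n : ℕ) (W : Opens ((Fin n → ℝ) × M.carrier)) k (s : M.Fam W),
    IsSmoothFam 𝓘(ℝ, Fin n → ℝ) W k s → ∀ (W' : Opens ((Fin n → ℝ) × M'.carrier))
    (h : ∀ r, ∀ y ∈ slice W' r, y ∈ dom ∧ body y ∈ slice W r),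
    IsSmoothFam 𝓘(ℝ, Fin n → ℝ) W' (k + d) fun r => D (slice W r) (slice W' r) (h r) (s r)

namespace LocalOp

variable {M : GradedManifold.{u}} {M' : GradedManifold.{v}} {d : ℤ} (P : LocalOp M M' d)

theorem D_congr {U U' : Opens M.carrier} {Y : Opens M'.carrier}
    (h : ∀ y ∈ Y, y ∈ P.dom ∧ P.body y ∈ U) (h' : ∀ y ∈ Y, y ∈ P.dom ∧ P.body y ∈ U')
    {f : M.O U} {f' : M.O U'} {V : Opens M.carrier} (hV : V ≤ U) (hV' : V ≤ U')
    (hY : ∀ y ∈ Y, P.body y ∈ V) (hf : M.res hV f = M.res hV' f') :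
    P.D U Y h f = P.D U' Y h' f' := by
  have h1 := P.D_res U V Y hV (fun y hy => ⟨(h y hy).1, hY y hy⟩) f
  have h2 := P.D_res U' V Y hV' (fun y hy => ⟨(h y hy).1, hY y hy⟩) f'
  rw [← h1, ← h2, hf]

variable {N EN HN : Type*} [NormedAddCommGroup EN] [NormedSpace ℝ EN]
  [TopologicalSpace HN] {I : ModelWithCorners ℝ EN HN} [TopologicalSpace N] [ChartedSpace HN N]
  {k : ℤ}

/-- The action on families, parameter by parameter. -/
def fam {W : Opens (N × M.carrier)} {W' : Opens (N × M'.carrier)}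
    (h : ∀ n, ∀ y ∈ slice W' n, y ∈ P.dom ∧ P.body y ∈ slice W n) (s : M.Fam W) : M'.Fam W' :=
  fun n => P.D (slice W n) (slice W' n) (h n) (s n)

/-- A local operator commutes with derivatives of families over `ℝ^d`: it can be
applied to the terms of Hadamard's lemma. -/
theorem hasFamDeriv_of_euclidean {e : ℕ} {W : Opens ((Fin e → ℝ) × M.carrier)}
    {W' : Opens ((Fin e → ℝ) × M'.carrier)}
    (h : ∀ n, ∀ y ∈ slice W' n, y ∈ P.dom ∧ P.body y ∈ slice W n) {s : M.Fam W}
    (hs : IsSmoothFam 𝓘(ℝ, Fin e → ℝ) W k s) {a v : Fin e → ℝ} {t : M.O (slice W a)}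
    (ht : HasFamDeriv 𝓘(ℝ, Fin e → ℝ) W s a v t) :
    HasFamDeriv 𝓘(ℝ, Fin e → ℝ) W' (P.fam h s) a v (P.D (slice W a) (slice W' a) (h a) t) := by
  refine hasFamDeriv_of_expansion (k := k + d) fun y hy => ?_
  -- near the point the family is `s a + ∑ j, (r j - a j) • w j r`, and the operator, being linear
  -- over constants, maps this to an expansion of the same form
  obtain ⟨W₁, hW₁, hW₁', w, hap, hw, hexp⟩ := hs.hadamard (a := a) (p := P.body y) (h a y hy).2
  have hcont : ContinuousOn (fun q : (Fin e → ℝ) × M'.carrier => (q.1, P.body q.2))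
      {q | q.2 ∈ P.dom} :=
    continuousOn_fst.prodMk (P.cont.comp continuousOn_snd fun q hq => hq)
  let W₂ : Opens ((Fin e → ℝ) × M'.carrier) :=
    ⟨W' ∩ (({q | q.2 ∈ P.dom} ∩ (fun q => (q.1, P.body q.2)) ⁻¹' W₁) ∩
      {q | (a, q.2) ∈ W'}),
      W'.isOpen.inter ((hcont.isOpen_inter_preimage (P.dom.isOpen.preimage continuous_snd)
        W₁.isOpen).inter (W'.isOpen.preimage (by fun_prop)))⟩
  have hW₂ : W₂ ≤ W' := fun q hq => hq.1
  have hh : ∀ r, ∀ y ∈ slice W₂ r, y ∈ P.dom ∧ P.body y ∈ slice W₁ r := fun r y hy => hy.2.1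
  have hW₂' : ∀ r, slice W₂ r ≤ slice W₂ a := fun r y hy =>
    ⟨hy.2.2, ⟨hy.2.1.1, hW₁' r (hy.2.1.2 : P.body y ∈ slice W₁ r)⟩, hy.2.2⟩
  refine ⟨W₂, hW₂, hW₂', fun j => P.fam hh (w j), ⟨hy, ⟨(h a y hy).1, hap⟩, hy⟩, fun j =>
    P.smooth e W₁ k (w j) (hw j) W₂ hh, fun r => ?_, ?_⟩
  · have h1 := congrArg (P.D (slice W₁ r) (slice W₂ r) (hh r)) (hexp r)
    simp only [map_add, map_sum, map_smul, P.D_res] at h1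
    simp only [fam, P.res_D]
    exact h1
  · -- the derivative of the given family is determined by the values of the quotients at `a`
    have h1 : HasFamDeriv 𝓘(ℝ, Fin e → ℝ) W₁ (fun r => M.res (slice_mono hW₁ r) (s r)) a v
        (∑ j, v j • w j a) := by
      refine hasFamDeriv_of_expansion (k := k) fun p' hp' =>
        ⟨W₁, le_rfl, hW₁', w, hp', hw, fun r => ?_, ?_⟩
      · rw [res_self', hexp, res_res']
      · rw [res_self']
    have h2 := congrArg (P.D (slice W₁ a) (slice W₂ a) (hh a)) ((ht.res hW₁).unique h1)
    simp only [map_sum, map_smul, P.D_res] at h2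
    simp only [fam, P.res_D]
    exact h2

variable [FiniteDimensional ℝ EN] [I.Boundaryless] [IsManifold I ∞ N]

section LocalCoords

variable {n : N} (C : LocalCoords I n) {W : Opens (N × M.carrier)} {W' : Opens (N × M'.carrier)}

theorem coords_compat
    (h : ∀ n, ∀ y ∈ slice W' n, y ∈ P.dom ∧ P.body y ∈ slice W n) :
    ∀ r, ∀ y ∈ slice (C.dom W') r, y ∈ P.dom ∧ P.body y ∈ slice (C.dom W) r :=
  fun r y hy => ⟨(h (C.ψ r) y hy.2).1, hy.1, (h (C.ψ r) y hy.2).2⟩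

/-- A local operator does not act on the parameter, hence commutes with the passage to coordinates
of the parameter space. -/
theorem pb_fam_coords
    (h : ∀ n, ∀ y ∈ slice W' n, y ∈ P.dom ∧ P.body y ∈ slice W n) (s : M.Fam W) :
    pbFam C.χ (C.mem_dom W') (P.fam (P.coords_compat C h) (C.fam W s)) =
      fun n => M'.res (slice_mono (C.cut_le W') n) (P.fam h s n) := by
  funext n'
  have hb : ∀ y ∈ slice (C.cut W') n', y ∈ P.dom ∧ P.body y ∈ slice (C.cut W) n' :=
    fun y hy => ⟨(h n' y hy.2).1, hy.1, (h n' y hy.2).2⟩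
  have h1 := congrFun (C.pb_fam W s) n'
  have h2 := congrArg (P.D (slice (C.cut W) n') (slice (C.cut W') n') hb) h1
  simp only [pbFam, P.D_res] at h2
  simp only [pbFam, fam, P.res_D]
  exact h2

end LocalCoords

theorem smoothFam {W : Opens (N × M.carrier)} {W' : Opens (N × M'.carrier)}
    (h : ∀ n, ∀ y ∈ slice W' n, y ∈ P.dom ∧ P.body y ∈ slice W n) {s : M.Fam W}
    (hs : IsSmoothFam I W k s) : IsSmoothFam I W' (k + d) (P.fam h s) := by
  refine isSmoothFam_of_local fun q hq => ?_
  obtain ⟨C⟩ := LocalCoords.nonempty I q.1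
  refine ⟨C.cut W', C.cut_le W', ⟨C.mem, hq⟩, ?_⟩
  rw [← P.pb_fam_coords C h s]
  exact (P.smooth C.d (C.dom W) k (C.fam W s) (C.fam_smooth W hs) (C.dom W')
    (P.coords_compat C h)).pb C.isOpen_Ω C.smooth_χ (fun q (hq : q ∈ C.cut W') => hq.1) _

/-- Local operators commute with derivatives along the parameter space. -/
theorem hasFamDeriv {W : Opens (N × M.carrier)} {W' : Opens (N × M'.carrier)}
    (h : ∀ n, ∀ y ∈ slice W' n, y ∈ P.dom ∧ P.body y ∈ slice W n) {s : M.Fam W}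
    (hs : IsSmoothFam I W k s) {n : N} {v : TangentSpace I n} {t : M.O (slice W n)}
    (ht : HasFamDeriv I W s n v t) :
    HasFamDeriv I W' (P.fam h s) n v (P.D (slice W n) (slice W' n) (h n) t) := by
  obtain ⟨C⟩ := LocalCoords.nonempty I n
  have hχ : MDifferentiableAt I 𝓘(ℝ, Fin C.d → ℝ) C.χ n := (C.smooth_χ.contMDiffAt
    (C.isOpen_Ω.mem_nhds C.mem)).mdifferentiableAt (by simp)
  have h0 := (C.fam_smooth W hs).hasFamDeriv (C.χ n) (mfderiv I 𝓘(ℝ, Fin C.d → ℝ) C.χ n v)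
  have h1 := HasFamDeriv.pb (C.fam_smooth W hs) hχ (C.mem_dom W) h0
  rw [C.pb_fam] at h1
  have h1' := h1.unique (ht.res (C.cut_le W))
  have h2 := P.hasFamDeriv_of_euclidean (P.coords_compat C h) (C.fam_smooth W hs) h0
  have h3 := HasFamDeriv.pb (P.smooth C.d (C.dom W) k (C.fam W s) (C.fam_smooth W hs) (C.dom W')
    (P.coords_compat C h)) hχ (C.mem_dom W') h2
  have h3' := congrFun (P.pb_fam_coords C h s)
  have hle : slice W' n ≤ slice (C.cut W') n := fun p hp => ⟨C.mem, hp⟩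
  have h4 : HasFamDeriv I W' (P.fam h s) n v _ := h3.congr hle fun p hp => by
    have hcont : Continuous fun r : N => (r, p) := by fun_prop
    filter_upwards [hcont.continuousAt.preimage_mem_nhds ((C.cut W').isOpen.mem_nhds (hle hp))]
      with n' hn' c hc m
    have h5 := h3' n'
    refine Eq.trans ?_ (congrArg (fun f => c.cf (slice (C.cut W') n') f m p) h5.symm)
    exact (c.cf_res _ _ _ hn').symm
  have h6 : M'.res hle (M'.res (slice_le_slice (C.mem_dom W') n)
      (P.D (slice (C.dom W) (C.χ n)) (slice (C.dom W') (C.χ n)) (P.coords_compat C h (C.χ n))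
        (GradedManifold.famDeriv 𝓘(ℝ, Fin C.d → ℝ) (C.dom W) (C.fam W s) (C.χ n)
          (mfderiv I 𝓘(ℝ, Fin C.d → ℝ) C.χ n v)))) =
      P.D (slice W n) (slice W' n) (h n) t := by
    rw [P.res_D, P.res_D]
    exact P.D_congr _ _ (slice_le_slice (C.mem_dom W) n) (slice_mono (C.cut_le W) n)
      (fun y hy => ⟨C.mem, (h n y hy).2⟩) h1'
  rw [← h6]
  exact h4

end LocalOp

/-- A vector field as a local operator. -/
def VField.toLocalOp {M : GradedManifold.{u}} {d : ℤ} (Q : VField M d) : LocalOp M M d where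
  dom := ⊤
  body := id
  cont := continuousOn_id
  D U Y h := (M.res fun y hy => (h y hy).2).toLinearMap ∘ₗ Q.D U
  res_D U Y h Y' hY f := res_res' _ _ _
  D_res U U' Y hU h f := by
    change M.res _ (Q.D U' (M.res hU f)) = M.res _ (Q.D U f)
    rw [Q.D_res, res_res']
  smooth n W k s hs W' h := (Q.smooth n W k s hs).res fun q hq => (h q.1 q.2 hq).2

/-- The pullback of functions along a morphism of graded manifolds with fixed parameter, as
a local operator. -/
def ParamMap.toLocalOp {EN N : Type*} [NormedAddCommGroup EN] [NormedSpace ℝ EN]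
    [TopologicalSpace N] [ChartedSpace EN N] {M : GradedManifold.{u}} {M' : GradedManifold.{v}}
    (φ : ParamMap EN N M M') (n : N) : LocalOp M' M 0 where
  dom := slice φ.dom n
  body y := φ.toFun (n, y)
  cont := φ.cont.comp (by fun_prop) fun y hy => hy
  D U Y h := (φ.pull n U Y h).toLinearMap
  res_D U Y h Y' hY f := φ.res_pull n U Y h Y' hY f
  D_res U U' Y hU h f := φ.pull_res n U U' Y hU h f
  smooth e W k s hs W' h := by
    have h1 := (φ.smooth e W k s hs).pb (I' := 𝓘(ℝ, Fin e → ℝ)) (φ := fun r => (r, n)) (W' := W')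
      isOpen_univ (contMDiff_id.prodMk contMDiff_const).contMDiffOn (fun _ _ => trivial)
      fun q hq => h q.1 q.2 hq
    rw [add_zero]
    convert h1 using 2 with r
    exact (φ.res_pull _ _ _ _ _ _ _).symm

namespace VField

variable {M : GradedManifold.{u}} {d : ℤ} (Q : VField M d)
  {N EN HN : Type*} [NormedAddCommGroup EN] [NormedSpace ℝ EN]
  [TopologicalSpace HN] {I : ModelWithCorners ℝ EN HN} [TopologicalSpace N] [ChartedSpace HN N]
  {k : ℤ} [FiniteDimensional ℝ EN] [I.Boundaryless] [IsManifold I ∞ N]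

theorem smoothFam {W : Opens (N × M.carrier)} {s : M.Fam W} (hs : IsSmoothFam I W k s) :
    IsSmoothFam I W (k + d) fun n => Q.D (slice W n) (s n) := by
  have := Q.toLocalOp.smoothFam (W' := W) (fun n y hy => ⟨trivial, hy⟩) hs
  convert this using 2 with n
  exact (res_self' _ _).symm

theorem hasFamDeriv {W : Opens (N × M.carrier)} {s : M.Fam W} (hs : IsSmoothFam I W k s) {n : N}
    {v : TangentSpace I n} {t : M.O (slice W n)} (ht : HasFamDeriv I W s n v t) :
    HasFamDeriv I W (fun n => Q.D (slice W n) (s n)) n v (Q.D (slice W n) t) := by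
  have := Q.toLocalOp.hasFamDeriv (W' := W) (fun n y hy => ⟨trivial, hy⟩) hs ht
  convert this using 1
  · funext n
    exact (res_self' _ _).symm
  · exact (res_self' _ _).symm

end VField

namespace ParamMap

variable {EN N : Type*} [NormedAddCommGroup EN] [NormedSpace ℝ EN]
  [TopologicalSpace N] [ChartedSpace EN N] {M : GradedManifold.{u}} {M' : GradedManifold.{v}}
  (φ : ParamMap EN N M M')
  {P EP HP : Type*} [NormedAddCommGroup EP] [NormedSpace ℝ EP]
  [TopologicalSpace HP] {I : ModelWithCorners ℝ EP HP} [TopologicalSpace P] [ChartedSpace HP P]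
  {k : ℤ} [FiniteDimensional ℝ EP] [I.Boundaryless] [IsManifold I ∞ P]
  {R ER HR : Type*} [NormedAddCommGroup ER] [NormedSpace ℝ ER]
  [TopologicalSpace HR] {J : ModelWithCorners ℝ ER HR} [TopologicalSpace R] [ChartedSpace HR R]

/-- The pullback of a smooth family, with all parameters depending smoothly on a point of `R`. -/
theorem smooth_pull {W : Opens (P × M'.carrier)} {s : M'.Fam W} (hs : IsSmoothFam I W k s)
    {a : R → P} {b : R → N} {Ω : Set R} (hΩ : IsOpen Ω) (ha : ContMDiffOn J I ∞ a Ω)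
    (hb : ContMDiffOn J 𝓘(ℝ, EN) ∞ b Ω) {W' : Opens (R × M.carrier)} (hW' : ∀ q ∈ W', q.1 ∈ Ω)
    (h : ∀ r, ∀ y ∈ slice W' r, (b r, y) ∈ φ.dom ∧ φ.toFun (b r, y) ∈ slice W (a r)) :
    IsSmoothFam J W' k fun r => φ.pull (b r) (slice W (a r)) (slice W' r) (h r) (s (a r)) := by
  refine isSmoothFam_of_local fun q hq => ?_
  obtain ⟨C⟩ := LocalCoords.nonempty I (a q.1)
  have hΩ' : IsOpen (Ω ∩ a ⁻¹' C.Ω) := ha.continuousOn.isOpen_inter_preimage hΩ C.isOpen_Ω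
  let W₁ := restrictParam W' _ hΩ'
  have hle : W₁ ≤ W' := fun q hq => hq.2
  refine ⟨W₁, hle, ⟨⟨hW' q hq, C.mem⟩, hq⟩, ?_⟩
  have hmaps : ∀ q ∈ W₁, ((C.χ (a q.1), b q.1), q.2) ∈
      pullOpens φ.dom φ.toFun φ.cont (C.dom W) := by
    intro q hq
    have h1 := h q.1 q.2 hq.2
    exact ⟨h1.1, C.mem_dom W (a q.1, φ.toFun (b q.1, q.2)) ⟨hq.1.2, h1.2⟩⟩
  have h1 := (φ.smooth C.d (C.dom W) k (C.fam W s) (C.fam_smooth W hs)).pb (I' := J)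
    (φ := fun r => (C.χ (a r), b r)) hΩ' ((C.smooth_χ.comp (ha.mono Set.inter_subset_left)
      fun r hr => hr.2).prodMk (hb.mono Set.inter_subset_left)) (fun q (hq : q ∈ W₁) => hq.1) hmaps
  convert h1 using 2 with r
  have hb' : ∀ y ∈ slice W₁ r, (b r, y) ∈ φ.dom ∧ φ.toFun (b r, y) ∈ slice (C.cut W) (a r) :=
    fun y hy => ⟨(h r y hy.2).1, hy.1.2, (h r y hy.2).2⟩
  have h2 := congrArg (φ.pull (b r) (slice (C.cut W) (a r)) (slice W₁ r) hb')
    (congrFun (C.pb_fam W s) (a r))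
  simp only [pbFam, φ.pull_res] at h2
  refine (φ.res_pull _ _ _ _ _ _ _).trans (h2.symm.trans ?_)
  have hle : slice W₁ r ≤ slice (pullOpens φ.dom φ.toFun φ.cont (C.dom W)) (C.χ (a r), b r) :=
    fun y hy => hmaps (r, y) hy
  exact (φ.res_pull (b r) (slice (C.dom W) (C.χ (a r))) _ (fun _ hy => hy) _ hle
    (C.fam W s (C.χ (a r)))).symm

theorem hasFamDeriv_pull {W : Opens (P × M'.carrier)} {s : M'.Fam W} (hs : IsSmoothFam I W k s)
    (n : N) {W' : Opens (P × M.carrier)}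
    (h : ∀ r, ∀ y ∈ slice W' r, (n, y) ∈ φ.dom ∧ φ.toFun (n, y) ∈ slice W r)
    {p : P} {v : TangentSpace I p} {t : M'.O (slice W p)} (ht : HasFamDeriv I W s p v t) :
    HasFamDeriv I W' (fun r => φ.pull n (slice W r) (slice W' r) (h r) (s r)) p v
      (φ.pull n (slice W p) (slice W' p) (h p) t) :=
  (φ.toLocalOp n).hasFamDeriv h hs ht

end ParamMap

/-! ### Vector fields on ordinary manifolds -/

section VectorFields

variable {EN N : Type*} [NormedAddCommGroup EN] [NormedSpace ℝ EN] [FiniteDimensional ℝ EN]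
  [TopologicalSpace N] [ChartedSpace EN N] [IsManifold 𝓘(ℝ, EN) ∞ N]

namespace Vect

@[ext] theorem ext' {v w : Vect EN N} (h : ∀ x, v x = w x) : v = w := by
  cases v; cases w
  congr
  exact funext h

/-- The product of a smooth function and a vector field. -/
def fsmul (f : C^∞⟮𝓘(ℝ, EN), N; ℝ⟯) (v : Vect EN N) : Vect EN N where
  toFun x := f x • v x
  contMDiff_toFun := ContMDiff.smul_section f.contMDiff v.contMDiff

theorem eq_fsmul {f : C^∞⟮𝓘(ℝ, EN), N; ℝ⟯} {v w : Vect EN N} (h : ∀ x, w x = f x • v x) :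
    w = fsmul f v := ext' h

/-- The derivative of a smooth function along a vector field. -/
def lie (v : Vect EN N) (f : C^∞⟮𝓘(ℝ, EN), N; ℝ⟯) : C^∞⟮𝓘(ℝ, EN), N; ℝ⟯ :=
  ⟨fun x => dirD 𝓘(ℝ, EN) f x (v x), contMDiffOn_univ.1
    (contMDiffOn_dirD isOpen_univ f.contMDiff.contMDiffOn v.contMDiff)⟩

theorem mdifferentiableAt (v : Vect EN N) (x : N) :
    MDifferentiableAt 𝓘(ℝ, EN) 𝓘(ℝ, EN).tangent
      (fun x => (⟨x, v x⟩ : TangentBundle 𝓘(ℝ, EN) N)) x :=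
  v.contMDiff.mdifferentiableAt (by simp)

theorem bracket_apply (v w : Vect EN N) (x : N) :
    bracket v w x = VectorField.mlieBracket 𝓘(ℝ, EN) v w x := rfl

theorem isManifold_two : IsManifold 𝓘(ℝ, EN) 2 N :=
  inferInstance

theorem bracket_swap (v w : Vect EN N) : bracket v w = -bracket w v := by
  ext x
  exact VectorField.mlieBracket_swap_apply

theorem bracket_self (v : Vect EN N) : bracket v v = 0 := by
  have h1 : bracket v v + bracket v v = 0 := by
    nth_rewrite 1 [bracket_swap v v]
    exact neg_add_cancel _
  have h2 : (2 : ℝ) • bracket v v = 0 := by rw [two_smul, h1]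
  exact (smul_eq_zero.1 h2).resolve_left two_ne_zero

theorem bracket_add_right (v w w' : Vect EN N) :
    bracket v (w + w') = bracket v w + bracket v w' := by
  have : CompleteSpace EN := FiniteDimensional.complete ℝ EN
  have : IsManifold 𝓘(ℝ, EN) 2 N := isManifold_two
  ext x
  exact VectorField.mlieBracket_add_right (w.mdifferentiableAt x) (w'.mdifferentiableAt x)

theorem bracket_add_left (v v' w : Vect EN N) :
    bracket (v + v') w = bracket v w + bracket v' w := by
  rw [bracket_swap, bracket_add_right, neg_add, ← bracket_swap, ← bracket_swap]

theorem bracket_fsmul_right (v w : Vect EN N) (f : C^∞⟮𝓘(ℝ, EN), N; ℝ⟯) :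
    bracket v (fsmul f w) = fsmul (lie v f) w + fsmul f (bracket v w) := by
  have : CompleteSpace EN := FiniteDimensional.complete ℝ EN
  have : IsManifold 𝓘(ℝ, EN) 2 N := isManifold_two
  ext x
  exact VectorField.mlieBracket_smul_right (f.contMDiff.mdifferentiableAt (by simp))
    (w.mdifferentiableAt x)

theorem jacobi (u v w : Vect EN N) :
    bracket u (bracket v w) = bracket (bracket u v) w + bracket v (bracket u w) := by
  have : CompleteSpace EN := FiniteDimensional.complete ℝ EN
  have : IsManifold 𝓘(ℝ, EN) (minSmoothness ℝ 3) N := by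
    simpa using (inferInstance : IsManifold 𝓘(ℝ, EN) 3 N)
  have h : minSmoothness ℝ 2 ≤ (∞ : WithTop ℕ∞) := by
    simpa using (ENat.LEInfty.out : (2 : WithTop ℕ∞) ≤ ∞)
  ext x
  exact congrFun (VectorField.leibniz_identity_mlieBracket (u.contMDiff.of_le h)
    (v.contMDiff.of_le h) (w.contMDiff.of_le h)) x

theorem sum_apply {ι : Type*} (t : Finset ι) (v : ι → Vect EN N) (x : N) :
    (∑ i ∈ t, v i) x = ∑ i ∈ t, v i x :=
  map_sum ((Pi.evalAddMonoidHom _ x).comp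
    (ContMDiffSection.coeAddHom 𝓘(ℝ, EN) EN ∞ (TangentSpace 𝓘(ℝ, EN) : N → Type _))) v t

/-- After multiplication by a function equal to one at `x`, all vector fields are combinations of
finitely many fixed ones, with coefficients whose value at `x` depends only on the value
of the vector field at `x`. -/
theorem exists_decomposition [T2Space N] (x : N) :
    ∃ (χ : C^∞⟮𝓘(ℝ, EN), N; ℝ⟯) (e : Fin (Module.finrank ℝ EN) → Vect EN N)
      (c : Fin (Module.finrank ℝ EN) → Vect EN N → C^∞⟮𝓘(ℝ, EN), N; ℝ⟯), χ x = 1 ∧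
      (∀ w : Vect EN N, fsmul χ w = ∑ i, fsmul (c i w) (e i)) ∧
      ∀ w w' : Vect EN N, w x = w' x → ∀ i, c i w x = c i w' x := by
  let t := trivializationAt EN (TangentSpace 𝓘(ℝ, EN)) x
  have hx : x ∈ t.baseSet := FiberBundle.mem_baseSet_trivializationAt EN _ x
  let b := Module.finBasis ℝ EN
  obtain ⟨χ, -, hχ⟩ := (SmoothBumpFunction.nhds_basis_tsupport (I := 𝓘(ℝ, EN)) x).mem_iff.1
    (t.open_baseSet.mem_nhds hx)
  have : ContMDiffVectorBundle ∞ EN (TangentSpace 𝓘(ℝ, EN) : N → Type _) 𝓘(ℝ, EN) :=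
    haveI : IsManifold 𝓘(ℝ, EN) (∞ + 1) N := by simpa using (inferInstance : IsManifold 𝓘(ℝ, EN) ∞ N)
    TangentBundle.contMDiffVectorBundle
  have hχ2 : ContMDiff 𝓘(ℝ, EN) 𝓘(ℝ, ℝ) ∞ fun y => χ y * χ y := χ.contMDiff.mul χ.contMDiff
  have he : ∀ i, ContMDiff 𝓘(ℝ, EN) 𝓘(ℝ, EN).tangent ∞
      fun y => (⟨y, χ y • t.localFrame b i y⟩ : TangentBundle 𝓘(ℝ, EN) N) := fun i =>
    ContMDiffOn.smul_section_of_tsupport χ.contMDiff.contMDiffOn t.open_baseSet hχ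
      (t.contMDiffOn_localFrame_baseSet ∞ b i)
  have hc : ∀ i (w : Vect EN N), ContMDiff 𝓘(ℝ, EN) 𝓘(ℝ, ℝ) ∞
      fun y => χ y • t.localFrameCoeff 𝓘(ℝ, EN) b i y (w y) := fun i w => by
    refine contMDiff_of_contMDiffOn_union_of_isOpen ?_ ?_ ?_ t.open_baseSet
      (isOpen_compl_iff.2 (isClosed_tsupport χ))
    · exact χ.contMDiff.contMDiffOn.smul
        (contMDiffOn_baseSet_localFrameCoeff b w.contMDiff.contMDiffOn i)
    · refine (contMDiffOn_const (c := (0 : ℝ))).congr fun y hy => ?_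
      simp [image_eq_zero_of_notMem_tsupport hy]
    · rw [Set.eq_univ_iff_forall]
      intro y
      by_cases hy : y ∈ tsupport χ
      · exact Or.inl (hχ hy)
      · exact Or.inr hy
  -- the frame and the coefficients are each multiplied by the bump function, so that both are
  -- globally smooth; hence the square
  let χ' : C^∞⟮𝓘(ℝ, EN), N; ℝ⟯ := ⟨_, hχ2⟩
  let e : Fin (Module.finrank ℝ EN) → Vect EN N := fun i => ⟨_, he i⟩
  let c : Fin (Module.finrank ℝ EN) → Vect EN N → C^∞⟮𝓘(ℝ, EN), N; ℝ⟯ := fun i w => ⟨_, hc i w⟩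
  refine ⟨χ', e, c, ?_, fun w => ?_, fun w w' hw i => ?_⟩
  · change χ x * χ x = 1
    rw [χ.eq_one, one_mul]
  · ext y
    rw [sum_apply]
    change (χ y * χ y) • w y = ∑ i, (χ y • t.localFrameCoeff 𝓘(ℝ, EN) b i y (w y)) •
      (χ y • t.localFrame b i y)
    by_cases hy : y ∈ tsupport χ
    · refine (congrArg (fun z => (χ y * χ y) • z)
        (t.eq_sum_localFrameCoeff_smul (I := 𝓘(ℝ, EN)) (b := b) (s := w) (hχ hy))).trans ?_
      refine Finset.smul_sum.trans (Finset.sum_congr rfl fun i _ => ?_)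
      rw [smul_smul, smul_smul]
      congr 1
      simp only [smul_eq_mul]
      ring
    · simp [image_eq_zero_of_notMem_tsupport hy]
  · change χ x • t.localFrameCoeff 𝓘(ℝ, EN) b i x (w x) =
      χ x • t.localFrameCoeff 𝓘(ℝ, EN) b i x (w' x)
    rw [hw]

end Vect

theorem inverse_mfderivWithin_extChartAt_symm {x : N} {r : EN}
    (hr : r ∈ (extChartAt 𝓘(ℝ, EN) x).target) :
    (mfderivWithin 𝓘(ℝ, EN) 𝓘(ℝ, EN) (extChartAt 𝓘(ℝ, EN) x).symm
      (Set.range 𝓘(ℝ, EN)) r).inverse =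
    mfderiv 𝓘(ℝ, EN) 𝓘(ℝ, EN) (extChartAt 𝓘(ℝ, EN) x) ((extChartAt 𝓘(ℝ, EN) x).symm r) := by
  have : IsManifold 𝓘(ℝ, EN) 1 N := inferInstance
  exact ContinuousLinearMap.inverse_eq
    (mfderivWithin_extChartAt_symm_comp_mfderiv_extChartAt hr)
    (mfderiv_extChartAt_comp_mfderivWithin_extChartAt_symm hr)

/-- The commutator formula for the derivatives of a vector valued function. -/
theorem dirD_bracket {Y : Type*} [NormedAddCommGroup Y] [NormedSpace ℝ Y] {φ : N → Y} {Ω : Set N}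
    (hΩ : IsOpen Ω) (hφ : ContMDiffOn 𝓘(ℝ, EN) 𝓘(ℝ, Y) ∞ φ Ω) (v w : Vect EN N) {x : N} (hx : x ∈ Ω) :
    dirD 𝓘(ℝ, EN) φ x (Vect.bracket v w x) =
      dirD 𝓘(ℝ, EN) (fun y => dirD 𝓘(ℝ, EN) φ y (w y)) x (v x) -
        dirD 𝓘(ℝ, EN) (fun y => dirD 𝓘(ℝ, EN) φ y (v y)) x (w x) := by
  have : CompleteSpace EN := FiniteDimensional.complete ℝ EN
  have : IsManifold 𝓘(ℝ, EN) 1 N := inferInstance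
  have : IsManifold 𝓘(ℝ, EN) 2 N := inferInstance
  -- the computation takes place in the chart at `x`: `f` is the coordinate expression of `φ`, and
  -- `P V` that of the vector field `V`
  let e := extChartAt 𝓘(ℝ, EN) x
  let f : EN → Y := φ ∘ e.symm
  have hxe : x ∈ e.source := mem_extChartAt_source x
  have hnear : ∀ᶠ y in 𝓝 x, y ∈ Ω ∩ e.source :=
    (hΩ.inter (isOpen_extChartAt_source x)).mem_nhds ⟨hx, hxe⟩
  have hf : ∀ y ∈ Ω ∩ e.source, ContDiffAt ℝ ∞ f (e y) := by
    intro y hy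
    refine contMDiffAt_iff_contDiffAt.1 ?_
    have h1 : ContMDiffAt 𝓘(ℝ, EN) 𝓘(ℝ, EN) ∞ e.symm (e y) :=
      (contMDiffOn_extChartAt_symm x).contMDiffAt ((isOpen_extChartAt_target x).mem_nhds
        (e.map_source hy.2))
    refine ContMDiffAt.comp (I' := 𝓘(ℝ, EN)) (e y) ?_ h1
    rw [e.left_inv hy.2]
    exact hφ.contMDiffAt (hΩ.mem_nhds hy.1)
  have hed : ∀ y ∈ e.source, MDifferentiableAt 𝓘(ℝ, EN) 𝓘(ℝ, EN) e y := fun y hy =>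
    mdifferentiableAt_extChartAt (by simpa [e] using hy)
  have hd : ∀ y ∈ Ω ∩ e.source, ∀ u : TangentSpace 𝓘(ℝ, EN) y,
      dirD 𝓘(ℝ, EN) φ y u = fderiv ℝ f (e y) (dirD 𝓘(ℝ, EN) e y u) := by
    intro y hy u
    have h1 : φ =ᶠ[𝓝 y] f ∘ e := by
      filter_upwards [(isOpen_extChartAt_source x).mem_nhds hy.2] with z hz
      simp only [f, Function.comp_apply, e.left_inv hz]
    rw [dirD_congr _ h1]
    have h2 := mfderiv_comp y (((hf y hy).differentiableAt (by simp)).mdifferentiableAt) (hed y hy.2)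
    unfold dirD
    rw [h2, mfderiv_eq_fderiv]
    rfl
  let P : Vect EN N → EN → EN := fun V r => dirD 𝓘(ℝ, EN) e (e.symm r) (V (e.symm r))
  have hPx : ∀ V : Vect EN N, P V (e x) = dirD 𝓘(ℝ, EN) e x (V x) := fun V =>
    congrArg (fun y => dirD 𝓘(ℝ, EN) e y (V y)) (e.left_inv hxe)
  have hP : ∀ V : Vect EN N, VectorField.mpullbackWithin 𝓘(ℝ, EN) 𝓘(ℝ, EN) e.symm V
      (Set.range 𝓘(ℝ, EN)) =ᶠ[𝓝 (e x)] P V := by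
    intro V
    filter_upwards [(isOpen_extChartAt_target x).mem_nhds (e.map_source hxe)] with r hr
    rw [VectorField.mpullbackWithin_apply, inverse_mfderivWithin_extChartAt_symm hr]
    rfl
  have hPd : ∀ V : Vect EN N, DifferentiableAt ℝ (P V) (e x) := by
    intro V
    have h1 := MDifferentiableWithinAt.differentiableWithinAt_mpullbackWithin_vectorField
      (s := Set.univ) (V.mdifferentiableAt x).mdifferentiableWithinAt
    have hset : e.symm ⁻¹' Set.univ ∩ Set.range 𝓘(ℝ, EN) = Set.univ := by simp
    have h2 := h1.mono (subset_of_eq hset.symm)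
    exact (h2.differentiableAt Filter.univ_mem).congr_of_eventuallyEq (hP V).symm
  have hsecond : ∀ V W : Vect EN N, dirD 𝓘(ℝ, EN) (fun y => dirD 𝓘(ℝ, EN) φ y (W y)) x (V x) =
      fderiv ℝ (fderiv ℝ f) (e x) (P V (e x)) (P W (e x)) +
        fderiv ℝ f (e x) (fderiv ℝ (P W) (e x) (P V (e x))) := by
    intro V W
    have h1 : (fun y => dirD 𝓘(ℝ, EN) φ y (W y)) =ᶠ[𝓝 x]
        (fun r => fderiv ℝ f r (P W r)) ∘ e := by
      filter_upwards [hnear] with y hy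
      rw [hd y hy]
      exact congrArg (fun z => fderiv ℝ f (e y) (dirD 𝓘(ℝ, EN) e z (W z)))
        (e.left_inv hy.2).symm
    have hf1 : DifferentiableAt ℝ (fderiv ℝ f) (e x) :=
      (((hf x ⟨hx, hxe⟩).fderiv_right (m := 1)
        (by rw [one_add_one_eq_two]; exact ENat.LEInfty.out)).differentiableAt (by simp))
    have h3 := hf1.hasFDerivAt.clm_apply (hPd W).hasFDerivAt
    rw [dirD_congr _ h1]
    have h2 := mfderiv_comp x h3.differentiableAt.mdifferentiableAt (hed x hxe)
    unfold dirD
    rw [h2, mfderiv_eq_fderiv, h3.fderiv, hPx V]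
    exact add_comm _ _
  -- the second derivatives of `f` cancel by symmetry, and the remaining terms are the derivative
  -- of `f` along the bracket of the coordinate expressions
  have hsymm : IsSymmSndFDerivAt ℝ f (e x) :=
    ((hf x ⟨hx, hxe⟩)).isSymmSndFDerivAt
      (by simpa using (ENat.LEInfty.out : (2 : WithTop ℕ∞) ≤ ∞))
  rw [hsecond, hsecond, hsymm.eq, add_sub_add_left_eq_sub, ← map_sub, hd x ⟨hx, hxe⟩]
  congr 1
  have h4 : dirD 𝓘(ℝ, EN) e x (Vect.bracket v w x) =
      VectorField.lieBracketWithin ℝ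
        (VectorField.mpullbackWithin 𝓘(ℝ, EN) 𝓘(ℝ, EN) e.symm v (Set.range 𝓘(ℝ, EN)))
        (VectorField.mpullbackWithin 𝓘(ℝ, EN) 𝓘(ℝ, EN) e.symm w (Set.range 𝓘(ℝ, EN)))
        (e.symm ⁻¹' Set.univ ∩ Set.range 𝓘(ℝ, EN)) (e x) := by
    unfold dirD
    rw [Vect.bracket_apply, VectorField.mlieBracket, VectorField.mlieBracketWithin_apply]
    exact (isInvertible_mfderiv_extChartAt (mem_extChartAt_source x)).self_apply_inverse _
  rw [h4]
  have hset : e.symm ⁻¹' Set.univ ∩ Set.range 𝓘(ℝ, EN) = Set.univ := by simp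
  refine (congrArg (fun s => VectorField.lieBracketWithin ℝ _ _ s (e x)) hset).trans
    ((congrFun VectorField.lieBracketWithin_univ (e x)).trans
      ((Filter.EventuallyEq.lieBracket_vectorField_eq (hP v) (hP w)).trans ?_))
  rfl

/-- Brackets of related vector fields are related. -/
theorem bracket_related {EN' N' : Type*} [NormedAddCommGroup EN'] [NormedSpace ℝ EN']
    [FiniteDimensional ℝ EN'] [TopologicalSpace N'] [ChartedSpace EN' N']
    [IsManifold 𝓘(ℝ, EN') ∞ N'] {π : N → N'} (hπ : ContMDiff 𝓘(ℝ, EN) 𝓘(ℝ, EN') ∞ π)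
    {v w : Vect EN N} {v' w' : Vect EN' N'}
    (hv : ∀ x, v' (π x) = mfderiv 𝓘(ℝ, EN) 𝓘(ℝ, EN') π x (v x))
    (hw : ∀ x, w' (π x) = mfderiv 𝓘(ℝ, EN) 𝓘(ℝ, EN') π x (w x)) (x : N) :
    Vect.bracket v' w' (π x) = mfderiv 𝓘(ℝ, EN) 𝓘(ℝ, EN') π x (Vect.bracket v w x) := by
  have : IsManifold 𝓘(ℝ, EN') 1 N' := inferInstance
  let e := extChartAt 𝓘(ℝ, EN') (π x)
  have he : ContMDiffOn 𝓘(ℝ, EN') 𝓘(ℝ, EN') ∞ e e.source := by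
    have := contMDiffOn_extChartAt (I := 𝓘(ℝ, EN')) (n := ∞) (x := π x)
    rwa [← extChartAt_source 𝓘(ℝ, EN')] at this
  have heo : IsOpen e.source := isOpen_extChartAt_source _
  have hxe : π x ∈ e.source := mem_extChartAt_source _
  have hchain : ∀ {Y : Type _} [NormedAddCommGroup Y] [NormedSpace ℝ Y] {g : N' → Y} {y : N}
      (_ : MDifferentiableAt 𝓘(ℝ, EN') 𝓘(ℝ, Y) g (π y)) (u : TangentSpace 𝓘(ℝ, EN) y),
      dirD 𝓘(ℝ, EN) (g ∘ π) y u = dirD 𝓘(ℝ, EN') g (π y) (mfderiv 𝓘(ℝ, EN) 𝓘(ℝ, EN') π y u) := by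
    intro Y _ _ g y hg u
    unfold dirD
    rw [mfderiv_comp y hg (hπ.mdifferentiableAt (by simp))]
    rfl
  have hed : ∀ y ∈ e.source, MDifferentiableAt 𝓘(ℝ, EN') 𝓘(ℝ, EN') e y := fun y hy =>
    (he.contMDiffAt (heo.mem_nhds hy)).mdifferentiableAt (by simp)
  have hinj : Function.Injective (mfderiv 𝓘(ℝ, EN') 𝓘(ℝ, EN') e (π x)) :=
    (isInvertible_mfderiv_extChartAt (mem_extChartAt_source (π x))).injective
  refine hinj ?_
  have hnear : ∀ᶠ y in 𝓝 x, π y ∈ e.source :=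
    hπ.continuous.continuousAt.preimage_mem_nhds (heo.mem_nhds hxe)
  -- both sides are compared after applying the chart `e`, where the commutator formula holds
  -- upstairs for `e ∘ π` and downstairs for `e`
  have h1 : ∀ (u : Vect EN N) (u' : Vect EN' N'),
      (∀ x, u' (π x) = mfderiv 𝓘(ℝ, EN) 𝓘(ℝ, EN') π x (u x)) →
      (fun y => dirD 𝓘(ℝ, EN) (e ∘ π) y (u y)) =ᶠ[𝓝 x]
        (fun z => dirD 𝓘(ℝ, EN') e z (u' z)) ∘ π := by
    intro u u' hu
    filter_upwards [hnear] with y hy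
    rw [hchain (hed _ hy), ← hu y]
    rfl
  have h2 : ∀ u' : Vect EN' N', MDifferentiableAt 𝓘(ℝ, EN') 𝓘(ℝ, EN')
      (fun z => dirD 𝓘(ℝ, EN') e z (u' z)) (π x) := fun u' =>
    ((contMDiffOn_dirD heo he u'.contMDiff).contMDiffAt (heo.mem_nhds hxe)).mdifferentiableAt
      (by simp)
  have h3 := dirD_bracket heo he v' w' hxe
  have h4 := dirD_bracket (heo.preimage hπ.continuous)
    (he.comp hπ.contMDiffOn fun y hy => hy) v w (x := x) hxe
  rw [dirD_congr _ (h1 v v' hv), dirD_congr _ (h1 w w' hw), hchain (h2 v'), hchain (h2 w'),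
    ← hv x, ← hw x, ← h3, hchain (hed _ hxe)] at h4
  exact h4.symm

end VectorFields

/-! ### Cartan calculus for forms with values in graded functions -/

namespace PreForm

section Recursion

variable {X R : Type*} [AddCommGroup R]

theorem contract_sub (l : X) (α β : PreForm X R) :
    contract l (α - β) = contract l α - contract l β := rfl

theorem removeNth_zero_cons {p : ℕ} (l : X) (w : Fin p → X) :
    (0 : Fin (p + 1)).removeNth (Fin.cons l w : Fin (p + 1) → X) = w := by
  funext i
  simp [Fin.removeNth]

theorem removeNth_succ_cons {p : ℕ} (l : X) (w : Fin (p + 1) → X) (i : Fin (p + 1)) :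
    i.succ.removeNth (Fin.cons l w : Fin (p + 2) → X) = Fin.cons l (i.removeNth w) := by
  funext j
  induction j using Fin.cases <;> simp [Fin.removeNth]

/-- The alternating sum anticommutes with the contraction up to the term in which `D` is taken
along the contracted vector: this is the expansion of the sum along its first argument. -/
theorem contract_altSum (D : X → R → R) (l : X) (α : PreForm X R) (p : ℕ) (w : Fin p → X) :
    contract l (altSum D α) p w = D l (α p w) - altSum D (contract l α) p w := by
  change altSum D α (p + 1) (Fin.cons l w) = _
  rw [altSum, Fin.sum_univ_succ]
  simp only [Fin.val_zero, pow_zero, one_smul, Fin.cons_zero, Fin.cons_succ, Fin.val_succ]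
  rw [removeNth_zero_cons, sub_eq_add_neg]
  congr 1
  cases p with
  | zero => simp [altSum]
  | succ p =>
    rw [altSum, ← Finset.sum_neg_distrib]
    refine Finset.sum_congr rfl fun i _ => ?_
    rw [pow_succ, mul_neg_one, neg_smul, removeNth_succ_cons]
    rfl

theorem cons_cons_comp_swap {p : ℕ} (l m : X) (w : Fin p → X) :
    (Fin.cons l (Fin.cons m w) : Fin (p + 2) → X) ∘ Equiv.swap 0 1 = Fin.cons m (Fin.cons l w) := by
  funext j
  induction j using Fin.cases with
  | zero => simp
  | succ j =>
    induction j using Fin.cases with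
    | zero => simp
    | succ j =>
      have h1 : j.succ.succ ≠ 1 := by
        rw [← Fin.succ_zero_eq_one, Ne, Fin.succ_inj]
        exact Fin.succ_ne_zero j
      rw [Function.comp_apply, Equiv.swap_apply_of_ne_of_ne (Fin.succ_ne_zero _) h1]
      simp

/-- A sequence of antisymmetric maps. -/
def IsAntisymm (α : PreForm X R) : Prop :=
  ∀ p (v : Fin p → X) i j, i ≠ j → α p (v ∘ Equiv.swap i j) = -α p v

theorem IsAntisymm.comp_perm {α : PreForm X R} (hα : α.IsAntisymm) {p : ℕ} (σ : Equiv.Perm (Fin p))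
    (v : Fin p → X) : α p (v ∘ σ) = (Equiv.Perm.sign σ : ℤ) • α p v := by
  induction σ using Equiv.Perm.swap_induction_on generalizing v with
  | one => simp
  | swap_mul f i j hij ih =>
    rw [Equiv.Perm.coe_mul, ← Function.comp_assoc, ih, hα p v i j hij, Equiv.Perm.sign_mul,
      Equiv.Perm.sign_swap hij]
    simp

theorem IsAntisymm.cons_removeNth {α : PreForm X R} (hα : α.IsAntisymm) {p : ℕ} (x : X)
    (w : Fin (p + 1) → X) (i : Fin (p + 1)) :
    α (p + 1) (Fin.cons x (i.removeNth w)) = (-1 : ℤ) ^ (i : ℕ) • α (p + 1) (Function.update w i x) := by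
  have h1 : (Fin.cons x (i.removeNth w) : Fin (p + 1) → X) =
      Function.update w i x ∘ i.cycleRange.symm := by
    funext j
    induction j using Fin.cases with
    | zero => simp
    | succ j => simp [Fin.removeNth, Fin.succAbove_ne]
  rw [h1, hα.comp_perm, Equiv.Perm.sign_symm, Fin.sign_cycleRange]
  simp

/-- The bracket sum anticommutes with the contraction up to the brackets with the contracted
vector; antisymmetry moves such a bracket from the first position to the position it comes from. -/
theorem contract_bracketSum (br : X → X → X) (l : X) {α : PreForm X R} (hα : α.IsAntisymm) (p : ℕ)
    (w : Fin p → X) :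
    contract l (bracketSum br α) p w =
      -∑ i, α p (Function.update w i (br l (w i))) - bracketSum br (contract l α) p w := by
  change bracketSum br α (p + 1) (Fin.cons l w) = _
  cases p with
  | zero => simp [bracketSum]
  | succ p =>
    rw [bracketSum, Fin.sum_univ_succ]
    simp only [Fin.not_lt_zero, if_false, Finset.sum_const_zero, zero_add, Fin.cons_succ,
      removeNth_succ_cons]
    have h1 : ∀ j : Fin (p + 1), (-1 : ℤ) ^ ((j : ℕ) + 1) • α (p + 1) (Fin.cons (br l (w j))
        (j.removeNth w)) = -α (p + 1) (Function.update w j (br l (w j))) := by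
      intro j
      rw [hα.cons_removeNth, smul_smul, ← pow_add, add_right_comm, pow_succ, Even.neg_one_pow ⟨_, rfl⟩]
      simp
    cases p with
    | zero =>
      have := h1 0
      simpa [bracketSum] using this
    | succ p =>
      rw [bracketSum, sub_eq_add_neg, ← Finset.sum_neg_distrib, ← Finset.sum_neg_distrib,
        ← Finset.sum_add_distrib]
      refine Finset.sum_congr rfl fun j _ => ?_
      rw [Fin.sum_univ_succ, ← Finset.sum_neg_distrib]
      refine congrArg₂ (· + ·) ?_ (Finset.sum_congr rfl fun i _ => ?_)
      · rw [← h1 j, if_pos (by simp), removeNth_zero_cons]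
        simp
      · simp only [Fin.castSucc_succ, Fin.succ_lt_succ_iff, Fin.cons_succ, removeNth_succ_cons]
        split_ifs with h
        · rw [Fin.val_succ, Fin.val_succ, show (i : ℕ) + 1 + (j + 1) = (i + j + 1) + 1 by ring,
            pow_succ, pow_succ]
          change _ = -((-1 : ℤ) ^ ((i : ℕ) + j) • α (p + 2) (Fin.cons l (Fin.cons _ _)))
          have h2 := hα (p + 2) (Fin.cons l (Fin.cons (br (w i.castSucc) (w j))
            (i.removeNth (j.removeNth w)))) 0 1 (by simp)
          rw [show (Fin.cons l (Fin.cons (br (w i.castSucc) (w j)) (i.removeNth (j.removeNth w))) :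
            Fin (p + 2) → X) ∘ Equiv.swap 0 1 = Fin.cons (br (w i.castSucc) (w j))
              (Fin.cons l (i.removeNth (j.removeNth w))) from ?_] at h2
          · rw [h2]
            simp
          · exact cons_cons_comp_swap _ _ _
        · simp

/-- The commutator of a contraction with a Lie derivative is the contraction with the bracket. -/
theorem contract_lieDer (br : X → X → X) (D : X → R → R) (l m : X) (α : PreForm X R) :
    contract m (lieDer br D l α) = lieDer br D l (contract m α) - contract (br l m) α := by
  funext p w
  change D l (α (p + 1) (Fin.cons m w)) - _ = D l (α (p + 1) (Fin.cons m w)) - _ - _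
  rw [Fin.sum_univ_succ, Fin.update_cons_zero]
  simp only [Fin.cons_succ, Fin.cons_zero, ← Fin.cons_update, contract]
  abel

/-- Cartan's formula. -/
theorem contract_extDer (br : X → X → X) (D : X → R → R) (l : X) {α : PreForm X R}
    (hα : α.IsAntisymm) :
    contract l (extDer br D α) = lieDer br D l α - extDer br D (contract l α) := by
  funext p w
  change contract l (altSum D α) p w + contract l (bracketSum br α) p w = _
  rw [contract_altSum, contract_bracketSum br l hα]
  change _ = D l (α p w) - _ - (altSum D (contract l α) p w + bracketSum br (contract l α) p w)
  abel

theorem contract_oddExt (q : R →+ R) (l : X) (α : PreForm X R) :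
    contract l (oddExt q α) = -oddExt q (contract l α) := by
  funext p w
  change (-1 : ℤ) ^ (p + 1) • q _ = -((-1 : ℤ) ^ p • q _)
  rw [pow_succ, mul_neg_one, neg_smul]
  rfl

end Recursion

end PreForm

section Calculus

variable {EN : Type*} (N : Type*) [NormedAddCommGroup EN] [NormedSpace ℝ EN] [FiniteDimensional ℝ EN]
  [TopologicalSpace N] [ChartedSpace EN N] [IsManifold 𝓘(ℝ, EN) ∞ N]

/-- A graded module over the smooth functions of `N` with a covariant derivative along the vector
fields of `N`. The operations need to be well behaved only on the elements of the subgroups `K d`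
of homogeneous elements of degree `d`. -/
structure CovModule (R : Type*) [AddCommGroup R] where
  K : ℤ → AddSubgroup R
  sm : C^∞⟮𝓘(ℝ, EN), N; ℝ⟯ → R → R
  D : Vect EN N → R → R
  sm_mem : ∀ f d, ∀ r ∈ K d, sm f r ∈ K d
  sm_add : ∀ f r r', sm f (r + r') = sm f r + sm f r'
  D_mem : ∀ v d, ∀ r ∈ K d, D v r ∈ K d
  D_add : ∀ v d, ∀ r ∈ K d, ∀ r' ∈ K d, D v (r + r') = D v r + D v r'
  D_add_vec : ∀ v w d, ∀ r ∈ K d, D (v + w) r = D v r + D w r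
  D_fsmul : ∀ f v d, ∀ r ∈ K d, D (Vect.fsmul f v) r = sm f (D v r)
  D_sm : ∀ v f d, ∀ r ∈ K d, D v (sm f r) = sm (v.lie f) r + sm f (D v r)

namespace CovModule

variable {N} {R : Type*} [AddCommGroup R] (c : CovModule (EN := EN) N R) {d : ℤ}

theorem sm_zero (f : C^∞⟮𝓘(ℝ, EN), N; ℝ⟯) : c.sm f 0 = 0 := by
  have := c.sm_add f 0 0
  rwa [add_zero, left_eq_add] at this

theorem sm_neg (f : C^∞⟮𝓘(ℝ, EN), N; ℝ⟯) (r : R) : c.sm f (-r) = -c.sm f r := by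
  have := c.sm_add f (-r) r
  rw [neg_add_cancel, sm_zero] at this
  exact eq_neg_of_add_eq_zero_left this.symm

theorem sm_sub (f : C^∞⟮𝓘(ℝ, EN), N; ℝ⟯) (r r' : R) : c.sm f (r - r') = c.sm f r - c.sm f r' := by
  rw [sub_eq_add_neg, sm_add, sm_neg, ← sub_eq_add_neg]

theorem D_zero (v : Vect EN N) : c.D v 0 = 0 := by
  have := c.D_add v 0 0 (c.K 0).zero_mem 0 (c.K 0).zero_mem
  rwa [add_zero, left_eq_add] at this

theorem D_neg (v : Vect EN N) {r : R} (hr : r ∈ c.K d) : c.D v (-r) = -c.D v r := by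
  have := c.D_add v d (-r) ((c.K d).neg_mem hr) r hr
  rw [neg_add_cancel, D_zero] at this
  exact eq_neg_of_add_eq_zero_left this.symm

theorem D_sub (v : Vect EN N) {r r' : R} (hr : r ∈ c.K d) (hr' : r' ∈ c.K d) :
    c.D v (r - r') = c.D v r - c.D v r' := by
  rw [sub_eq_add_neg, c.D_add v d r hr _ ((c.K d).neg_mem hr'), c.D_neg v hr', ← sub_eq_add_neg]

/-- The component of form degree `p` of `α` is multilinear over the functions, alternating and has
values of degree `d - p`. -/
structure IsFormAt (d : ℤ) (α : PreForm (Vect EN N) R) (p : ℕ) : Prop where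
  mem : ∀ v, α p v ∈ c.K (d - p)
  add : ∀ v i w w', α p (Function.update v i (w + w')) =
    α p (Function.update v i w) + α p (Function.update v i w')
  fsmul : ∀ v i w (f : C^∞⟮𝓘(ℝ, EN), N; ℝ⟯), α p (Function.update v i (Vect.fsmul f w)) =
    c.sm f (α p (Function.update v i w))
  alt : ∀ v i j, i ≠ j → v i = v j → α p v = 0

/-- Forms of total degree `d`. -/
def IsForm (d : ℤ) (α : PreForm (Vect EN N) R) : Prop := ∀ p, c.IsFormAt d α p

variable {c} {α β : PreForm (Vect EN N) R}

theorem IsFormAt.neg {p : ℕ} (h : c.IsFormAt d α p) : c.IsFormAt d (-α) p where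
  mem v := (c.K _).neg_mem (h.mem v)
  add v i w w' := by simp only [Pi.neg_apply, h.add]; abel
  fsmul v i w f := by simp only [Pi.neg_apply, h.fsmul, c.sm_neg]
  alt v i j hij hv := by simp only [Pi.neg_apply, h.alt v i j hij hv, neg_zero]

theorem IsFormAt.addf {p : ℕ} (h : c.IsFormAt d α p) (h' : c.IsFormAt d β p) :
    c.IsFormAt d (α + β) p where
  mem v := (c.K _).add_mem (h.mem v) (h'.mem v)
  add v i w w' := by simp only [Pi.add_apply, h.add, h'.add]; abel
  fsmul v i w f := by simp only [Pi.add_apply, h.fsmul, h'.fsmul, c.sm_add]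
  alt v i j hij hv := by simp only [Pi.add_apply, h.alt v i j hij hv, h'.alt v i j hij hv, add_zero]

theorem IsFormAt.sub {p : ℕ} (h : c.IsFormAt d α p) (h' : c.IsFormAt d β p) :
    c.IsFormAt d (α - β) p := by
  rw [sub_eq_add_neg]
  exact h.addf h'.neg

theorem IsForm.neg (h : c.IsForm d α) : c.IsForm d (-α) := fun p => (h p).neg

theorem IsForm.sub (h : c.IsForm d α) (h' : c.IsForm d β) : c.IsForm d (α - β) :=
  fun p => (h p).sub (h' p)

/-- Alternating forms are antisymmetric, by polarization. -/
theorem IsForm.isAntisymm (h : c.IsForm d α) : α.IsAntisymm := by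
  classical
  intro p v i j hij
  -- the form as a function of its arguments at the positions `i` and `j`
  let g : Vect EN N → Vect EN N → R := fun x y =>
    α p (Function.update (Function.update v i x) j y)
  have hg1 : ∀ x y y', g x (y + y') = g x y + g x y' := fun x y y' => (h p).add _ _ _ _
  have hg2 : ∀ x x' y, g (x + x') y = g x y + g x' y := fun x x' y => by
    simp only [g, Function.update_comm hij, (h p).add]
  have hg0 : ∀ x, g x x = 0 := fun x => (h p).alt _ i j hij (by simp [hij])
  have key : ∀ x y, g x y = -g y x := fun x y => by
    have h1 := hg0 (x + y)
    rw [hg1, hg2, hg2, hg0, hg0, zero_add, add_zero] at h1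
    exact eq_neg_of_add_eq_zero_right h1
  have h3 := key (v i) (v j)
  simp only [g] at h3
  rw [Function.update_eq_self, Function.update_eq_self] at h3
  rw [h3, neg_neg]
  congr 1
  funext k
  by_cases hk : k = j
  · subst hk; simp
  · by_cases hk' : k = i
    · subst hk'; simp [hk]
    · simp [Equiv.swap_apply_of_ne_of_ne hk' hk, hk, hk']

theorem IsForm.contract (h : c.IsForm d α) (l : Vect EN N) :
    c.IsForm (d - 1) (PreForm.contract l α) := fun p => {
  mem := fun v => by
    have := (h (p + 1)).mem (Fin.cons l v)
    rwa [Nat.cast_succ, add_comm, ← sub_sub] at this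
  add := fun v i w w' => by
    simp only [PreForm.contract, Fin.cons_update]
    exact (h (p + 1)).add _ _ _ _
  fsmul := fun v i w f => by
    simp only [PreForm.contract, Fin.cons_update]
    exact (h (p + 1)).fsmul _ _ _ _
  alt := fun v i j hij hv => (h (p + 1)).alt _ i.succ j.succ (by simpa using hij) (by simpa using hv) }

theorem IsForm.contract_self (h : c.IsForm d α) (l : Vect EN N) :
    PreForm.contract l (PreForm.contract l α) = 0 := by
  funext p v
  exact (h (p + 2)).alt _ 0 1 (by simp) (by simp)

theorem IsForm.contract_contract (h : c.IsForm d α) (l m : Vect EN N) :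
    PreForm.contract l (PreForm.contract m α) = -PreForm.contract m (PreForm.contract l α) := by
  funext p v
  have := h.isAntisymm (p + 2) (Fin.cons l (Fin.cons m v)) 0 1 (by simp)
  rw [PreForm.cons_cons_comp_swap] at this
  exact this

theorem IsForm.contract_add_vec (h : c.IsForm d α) (l m : Vect EN N) :
    PreForm.contract (l + m) α = PreForm.contract l α + PreForm.contract m α := by
  funext p v
  have := (h (p + 1)).add (Fin.cons 0 v) 0 l m
  simp only [Fin.update_cons_zero] at this
  exact this

theorem IsForm.contract_neg_vec (h : c.IsForm d α) (l : Vect EN N) :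
    PreForm.contract (-l) α = -PreForm.contract l α := by
  have h0 : PreForm.contract (0 : Vect EN N) α = 0 := by
    have := h.contract_add_vec 0 0
    rwa [add_zero, left_eq_add] at this
  have := h.contract_add_vec (-l) l
  rw [neg_add_cancel, h0] at this
  exact eq_neg_of_add_eq_zero_left this.symm

/-- A sequence of maps whose contractions are forms is a form as soon as it is antisymmetric in the
first two arguments. -/
theorem isFormAt_of_contract {p : ℕ} (h : ∀ l, c.IsFormAt (d - 1) (PreForm.contract l α) (p + 1))
    (h0 : ∀ l v, α (p + 2) (Fin.cons l (Fin.cons l v)) = 0)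
    (h1 : ∀ l m v, α (p + 2) (Fin.cons l (Fin.cons m v)) = -α (p + 2) (Fin.cons m (Fin.cons l v))) :
    c.IsFormAt d α (p + 2) := by
  have hcons : ∀ v : Fin (p + 2) → Vect EN N, v = Fin.cons (v 0) (Fin.tail v) := fun v =>
    (Fin.cons_self_tail v).symm
  have hcons2 : ∀ v : Fin (p + 2) → Vect EN N,
      v = Fin.cons (v 0) (Fin.cons (v 1) (Fin.tail (Fin.tail v))) := fun v => by
    conv_lhs => rw [hcons v, ← Fin.cons_self_tail (Fin.tail v)]
    rfl
  -- a property of the first slot is transferred to the second one by antisymmetry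
  have hslot : ∀ (l m : Vect EN N) v, α (p + 2) (Function.update (Fin.cons l (Fin.cons m v)) 0 l) =
      -PreForm.contract m α (p + 1) (Function.update (Fin.cons m v) 0 l) := fun l m v => by
    rw [Fin.update_cons_zero, Fin.update_cons_zero]
    exact h1 l m v
  refine ⟨fun v => ?_, fun v i w w' => ?_, fun v i w f => ?_, fun v i j hij hv => ?_⟩
  · rw [hcons v]
    have := (h (v 0)).mem (Fin.tail v)
    rwa [sub_sub, add_comm (1 : ℤ), ← Nat.cast_succ] at this
  · induction i using Fin.cases with
    | zero =>
      rw [hcons2 v]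
      simp only [Fin.update_cons_zero, h1 _ (v 1)]
      have := (h (v 1)).add (Fin.cons 0 (Fin.tail (Fin.tail v))) 0 w w'
      simp only [Fin.update_cons_zero] at this
      refine (congrArg Neg.neg this).trans ?_
      rw [neg_add]
      rfl
    | succ i =>
      rw [hcons v]
      simp only [← Fin.cons_update]
      exact (h _).add _ _ _ _
  · induction i using Fin.cases with
    | zero =>
      rw [hcons2 v]
      simp only [Fin.update_cons_zero, h1 _ (v 1), c.sm_neg]
      have := (h (v 1)).fsmul (Fin.cons 0 (Fin.tail (Fin.tail v))) 0 w f
      simp only [Fin.update_cons_zero] at this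
      exact congrArg Neg.neg this
    | succ i =>
      rw [hcons v]
      simp only [← Fin.cons_update]
      exact (h _).fsmul _ _ _ _
  · have hsucc : ∀ (v : Fin (p + 2) → Vect EN N) (i j : Fin (p + 1)), i ≠ j → v i.succ = v j.succ →
        α (p + 2) v = 0 := fun v i j hij hv => by
      rw [hcons v]
      exact (h _).alt _ i j hij hv
    have hzero : ∀ (v : Fin (p + 2) → Vect EN N) (j : Fin (p + 1)), v 0 = v j.succ →
        α (p + 2) v = 0 := fun v j hv => by
      rw [hcons2 v]
      induction j using Fin.cases with
      | zero =>
        rw [show v 0 = v 1 from hv]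
        exact h0 _ _
      | succ j =>
        rw [h1, neg_eq_zero]
        exact hsucc _ 0 j.succ (Fin.succ_ne_zero j).symm (by simpa [Fin.tail] using hv)
    induction i using Fin.cases with
    | zero =>
      induction j using Fin.cases with
      | zero => exact absurd rfl hij
      | succ j => exact hzero v j hv
    | succ i =>
      induction j using Fin.cases with
      | zero => exact hzero v i hv.symm
      | succ j => exact hsucc v i j (fun h => hij (by rw [h])) hv

theorem lieDer_sub (l : Vect EN N) (hα : c.IsForm d α) (hβ : c.IsForm d β) :
    PreForm.lieDer Vect.bracket c.D l (α - β) =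
      PreForm.lieDer Vect.bracket c.D l α - PreForm.lieDer Vect.bracket c.D l β := by
  funext p v
  simp only [PreForm.lieDer, Pi.sub_apply, c.D_sub l ((hα p).mem v) ((hβ p).mem v),
    Finset.sum_sub_distrib]
  abel

theorem lieDer_neg (l : Vect EN N) (hα : c.IsForm d α) :
    PreForm.lieDer Vect.bracket c.D l (-α) = -PreForm.lieDer Vect.bracket c.D l α := by
  funext p v
  simp only [PreForm.lieDer, Pi.neg_apply, c.D_neg l ((hα p).mem v), Finset.sum_neg_distrib]
  abel

theorem isFormAt_one {α : PreForm (Vect EN N) R} (h : ∀ v, α 1 v ∈ c.K (d - 1))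
    (h1 : ∀ w w', α 1 (fun _ => w + w') = α 1 (fun _ => w) + α 1 fun _ => w')
    (h2 : ∀ w f, α 1 (fun _ => Vect.fsmul f w) = c.sm f (α 1 fun _ => w)) : c.IsFormAt d α 1 := by
  have hu : ∀ (v : Fin 1 → Vect EN N) i w, Function.update v i w = fun _ => w := fun v i w => by
    funext j
    rw [Subsingleton.elim j i, Function.update_self]
  refine ⟨fun v => ?_, fun v i w w' => ?_, fun v i w f => ?_,
    fun v i j hij => absurd (Subsingleton.elim i j) hij⟩
  · rw [Nat.cast_one]; exact h v
  · simp only [hu, h1]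
  · simp only [hu, h2]

/-- The Lie derivative of a form is a form. Beyond degree one this follows by induction from the
contractions of the Lie derivative, since a form is determined by its contractions. -/
theorem IsForm.lieDer (l : Vect EN N) (hα : c.IsForm d α) :
    c.IsForm d (PreForm.lieDer Vect.bracket c.D l α) := by
  intro p
  induction p using Nat.strong_induction_on generalizing d α with
  | _ p ih =>
    match p with
    | 0 =>
      refine ⟨fun v => ?_, fun v i => i.elim0, fun v i => i.elim0, fun v i => i.elim0⟩
      simpa [PreForm.lieDer] using c.D_mem l _ _ ((hα 0).mem v)
    | 1 =>
      have hL : ∀ w, PreForm.lieDer Vect.bracket c.D l α 1 (fun _ => w) =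
          c.D l (α 1 fun _ => w) - α 1 fun _ => Vect.bracket l w := fun w => by
        simp only [PreForm.lieDer, Finset.univ_unique, Finset.sum_singleton]
        congr 2
        funext j
        rw [Subsingleton.elim j default, Function.update_self]
      have hα1 := hα 1
      have hu : ∀ (v : Fin 1 → Vect EN N) i w, Function.update v i w = fun _ => w := fun v i w => by
        funext j
        rw [Subsingleton.elim j i, Function.update_self]
      have hadd := fun w w' => hα1.add (fun _ => 0) 0 w w'
      have hsm := fun w f => hα1.fsmul (fun _ => 0) 0 w f
      have hmem := fun w => hα1.mem (fun _ => w)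
      simp only [hu] at hadd hsm
      refine isFormAt_one (fun v => ?_) (fun w w' => ?_) fun w f => ?_
      · rw [show v = fun _ => v 0 from funext fun j => congrArg v (Subsingleton.elim _ _), hL]
        simpa using (c.K _).sub_mem (c.D_mem l _ _ (hmem _)) (hmem _)
      · rw [hL, hL, hL, hadd, c.D_add l _ _ (hmem _) _ (hmem _), Vect.bracket_add_right, hadd]
        abel
      · rw [hL, hL, hsm, c.D_sm l f _ _ (hmem _), Vect.bracket_fsmul_right, hadd, hsm, hsm, c.sm_sub]
        abel
    | p + 2 =>
      refine isFormAt_of_contract (fun m => ?_) (fun m v => ?_) fun m n v => ?_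
      · rw [PreForm.contract_lieDer]
        exact (ih (p + 1) (by omega) (hα.contract m)).sub (hα.contract _ _)
      · have : PreForm.contract m (PreForm.contract m (PreForm.lieDer Vect.bracket c.D l α)) = 0 := by
          rw [PreForm.contract_lieDer, PreForm.contract_sub, PreForm.contract_lieDer,
            hα.contract_self, hα.contract_contract m (Vect.bracket l m), sub_neg_eq_add, sub_add_cancel]
          funext p v
          simp [PreForm.lieDer, c.D_zero]
        exact congrFun (congrFun this p) v
      · have : PreForm.contract n (PreForm.contract m (PreForm.lieDer Vect.bracket c.D l α)) =
            -PreForm.contract m (PreForm.contract n (PreForm.lieDer Vect.bracket c.D l α)) := by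
          rw [PreForm.contract_lieDer, PreForm.contract_lieDer, PreForm.contract_sub,
            PreForm.contract_sub, PreForm.contract_lieDer, PreForm.contract_lieDer,
            hα.contract_contract n m, lieDer_neg _ ((hα.contract n).contract m),
            hα.contract_contract n (Vect.bracket l m), hα.contract_contract m (Vect.bracket l n)]
          abel
        exact congrFun (congrFun this p) v

/-- The exterior covariant derivative is additive on forms. Since `D` is additive on elements of
one degree only, this is proved by induction through Cartan's formula. -/
theorem extDer_sub (hα : c.IsForm d α) (hβ : c.IsForm d β) :
    PreForm.extDer Vect.bracket c.D (α - β) =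
      PreForm.extDer Vect.bracket c.D α - PreForm.extDer Vect.bracket c.D β := by
  funext p
  induction p generalizing d α β with
  | zero => funext v; simp [PreForm.extDer, PreForm.altSum, PreForm.bracketSum]
  | succ p ih =>
    funext v
    rw [← Fin.cons_self_tail v]
    have h1 := PreForm.contract_extDer Vect.bracket c.D (v 0) (hα.sub hβ).isAntisymm
    have h2 := PreForm.contract_extDer Vect.bracket c.D (v 0) hα.isAntisymm
    have h3 := PreForm.contract_extDer Vect.bracket c.D (v 0) hβ.isAntisymm
    have h4 := ih (hα.contract (v 0)) (hβ.contract (v 0))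
    refine (congrFun (congrFun h1 p) _).trans (Eq.trans ?_ (congrArg₂ (· - ·)
      (congrFun (congrFun h2 p) _) (congrFun (congrFun h3 p) _)).symm)
    rw [lieDer_sub _ hα hβ, PreForm.contract_sub]
    simp only [Pi.sub_apply, congrFun h4 _]
    abel

theorem extDer_neg (hα : c.IsForm d α) :
    PreForm.extDer Vect.bracket c.D (-α) = -PreForm.extDer Vect.bracket c.D α := by
  have h0 := extDer_sub hα hα
  rw [sub_self, sub_self] at h0
  have hz : c.IsForm d (0 : PreForm (Vect EN N) R) := by
    have := hα.sub hα
    rwa [sub_self] at this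
  rw [← zero_sub, extDer_sub hz hα, h0, zero_sub]

theorem extDer_zero (br : Vect EN N → Vect EN N → Vect EN N) :
    PreForm.extDer br c.D (0 : PreForm (Vect EN N) R) = 0 := by
  funext p v
  rcases p with - | - | p <;> simp [PreForm.extDer, PreForm.altSum, PreForm.bracketSum, c.D_zero]

/-- The exterior covariant derivative of a form is a form. By Cartan's formula, contractions
of it are given by exterior derivatives of contractions and by Lie derivatives. -/
theorem IsForm.extDer (hα : c.IsForm d α) :
    c.IsForm (d + 1) (PreForm.extDer Vect.bracket c.D α) := by
  have hcc : ∀ {d : ℤ} {α : PreForm (Vect EN N) R} (_ : c.IsForm d α) (l m : Vect EN N),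
      PreForm.contract l (PreForm.contract m (PreForm.extDer Vect.bracket c.D α)) =
        PreForm.lieDer Vect.bracket c.D m (PreForm.contract l α) -
          PreForm.contract (Vect.bracket m l) α - PreForm.lieDer Vect.bracket c.D l
            (PreForm.contract m α) + PreForm.extDer Vect.bracket c.D
              (PreForm.contract l (PreForm.contract m α)) := by
    intro d α hα l m
    rw [PreForm.contract_extDer _ _ _ hα.isAntisymm, PreForm.contract_sub, PreForm.contract_lieDer,
      PreForm.contract_extDer _ _ _ (hα.contract m).isAntisymm]
    abel
  intro p
  induction p using Nat.strong_induction_on generalizing d α with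
  | _ p ih =>
    match p with
    | 0 =>
      refine ⟨fun v => ?_, fun v i => i.elim0, fun v i => i.elim0, fun v i => i.elim0⟩
      simp [PreForm.extDer, PreForm.altSum, PreForm.bracketSum, (c.K _).zero_mem]
    | 1 =>
      have hL : ∀ v, PreForm.extDer Vect.bracket c.D α 1 v = c.D (v 0) (α 0 Fin.elim0) := fun v => by
        simp only [PreForm.extDer, PreForm.altSum, PreForm.bracketSum, Pi.add_apply, add_zero]
        simp
        congr 2
        exact Subsingleton.elim _ _
      have hmem := (hα 0).mem Fin.elim0
      refine isFormAt_one (fun v => ?_) (fun w w' => ?_) fun w f => ?_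
      · rw [hL]
        simpa using c.D_mem _ _ _ hmem
      · rw [hL, hL, hL, c.D_add_vec _ _ _ _ hmem]
      · rw [hL, hL, c.D_fsmul _ _ _ _ hmem]
    | p + 2 =>
      refine isFormAt_of_contract (fun m => ?_) (fun m v => ?_) fun m n v => ?_
      · rw [PreForm.contract_extDer _ _ _ hα.isAntisymm, add_sub_cancel_right]
        have := ih (p + 1) (by omega) (hα.contract m)
        rw [sub_add_cancel] at this
        exact (hα.lieDer m (p + 1)).sub this
      · have := hcc hα m m
        rw [hα.contract_self, Vect.bracket_self, extDer_zero] at this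
        refine (congrFun (congrFun this p) v).trans ?_
        have h0 := hα.contract_add_vec 0 0
        rw [add_zero, left_eq_add] at h0
        simp [h0]
      · have : PreForm.contract n (PreForm.contract m (PreForm.extDer Vect.bracket c.D α)) =
            -PreForm.contract m (PreForm.contract n (PreForm.extDer Vect.bracket c.D α)) := by
          rw [hcc hα, hcc hα, hα.contract_contract n m, extDer_neg ((hα.contract n).contract m),
            Vect.bracket_swap m n, hα.contract_neg_vec]
          abel
        exact congrFun (congrFun this p) v

/-- The covariant derivative is flat. -/
def IsFlat (c : CovModule (EN := EN) N R) : Prop :=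
  ∀ v w d, ∀ r ∈ c.K d, c.D v (c.D w r) - c.D w (c.D v r) = c.D (Vect.bracket v w) r

/-- For a flat covariant derivative, Lie derivatives represent the Lie algebra of vector fields:
flatness is the claim in degree zero, and the Jacobi identity gives the induction step. -/
theorem lieDer_lieDer (hc : c.IsFlat) (hα : c.IsForm d α) (l m : Vect EN N) :
    PreForm.lieDer Vect.bracket c.D l (PreForm.lieDer Vect.bracket c.D m α) -
      PreForm.lieDer Vect.bracket c.D m (PreForm.lieDer Vect.bracket c.D l α) =
      PreForm.lieDer Vect.bracket c.D (Vect.bracket l m) α := by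
  funext p
  induction p generalizing d α with
  | zero =>
    funext v
    simpa [PreForm.lieDer] using hc l m _ _ ((hα 0).mem v)
  | succ p ih =>
    funext v
    rw [← Fin.cons_self_tail v]
    set n := v 0
    have h1 : ∀ l m, PreForm.contract n (PreForm.lieDer Vect.bracket c.D l
        (PreForm.lieDer Vect.bracket c.D m α)) =
        PreForm.lieDer Vect.bracket c.D l (PreForm.lieDer Vect.bracket c.D m
          (PreForm.contract n α)) -
        PreForm.lieDer Vect.bracket c.D l (PreForm.contract (Vect.bracket m n) α) -
        (PreForm.lieDer Vect.bracket c.D m (PreForm.contract (Vect.bracket l n) α) -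
          PreForm.contract (Vect.bracket m (Vect.bracket l n)) α) := fun l m => by
      rw [PreForm.contract_lieDer, PreForm.contract_lieDer, PreForm.contract_lieDer,
        lieDer_sub _ ((hα.contract n).lieDer m) (hα.contract _)]
    have h2 : PreForm.contract (Vect.bracket l (Vect.bracket m n)) α =
        PreForm.contract (Vect.bracket (Vect.bracket l m) n) α +
          PreForm.contract (Vect.bracket m (Vect.bracket l n)) α := by
      rw [Vect.jacobi, hα.contract_add_vec]
    have h3 := congrFun (ih (hα.contract n)) (Fin.tail v)
    have h4 := congrFun (congrFun (h1 l m) p) (Fin.tail v)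
    have h5 := congrFun (congrFun (h1 m l) p) (Fin.tail v)
    have h6 := congrFun (congrFun h2 p) (Fin.tail v)
    have h7 := congrFun (congrFun (PreForm.contract_lieDer Vect.bracket c.D (Vect.bracket l m) n α) p)
      (Fin.tail v)
    refine (congrArg₂ (· - ·) h4 h5).trans (Eq.trans ?_ h7.symm)
    simp only [Pi.sub_apply, Pi.add_apply] at h3 h6 ⊢
    rw [← h3, h6]
    abel

/-- For a flat covariant derivative, Lie derivatives commute with the exterior covariant
derivative. The contractions of both sides agree by induction on the degree. -/
theorem lieDer_extDer (hc : c.IsFlat) (hα : c.IsForm d α) (l : Vect EN N) :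
    PreForm.lieDer Vect.bracket c.D l (PreForm.extDer Vect.bracket c.D α) =
      PreForm.extDer Vect.bracket c.D (PreForm.lieDer Vect.bracket c.D l α) := by
  funext p
  induction p generalizing d α with
  | zero =>
    funext v
    simp [PreForm.lieDer, PreForm.extDer, PreForm.altSum, PreForm.bracketSum, c.D_zero]
  | succ p ih =>
    funext v
    rw [← Fin.cons_self_tail v]
    set m := v 0
    have h1 : PreForm.contract m (PreForm.lieDer Vect.bracket c.D l
        (PreForm.extDer Vect.bracket c.D α)) =
        PreForm.lieDer Vect.bracket c.D l (PreForm.lieDer Vect.bracket c.D m α) -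
        PreForm.lieDer Vect.bracket c.D l (PreForm.extDer Vect.bracket c.D
          (PreForm.contract m α)) - (PreForm.lieDer Vect.bracket c.D (Vect.bracket l m) α -
            PreForm.extDer Vect.bracket c.D (PreForm.contract (Vect.bracket l m) α)) := by
      have h := (hα.contract m).extDer
      rw [sub_add_cancel] at h
      rw [PreForm.contract_lieDer, PreForm.contract_extDer _ _ _ hα.isAntisymm,
        PreForm.contract_extDer _ _ _ hα.isAntisymm, lieDer_sub _ (hα.lieDer m) h]
    have h2 : PreForm.contract m (PreForm.extDer Vect.bracket c.D
        (PreForm.lieDer Vect.bracket c.D l α)) =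
        PreForm.lieDer Vect.bracket c.D m (PreForm.lieDer Vect.bracket c.D l α) -
        (PreForm.extDer Vect.bracket c.D (PreForm.lieDer Vect.bracket c.D l
          (PreForm.contract m α)) -
            PreForm.extDer Vect.bracket c.D (PreForm.contract (Vect.bracket l m) α)) := by
      rw [PreForm.contract_extDer _ _ _ (hα.lieDer l).isAntisymm, PreForm.contract_lieDer,
        extDer_sub ((hα.contract m).lieDer l) (hα.contract _)]
    have h3 := congrFun (ih (hα.contract m)) (Fin.tail v)
    have h4 := congrFun (congrFun h1 p) (Fin.tail v)
    have h5 := congrFun (congrFun h2 p) (Fin.tail v)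
    have h6 := congrFun (congrFun (lieDer_lieDer hc hα l m) p) (Fin.tail v)
    refine h4.trans (Eq.trans ?_ h5.symm)
    simp only [Pi.sub_apply] at h6 ⊢
    rw [← h6, h3]
    abel

/-- The exterior covariant derivative of a flat covariant derivative squares to zero: by Cartan's
formula its square commutes with contractions, so that induction on the degree applies. -/
theorem extDer_extDer (hc : c.IsFlat) (hα : c.IsForm d α) :
    PreForm.extDer Vect.bracket c.D (PreForm.extDer Vect.bracket c.D α) = 0 := by
  funext p
  induction p generalizing d α with
  | zero =>
    funext v
    simp [PreForm.extDer, PreForm.altSum, PreForm.bracketSum]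
  | succ p ih =>
    funext v
    rw [← Fin.cons_self_tail v]
    have h := (hα.contract (v 0)).extDer
    rw [sub_add_cancel] at h
    have h1 : PreForm.contract (v 0) (PreForm.extDer Vect.bracket c.D
        (PreForm.extDer Vect.bracket c.D α)) = PreForm.extDer Vect.bracket c.D
          (PreForm.extDer Vect.bracket c.D (PreForm.contract (v 0) α)) := by
      rw [PreForm.contract_extDer _ _ _ hα.extDer.isAntisymm,
        PreForm.contract_extDer _ _ _ hα.isAntisymm, lieDer_extDer hc hα,
        extDer_sub (hα.lieDer _) h, sub_sub_cancel]
    exact (congrFun (congrFun h1 p) _).trans (congrFun (ih (hα.contract (v 0))) _)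

section Odd

variable {q : R →+ R} (hq : ∀ d, ∀ r ∈ c.K d, q r ∈ c.K (d + 1))
  (hqs : ∀ f r, q (c.sm f r) = c.sm f (q r)) (hqD : ∀ v d, ∀ r ∈ c.K d, q (c.D v r) = c.D v (q r))

include hq hqs in
theorem IsForm.oddExt (hα : c.IsForm d α) : c.IsForm (d + 1) (PreForm.oddExt q α) := by
  have hz : ∀ (n : ℤ) (f : C^∞⟮𝓘(ℝ, EN), N; ℝ⟯) r, c.sm f (n • r) = n • c.sm f r := fun n f r =>
    map_zsmul (AddMonoidHom.mk' (c.sm f) (c.sm_add f)) n r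
  intro p
  refine ⟨fun v => ?_, fun v i w w' => ?_, fun v i w f => ?_, fun v i j hij hv => ?_⟩
  · have := hq _ _ ((hα p).mem v)
    rw [sub_add_eq_add_sub] at this
    exact (c.K _).zsmul_mem this _
  · simp only [PreForm.oddExt, (hα p).add, map_add, smul_add]
  · simp only [PreForm.oddExt, (hα p).fsmul, hqs, hz]
  · simp only [PreForm.oddExt, (hα p).alt v i j hij hv, map_zero, smul_zero]

include hq hqs hqD in
/-- An odd operator that commutes with the covariant derivatives anticommutes, in its extension to
forms, with the exterior covariant derivative. -/
theorem oddExt_extDer (hα : c.IsForm d α) :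
    PreForm.oddExt q (PreForm.extDer Vect.bracket c.D α) =
      -PreForm.extDer Vect.bracket c.D (PreForm.oddExt q α) := by
  have hDz : ∀ (n : ℕ) (v : Vect EN N) {d : ℤ} {r : R}, r ∈ c.K d →
      c.D v ((-1 : ℤ) ^ n • r) = (-1 : ℤ) ^ n • c.D v r := fun n v d r hr => by
    rcases Nat.even_or_odd n with h | h <;> simp [h.neg_one_pow, c.D_neg v hr]
  have hodd : ∀ {d : ℤ} {α : PreForm (Vect EN N) R} (_ : c.IsForm d α) (l : Vect EN N),
      PreForm.oddExt q (PreForm.lieDer Vect.bracket c.D l α) =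
        PreForm.lieDer Vect.bracket c.D l (PreForm.oddExt q α) := by
    intro d α hα l
    funext p v
    simp only [PreForm.oddExt, PreForm.lieDer, map_sub, map_sum, hqD l _ _ ((hα p).mem v), smul_sub,
      Finset.smul_sum, hDz p l (hq _ _ ((hα p).mem v))]
  funext p
  induction p generalizing d α with
  | zero =>
    funext v
    simp [PreForm.oddExt, PreForm.extDer, PreForm.altSum, PreForm.bracketSum]
  | succ p ih =>
    funext v
    rw [← Fin.cons_self_tail v]
    have hs : ∀ α β : PreForm (Vect EN N) R, PreForm.oddExt q (α - β) =
        PreForm.oddExt q α - PreForm.oddExt q β := fun α β => by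
      funext p v
      simp [PreForm.oddExt, smul_sub]
    have hn : ∀ α : PreForm (Vect EN N) R, -(-PreForm.oddExt q α) = PreForm.oddExt q α :=
      fun α => neg_neg _
    have h1 : PreForm.contract (v 0) (PreForm.oddExt q (PreForm.extDer Vect.bracket c.D α)) =
        -PreForm.lieDer Vect.bracket c.D (v 0) (PreForm.oddExt q α) + PreForm.oddExt q
          (PreForm.extDer Vect.bracket c.D (PreForm.contract (v 0) α)) := by
      rw [PreForm.contract_oddExt, PreForm.contract_extDer _ _ _ hα.isAntisymm, hs, hodd hα]
      abel
    have h2 : PreForm.contract (v 0) (PreForm.extDer Vect.bracket c.D (PreForm.oddExt q α)) =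
        PreForm.lieDer Vect.bracket c.D (v 0) (PreForm.oddExt q α) +
          PreForm.extDer Vect.bracket c.D (PreForm.oddExt q (PreForm.contract (v 0) α)) := by
      rw [PreForm.contract_extDer _ _ _ (hα.oddExt hq hqs).isAntisymm, PreForm.contract_oddExt,
        extDer_neg ((hα.contract (v 0)).oddExt hq hqs), sub_neg_eq_add]
    have h3 := congrFun (ih (hα.contract (v 0))) (Fin.tail v)
    refine (congrFun (congrFun h1 p) _).trans (Eq.trans ?_
      (congrArg Neg.neg (congrFun (congrFun h2 p) _)).symm)
    simp only [Pi.add_apply, Pi.neg_apply] at h3 ⊢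
    rw [h3]
    abel

include hq hqs in
theorem IsForm.extDer_add_oddExt (hα : c.IsForm d α) :
    c.IsForm (d + 1) (PreForm.extDer Vect.bracket c.D α + PreForm.oddExt q α) :=
  fun p => (hα.extDer p).addf (hα.oddExt hq hqs p)

include hq hqs hqD in
/-- The sum of a flat exterior covariant derivative and of a commuting odd differential of
the coefficients is a differential. -/
theorem extDer_add_oddExt_sq (hc : c.IsFlat) (hq2 : ∀ d, ∀ r ∈ c.K d, q (q r) = 0)
    (hα : c.IsForm d α) :
    PreForm.extDer Vect.bracket c.D (PreForm.extDer Vect.bracket c.D α + PreForm.oddExt q α) +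
      PreForm.oddExt q (PreForm.extDer Vect.bracket c.D α + PreForm.oddExt q α) = 0 := by
  have h1 := extDer_sub hα.extDer (hα.oddExt hq hqs).neg
  rw [sub_neg_eq_add, extDer_extDer hc hα, extDer_neg (hα.oddExt hq hqs)] at h1
  have h2 : PreForm.oddExt q (PreForm.extDer Vect.bracket c.D α + PreForm.oddExt q α) =
      PreForm.oddExt q (PreForm.extDer Vect.bracket c.D α) := by
    funext p v
    simp only [PreForm.oddExt, Pi.add_apply, map_add, map_zsmul, hq2 _ _ ((hα p).mem v), smul_zero,
      add_zero]
  rw [h1, h2, oddExt_extDer hq hqs hqD hα]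
  abel

end Odd

end CovModule

end Calculus

/-! ### Frames, partial derivatives and submersions -/

section Generic

variable {EN N : Type*} [NormedAddCommGroup EN] [NormedSpace ℝ EN] [FiniteDimensional ℝ EN]
  [TopologicalSpace N] [ChartedSpace EN N] [IsManifold 𝓘(ℝ, EN) ∞ N]
  {EM M : Type*} [NormedAddCommGroup EM] [NormedSpace ℝ EM]
  [TopologicalSpace M] [ChartedSpace EM M] [IsManifold 𝓘(ℝ, EM) ∞ M]
  {EM' M' : Type*} [NormedAddCommGroup EM'] [NormedSpace ℝ EM']
  [TopologicalSpace M'] [ChartedSpace EM' M'] [IsManifold 𝓘(ℝ, EM') ∞ M']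

/-- Near every point there is a frame of global vector fields. -/
theorem exists_frame [T2Space N] (x : N) :
    ∃ (V : Set N) (e : Fin (Module.finrank ℝ EN) → Vect EN N)
      (C : Fin (Module.finrank ℝ EN) → TangentBundle 𝓘(ℝ, EN) N → ℝ), IsOpen V ∧ x ∈ V ∧
      (∀ i, ContMDiffOn 𝓘(ℝ, EN).tangent 𝓘(ℝ, ℝ) ∞ (C i) (Bundle.TotalSpace.proj ⁻¹' V)) ∧
      ∀ y ∈ V, ∀ z : TangentSpace 𝓘(ℝ, EN) y, z = ∑ i, C i ⟨y, z⟩ • e i y := by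
  let t := trivializationAt EN (TangentSpace 𝓘(ℝ, EN)) x
  have hx : x ∈ t.baseSet := FiberBundle.mem_baseSet_trivializationAt EN _ x
  let b := Module.finBasis ℝ EN
  have : IsManifold 𝓘(ℝ, EN) (∞ + 1) N := by
    simpa using (inferInstance : IsManifold 𝓘(ℝ, EN) ∞ N)
  have : ContMDiffVectorBundle ∞ EN (TangentSpace 𝓘(ℝ, EN) : N → Type _) 𝓘(ℝ, EN) :=
    TangentBundle.contMDiffVectorBundle
  obtain ⟨χ, -, hχ⟩ := (SmoothBumpFunction.nhds_basis_tsupport (I := 𝓘(ℝ, EN)) x).mem_iff.1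
    (t.open_baseSet.mem_nhds hx)
  have he : ∀ i, ContMDiff 𝓘(ℝ, EN) 𝓘(ℝ, EN).tangent ∞
      fun y => (⟨y, χ y • t.localFrame b i y⟩ : TangentBundle 𝓘(ℝ, EN) N) := fun i =>
    ContMDiffOn.smul_section_of_tsupport χ.contMDiff.contMDiffOn t.open_baseSet hχ
      (t.contMDiffOn_localFrame_baseSet ∞ b i)
  let e : Fin (Module.finrank ℝ EN) → Vect EN N := fun i => ⟨_, he i⟩
  -- where the bump function is one, the global vector fields `e i` agree with the local frame
  obtain ⟨V, hV, hVo, hxV⟩ := eventually_nhds_iff.1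
    ((χ.eventuallyEq_one).and (t.open_baseSet.mem_nhds hx))
  refine ⟨V, e, fun i z => b.repr (t z).2 i, hVo, hxV, fun i => ?_, fun y hy z => ?_⟩
  · have h1 : ContMDiffOn 𝓘(ℝ, EN).tangent (𝓘(ℝ, EN).prod 𝓘(ℝ, EN)) ∞ t t.source :=
      t.contMDiffOn
    have h2 := contMDiff_snd (n := ∞) (I := 𝓘(ℝ, EN)) (J := 𝓘(ℝ, EN)) (M := N) (N := EN)
    let L : EN →L[ℝ] ℝ := LinearMap.toContinuousLinearMap (b.coord i)
    have h3 := (L.contMDiff (n := ∞)).comp_contMDiffOn (h2.comp_contMDiffOn h1)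
    refine h3.mono fun z hz => ?_
    exact t.mem_source.2 (hV _ hz).2
  · have hyb := (hV y hy).2
    have h1 : ∀ i, e i y = t.localFrame b i y := fun i => by
      change χ y • t.localFrame b i y = _
      rw [(hV y hy).1]; exact one_smul _ _
    classical
    have hs := t.eq_sum_localFrameCoeff_smul (I := 𝓘(ℝ, EN)) (b := b)
      (s := Function.update 0 y z) hyb
    rw [Function.update_self] at hs
    refine hs.trans (Finset.sum_congr rfl fun i _ => ?_)
    rw [h1]
    congr 1
    have h2 := t.localFrameCoeff_eq_coeff (I := 𝓘(ℝ, EN)) (b := b) (i := i)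
      (s := Function.update 0 y z) hyb
    rw [Function.update_self] at h2
    simpa using h2

theorem Vect.exists_apply_eq [T2Space N] (x : N) (z : TangentSpace 𝓘(ℝ, EN) x) :
    ∃ w : Vect EN N, w x = z := by
  obtain ⟨V, e, C, -, hx, -, h⟩ := exists_frame (EN := EN) x
  exact ⟨∑ i, C i ⟨x, z⟩ • e i, (Vect.sum_apply _ _ x).trans (h x hx z).symm⟩

/-- The derivative of a smooth map `A` on a product in the direction of the second factor, evaluated on a
vector field along the graph of `p`. -/
theorem contMDiff_partial {A : N × M → M'} {p : N → M} (hp : ContMDiff 𝓘(ℝ, EN) 𝓘(ℝ, EM) ∞ p)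
    {Ω : Set (N × M)} (hΩ : IsOpen Ω)
    (hA : ContMDiffOn (𝓘(ℝ, EN).prod 𝓘(ℝ, EM)) 𝓘(ℝ, EM') ∞ A Ω) (hmem : ∀ g, (g, p g) ∈ Ω)
    (w : Vect EM M) :
    ContMDiff 𝓘(ℝ, EN) 𝓘(ℝ, EM').tangent ∞ fun g =>
      (⟨A (g, p g), mfderiv 𝓘(ℝ, EM) 𝓘(ℝ, EM') (fun z => A (g, z)) (p g) (w (p g))⟩ :
        TangentBundle 𝓘(ℝ, EM') M') := by
  have : IsManifold 𝓘(ℝ, EN) (∞ + 1) N := by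
    simpa using (inferInstance : IsManifold 𝓘(ℝ, EN) ∞ N)
  have : IsManifold 𝓘(ℝ, EM) (∞ + 1) M := by
    simpa using (inferInstance : IsManifold 𝓘(ℝ, EM) ∞ M)
  let fg : N → TangentBundle 𝓘(ℝ, EN) N := fun g => Bundle.TotalSpace.mk' EN g 0
  have sfg : ContMDiff 𝓘(ℝ, EN) 𝓘(ℝ, EN).tangent ∞ fg := Bundle.contMDiff_zeroSection _ _
  let fv : N → TangentBundle 𝓘(ℝ, EM) M := fun g => ⟨p g, w (p g)⟩
  have sfv : ContMDiff 𝓘(ℝ, EN) 𝓘(ℝ, EM).tangent ∞ fv := w.contMDiff.comp hp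
  let F₂ := (equivTangentBundleProd 𝓘(ℝ, EN) N 𝓘(ℝ, EM) M).symm
  have S₃ := ContMDiffOn.contMDiffOn_tangentMapWithin hA (m := ∞) (by simp) hΩ.uniqueMDiffOn
  have S := S₃.comp_contMDiff ((contMDiff_equivTangentBundleProd_symm (n := ∞)).comp
    (sfg.prodMk sfv)) (fun g => hmem g)
  refine S.congr fun g => ?_
  have hAg : MDifferentiableAt (𝓘(ℝ, EN).prod 𝓘(ℝ, EM)) 𝓘(ℝ, EM') A (g, p g) :=
    (hA.contMDiffAt (hΩ.mem_nhds (hmem g))).mdifferentiableAt (by simp)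
  refine Bundle.TotalSpace.ext rfl (heq_of_eq ?_)
  change _ = mfderivWithin (𝓘(ℝ, EN).prod 𝓘(ℝ, EM)) 𝓘(ℝ, EM') A Ω (g, p g) (0, w (p g))
  rw [mfderivWithin_of_isOpen hΩ (hmem g)]
  refine Eq.symm ((mfderiv_prod_eq_add_apply hAg).trans ?_)
  refine (congrArg₂ (· + ·) (map_zero _) rfl).trans (zero_add _)

/-- A smooth family of tangent vectors at a fixed point is smooth as a vector valued map. -/
theorem contMDiff_of_fixed_base {m : M'} {f : N → EM'}
    (hf : ContMDiff 𝓘(ℝ, EN) 𝓘(ℝ, EM').tangent ∞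
      fun g => (⟨m, f g⟩ : TangentBundle 𝓘(ℝ, EM') M')) :
    ContMDiff 𝓘(ℝ, EN) 𝓘(ℝ, EM') ∞ f := by
  intro g
  refine (Bundle.contMDiffAt_totalSpace.1 (hf g)).2.congr_of_eventuallyEq
    (Filter.Eventually.of_forall fun g' => ?_)
  exact ((tangentBundleCore 𝓘(ℝ, EM') M').coordChange_self (achart EM' m) m
    (mem_chart_source EM' m) (f g')).symm

end Generic

/-! ### The homogeneous space -/

section HomogeneousSpace

variable {EG : Type u} {G : Type*} [NormedAddCommGroup EG] [NormedSpace ℝ EG]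
  [FiniteDimensional ℝ EG]
  [TopologicalSpace G] [ChartedSpace EG G] [Group G] [LieGroup 𝓘(ℝ, EG) ∞ G]
  {EX : Type*} [NormedAddCommGroup EX] [NormedSpace ℝ EX] [FiniteDimensional ℝ EX]
  {H : Subgroup G} [ChartedSpace EX (G ⧸ H)] [IsManifold 𝓘(ℝ, EX) ∞ (G ⧸ H)]

theorem t2Space_quotient (EG : Type*) {G : Type*} [NormedAddCommGroup EG] [NormedSpace ℝ EG]
    [TopologicalSpace G] [ChartedSpace EG G] [Group G] [LieGroup 𝓘(ℝ, EG) ∞ G] {H : Subgroup G}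
    (hH : IsClosed (H : Set G)) : T2Space (G ⧸ H) := by
  have : IsTopologicalGroup G := topologicalGroup_of_lieGroup 𝓘(ℝ, EG) ∞
  refine (t2Space_iff_of_isOpenQuotientMap QuotientGroup.isOpenQuotientMap_mk).2 ?_
  have : {p : G × G | (QuotientGroup.mk p.1 : G ⧸ H) = QuotientGroup.mk p.2} =
      (fun p : G × G => p.1⁻¹ * p.2) ⁻¹' H := by
    ext p
    exact QuotientGroup.eq
  rw [this]
  exact hH.preimage (by fun_prop)

theorem contMDiff_mk
    (hsub : Manifold.IsSubmersion 𝓘(ℝ, EG) 𝓘(ℝ, EX) ∞ (QuotientGroup.mk : G → G ⧸ H)) :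
    ContMDiff 𝓘(ℝ, EG) 𝓘(ℝ, EX) ∞ (QuotientGroup.mk : G → G ⧸ H) := by
  obtain ⟨F, _, _, h⟩ := hsub
  exact fun x => (h x).contMDiffAt

/-- Smooth local sections with a prescribed value. -/
theorem exists_section
    (hsub : Manifold.IsSubmersion 𝓘(ℝ, EG) 𝓘(ℝ, EX) ∞ (QuotientGroup.mk : G → G ⧸ H)) (g : G) :
    ∃ (V : Opens (G ⧸ H)) (σ : G ⧸ H → G), QuotientGroup.mk g ∈ V ∧
      ContMDiffOn 𝓘(ℝ, EX) 𝓘(ℝ, EG) ∞ σ V ∧ (∀ x ∈ V, (QuotientGroup.mk (σ x) : G ⧸ H) = x) ∧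
      σ (QuotientGroup.mk g) = g := by
  obtain ⟨F, _, _, hs⟩ := hsub
  have h := hs g
  let φ := h.domChart
  let ψ := h.codChart
  have hφ : ContMDiffOn 𝓘(ℝ, EG) 𝓘(ℝ, EG) ∞ φ.symm φ.target :=
    contMDiffOn_symm_of_mem_maximalAtlas h.domChart_mem_maximalAtlas
  have hψ : ContMDiffOn 𝓘(ℝ, EX) 𝓘(ℝ, EX) ∞ ψ ψ.source :=
    contMDiffOn_of_mem_maximalAtlas h.codChart_mem_maximalAtlas
  have hw : ∀ z ∈ φ.target, ψ (QuotientGroup.mk (φ.symm z)) = (h.equiv z).1 := fun z hz =>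
    h.writtenInCharts (by simpa [OpenPartialHomeomorph.extend] using hz)
  have hg : ψ (QuotientGroup.mk g) = (h.equiv (φ g)).1 := by
    have := hw (φ g) (φ.map_source h.mem_domChart_source)
    rwa [φ.left_inv h.mem_domChart_source] at this
  -- the section is constant in the complementary direction of the normal form of the submersion
  let τ : G ⧸ H → EG := fun x => h.equiv.symm (ψ x, (h.equiv (φ g)).2)
  have hτ : ContMDiffOn 𝓘(ℝ, EX) 𝓘(ℝ, EG) ∞ τ ψ.source :=
    h.equiv.symm.contDiff.contMDiff.comp_contMDiffOn (hψ.prodMk_space contMDiffOn_const)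
  have hτg : τ (QuotientGroup.mk g) = φ g := by
    change h.equiv.symm (ψ (QuotientGroup.mk g), (h.equiv (φ g)).2) = φ g
    rw [hg]; exact h.equiv.symm_apply_apply _
  have hV : IsOpen (ψ.source ∩ τ ⁻¹' φ.target) :=
    hτ.continuousOn.isOpen_inter_preimage ψ.open_source φ.open_target
  refine ⟨⟨_, hV⟩, φ.symm ∘ τ, ⟨h.mem_codChart_source, ?_⟩, hφ.comp (hτ.mono fun x hx => hx.1)
    fun x hx => hx.2, fun x hx => ?_, ?_⟩
  · change τ _ ∈ φ.target
    rw [hτg]; exact φ.map_source h.mem_domChart_source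
  · refine ψ.injOn (h.source_subset_preimage_source (φ.map_target hx.2)) hx.1 ?_
    refine (hw _ hx.2).trans ?_
    change (h.equiv (h.equiv.symm _)).1 = _
    rw [h.equiv.apply_symm_apply]
  · change φ.symm (τ _) = g
    rw [hτg]; exact φ.left_inv h.mem_domChart_source

/-- The action of the group on the homogeneous space is smooth: in the second argument, it factors
locally through a section of the submersion. -/
theorem contMDiff_smul_quotient
    (hsub : Manifold.IsSubmersion 𝓘(ℝ, EG) 𝓘(ℝ, EX) ∞ (QuotientGroup.mk : G → G ⧸ H)) :
    ContMDiff (𝓘(ℝ, EG).prod 𝓘(ℝ, EX)) 𝓘(ℝ, EX) ∞ (fun p : G × (G ⧸ H) => p.1 • p.2) := by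
  rintro ⟨g, x⟩
  obtain ⟨g₀, rfl⟩ := QuotientGroup.mk_surjective x
  obtain ⟨V, σ, hV, hσ, hσ', -⟩ := exists_section hsub g₀
  have h1 : ContMDiffAt (𝓘(ℝ, EG).prod 𝓘(ℝ, EX)) 𝓘(ℝ, EX) ∞
      (fun p : G × (G ⧸ H) => (QuotientGroup.mk (p.1 * σ p.2) : G ⧸ H)) (g, QuotientGroup.mk g₀) := by
    refine ((contMDiff_mk hsub) _).comp _ ?_
    exact contMDiffAt_fst.mul (ContMDiffAt.comp (g, (QuotientGroup.mk g₀ : G ⧸ H))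
      (hσ.contMDiffAt (V.isOpen.mem_nhds hV)) contMDiffAt_snd)
  refine h1.congr_of_eventuallyEq ?_
  filter_upwards [(V.isOpen.preimage continuous_snd).mem_nhds hV] with p hp
  exact (congrArg (fun y => p.1 • y) (hσ' p.2 hp)).symm

theorem contMDiff_smul_left
    (hsub : Manifold.IsSubmersion 𝓘(ℝ, EG) 𝓘(ℝ, EX) ∞ (QuotientGroup.mk : G → G ⧸ H)) (g : G) :
    ContMDiff 𝓘(ℝ, EX) 𝓘(ℝ, EX) ∞ (fun x : G ⧸ H => g • x) :=
  (contMDiff_smul_quotient hsub).comp (contMDiff_const.prodMk contMDiff_id)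

/-- Every vector field can be translated by an element of the group. -/
theorem exists_translate
    (hsub : Manifold.IsSubmersion 𝓘(ℝ, EG) 𝓘(ℝ, EX) ∞ (QuotientGroup.mk : G → G ⧸ H)) (g : G)
    (w : Vect EX (G ⧸ H)) : ∃ w' : Vect EX (G ⧸ H), ∀ x,
      w (g • x) = mfderiv 𝓘(ℝ, EX) 𝓘(ℝ, EX) (fun z : G ⧸ H => g • z) x (w' x) := by
  have h1 := contMDiff_partial (A := fun p : (G ⧸ H) × (G ⧸ H) => g⁻¹ • p.2)
    (p := fun x : G ⧸ H => g • x) (contMDiff_smul_left hsub g) isOpen_univ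
    ((contMDiff_smul_left hsub g⁻¹).comp contMDiff_snd).contMDiffOn (fun _ => trivial) w
  have hinv : ∀ x : G ⧸ H, g⁻¹ • g • x = x := fun x => inv_smul_smul g x
  let z : ∀ x : G ⧸ H, TangentSpace 𝓘(ℝ, EX) x := fun x =>
    mfderiv 𝓘(ℝ, EX) 𝓘(ℝ, EX) (fun y : G ⧸ H => g⁻¹ • y) (g • x) (w (g • x))
  refine ⟨⟨z, h1.congr fun x => ?_⟩, fun x => ?_⟩
  · refine Bundle.TotalSpace.ext (hinv x).symm (heq_of_eq rfl)
  · have hd := mfderiv_comp (I := 𝓘(ℝ, EX)) (I' := 𝓘(ℝ, EX)) (I'' := 𝓘(ℝ, EX)) (g • x)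
      (g := fun y : G ⧸ H => g • y) (f := fun y : G ⧸ H => g⁻¹ • y)
      ((contMDiff_smul_left hsub g).mdifferentiableAt (by simp))
      ((contMDiff_smul_left hsub g⁻¹).mdifferentiableAt (by simp))
    have hid : (fun y : G ⧸ H => g • y) ∘ (fun y : G ⧸ H => g⁻¹ • y) = id :=
      funext fun y => smul_inv_smul g y
    rw [hid, mfderiv_id] at hd
    have h2 := congrArg (fun L => L (w (g • x))) hd
    refine h2.trans ?_
    change mfderiv 𝓘(ℝ, EX) 𝓘(ℝ, EX) (fun y : G ⧸ H => g • y) (g⁻¹ • g • x) _ = _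
    rw [hinv x]
    rfl

/-- The differential of `G → G ⧸ H` in terms of left translations. -/
theorem mfderiv_mk_leftInvariant
    (hsub : Manifold.IsSubmersion 𝓘(ℝ, EG) 𝓘(ℝ, EX) ∞ (QuotientGroup.mk : G → G ⧸ H))
    (t : GroupLieAlgebra 𝓘(ℝ, EG) G) (g : G) :
    mfderiv 𝓘(ℝ, EG) 𝓘(ℝ, EX) (QuotientGroup.mk : G → G ⧸ H) g (leftInvariant t g) =
      mfderiv 𝓘(ℝ, EX) 𝓘(ℝ, EX) (fun z : G ⧸ H => g • z) (QuotientGroup.mk 1)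
        (mfderiv 𝓘(ℝ, EG) 𝓘(ℝ, EX) (QuotientGroup.mk : G → G ⧸ H) 1 t) := by
  have hL : ContMDiff 𝓘(ℝ, EG) 𝓘(ℝ, EG) ∞ (fun z : G => g * z) := contMDiff_mul_left
  have h1 := mfderiv_comp (I := 𝓘(ℝ, EG)) (I' := 𝓘(ℝ, EG)) (I'' := 𝓘(ℝ, EX)) 1
    (g := (QuotientGroup.mk : G → G ⧸ H)) (f := fun z : G => g * z)
    ((contMDiff_mk hsub).mdifferentiableAt (by simp)) (hL.mdifferentiableAt (by simp))
  have h2 := mfderiv_comp (I := 𝓘(ℝ, EG)) (I' := 𝓘(ℝ, EX)) (I'' := 𝓘(ℝ, EX)) 1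
    (g := fun z : G ⧸ H => g • z) (f := (QuotientGroup.mk : G → G ⧸ H))
    ((contMDiff_smul_left hsub g).mdifferentiableAt (by simp))
    ((contMDiff_mk hsub).mdifferentiableAt (by simp))
  refine Eq.trans ?_ ((congrArg (fun L => L t) h1.symm).trans (congrArg (fun L => L t) h2))
  change mfderiv 𝓘(ℝ, EG) 𝓘(ℝ, EX) (QuotientGroup.mk : G → G ⧸ H) g
    (mfderiv 𝓘(ℝ, EG) 𝓘(ℝ, EG) (fun z : G => g * z) 1 t) =
      mfderiv 𝓘(ℝ, EG) 𝓘(ℝ, EX) (QuotientGroup.mk : G → G ⧸ H) (g * 1)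
        (mfderiv 𝓘(ℝ, EG) 𝓘(ℝ, EG) (fun z : G => g * z) 1 t)
  rw [mul_one]

theorem maurerCartan_leftInvariant (t : GroupLieAlgebra 𝓘(ℝ, EG) G) (g : G) :
    maurerCartan g (leftInvariant t g) = t := by
  have hL : ∀ g : G, ContMDiff 𝓘(ℝ, EG) 𝓘(ℝ, EG) ∞ (fun z : G => g * z) := fun g =>
    contMDiff_mul_left
  have h1 := mfderiv_comp (I := 𝓘(ℝ, EG)) (I' := 𝓘(ℝ, EG)) (I'' := 𝓘(ℝ, EG)) 1
    (g := fun z : G => g⁻¹ * z) (f := fun z : G => g * z)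
    ((hL _).mdifferentiableAt (by simp)) ((hL _).mdifferentiableAt (by simp))
  have h2 : (fun z : G => g⁻¹ * z) ∘ (fun z : G => g * z) = id :=
    funext fun z => inv_mul_cancel_left g z
  rw [h2, mfderiv_id] at h1
  refine Eq.trans ?_ (congrArg (fun L => L t) h1).symm
  change mfderiv 𝓘(ℝ, EG) 𝓘(ℝ, EG) (fun z : G => g⁻¹ * z) g
    (mfderiv 𝓘(ℝ, EG) 𝓘(ℝ, EG) (fun z : G => g * z) 1 t) =
      mfderiv 𝓘(ℝ, EG) 𝓘(ℝ, EG) (fun z : G => g⁻¹ * z) (g * 1)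
        (mfderiv 𝓘(ℝ, EG) 𝓘(ℝ, EG) (fun z : G => g * z) 1 t)
  rw [mul_one]

theorem leftInvariant_maurerCartan (g : G) (z : TangentSpace 𝓘(ℝ, EG) g) :
    leftInvariant (maurerCartan g z) g = z := by
  have hL : ∀ g : G, ContMDiff 𝓘(ℝ, EG) 𝓘(ℝ, EG) ∞ (fun z : G => g * z) := fun g =>
    contMDiff_mul_left
  have h1 := mfderiv_comp (I := 𝓘(ℝ, EG)) (I' := 𝓘(ℝ, EG)) (I'' := 𝓘(ℝ, EG)) g
    (g := fun z : G => g * z) (f := fun z : G => g⁻¹ * z)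
    ((hL _).mdifferentiableAt (by simp)) ((hL _).mdifferentiableAt (by simp))
  have h2 : (fun z : G => g * z) ∘ (fun z : G => g⁻¹ * z) = id :=
    funext fun z => mul_inv_cancel_left g z
  rw [h2, mfderiv_id] at h1
  refine Eq.trans ?_ (congrArg (fun L => L z) h1).symm
  change mfderiv 𝓘(ℝ, EG) 𝓘(ℝ, EG) (fun z : G => g * z) 1
    (mfderiv 𝓘(ℝ, EG) 𝓘(ℝ, EG) (fun z : G => g⁻¹ * z) g z) =
      mfderiv 𝓘(ℝ, EG) 𝓘(ℝ, EG) (fun z : G => g * z) (g⁻¹ * g)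
        (mfderiv 𝓘(ℝ, EG) 𝓘(ℝ, EG) (fun z : G => g⁻¹ * z) g z)
  rw [inv_mul_cancel]

theorem maurerCartan_add (g : G) (z z' : TangentSpace 𝓘(ℝ, EG) g) :
    maurerCartan g (z + z') = maurerCartan g z + maurerCartan g z' := map_add _ _ _

theorem maurerCartan_smul (g : G) (c : ℝ) (z : TangentSpace 𝓘(ℝ, EG) g) :
    maurerCartan g (c • z) = c • maurerCartan g z := map_smul _ _ _

theorem bracket_leftInvariant (s t : GroupLieAlgebra 𝓘(ℝ, EG) G) :
    ∃ r : GroupLieAlgebra 𝓘(ℝ, EG) G,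
      Vect.bracket (leftInvariant s) (leftInvariant t) = leftInvariant r := by
  have : CompleteSpace EG := FiniteDimensional.complete ℝ EG
  have : LieGroup 𝓘(ℝ, EG) (minSmoothness ℝ 3) G := by
    simpa using (LieGroup.of_le (ENat.LEInfty.out : (3 : WithTop ℕ∞) ≤ ∞) :
      LieGroup 𝓘(ℝ, EG) 3 G)
  refine ⟨⁅s, t⁆, ?_⟩
  ext g
  exact congrFun (mulInvariantVector_mlieBracket s t).symm g

/-- The Maurer–Cartan form evaluated on a vector field is smooth. -/
theorem contMDiff_maurerCartan (v : Vect EG G) :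
    ContMDiff (M' := EG) 𝓘(ℝ, EG) 𝓘(ℝ, EG) ∞ (fun g => maurerCartan g (v g)) := by
  have h1 := contMDiff_partial (A := fun p : G × G => p.1⁻¹ * p.2) (p := id) contMDiff_id
    isOpen_univ ((contMDiff_fst.inv).mul contMDiff_snd).contMDiffOn (fun _ => trivial) v
  refine contMDiff_of_fixed_base (m := (1 : G)) (h1.congr fun g => ?_)
  exact Bundle.TotalSpace.ext (inv_mul_cancel g).symm (heq_of_eq rfl)

/-- Vector fields on the group are combinations of left-invariant ones. -/
theorem exists_eq_sum_leftInvariant (v : Vect EG G) :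
    ∃ f : Fin (Module.finrank ℝ EG) → C^∞⟮𝓘(ℝ, EG), G; ℝ⟯,
      (∀ g, maurerCartan g (v g) = ∑ i, f i g • (Module.finBasis ℝ EG i : EG)) ∧
      v = ∑ i, Vect.fsmul (f i) (leftInvariant (Module.finBasis ℝ EG i : EG)) := by
  let b := Module.finBasis ℝ EG
  have hL : ∀ i, ContMDiff 𝓘(ℝ, EG) 𝓘(ℝ, ℝ) ∞ (LinearMap.toContinuousLinearMap (b.coord i)) :=
    fun i => (LinearMap.toContinuousLinearMap (b.coord i)).contMDiff
  let f : Fin (Module.finrank ℝ EG) → C^∞⟮𝓘(ℝ, EG), G; ℝ⟯ := fun i =>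
    ⟨fun g => LinearMap.toContinuousLinearMap (b.coord i) (maurerCartan g (v g) : EG),
      (hL i).comp (contMDiff_maurerCartan v)⟩
  have hf : ∀ g, maurerCartan g (v g) = ∑ i, f i g • (b i : EG) := fun g =>
    (b.sum_repr _).symm
  refine ⟨f, hf, ?_⟩
  ext g
  rw [Vect.sum_apply]
  refine (leftInvariant_maurerCartan g (v g)).symm.trans ?_
  let L : GroupLieAlgebra 𝓘(ℝ, EG) G →ₗ[ℝ] TangentSpace 𝓘(ℝ, EG) g :=
    (mfderiv 𝓘(ℝ, EG) 𝓘(ℝ, EG) (fun z : G => g * z) 1 : EG →L[ℝ] EG).toLinearMap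
  have h1 : ∀ t, leftInvariant t g = L t := fun t => rfl
  rw [hf]
  refine (map_sum L _ _).trans (Finset.sum_congr rfl fun i _ => map_smul L _ _)

/-- Vector fields on the homogeneous space lift to the group. -/
theorem exists_lift
    (hsub : Manifold.IsSubmersion 𝓘(ℝ, EG) 𝓘(ℝ, EX) ∞ (QuotientGroup.mk : G → G ⧸ H))
    (w : Vect EX (G ⧸ H)) : ∃ v : Vect EG G, ∀ g, w (QuotientGroup.mk g) =
      mfderiv 𝓘(ℝ, EG) 𝓘(ℝ, EX) (QuotientGroup.mk : G → G ⧸ H) g (v g) := by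
  obtain ⟨V, σ, hV, hσ, hσ', hσ1⟩ := exists_section hsub (1 : G)
  have hact : ContMDiff (𝓘(ℝ, EG).prod 𝓘(ℝ, EX)) 𝓘(ℝ, EX) ∞
      (fun p : G × (G ⧸ H) => p.1⁻¹ • p.2) :=
    (contMDiff_smul_quotient hsub).comp (contMDiff_fst.inv.prodMk contMDiff_snd)
  have hΩ : IsOpen ((fun p : G × (G ⧸ H) => p.1⁻¹ • p.2) ⁻¹' V) := V.isOpen.preimage hact.continuous
  have hA : ContMDiffOn (𝓘(ℝ, EG).prod 𝓘(ℝ, EX)) 𝓘(ℝ, EG) ∞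
      (fun p : G × (G ⧸ H) => p.1 * σ (p.1⁻¹ • p.2)) ((fun p : G × (G ⧸ H) => p.1⁻¹ • p.2) ⁻¹' V) :=
    contMDiff_fst.contMDiffOn.mul (hσ.comp hact.contMDiffOn fun p hp => hp)
  have hg1 : ∀ g : G, g⁻¹ • (QuotientGroup.mk g : G ⧸ H) = QuotientGroup.mk 1 := fun g =>
    congrArg QuotientGroup.mk (inv_mul_cancel g)
  have hmem : ∀ g : G, (g, (QuotientGroup.mk g : G ⧸ H)) ∈
      (fun p : G × (G ⧸ H) => p.1⁻¹ • p.2) ⁻¹' V := fun g => by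
    change g⁻¹ • (QuotientGroup.mk g : G ⧸ H) ∈ V
    rw [hg1]; exact hV
  have h1 := contMDiff_partial (contMDiff_mk hsub) hΩ hA hmem w
  have hbase : ∀ g : G, g * σ (g⁻¹ • (QuotientGroup.mk g : G ⧸ H)) = g := fun g => by
    rw [hg1, hσ1, mul_one]
  -- translates of one section by the group give, at each `g`, a section through `g` that depends
  -- smoothly on `g`; the lift is the image of the vector field under its differential
  let z : ∀ g : G, TangentSpace 𝓘(ℝ, EG) g := fun g =>
    mfderiv 𝓘(ℝ, EX) 𝓘(ℝ, EG) (fun x : G ⧸ H => g * σ (g⁻¹ • x)) (QuotientGroup.mk g)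
      (w (QuotientGroup.mk g))
  refine ⟨⟨z, h1.congr fun g => Bundle.TotalSpace.ext (hbase g).symm (heq_of_eq rfl)⟩, fun g => ?_⟩
  have hAg : ContMDiffAt 𝓘(ℝ, EX) 𝓘(ℝ, EG) ∞ (fun x : G ⧸ H => g * σ (g⁻¹ • x))
      (QuotientGroup.mk g) :=
    ContMDiffAt.comp (I' := 𝓘(ℝ, EG).prod 𝓘(ℝ, EX)) (f := fun x : G ⧸ H => (g, x))
      (QuotientGroup.mk g : G ⧸ H) (hA.contMDiffAt (hΩ.mem_nhds (hmem g)))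
      (contMDiff_const.prodMk contMDiff_id).contMDiffAt
  have hd := mfderiv_comp (I := 𝓘(ℝ, EX)) (I' := 𝓘(ℝ, EG)) (I'' := 𝓘(ℝ, EX)) (QuotientGroup.mk g)
      (g := (QuotientGroup.mk : G → G ⧸ H)) (f := fun x : G ⧸ H => g * σ (g⁻¹ • x))
      ((contMDiff_mk hsub).mdifferentiableAt (by simp)) (hAg.mdifferentiableAt (by simp))
  have hev : (QuotientGroup.mk : G → G ⧸ H) ∘ (fun x : G ⧸ H => g * σ (g⁻¹ • x))
      =ᶠ[𝓝 (QuotientGroup.mk g)] id := by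
    have hc : Continuous fun x : G ⧸ H => g⁻¹ • x := (contMDiff_smul_left hsub g⁻¹).continuous
    filter_upwards [(V.isOpen.preimage hc).mem_nhds (hmem g)] with x hx
    refine (congrArg (fun y => g • y) (hσ' _ hx)).trans (smul_inv_smul g x)
  rw [hev.mfderiv_eq, mfderiv_id] at hd
  refine (congrArg (fun L => L (w (QuotientGroup.mk g))) hd).trans ?_
  change mfderiv 𝓘(ℝ, EG) 𝓘(ℝ, EX) (QuotientGroup.mk : G → G ⧸ H)
    (g * σ (g⁻¹ • (QuotientGroup.mk g : G ⧸ H))) _ = _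
  rw [hbase g]
  rfl

/-- The kernel of the differential of the projection is invariant under left translations, because
the translations act on the quotient by diffeomorphisms. -/
theorem mfderiv_mk_eq_zero_iff
    (hsub : Manifold.IsSubmersion 𝓘(ℝ, EG) 𝓘(ℝ, EX) ∞ (QuotientGroup.mk : G → G ⧸ H))
    (t : GroupLieAlgebra 𝓘(ℝ, EG) G) (g : G) :
    mfderiv 𝓘(ℝ, EG) 𝓘(ℝ, EX) (QuotientGroup.mk : G → G ⧸ H) g (leftInvariant t g) = 0 ↔
      mfderiv 𝓘(ℝ, EG) 𝓘(ℝ, EX) (QuotientGroup.mk : G → G ⧸ H) 1 t = 0 := by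
  rw [mfderiv_mk_leftInvariant hsub]
  refine ⟨fun h => ?_, fun h => ?_⟩
  · have hd := mfderiv_comp (I := 𝓘(ℝ, EX)) (I' := 𝓘(ℝ, EX)) (I'' := 𝓘(ℝ, EX))
      (QuotientGroup.mk 1 : G ⧸ H) (g := fun y : G ⧸ H => g⁻¹ • y) (f := fun y : G ⧸ H => g • y)
      ((contMDiff_smul_left hsub g⁻¹).mdifferentiableAt (by simp))
      ((contMDiff_smul_left hsub g).mdifferentiableAt (by simp))
    have hid : (fun y : G ⧸ H => g⁻¹ • y) ∘ (fun y : G ⧸ H => g • y) = id :=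
      funext fun y => inv_smul_smul g y
    rw [hid, mfderiv_id] at hd
    refine (congrArg (fun L => L
      (mfderiv 𝓘(ℝ, EG) 𝓘(ℝ, EX) (QuotientGroup.mk : G → G ⧸ H) 1 t)) hd).trans ?_
    exact (congrArg (mfderiv 𝓘(ℝ, EX) 𝓘(ℝ, EX) (fun y : G ⧸ H => g⁻¹ • y)
      (g • (QuotientGroup.mk 1 : G ⧸ H))) h).trans (map_zero _)
  · rw [h]; exact map_zero _

/-- A lift of a vector field to the group can be prescribed at a point. -/
theorem exists_lift_apply_eq
    (hsub : Manifold.IsSubmersion 𝓘(ℝ, EG) 𝓘(ℝ, EX) ∞ (QuotientGroup.mk : G → G ⧸ H))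
    (w : Vect EX (G ⧸ H)) (g₀ : G) (z : TangentSpace 𝓘(ℝ, EG) g₀)
    (hz : w (QuotientGroup.mk g₀) =
      mfderiv 𝓘(ℝ, EG) 𝓘(ℝ, EX) (QuotientGroup.mk : G → G ⧸ H) g₀ z) :
    ∃ v : Vect EG G, v g₀ = z ∧ ∀ g, w (QuotientGroup.mk g) =
      mfderiv 𝓘(ℝ, EG) 𝓘(ℝ, EX) (QuotientGroup.mk : G → G ⧸ H) g (v g) := by
  obtain ⟨v, hv⟩ := exists_lift hsub w
  let t : GroupLieAlgebra 𝓘(ℝ, EG) G := maurerCartan g₀ (z - v g₀)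
  have ht₀ : leftInvariant t g₀ = z - v g₀ := leftInvariant_maurerCartan g₀ _
  have ht : mfderiv 𝓘(ℝ, EG) 𝓘(ℝ, EX) (QuotientGroup.mk : G → G ⧸ H) 1 t = 0 := by
    rw [← mfderiv_mk_eq_zero_iff hsub t g₀, ht₀]
    refine (map_sub _ _ _).trans ?_
    rw [← hz, ← hv, sub_self]
  refine ⟨v + leftInvariant t, ?_, fun g => ?_⟩
  · change v g₀ + leftInvariant t g₀ = z
    rw [ht₀]; exact add_sub_cancel _ _
  · refine Eq.symm ((map_add (mfderiv 𝓘(ℝ, EG) 𝓘(ℝ, EX) (QuotientGroup.mk : G → G ⧸ H) g)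
      (v g) (leftInvariant t g)).trans ?_)
    rw [(mfderiv_mk_eq_zero_iff hsub t g).2 ht, ← hv, add_zero]

/-- The subgroup is a submanifold near the identity: there are a neighbourhood `O` of `1`
and a chart of `G` in which `H` contains a ball of a linear subspace. The parametrization `ψ` of this part of `H`
is smooth, covers a neighbourhood of `1` in `H` and all tangent vectors of the fibre. -/
theorem exists_parametrization
    (hsub : Manifold.IsSubmersion 𝓘(ℝ, EG) 𝓘(ℝ, EX) ∞ (QuotientGroup.mk : G → G ⧸ H)) :
    ∃ (K : Type u) (_ : NormedAddCommGroup K) (_ : NormedSpace ℝ K) (ψ : K → G) (ε : ℝ),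
      0 < ε ∧ ContMDiffOn 𝓘(ℝ, K) 𝓘(ℝ, EG) ∞ ψ (Metric.ball 0 ε) ∧ ψ 0 = 1 ∧
      (∀ y ∈ Metric.ball 0 ε, ψ y ∈ H) ∧
      (∀ᶠ h in 𝓝 (1 : G), h ∈ H → ∃ y ∈ Metric.ball 0 ε, ψ y = h) ∧
      ∀ t : GroupLieAlgebra 𝓘(ℝ, EG) G,
        mfderiv 𝓘(ℝ, EG) 𝓘(ℝ, EX) (QuotientGroup.mk : G → G ⧸ H) 1 t = 0 →
        ∃ y : K, mfderiv 𝓘(ℝ, K) 𝓘(ℝ, EG) ψ 0 y = t := by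
  obtain ⟨K, _, _, hs⟩ := hsub
  have hsub : ContMDiff 𝓘(ℝ, EG) 𝓘(ℝ, EX) ∞ (QuotientGroup.mk : G → G ⧸ H) :=
    fun x => (hs x).contMDiffAt
  have h := hs 1
  let φ := h.domChart
  let χ := h.codChart
  have h1φ : (1 : G) ∈ φ.source := h.mem_domChart_source
  have hφ : ContMDiffOn 𝓘(ℝ, EG) 𝓘(ℝ, EG) ∞ φ.symm φ.target :=
    contMDiffOn_symm_of_mem_maximalAtlas h.domChart_mem_maximalAtlas
  have hφ' : ContMDiffOn 𝓘(ℝ, EG) 𝓘(ℝ, EG) ∞ φ φ.source :=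
    contMDiffOn_of_mem_maximalAtlas h.domChart_mem_maximalAtlas
  have hχ : ContMDiffOn 𝓘(ℝ, EX) 𝓘(ℝ, EX) ∞ χ χ.source :=
    contMDiffOn_of_mem_maximalAtlas h.codChart_mem_maximalAtlas
  have hw : ∀ z ∈ φ.target, χ (QuotientGroup.mk (φ.symm z)) = (h.equiv z).1 := fun z hz =>
    h.writtenInCharts (by simpa [OpenPartialHomeomorph.extend] using hz)
  have hw' : ∀ g ∈ φ.source, χ (QuotientGroup.mk g) = (h.equiv (φ g)).1 := fun g hg => by
    have := hw (φ g) (φ.map_source hg)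
    rwa [φ.left_inv hg] at this
  -- in the charts, `H` is the fibre of the linear projection through the image of `1`
  have hH : ∀ g ∈ φ.source, (h.equiv (φ g)).1 = (h.equiv (φ 1)).1 ↔ g ∈ H := by
    intro g hg
    have h1 : (QuotientGroup.mk g : G ⧸ H) = QuotientGroup.mk 1 ↔ g ∈ H := by
      rw [eq_comm, QuotientGroup.eq, inv_one, one_mul]
    rw [← h1, ← hw' g hg, ← hw' 1 h1φ]
    exact ⟨fun h2 => χ.injOn (h.source_subset_preimage_source hg) h.mem_codChart_source h2,
      fun h2 => by rw [h2]⟩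
  -- a parametrization of this fibre, composed with the inverse chart to give `ψ`
  let j : K → EG := fun y => φ 1 + h.equiv.symm (0, y)
  have hj : ContDiff ℝ ∞ j :=
    contDiff_const.add (h.equiv.symm.contDiff.comp (contDiff_const.prodMk contDiff_id))
  have hj0 : j 0 = φ 1 := by
    change φ 1 + h.equiv.symm (0, 0) = φ 1
    rw [← Prod.zero_eq_mk, map_zero, add_zero]
  have hej : ∀ y, h.equiv (j y) = h.equiv (φ 1) + (0, y) := fun y => by
    change h.equiv (φ 1 + h.equiv.symm (0, y)) = _
    rw [map_add, h.equiv.apply_symm_apply]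
  obtain ⟨ε, hε, hball⟩ := Metric.mem_nhds_iff.1 (hj.continuous.continuousAt.preimage_mem_nhds
    (x := (0 : K)) (by rw [hj0]; exact φ.open_target.mem_nhds (φ.map_source h1φ)))
  refine ⟨K, _, _, fun y => φ.symm (j y), ε, hε,
    hφ.comp hj.contMDiff.contMDiffOn fun y hy => hball hy, ?_, fun y hy => ?_, ?_, fun t ht => ?_⟩
  · change φ.symm (j 0) = 1
    rw [hj0, φ.left_inv h1φ]
  · refine (hH _ (φ.map_target (hball hy))).1 ?_
    rw [φ.right_inv (hball hy), hej]
    simp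
  · have hc : ContinuousAt (fun g => (h.equiv (φ g)).2 - (h.equiv (φ 1)).2) (1 : G) := by
      have := φ.continuousAt h1φ
      fun_prop
    have h0 : (h.equiv (φ 1)).2 - (h.equiv (φ 1)).2 ∈ Metric.ball (0 : K) ε := by
      rw [sub_self]; exact Metric.mem_ball_self hε
    filter_upwards [φ.open_source.mem_nhds h1φ, hc.preimage_mem_nhds
      (Metric.isOpen_ball.mem_nhds h0)] with g hg hg' hgH
    refine ⟨_, hg', ?_⟩
    have h2 : j ((h.equiv (φ g)).2 - (h.equiv (φ 1)).2) = φ g := by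
      apply h.equiv.injective
      rw [hej]
      refine Prod.ext ?_ ?_
      · simpa using ((hH g hg).2 hgH).symm
      · simp
    change φ.symm (j _) = g
    rw [h2, φ.left_inv hg]
  · have hφd : MDifferentiableAt 𝓘(ℝ, EG) 𝓘(ℝ, EG) φ 1 :=
      (hφ'.contMDiffAt (φ.open_source.mem_nhds h1φ)).mdifferentiableAt (by simp)
    have hφsd : MDifferentiableAt 𝓘(ℝ, EG) 𝓘(ℝ, EG) φ.symm (φ 1) :=
      (hφ.contMDiffAt (φ.open_target.mem_nhds (φ.map_source h1φ))).mdifferentiableAt (by simp)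
    have hχd : MDifferentiableAt 𝓘(ℝ, EX) 𝓘(ℝ, EX) χ (QuotientGroup.mk 1) :=
      (hχ.contMDiffAt (χ.open_source.mem_nhds h.mem_codChart_source)).mdifferentiableAt (by simp)
    let u : EG := (mfderiv 𝓘(ℝ, EG) 𝓘(ℝ, EG) φ 1 : EG →L[ℝ] EG) t
    let p : EG →L[ℝ] EX := (ContinuousLinearMap.fst ℝ EX K).comp (h.equiv : EG →L[ℝ] EX × K)
    have hu : (h.equiv u).1 = 0 := by
      have h1 := mfderiv_comp (I := 𝓘(ℝ, EG)) (I' := 𝓘(ℝ, EX)) (I'' := 𝓘(ℝ, EX)) 1 hχd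
        (hsub.mdifferentiableAt (by simp) : MDifferentiableAt 𝓘(ℝ, EG) 𝓘(ℝ, EX)
          (QuotientGroup.mk : G → G ⧸ H) 1)
      have h2 := mfderiv_comp (I := 𝓘(ℝ, EG)) (I' := 𝓘(ℝ, EG)) (I'' := 𝓘(ℝ, EX)) 1
        (p.mdifferentiableAt (x := φ 1)) hφd
      have h3 : χ ∘ (QuotientGroup.mk : G → G ⧸ H) =ᶠ[𝓝 (1 : G)] p ∘ φ := by
        filter_upwards [φ.open_source.mem_nhds h1φ] with g hg
        exact hw' g hg
      rw [h3.mfderiv_eq, h2, p.mfderiv_eq] at h1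
      refine (congrArg (fun L => L t) h1).trans ?_
      exact (congrArg (mfderiv 𝓘(ℝ, EX) 𝓘(ℝ, EX) χ (QuotientGroup.mk 1)) ht).trans (map_zero _)
    refine ⟨(h.equiv u).2, ?_⟩
    have hjd : HasFDerivAt j ((h.equiv.symm : EX × K →L[ℝ] EG).comp
        (ContinuousLinearMap.inr ℝ EX K)) 0 :=
      (((h.equiv.symm : EX × K →L[ℝ] EG).comp
        (ContinuousLinearMap.inr ℝ EX K)).hasFDerivAt).const_add _
    have h1 := mfderiv_comp (I := 𝓘(ℝ, K)) (I' := 𝓘(ℝ, EG)) (I'' := 𝓘(ℝ, EG)) (0 : K)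
      (g := φ.symm) (f := j) (by rw [hj0]; exact hφsd) hjd.differentiableAt.mdifferentiableAt
    rw [hjd.hasMFDerivAt.mfderiv] at h1
    have h2 : ((h.equiv.symm : EX × K →L[ℝ] EG).comp
        (ContinuousLinearMap.inr ℝ EX K)) (h.equiv u).2 = u := by
      change h.equiv.symm (0, (h.equiv u).2) = u
      rw [← hu]; exact h.equiv.symm_apply_apply u
    refine (congrArg (fun L => L (h.equiv u).2) h1).trans ?_
    refine (congrArg (mfderiv 𝓘(ℝ, EG) 𝓘(ℝ, EG) φ.symm (j 0)) h2).trans ?_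
    have h3 := mfderiv_comp (I := 𝓘(ℝ, EG)) (I' := 𝓘(ℝ, EG)) (I'' := 𝓘(ℝ, EG)) 1 hφsd hφd
    have h4 : φ.symm ∘ φ =ᶠ[𝓝 (1 : G)] id := by
      filter_upwards [φ.open_source.mem_nhds h1φ] with g hg
      exact φ.left_inv hg
    rw [h4.mfderiv_eq, mfderiv_id] at h3
    refine Eq.trans ?_ (congrArg (fun L => L t) h3).symm
    rw [hj0]
    rfl

/-- The Lie algebra of the subgroup is tangent to the fibre of the projection, since curves in `H`
have constant image. -/
theorem mfderiv_mk_eq_zero_of_mem_subgroupLie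
    (hsub : Manifold.IsSubmersion 𝓘(ℝ, EG) 𝓘(ℝ, EX) ∞ (QuotientGroup.mk : G → G ⧸ H))
    {t : GroupLieAlgebra 𝓘(ℝ, EG) G} (ht : t ∈ subgroupLie EG H) :
    mfderiv 𝓘(ℝ, EG) 𝓘(ℝ, EX) (QuotientGroup.mk : G → G ⧸ H) 1 t = 0 := by
  obtain ⟨γ, hγ, hγ0, hγH, rfl⟩ := ht
  have h1 := mfderiv_comp (I := 𝓘(ℝ, ℝ)) (I' := 𝓘(ℝ, EG)) (I'' := 𝓘(ℝ, EX)) (0 : ℝ)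
    (g := (QuotientGroup.mk : G → G ⧸ H)) (f := γ)
    ((contMDiff_mk hsub).mdifferentiableAt (by simp)) (hγ.mdifferentiableAt (by simp))
  have h2 : (QuotientGroup.mk : G → G ⧸ H) ∘ γ = fun _ => QuotientGroup.mk 1 := by
    funext s
    exact QuotientGroup.eq.2 (by simpa using hγH s)
  rw [h2, mfderiv_const] at h1
  have h3 := congrArg (fun L => L (1 : ℝ)) h1
  refine Eq.trans ?_ h3.symm
  change mfderiv 𝓘(ℝ, EG) 𝓘(ℝ, EX) (QuotientGroup.mk : G → G ⧸ H) 1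
    ((mfderiv 𝓘(ℝ, ℝ) 𝓘(ℝ, EG) γ 0 : ℝ →L[ℝ] EG) 1) =
    mfderiv 𝓘(ℝ, EG) 𝓘(ℝ, EX) (QuotientGroup.mk : G → G ⧸ H) (γ 0)
    ((mfderiv 𝓘(ℝ, ℝ) 𝓘(ℝ, EG) γ 0 : ℝ →L[ℝ] EG) 1)
  rw [hγ0]

/-- The Lie algebra of the subgroup is the kernel of the differential of the projection. -/
theorem mem_subgroupLie_iff
    (hsub : Manifold.IsSubmersion 𝓘(ℝ, EG) 𝓘(ℝ, EX) ∞ (QuotientGroup.mk : G → G ⧸ H))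
    {t : GroupLieAlgebra 𝓘(ℝ, EG) G} : t ∈ subgroupLie EG H ↔
    mfderiv 𝓘(ℝ, EG) 𝓘(ℝ, EX) (QuotientGroup.mk : G → G ⧸ H) 1 t = 0 := by
  refine ⟨mfderiv_mk_eq_zero_of_mem_subgroupLie hsub, fun ht => ?_⟩
  obtain ⟨K, _, _, ψ, ε, hε, hψ, hψ0, hψH, -, hψt⟩ := exists_parametrization hsub
  obtain ⟨y, rfl⟩ := hψt t ht
  -- a bounded curve in the ball with velocity `y` at zero
  let δ : ℝ := ε / (‖y‖ + 1)
  have hδ : 0 < δ := by positivity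
  let η : ℝ → K := fun s => (δ * Real.sin (s / δ)) • y
  have hηs : ContDiff ℝ ∞ η :=
    (contDiff_const.mul (Real.contDiff_sin.comp (contDiff_id.div_const δ))).smul contDiff_const
  have hη : ∀ s, η s ∈ Metric.ball (0 : K) ε := fun s => by
    rw [mem_ball_zero_iff, norm_smul, norm_mul, Real.norm_of_nonneg hδ.le]
    have h1 : ‖Real.sin (s / δ)‖ ≤ 1 := Real.abs_sin_le_one _
    calc δ * ‖Real.sin (s / δ)‖ * ‖y‖ ≤ δ * 1 * ‖y‖ := by gcongr
      _ < δ * (‖y‖ + 1) := by nlinarith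
      _ = ε := div_mul_cancel₀ _ (by positivity)
  have hη0 : η 0 = 0 := by simp [η]
  have hηd : HasDerivAt η y 0 := by
    have h1 : HasDerivAt (fun s : ℝ => δ * Real.sin (s / δ)) 1 0 := by
      have h2 := ((Real.hasDerivAt_sin (0 / δ)).comp (0 : ℝ)
        ((hasDerivAt_id (0 : ℝ)).div_const δ)).const_mul δ
      simp only [zero_div, Real.cos_zero, one_mul] at h2
      rwa [mul_one_div_cancel hδ.ne'] at h2
    simpa using h1.smul_const y
  refine ⟨fun s => ψ (η s), fun s => ?_, ?_, fun s => hψH _ (hη s), ?_⟩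
  · exact ContMDiffAt.comp s (hψ.contMDiffAt (Metric.isOpen_ball.mem_nhds (hη s)))
      hηs.contMDiff.contMDiffAt
  · change ψ (η 0) = 1
    rw [hη0, hψ0]
  · have hψd : MDifferentiableAt 𝓘(ℝ, K) 𝓘(ℝ, EG) ψ (η 0) :=
      (hψ.contMDiffAt (Metric.isOpen_ball.mem_nhds (hη 0))).mdifferentiableAt (by simp)
    have h1 := mfderiv_comp (I := 𝓘(ℝ, ℝ)) (I' := 𝓘(ℝ, K)) (I'' := 𝓘(ℝ, EG)) (0 : ℝ) hψd
      hηd.differentiableAt.mdifferentiableAt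
    rw [hηd.hasFDerivAt.hasMFDerivAt.mfderiv] at h1
    refine (congrArg (fun L => L (1 : ℝ)) h1).trans ?_
    change mfderiv 𝓘(ℝ, K) 𝓘(ℝ, EG) ψ (η 0) ((1 : ℝ) • y) = _
    rw [hη0, one_smul]

/-- A subgroup that contains the end points of all smooth curves in `H` starting at `1` contains the
connected subgroup `H`. -/
theorem le_of_smooth_curves
    (hsub : Manifold.IsSubmersion 𝓘(ℝ, EG) 𝓘(ℝ, EX) ∞ (QuotientGroup.mk : G → G ⧸ H))
    (hH : IsConnected (H : Set G)) (K : Subgroup G)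
    (hK : ∀ γ : ℝ → G, ContMDiff 𝓘(ℝ, ℝ) 𝓘(ℝ, EG) ∞ γ → γ 0 = 1 → (∀ s, γ s ∈ H) → γ 1 ∈ K) :
    H ≤ K := by
  have : IsTopologicalGroup G := topologicalGroup_of_lieGroup 𝓘(ℝ, EG) ∞
  obtain ⟨Y, _, _, ψ, ε, hε, hψ, hψ0, hψH, hψn, -⟩ := exists_parametrization hsub
  -- points of `H` near `1` are joined to `1` inside `H` by the image of a segment, reparametrized
  -- to be defined on all of `ℝ`
  have hnear : ∀ᶠ h in 𝓝 (1 : G), h ∈ H → h ∈ K := by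
    filter_upwards [hψn] with h hh hH
    obtain ⟨y, hy, rfl⟩ := hh hH
    have hmem : ∀ s : ℝ, Real.smoothTransition s • y ∈ Metric.ball (0 : Y) ε := fun s => by
      rw [mem_ball_zero_iff] at hy ⊢
      rw [norm_smul, Real.norm_of_nonneg (Real.smoothTransition.nonneg s)]
      exact (mul_le_of_le_one_left (norm_nonneg _) (Real.smoothTransition.le_one s)).trans_lt hy
    have hs : ContDiff ℝ ∞ fun s : ℝ => Real.smoothTransition s • y :=
      Real.smoothTransition.contDiff.smul contDiff_const
    have := hK (fun s => ψ (Real.smoothTransition s • y)) (fun s =>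
      ContMDiffAt.comp s (hψ.contMDiffAt (Metric.isOpen_ball.mem_nhds (hmem s)))
        hs.contMDiff.contMDiffAt) (by simp [hψ0]) fun s => hψH _ (hmem s)
    simpa using this
  have : ConnectedSpace H := isConnected_iff_connectedSpace.1 hH
  -- hence the intersection with `K` is an open subgroup of the connected group `H`
  have h1 : (K.subgroupOf H : Set H) ∈ 𝓝 (1 : H) := by
    have := (continuous_subtype_val (p := fun g => g ∈ H)).continuousAt (x := 1)
    filter_upwards [this.preimage_mem_nhds hnear] with h hh
    exact Subgroup.mem_subgroupOf.2 (hh h.2)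
  have h2 : IsOpen (K.subgroupOf H : Set H) := Subgroup.isOpen_of_mem_nhds _ h1
  have h3 : (K.subgroupOf H : Set H) = Set.univ :=
    IsClopen.eq_univ ⟨Subgroup.isClosed_of_isOpen _ h2, h2⟩ ⟨1, one_mem _⟩
  intro h hh
  have : (⟨h, hh⟩ : H) ∈ (K.subgroupOf H : Set H) := by rw [h3]; trivial
  exact Subgroup.mem_subgroupOf.1 this

end HomogeneousSpace

/-! ### Local trivializations -/

open GradedManifold

namespace GradedManifold

/-- A function, considered as a family which does not depend on the parameter, is smooth. -/
theorem isSmoothFam_const {M : GradedManifold.{u}}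
    {N EN HN : Type*} [NormedAddCommGroup EN] [NormedSpace ℝ EN]
    [TopologicalSpace HN] {I : ModelWithCorners ℝ EN HN} [TopologicalSpace N] [ChartedSpace HN N]
    {U : Opens M.carrier} {k : ℤ} {f : M.O U} (hf : f ∈ M.gr U k) {W : Opens (N × M.carrier)}
    (hW : ∀ n, slice W n ≤ U) : IsSmoothFam I W k fun n => M.res (hW n) f := by
  refine ⟨fun n => M.sheaf.res_mem _ _ _ hf, fun c hc q hq hqc => ?_⟩
  have h1 := c.coef_smooth (U ⊓ c.dom) inf_le_right k (M.res inf_le_left f)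
    (M.sheaf.res_mem _ _ _ hf) q.2 ⟨hW q.1 hq, hqc⟩
  refine SmoothGerm.comp (φ := fun _ : N => (0 : Fin 0 → ℝ)) isOpen_univ contMDiffOn_const
    (Set.mem_univ _) h1 ?_
  filter_upwards [W.isOpen.mem_nhds hq] with r hr m
  exact c.cf_res (hW r.1) f m hr

/-- The open set `N × U`. -/
def cylinder (N : Type*) [TopologicalSpace N] {M : GradedManifold.{u}} (U : Opens M.carrier) :
    Opens (N × M.carrier) :=
  ⟨{q | q.2 ∈ U}, U.isOpen.preimage continuous_snd⟩

theorem slice_cylinder_le {N : Type*} [TopologicalSpace N] {M : GradedManifold.{u}}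
    (U : Opens M.carrier) (n : N) : slice (cylinder N U) n ≤ U := fun _ hy => hy

theorem le_slice_cylinder {N : Type*} [TopologicalSpace N] {M : GradedManifold.{u}}
    (U : Opens M.carrier) (n : N) : U ≤ slice (cylinder N U) n := fun _ hy => hy

/-- A linear map on functions can be defined on homogeneous functions, by a relation. -/
theorem exists_linearMap_of_homogeneous {M : GradedManifold.{u}} {M' : GradedManifold.{v}}
    {U : Opens M.carrier} {V : Opens M'.carrier} {d : ℤ} (R : M.O U → M'.O V → Prop)
    (hadd : ∀ f f' g g', R f g → R f' g' → R (f + f') (g + g'))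
    (hsmul : ∀ (a : ℝ) f g, R f g → R (a • f) (a • g))
    (hex : ∀ k, ∀ f ∈ M.gr U k, ∃ g ∈ M'.gr V (k + d), R f g)
    (huniq : ∀ k, ∀ f ∈ M.gr U k, ∀ g ∈ M'.gr V (k + d), ∀ g' ∈ M'.gr V (k + d),
      R f g → R f g' → g = g') :
    ∃ L : M.O U →ₗ[ℝ] M'.O V, (∀ f, R f (L f)) ∧ ∀ k, ∀ f ∈ M.gr U k, L f ∈ M'.gr V (k + d) := by
  classical
  choose! φ hφ hφR using hex
  -- on each graded piece the relation is the graph of a linear map; the pieces are assembled by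
  -- the direct sum decomposition of the functions
  let Lk : ∀ k, M.gr U k →ₗ[ℝ] M'.O V := fun k =>
    { toFun := fun f => φ k f
      map_add' := fun f f' => huniq k (f + f') (Submodule.add_mem _ f.2 f'.2) _
        (hφ k _ (Submodule.add_mem _ f.2 f'.2)) _
        (Submodule.add_mem _ (hφ k _ f.2) (hφ k _ f'.2))
        (hφR k _ (Submodule.add_mem _ f.2 f'.2)) (hadd _ _ _ _ (hφR k _ f.2) (hφR k _ f'.2))
      map_smul' := fun a f => huniq k (a • f) (Submodule.smul_mem _ _ f.2) _
        (hφ k _ (Submodule.smul_mem _ _ f.2)) _ (Submodule.smul_mem _ _ (hφ k _ f.2))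
        (hφR k _ (Submodule.smul_mem _ _ f.2)) (hsmul _ _ _ (hφR k _ f.2)) }
  let e := LinearEquiv.ofBijective (DirectSum.coeLinearMap (M.gr U)) (M.sheaf.internal U)
  let L := (DirectSum.toModule ℝ ℤ (M'.O V) Lk).comp e.symm.toLinearMap
  have hL : ∀ k, ∀ f, ∀ hf : f ∈ M.gr U k, L f = φ k f := fun k f hf => by
    have h1 : e.symm f = DirectSum.lof ℝ ℤ (fun k => M.gr U k) k ⟨f, hf⟩ := by
      rw [LinearEquiv.symm_apply_eq]
      exact (DirectSum.coeLinearMap_lof (M.gr U) k ⟨f, hf⟩).symm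
    change DirectSum.toModule ℝ ℤ (M'.O V) Lk (e.symm f) = _
    rw [h1, DirectSum.toModule_lof]
    rfl
  refine ⟨L, fun f => ?_, fun k f hf => by rw [hL k f hf]; exact hφ k f hf⟩
  refine homogeneous_induction (P := fun f => R f (L f)) f ?_ (fun f g hf hg => ?_)
    fun k f hf => ?_
  · have h0 : (0 : M.O U) ∈ M.gr U 0 := Submodule.zero_mem _
    have := hφR 0 0 h0
    rwa [← hL 0 0 h0] at this
  · rw [map_add]; exact hadd _ _ _ _ hf hg
  · rw [hL k f hf]; exact hφR k f hf

end GradedManifold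

section Triv

variable {EX X : Type*} [NormedAddCommGroup EX] [NormedSpace ℝ EX] [FiniteDimensional ℝ EX]
  [TopologicalSpace X] [ChartedSpace EX X] [IsManifold 𝓘(ℝ, EX) ∞ X]
  {F : GradedManifold.{u}} {E : GradedManifold.{v}} {π : GradedOver EX X E}

namespace LocalTriv

variable (T : LocalTriv F π)

/-- The open set of `(x, y)` that the trivialization maps to `U`. -/
def overOpens (U : Opens E.carrier) : Opens (X × F.carrier) :=
  ⟨{q | q ∈ T.map.dom ∧ T.map.toFun q ∈ U},
    T.map.cont.isOpen_inter_preimage T.map.dom.isOpen U.isOpen⟩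

/-- A function in the trivialization, as a family of functions on `F`. -/
def fam (U : Opens E.carrier) (f : E.O U) : F.Fam (T.overOpens U) :=
  fun x => T.map.pull x U (slice (T.overOpens U) x) (fun _ hy => hy) f

theorem fam_smooth {U : Opens E.carrier} {k : ℤ} {f : E.O U} (hf : f ∈ E.gr U k) :
    IsSmoothFam 𝓘(ℝ, EX) (T.overOpens U) k (T.fam U f) := by
  have h1 : IsSmoothFam 𝓘(ℝ, Fin 0 → ℝ) (N := Fin 0 → ℝ) (cylinder _ U) k _ :=
    isSmoothFam_const hf (slice_cylinder_le U)
  have h2 := T.map.smooth_pull h1 (J := 𝓘(ℝ, EX)) (a := fun _ : X => (0 : Fin 0 → ℝ)) (b := id)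
    isOpen_univ contMDiffOn_const contMDiffOn_id (W' := T.overOpens U) (fun _ _ => trivial)
    (fun r y hy => hy)
  convert h2 using 2 with x
  exact (T.map.pull_res _ _ _ _ _ _ _).symm

/-- Parametrized form of the fact that functions are given by their expressions in a trivialization. -/
theorem exists_family {d : ℕ} {k : ℤ} (W : Opens ((Fin d → ℝ) × E.carrier))
    (hW : ∀ r ∈ W, π.proj r.2 ∈ T.base)
    (s' : F.Fam (pullOpens T.map.dom T.map.toFun T.map.cont W))
    (hs' : IsSmoothFam (𝓘(ℝ, Fin d → ℝ).prod 𝓘(ℝ, EX)) _ k s') :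
    ∃ s : E.Fam W, IsSmoothFam 𝓘(ℝ, Fin d → ℝ) W k s ∧ T.map.pullFam W s = s' := by
  obtain ⟨s, hs, -⟩ := T.iso d W hW k s' hs'
  exact ⟨s, hs⟩

/-- A homogeneous function is determined by its expression in a trivialization. -/
theorem ext_gr {U : Opens E.carrier} (hU : ∀ b ∈ U, π.proj b ∈ T.base) {k : ℤ} {f f' : E.O U}
    (hf : f ∈ E.gr U k) (hf' : f' ∈ E.gr U k)
    (h : ∀ x W hW, T.map.pull x U W hW f = T.map.pull x U W hW f') : f = f' := by
  let W : Opens ((Fin 0 → ℝ) × E.carrier) := cylinder _ U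
  let c : E.O U → E.Fam W := fun f n => E.res (slice_cylinder_le U n) f
  have hc : ∀ {f}, f ∈ E.gr U k → IsSmoothFam 𝓘(ℝ, Fin 0 → ℝ) W k (c f) := fun hf =>
    isSmoothFam_const hf (slice_cylinder_le U)
  have hs' := T.map.smooth 0 W k (c f) (hc hf)
  obtain ⟨s, -, hs⟩ := T.iso 0 W (fun r hr => hU _ hr) k _ hs'
  have h1 := hs (c f) ⟨hc hf, rfl⟩
  have h2 := hs (c f') ⟨hc hf', by
    funext r
    change T.map.pull _ _ _ _ (E.res _ f') = T.map.pull _ _ _ _ (E.res _ f)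
    exact (T.map.pull_res _ _ _ _ _ _ _).trans ((h _ _ _).symm.trans
      (T.map.pull_res _ _ _ _ _ _ _).symm)⟩
  have h3 := congrFun (h1.trans h2.symm) 0
  have h4 : ∀ f, E.res (le_slice_cylinder U _) (c f 0) = f := fun f =>
    (res_res' _ _ _).trans (res_self' _ _)
  rw [← h4 f, ← h4 f', h3]

/-- Every family of functions on the fibre is the expression of a function in the trivialization. -/
theorem exists_fn {U : Opens E.carrier} (hU : ∀ b ∈ U, π.proj b ∈ T.base) {k : ℤ}
    {W : Opens (X × F.carrier)} (hW : T.overOpens U ≤ W) {s : F.Fam W}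
    (hs : IsSmoothFam 𝓘(ℝ, EX) W k s) :
    ∃ f ∈ E.gr U k, ∀ x Y hY, T.map.pull x U Y hY f =
      F.res (fun y hy => hW (show (x, y) ∈ T.overOpens U from hY y hy)) (s x) := by
  let W₀ : Opens ((Fin 0 → ℝ) × E.carrier) := cylinder _ U
  have h1 := hs.pb (I' := 𝓘(ℝ, Fin 0 → ℝ).prod 𝓘(ℝ, EX)) (φ := Prod.snd)
    (W' := pullOpens T.map.dom T.map.toFun T.map.cont W₀) isOpen_univ contMDiffOn_snd
    (fun _ _ => trivial) (fun q hq => hW hq)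
  obtain ⟨t, ht, hts⟩ := T.exists_family W₀ (fun r hr => hU _ hr) _ h1
  refine ⟨E.res (le_slice_cylinder U _) (t 0), E.sheaf.res_mem _ _ _ (ht.1 0),
    fun x Y hY => ?_⟩
  have h2 := congrFun hts (0, x)
  have hle : Y ≤ slice (pullOpens T.map.dom T.map.toFun T.map.cont W₀) (0, x) := fun y hy => hY y hy
  have h3 := congrArg (F.res hle) h2
  rw [T.map.pull_res]
  refine (T.map.res_pull _ _ _ _ _ _ _).symm.trans (h3.trans ?_)
  exact res_res' _ _ _

open Classical in
/-- The coordinate in the fibre of a point of the body. -/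
def snd [Nonempty (E.carrier → F.carrier)] (b : E.carrier) : F.carrier :=
  if h : π.proj b ∈ T.base then (T.bijective b h).choose
  else Classical.arbitrary (E.carrier → F.carrier) b

variable [Nonempty (E.carrier → F.carrier)]

theorem map_snd {b : E.carrier} (h : π.proj b ∈ T.base) : T.map.toFun (π.proj b, T.snd b) = b := by
  rw [snd, dif_pos h]
  exact (T.bijective b h).choose_spec.1

theorem snd_map {x : X} (hx : x ∈ T.base) (y : F.carrier) : T.snd (T.map.toFun (x, y)) = y := by
  have h1 := T.proj_map x y hx
  have h2 : π.proj (T.map.toFun (x, y)) ∈ T.base := by rw [h1]; exact hx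
  refine (T.bijective _ h2).unique (T.map_snd h2) ?_
  rw [h1]

/-- The fibre coordinate of a trivialization is continuous, because trivializations are open maps.
-/
theorem continuousOn_fibreCoord : ContinuousOn T.snd {b | π.proj b ∈ T.base} := by
  have hopen : IsOpen {b | π.proj b ∈ T.base} := T.base.isOpen.preimage π.continuous_proj
  rw [continuousOn_open_iff hopen]
  intro V hV
  have h1 : IsOpen {q : X × F.carrier | q.1 ∈ T.base ∧ q.2 ∈ V} :=
    (T.base.isOpen.preimage continuous_fst).inter (hV.preimage continuous_snd)
  convert T.isOpen_image _ h1 fun q hq => (T.mem_dom q.1 q.2).2 hq.1 using 1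
  ext b
  constructor
  · rintro ⟨hb, hbV⟩
    exact ⟨(π.proj b, T.snd b), ⟨hb, hbV⟩, T.map_snd hb⟩
  · rintro ⟨⟨x, y⟩, ⟨hx, hy⟩, rfl⟩
    refine ⟨?_, ?_⟩
    · change π.proj _ ∈ T.base
      rw [T.proj_map x y hx]; exact hx
    · change T.snd _ ∈ V
      rw [T.snd_map hx]; exact hy

theorem mem_of_map_mem {U : Opens E.carrier} {V : Opens F.carrier}
    (h : ∀ b ∈ U, π.proj b ∈ T.base ∧ T.snd b ∈ V) {x : X} {y : F.carrier}
    (hy : (x, y) ∈ T.map.dom ∧ T.map.toFun (x, y) ∈ U) : y ∈ V := by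
  have := (h _ hy.2).2
  rwa [T.snd_map ((T.mem_dom x y).1 hy.1)] at this

/-- Functions on the fibre extend linearly to functions on the total space that restrict to the
given one in every fibre of the trivialization. -/
theorem exists_ext (U : Opens E.carrier) (V : Opens F.carrier)
    (h : ∀ b ∈ U, π.proj b ∈ T.base ∧ T.snd b ∈ V) :
    ∃ L : F.O V →ₗ[ℝ] E.O U, (∀ f x W (hW : ∀ y ∈ W, (x, y) ∈ T.map.dom ∧ T.map.toFun (x, y) ∈ U),
      T.map.pull x U W hW (L f) = F.res (fun y hy => T.mem_of_map_mem h (hW y hy)) f) ∧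
      ∀ k, ∀ f ∈ F.gr V k, L f ∈ E.gr U (k + 0) := by
  refine exists_linearMap_of_homogeneous (fun (f : F.O V) (g : E.O U) =>
    ∀ x W (hW : ∀ y ∈ W, (x, y) ∈ T.map.dom ∧ T.map.toFun (x, y) ∈ U),
      T.map.pull x U W hW g = F.res (fun y hy => T.mem_of_map_mem h (hW y hy)) f)
    (fun f f' g g' hf hf' x W hW => ?_) (fun a f g hf x W hW => ?_) (fun k f hf => ?_)
    fun k f hf g hg g' hg' h1 h2 => ?_
  · rw [map_add, map_add, hf, hf']
  · rw [map_smul, map_smul, hf]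
  · obtain ⟨g, hg, hgf⟩ := T.exists_fn (fun b hb => (h b hb).1) (W := T.overOpens U) le_rfl
      (isSmoothFam_const (W := T.overOpens U) hf fun x y hy => T.mem_of_map_mem h (x := x) hy)
    refine ⟨g, by rwa [add_zero], fun x W hW => (hgf x W hW).trans (res_res' _ _ _)⟩
  · exact T.ext_gr (fun b hb => (h b hb).1) hg hg' fun x W hW => (h1 x W hW).trans (h2 x W hW).symm

/-- The extension of functions on an open set of the fibre to functions on the total space which are
constant in the direction of the base. -/
def extendMap (U : Opens E.carrier) (V : Opens F.carrier)
    (h : ∀ b ∈ U, π.proj b ∈ T.base ∧ T.snd b ∈ V) : F.O V →ₗ[ℝ] E.O U := (T.exists_ext U V h).choose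

theorem pull_extendMap {U : Opens E.carrier} {V : Opens F.carrier}
    (h : ∀ b ∈ U, π.proj b ∈ T.base ∧ T.snd b ∈ V) (f : F.O V) (x : X) (W : Opens F.carrier)
    (hW : ∀ y ∈ W, (x, y) ∈ T.map.dom ∧ T.map.toFun (x, y) ∈ U) :
    T.map.pull x U W hW (T.extendMap U V h f) =
      F.res (fun y hy => T.mem_of_map_mem h (hW y hy)) f :=
  (T.exists_ext U V h).choose_spec.1 f x W hW

theorem extendMap_mem {U : Opens E.carrier} {V : Opens F.carrier}
    (h : ∀ b ∈ U, π.proj b ∈ T.base ∧ T.snd b ∈ V) {k : ℤ} {f : F.O V} (hf : f ∈ F.gr V k) :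
    T.extendMap U V h f ∈ E.gr U k := by
  have := (T.exists_ext U V h).choose_spec.2 k f hf
  rwa [add_zero] at this

/-- Functions on the fibre as functions on the total space which are constant in the
direction of the base, in a trivialization. -/
def extend : LocalOp F E 0 where
  dom := ⟨{b | π.proj b ∈ T.base}, T.base.isOpen.preimage π.continuous_proj⟩
  body := T.snd
  cont := T.continuousOn_fibreCoord
  D V U h := T.extendMap U V h
  res_D V U h U' hU f := by
    refine homogeneous_induction (P := fun f => E.res hU (T.extendMap U V h f) =
      T.extendMap U' V (fun b hb => h b (hU hb)) f) f ?_ (fun f g hf hg => ?_)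
      fun k f hf => ?_
    · simp only [map_zero]
    · simp only [map_add, hf, hg]
    · refine T.ext_gr (fun b hb => (h b (hU hb)).1)
        (E.sheaf.res_mem _ _ _ (T.extendMap_mem h hf)) (T.extendMap_mem _ hf) fun x W hW => ?_
      rw [T.map.pull_res, T.pull_extendMap h, T.pull_extendMap]
  D_res V V' U hV h f := by
    have h' : ∀ b ∈ U, π.proj b ∈ T.base ∧ T.snd b ∈ V := fun b hb => ⟨(h b hb).1, hV (h b hb).2⟩
    refine homogeneous_induction (P := fun f => T.extendMap U V' h (F.res hV f) =
      T.extendMap U V h' f) f ?_ (fun f g hf hg => ?_)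
      fun k f hf => ?_
    · simp only [map_zero]
    · simp only [map_add, hf, hg]
    · refine T.ext_gr (fun b hb => (h b hb).1)
        (T.extendMap_mem h (F.sheaf.res_mem _ _ _ hf)) (T.extendMap_mem h' hf) fun x W hW => ?_
      rw [T.pull_extendMap h, T.pull_extendMap h', res_res']
  smooth d W k s hs W' h := by
    have h1 := hs.pb (I' := 𝓘(ℝ, Fin d → ℝ).prod 𝓘(ℝ, EX)) (φ := Prod.fst)
      (W' := pullOpens T.map.dom T.map.toFun T.map.cont W') isOpen_univ contMDiffOn_fst
      (fun _ _ => trivial) (fun q hq => T.mem_of_map_mem (U := slice W' q.1.1) (h q.1.1) hq)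
    obtain ⟨t, ht, hts⟩ := T.exists_family W' (fun r hr => (h r.1 r.2 hr).1) _ h1
    rw [add_zero]
    convert ht using 1
    funext r
    refine T.ext_gr (fun b hb => (h r b hb).1) (T.extendMap_mem (h r) (hs.1 r)) (ht.1 r)
      fun x Y hY => ?_
    have h2 := congrFun hts (r, x)
    have hle : Y ≤ slice (pullOpens T.map.dom T.map.toFun T.map.cont W') (r, x) :=
      fun y hy => hY y hy
    have h3 := congrArg (F.res hle) h2
    refine (T.pull_extendMap (h r) _ x Y hY).trans (Eq.symm ?_)
    exact (T.map.res_pull _ _ _ _ _ _ _).symm.trans (h3.trans (res_res' _ _ _))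

end LocalTriv

/-- `P` is an operator over the fibre of `x`: it vanishes on the products with functions of the base which
vanish at `x`. -/
structure LocalOp.IsOver {M' : GradedManifold.{w}} {d : ℤ} (P : LocalOp E M' d)
    (π : GradedOver EX X E) (x : X) : Prop where
  proj_body : ∀ y ∈ P.dom, π.proj (P.body y) = x
  D_fn_mul : ∀ U Y h (φ : C^∞⟮𝓘(ℝ, EX), X; ℝ⟯), φ x = 0 → ∀ f, P.D U Y h (π.fn U φ * f) = 0

/-- Hadamard's lemma: a function that vanishes on the fibre of `x` is locally a combination
of functions of the base vanishing at `x`. -/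
theorem LocalTriv.exists_eq_sum_fn_mul [T2Space X] (T : LocalTriv F π) {U : Opens E.carrier} {k : ℤ}
    {f : E.O U}
    (hf : f ∈ E.gr U k) {b : E.carrier} (hb : b ∈ U) (hx : π.proj b ∈ T.base)
    (h0 : ∀ W hW, T.map.pull (π.proj b) U W hW f = 0) :
    ∃ (U' : Opens E.carrier) (hU : U' ≤ U) (d : ℕ) (φ : Fin d → C^∞⟮𝓘(ℝ, EX), X; ℝ⟯)
      (f' : Fin d → E.O U'), b ∈ U' ∧ (∀ j, φ j (π.proj b) = 0) ∧
      E.res hU f = ∑ j, π.fn U' (φ j) * f' j := by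
  obtain ⟨C⟩ := LocalCoords.nonempty 𝓘(ℝ, EX) (π.proj b)
  set x := π.proj b with hxb
  obtain ⟨y, hy, -⟩ := T.bijective b hx
  have hy : T.map.toFun (x, y) = b := hy
  have hxy : (x, y) ∈ T.overOpens U := ⟨(T.mem_dom _ _).2 hx, by
    rw [hy]; exact hb⟩
  have hs := T.fam_smooth hf
  -- coordinates are extended to the whole base by a bump function
  obtain ⟨χ, -, hχ⟩ := (SmoothBumpFunction.nhds_basis_tsupport (I := 𝓘(ℝ, EX)) x).mem_iff.1
    (C.isOpen_Ω.mem_nhds C.mem)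
  have hφ : ∀ j, ContMDiff 𝓘(ℝ, EX) 𝓘(ℝ, ℝ) ∞ fun z => χ z • (C.χ z j - C.χ x j) := fun j => by
    refine contMDiff_of_contMDiffOn_union_of_isOpen (s := C.Ω) (t := (tsupport χ)ᶜ) ?_ ?_ ?_
      C.isOpen_Ω (isOpen_compl_iff.2 (isClosed_tsupport χ))
    · refine χ.contMDiff.contMDiffOn.smul ?_
      exact (((contDiff_apply ℝ ℝ j).contMDiff).comp_contMDiffOn C.smooth_χ).sub contMDiffOn_const
    · refine (contMDiffOn_const (c := (0 : ℝ))).congr fun z hz => ?_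
      simp [image_eq_zero_of_notMem_tsupport hz]
    · rw [Set.eq_univ_iff_forall]
      intro z
      by_cases hz : z ∈ tsupport χ
      · exact Or.inl (hχ hz)
      · exact Or.inr hz
  let φ : Fin C.d → C^∞⟮𝓘(ℝ, EX), X; ℝ⟯ := fun j => ⟨_, hφ j⟩
  obtain ⟨V, hV, hVo, hxV⟩ := eventually_nhds_iff.1 χ.eventuallyEq_one
  have hax : (C.χ x, y) ∈ C.dom (T.overOpens U) := C.mem_dom (T.overOpens U) (x, y) ⟨C.mem, hxy⟩
  obtain ⟨W₁, hW₁, hW₁', w, hxW₁, hw, hexp⟩ := (C.fam_smooth _ hs).hadamard hax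
  let B : Set (X × F.carrier) := {q | q.1 ∈ C.Ω ∩ V ∩ T.base} ∩ (T.overOpens U) ∩
    {q | (q.1 ∈ C.Ω) ∧ (C.χ q.1, q.2) ∈ W₁}
  have hB : IsOpen B := by
    refine ((((C.isOpen_Ω.inter hVo).inter T.base.isOpen).preimage continuous_fst).inter
      (T.overOpens U).isOpen).inter ?_
    exact (((C.smooth_χ.continuousOn.comp continuousOn_fst fun q hq => hq).prodMk
      continuousOn_snd).isOpen_inter_preimage (C.isOpen_Ω.preimage continuous_fst) W₁.isOpen)
  let U' : Opens E.carrier := ⟨T.map.toFun '' B, T.isOpen_image B hB fun q hq => hq.1.2.1⟩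
  have hU : U' ≤ U := by
    rintro _ ⟨q, hq, rfl⟩
    exact hq.1.2.2
  have hbase : ∀ c ∈ U', π.proj c ∈ T.base := by
    rintro _ ⟨q, hq, rfl⟩
    rw [T.proj_map q.1 q.2 hq.1.1.2]; exact hq.1.1.2
  have hover : ∀ q, q ∈ T.overOpens U' → q ∈ B := by
    rintro ⟨z, y'⟩ ⟨hz, ⟨z', y''⟩, hq, he⟩
    have hz' : z ∈ T.base := (T.mem_dom _ _).1 hz
    have h1 : z' = z := by
      rw [← T.proj_map z' y'' hq.1.1.2, he, T.proj_map z y' hz']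
    subst h1
    have hpb : π.proj (T.map.toFun (z', y')) = z' := T.proj_map z' y' hz'
    have h2 := (T.bijective (T.map.toFun (z', y')) (by rw [hpb]; exact hz')).unique
      (y₁ := y'') (y₂ := y') (by rw [hpb]; exact he) (by rw [hpb])
    rwa [← h2]
  have hcut : ∀ q, q ∈ T.overOpens U' → (C.χ q.1, q.2) ∈ W₁ := fun q hq => (hover q hq).2.2
  have hwf : ∀ j, ∃ f' ∈ E.gr U' k, ∀ z Y hY, T.map.pull z U' Y hY f' =
      F.res (fun y hy => hY y hy) (pbFam C.χ hcut (w j) z) := fun j =>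
    T.exists_fn hbase le_rfl ((hw j).pb C.isOpen_Ω C.smooth_χ
      (fun q hq => (hover q hq).2.1) hcut)
  choose f' hf' hf'w using hwf
  have hxU' : b ∈ U' := ⟨(x, y), ⟨⟨⟨⟨C.mem, hxV⟩, hx⟩, hxy⟩, C.mem, hxW₁⟩, hy⟩
  have hφ0 : ∀ j, φ j x = 0 := fun j => by
    change χ x • (C.χ x j - C.χ x j) = 0
    rw [sub_self, smul_zero]
  have hfnmem : ∀ j, π.fn U' (φ j) * f' j ∈ E.gr U' k := fun j => by
    have := E.sheaf.mul_mem U' 0 k _ _ (E.sheaf.res_mem le_top 0 _ (π.pull_mem (φ j))) (hf' j)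
    rwa [zero_add] at this
  refine ⟨U', hU, C.d, φ, f', hxU', hφ0, T.ext_gr hbase (E.sheaf.res_mem _ _ _ hf)
    (Submodule.sum_mem _ fun j _ => hfnmem j) fun z Y hY => ?_⟩
  by_cases hYe : ∃ y', y' ∈ Y
  · obtain ⟨y', hy'⟩ := hYe
    have hz := hover (z, y') (hY y' hy')
    have hzΩ : z ∈ C.Ω := hz.2.1
    have hzb : z ∈ T.base := hz.1.1.2
    have hzV : χ z = 1 := hV z hz.1.1.1.2
    have hYW : Y ≤ slice W₁ (C.χ z) := fun y hy => hcut (z, y) (hY y hy)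
    have h1 := congrArg (F.res hYW) (hexp (C.χ z))
    rw [map_sum]
    have h3 : ∀ j, T.map.pull z U' Y hY (π.fn U' (φ j) * f' j) =
        (C.χ z j - C.χ x j) • F.res hYW (w j (C.χ z)) := fun j => by
      rw [map_mul, T.pull_fn z U' Y hY (φ j) hzb, ← Algebra.smul_def, hf'w j z Y hY]
      change (χ z • (C.χ z j - C.χ x j)) • _ = _
      rw [hzV, one_smul]
      exact congrArg _ (res_res' _ _ _)
    rw [Finset.sum_congr rfl fun j _ => h3 j, T.map.pull_res]
    simp only [map_add, map_sum, map_smul, res_res'] at h1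
    have h4 : C.fam (T.overOpens U) (T.fam U f) (C.χ x) = 0 := by
      have h5 : ∀ z', z' = x → ∀ W hW, T.map.pull z' U W hW f = 0 := by
        rintro _ rfl; exact h0
      refine (congrArg (F.res _) (h5 (C.ψ (C.χ x)) (C.ψ_χ x C.mem) _ _)).trans (map_zero _)
    rw [h4, map_zero, zero_add] at h1
    refine Eq.trans ?_ h1
    have h6 : ∀ z', z' = z → ∀ (hW : ∀ y ∈ Y, y ∈ slice (T.overOpens U) z'),
        T.map.pull z U Y (fun y hy => (hover (z, y) (hY y hy)).1.2) f =
        F.res hW (T.map.pull z' U (slice (T.overOpens U) z') (fun _ hy => hy) f) := by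
      intro z' hz' hW
      subst hz'
      exact (T.map.res_pull z' U (slice (T.overOpens U) z') (fun _ hy => hy) Y hW f).symm
    refine (h6 (C.ψ (C.χ z)) (C.ψ_χ z hzΩ) fun y hy => (hW₁ (hYW hy)).2).trans ?_
    exact (res_res' _ _ _).symm
  · refine eq_of_local fun p hp => absurd ⟨p, hp⟩ hYe

/-- Operators over the fibre of `x` depend only on the restriction of functions to this fibre. -/
theorem LocalOp.IsOver.D_eq_zero [T2Space X] (T : LocalTriv F π) {M' : GradedManifold.{w}} {d : ℤ}
    {P : LocalOp E M' d} {x : X} (hP : P.IsOver π x) (hx : x ∈ T.base) {U : Opens E.carrier} {k : ℤ}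
    {f : E.O U} (hf : f ∈ E.gr U k) (h0 : ∀ W hW, T.map.pull x U W hW f = 0)
    (Y : Opens M'.carrier) (h : ∀ y ∈ Y, y ∈ P.dom ∧ P.body y ∈ U) : P.D U Y h f = 0 := by
  refine eq_of_local fun y hy => ?_
  have hxy : π.proj (P.body y) = x := hP.proj_body y (h y hy).1
  obtain ⟨U', hU, e, φ, f', hb, hφ, hsum⟩ := T.exists_eq_sum_fn_mul hf (h y hy).2
    (by rw [hxy]; exact hx) (by rw [hxy]; exact h0)
  rw [hxy] at hφ
  let Y' : Opens M'.carrier := ⟨Y ∩ (P.dom ∩ P.body ⁻¹' U'),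
    Y.isOpen.inter (P.cont.isOpen_inter_preimage P.dom.isOpen U'.isOpen)⟩
  have hY : Y' ≤ Y := fun z hz => hz.1
  refine ⟨Y', hY, ⟨hy, (h y hy).1, hb⟩, ?_⟩
  have h1 := P.D_res U U' Y' hU (fun z hz => hz.2) f
  rw [map_zero, P.res_D]
  refine h1.symm.trans ?_
  rw [hsum, map_sum]
  exact Finset.sum_eq_zero fun j _ => hP.D_fn_mul U' Y' _ (φ j) (hφ j) _

end Triv

/-! ### Vertical vector fields and their restriction to a fibre -/

open GradedManifold

/-- The composition of local operators. -/
def LocalOp.comp {M : GradedManifold.{u}} {M' : GradedManifold.{v}} {M'' : GradedManifold.{w}}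
    {d d' : ℤ} (P : LocalOp M' M'' d') (R : LocalOp M M' d) : LocalOp M M'' (d + d') where
  dom := ⟨P.dom ∩ P.body ⁻¹' R.dom, P.cont.isOpen_inter_preimage P.dom.isOpen R.dom.isOpen⟩
  body := R.body ∘ P.body
  cont := R.cont.comp (P.cont.mono fun _ hy => hy.1) fun _ hy => hy.2
  D U Y h := (P.D ⟨R.dom ∩ R.body ⁻¹' U, R.cont.isOpen_inter_preimage R.dom.isOpen U.isOpen⟩ Y
    fun y hy => ⟨(h y hy).1.1, (h y hy).1.2, (h y hy).2⟩).comp (R.D U _ fun _ hy => hy)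
  res_D U Y h Y' hY f := P.res_D _ _ _ _ _ _
  D_res U U' Y hU h f := by
    refine P.D_congr _ _ (V := ⟨R.dom ∩ R.body ⁻¹' U',
      R.cont.isOpen_inter_preimage R.dom.isOpen U'.isOpen⟩) le_rfl
      (fun z hz => ⟨hz.1, hU hz.2⟩) (fun y hy => ⟨(h y hy).1.2, (h y hy).2⟩) ?_
    let Y₁ : Opens M'.carrier := ⟨R.dom ∩ R.body ⁻¹' U,
      R.cont.isOpen_inter_preimage R.dom.isOpen U.isOpen⟩
    let Y₂ : Opens M'.carrier := ⟨R.dom ∩ R.body ⁻¹' U',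
      R.cont.isOpen_inter_preimage R.dom.isOpen U'.isOpen⟩
    have hY : Y₂ ≤ Y₁ := fun z hz => ⟨hz.1, hU hz.2⟩
    exact (res_self' _ _).trans ((R.D_res U U' Y₂ hU (fun _ hy => hy) f).trans
      (R.res_D U Y₁ (fun _ hy => hy) Y₂ hY f).symm)
  smooth n W k s hs W' h := by
    let W₁ : Opens ((Fin n → ℝ) × M'.carrier) := ⟨{q | q.2 ∈ R.dom} ∩ (fun q => (q.1, R.body q.2)) ⁻¹' W,
      (continuousOn_fst.prodMk (R.cont.comp continuousOn_snd
        fun q hq => hq)).isOpen_inter_preimage (R.dom.isOpen.preimage continuous_snd) W.isOpen⟩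
    have h1 := R.smooth n W k s hs W₁ fun r y hy => hy
    have h2 := P.smooth n W₁ (k + d) _ h1 W' fun r y hy =>
      ⟨(h r y hy).1.1, (h r y hy).1.2, (h r y hy).2⟩
    rwa [add_assoc] at h2

section Restrict

variable {EX X : Type*} [NormedAddCommGroup EX] [NormedSpace ℝ EX] [FiniteDimensional ℝ EX]
  [TopologicalSpace X] [ChartedSpace EX X] [IsManifold 𝓘(ℝ, EX) ∞ X]
  {F : GradedManifold.{u}} {E : GradedManifold.{v}} {π : GradedOver EX X E}

theorem GradedOver.fn_mem (π : GradedOver EX X E) (U : Opens E.carrier)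
    (φ : C^∞⟮𝓘(ℝ, EX), X; ℝ⟯) : π.fn U φ ∈ E.gr U 0 :=
  E.sheaf.res_mem le_top 0 _ (π.pull_mem φ)

theorem GradedOver.res_fn (π : GradedOver EX X E) {U V : Opens E.carrier} (h : U ≤ V)
    (φ : C^∞⟮𝓘(ℝ, EX), X; ℝ⟯) : E.res h (π.fn V φ) = π.fn U φ := res_res' _ _ _

namespace LocalOp

theorem isOver_toLocalOp (T : LocalTriv F π) {x : X} (hx : x ∈ T.base) :
    (T.map.toLocalOp x).IsOver π x where
  proj_body y _ := T.proj_map x y hx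
  D_fn_mul U Y h φ hφ f := by
    change T.map.pull x U Y h (π.fn U φ * f) = 0
    rw [map_mul, T.pull_fn x U Y h φ hx, hφ, map_zero, zero_mul]

/-- Composition of an operator over a point with an operator that maps multiples of functions of the
base to such multiples. -/
theorem IsOver.comp {M' : GradedManifold.{w}} {d d' : ℤ} {P : LocalOp E M' d'} {x x' : X}
    (hP : P.IsOver π x) {R : LocalOp E E d} (hproj : ∀ b, π.proj b = x → π.proj (R.body b) = x')
    (hfn : ∀ φ : C^∞⟮𝓘(ℝ, EX), X; ℝ⟯, φ x' = 0 → ∃ φ' : C^∞⟮𝓘(ℝ, EX), X; ℝ⟯, φ' x = 0 ∧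
      ∀ U U' h f, ∃ f', R.D U U' h (π.fn U φ * f) = π.fn U' φ' * f') :
    (P.comp R).IsOver π x' where
  proj_body y hy := hproj _ (hP.proj_body y hy.1)
  D_fn_mul U Y h φ hφ f := by
    obtain ⟨φ', hφ', hR⟩ := hfn φ hφ
    obtain ⟨f', hf'⟩ := hR U ⟨R.dom ∩ R.body ⁻¹' U,
      R.cont.isOpen_inter_preimage R.dom.isOpen U.isOpen⟩ (fun _ hy => hy) f
    change P.D _ Y _ (R.D U _ _ (π.fn U φ * f)) = 0
    rw [hf']
    exact hP.D_fn_mul _ _ _ φ' hφ' _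

theorem IsOver.comp_vertical {M' : GradedManifold.{w}} {d d' : ℤ} {P : LocalOp E M' d'} {x : X}
    (hP : P.IsOver π x) {q : VField E d} (hq : ∀ U φ, q.D U (π.fn U φ) = 0) :
    (P.comp q.toLocalOp).IsOver π x := by
  refine hP.comp (fun b hb => hb) fun φ hφ => ⟨φ, hφ, fun U U' h f =>
    ⟨E.res (fun b hb => (h b hb).2) (q.D U f), ?_⟩⟩
  change E.res _ (q.D U (π.fn U φ * f)) = _
  rw [q.leibniz U 0 _ (π.fn_mem U φ), hq, zero_mul, zero_add, mul_zero, Int.negOnePow_zero,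
    one_smul, map_mul, π.res_fn]

end LocalOp

variable [T2Space X] (T : LocalTriv F π)

/-- The restriction of a vertical vector field to a fibre commutes with the restriction of functions. -/
theorem LocalTriv.exists_restrict [Nonempty (E.carrier → F.carrier)] {x : X} (hx : x ∈ T.base)
    {d : ℤ} (q : VField E d) (hq : ∀ U φ, q.D U (π.fn U φ) = 0) :
    ∃ qF : VField F d, ∀ U W (h : ∀ y ∈ W, (x, y) ∈ T.map.dom ∧ T.map.toFun (x, y) ∈ U) f,
      qF.D W (T.map.pull x U W h f) = T.map.pull x U W h (q.D U f) := by
  -- a function on the fibre is extended along the base, the vector field is applied, and the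
  -- result is restricted to the fibre over `x`
  let P := (T.map.toLocalOp x).comp q.toLocalOp
  let R := P.comp T.extend
  have hP : P.IsOver π x := (LocalOp.isOver_toLocalOp T hx).comp_vertical hq
  have hmap : ∀ y, π.proj (T.map.toFun (x, y)) ∈ T.base := fun y => by
    rw [T.proj_map x y hx]; exact hx
  have hdom : ∀ y, (x, y) ∈ T.map.dom := fun y => (T.mem_dom x y).2 hx
  have hR : ∀ (U : Opens F.carrier), ∀ y ∈ U, y ∈ R.dom ∧ R.body y ∈ U := fun U y hy => by
    refine ⟨⟨⟨hdom y, trivial⟩, hmap y⟩, ?_⟩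
    change T.snd (T.map.toFun (x, y)) ∈ U
    rw [T.snd_map hx]; exact hy
  let tube : Opens F.carrier → Opens E.carrier := fun V =>
    ⟨{b | π.proj b ∈ T.base} ∩ T.snd ⁻¹' V, T.continuousOn_fibreCoord.isOpen_inter_preimage
      (T.base.isOpen.preimage π.continuous_proj) V.isOpen⟩
  have htube : ∀ V : Opens F.carrier, ∀ b ∈ tube V, π.proj b ∈ T.base ∧ T.snd b ∈ V :=
    fun V b hb => hb
  have hmem : ∀ V : Opens F.carrier, ∀ y ∈ V, (x, y) ∈ T.map.dom ∧ T.map.toFun (x, y) ∈ tube V :=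
    fun V y hy => ⟨hdom y, hmap y, by
      change T.snd (T.map.toFun (x, y)) ∈ V
      rw [T.snd_map hx]; exact hy⟩
  have hD : ∀ V f, R.D V V (hR V) f =
      T.map.pull x (tube V) V (hmem V) (q.D (tube V) (T.extendMap (tube V) V (htube V) f)) := by
    intro V f
    change T.map.pull x _ V _ (E.res _ (q.D (tube V) (T.extendMap (tube V) V (htube V) f))) = _
    exact T.map.pull_res _ _ _ _ _ _ _
  have hpe : ∀ V f, T.map.pull x (tube V) V (hmem V) (T.extendMap (tube V) V (htube V) f) = f :=
    fun V f => (T.pull_extendMap (htube V) f x V (hmem V)).trans (res_self' _ _)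
  have key : ∀ U W (h : ∀ y ∈ W, (x, y) ∈ T.map.dom ∧ T.map.toFun (x, y) ∈ U) f,
      R.D W W (hR W) (T.map.pull x U W h f) = T.map.pull x U W h (q.D U f) := by
    intro U W h f
    refine homogeneous_induction (P := fun f => R.D W W (hR W) (T.map.pull x U W h f) =
      T.map.pull x U W h (q.D U f)) f ?_ (fun f g hf hg => ?_) fun k f hf => ?_
    · simp only [map_zero]
    · simp only [map_add, hf, hg]
    rw [hD]
    let f₁ := T.extendMap (tube W) W (htube W) (T.map.pull x U W h f)
    have hf₁ : f₁ ∈ E.gr (tube W) k := T.extendMap_mem _ (T.map.pull_mem x U W h k f hf)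
    -- two extensions of the same function differ by a function that vanishes on the fibre, and
    -- vertical vector fields preserve such functions
    let f₂ := E.res (inf_le_left : U ⊓ tube W ≤ U) f - E.res inf_le_right f₁
    have hf₂ : f₂ ∈ E.gr (U ⊓ tube W) k :=
      Submodule.sub_mem _ (E.sheaf.res_mem _ _ _ hf) (E.sheaf.res_mem _ _ _ hf₁)
    have h0 : ∀ W' hW', T.map.pull x (U ⊓ tube W) W' hW' f₂ = 0 := fun W' hW' => by
      have hle : W' ≤ W := fun y hy => by
        have h1 : T.snd (T.map.toFun (x, y)) ∈ W := (hW' y hy).2.2.2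
        rwa [T.snd_map hx] at h1
      rw [map_sub, T.map.pull_res, T.map.pull_res, T.pull_extendMap, T.map.res_pull, sub_self]
    have h1 := hP.D_eq_zero T hx hf₂ h0 W fun y hy => ⟨⟨hdom y, trivial⟩, (h y hy).2, (hmem W y hy).2⟩
    have h2 : T.map.pull x (U ⊓ tube W) W (fun y hy => ⟨hdom y, (h y hy).2, (hmem W y hy).2⟩)
        (q.D (U ⊓ tube W) f₂) = 0 := by
      refine Eq.trans ?_ h1
      exact (T.map.pull_res _ _ _ _ _ _ _).symm
    rw [map_sub, map_sub, q.D_res, q.D_res, T.map.pull_res, T.map.pull_res, sub_eq_zero] at h2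
    exact h2.symm
  refine ⟨{
    D := fun U => R.D U U (hR U)
    D_res := fun {U V} h f => ?_
    D_mem := fun U k f hf => ?_
    leibniz := fun U k f hf g => ?_
    smooth := fun n W k s hs => ?_ }, key⟩
  · have h1 := R.D_res V U U h (hR U) f
    exact h1.trans (R.res_D V V (hR V) U h f).symm
  · rw [hD]
    exact T.map.pull_mem _ _ _ _ _ _ (q.D_mem _ _ _ (T.extendMap_mem _ hf))
  · have h1 := key (tube U) U (hmem U) (T.extendMap (tube U) U (htube U) f *
      T.extendMap (tube U) U (htube U) g)
    rw [q.leibniz _ k _ (T.extendMap_mem _ hf)] at h1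
    simp only [map_mul, map_add, hpe] at h1
    rw [h1, hD, hD, Units.smul_def, Units.smul_def, map_zsmul, map_mul, hpe]
  · have := R.smooth n W k s hs W fun r => hR _
    have he : k + (0 + (d + 0)) = k + d := by ring
    rwa [he] at this

end Restrict

/-! ### Components of the equation `Q² = 0` and of the invariance of `Q` -/

/-- A function as a form of form degree zero. -/
def PreForm.zeroForm {X R : Type*} [Zero R] (f : R) : PreForm X R
  | 0, _ => f
  | _ + 1, _ => 0

section Components

variable {EX X : Type*} [NormedAddCommGroup EX] [NormedSpace ℝ EX] [FiniteDimensional ℝ EX]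
  [TopologicalSpace X] [ChartedSpace EX X] [IsManifold 𝓘(ℝ, EX) ∞ X]
  {F : GradedManifold.{u}} {E : GradedManifold.{v}}

/-- Functions are horizontal forms of form degree zero. -/
theorem isHorizontalForm_zeroForm (π : GradedOver EX X E) {U : Opens E.carrier} {k : ℤ} {f : E.O U}
    (hf : f ∈ E.gr U k) : IsHorizontalForm π U k (PreForm.zeroForm f) := by
  refine ⟨?_, ?_, ?_, ?_⟩
  · rintro (_ | p) v
    · simpa [PreForm.zeroForm] using hf
    · exact Submodule.zero_mem _
  · rintro (_ | p) v i w w'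
    · exact i.elim0
    · simp [PreForm.zeroForm]
  · rintro (_ | p) v i w w' φ h
    · exact i.elim0
    · simp [PreForm.zeroForm]
  · rintro (_ | p) v i j hij h
    · exact i.elim0
    · rfl

section TotalQ

variable {π : GradedOver EX X E} (nabla : Connection π) (q : VField E 1) (U : Opens E.carrier)
  (α : PreForm (Vect EX X) (E.O U))

theorem totalQ_zero (v : Fin 0 → Vect EX X) : totalQ nabla q U α 0 v = q.D U (α 0 v) := by
  change (0 : E.O U) + 0 + (-1 : ℤ) ^ 0 • q.D U (α 0 v) = _
  simp

theorem totalQ_one (v : Fin 1 → Vect EX X) : totalQ nabla q U α 1 v =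
    (nabla.cov (v 0)).D U (α 0 Fin.elim0) - q.D U (α 1 v) := by
  have h : ∀ w : Fin 0 → Vect EX X, w = Fin.elim0 := fun w => Subsingleton.elim _ _
  change ∑ i : Fin 1, (-1 : ℤ) ^ (i : ℕ) • (nabla.cov (v i)).D U (α 0 (i.removeNth v)) + 0 +
    (-1 : ℤ) ^ 1 • q.D U (α 1 v) = _
  rw [Fin.sum_univ_one, h (Fin.removeNth 0 v)]
  simp [sub_eq_add_neg]

theorem totalQ_two (v w : Vect EX X) : totalQ nabla q U α 2 ![v, w] =
    (nabla.cov v).D U (α 1 ![w]) - (nabla.cov w).D U (α 1 ![v]) - α 1 ![Vect.bracket v w] +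
      q.D U (α 2 ![v, w]) := by
  have h0 : (Fin.removeNth 0 ![v, w] : Fin 1 → Vect EX X) = ![w] := by
    funext i; fin_cases i; rfl
  have h1 : (Fin.removeNth 1 ![v, w] : Fin 1 → Vect EX X) = ![v] := by
    funext i; fin_cases i; rfl
  have h2 : ∀ u : Fin 0 → Vect EX X,
      (Fin.cons (Vect.bracket v w) u : Fin 1 → Vect EX X) = ![Vect.bracket v w] := fun u => by
    funext i; fin_cases i; rfl
  change ∑ i : Fin 2, (-1 : ℤ) ^ (i : ℕ) • (nabla.cov (![v, w] i)).D U (α 1 (i.removeNth ![v, w])) +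
    (∑ j : Fin 2, ∑ i : Fin 1, if i.castSucc < j then (-1 : ℤ) ^ ((i : ℕ) + j) • α 1 (Fin.cons
      (Vect.bracket (![v, w] i.castSucc) (![v, w] j)) (i.removeNth (j.removeNth ![v, w]))) else 0) +
    (-1 : ℤ) ^ 2 • q.D U (α 2 ![v, w]) = _
  simp only [Fin.sum_univ_two, Fin.sum_univ_one, h0, h1]
  simp [h2, sub_eq_add_neg]

end TotalQ

namespace StandardGPDE

variable (S : StandardGPDE EX X F E)

theorem q_q_of_mem {U : Opens E.carrier} {k : ℤ} {f : E.O U} (hf : f ∈ E.gr U k) :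
    S.q.D U (S.q.D U f) = 0 := by
  have h := congrFun (congrFun (S.Q_sq U k _ (isHorizontalForm_zeroForm _ hf)) 0) Fin.elim0
  rwa [totalQ_zero, totalQ_zero] at h

theorem cov_q (v : Vect EX X) {U : Opens E.carrier} {k : ℤ} {f : E.O U} (hf : f ∈ E.gr U k) :
    (S.nabla.cov v).D U (S.q.D U f) = S.q.D U ((S.nabla.cov v).D U f) := by
  have h := congrFun (congrFun (S.Q_sq U k _ (isHorizontalForm_zeroForm _ hf)) 1) ![v]
  rw [totalQ_one, totalQ_one, totalQ_zero] at h
  simp only [PreForm.zeroForm, map_zero, sub_zero] at h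
  exact sub_eq_zero.1 h

/-- The connection is flat. -/
theorem cov_cov (v w : Vect EX X) {U : Opens E.carrier} {k : ℤ} {f : E.O U} (hf : f ∈ E.gr U k) :
    (S.nabla.cov v).D U ((S.nabla.cov w).D U f) - (S.nabla.cov w).D U ((S.nabla.cov v).D U f) =
      (S.nabla.cov (Vect.bracket v w)).D U f := by
  have h := congrFun (congrFun (S.Q_sq U k _ (isHorizontalForm_zeroForm _ hf)) 2) ![v, w]
  rw [totalQ_two, totalQ_one, totalQ_one, totalQ_one, totalQ_two] at h
  simp only [PreForm.zeroForm, map_zero, sub_zero, add_zero, sub_self] at h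
  exact sub_eq_zero.1 h

end StandardGPDE

end Components

section Invariance

variable {EG G : Type*} [NormedAddCommGroup EG] [NormedSpace ℝ EG]
  [FiniteDimensional ℝ EG] [TopologicalSpace G] [ChartedSpace EG G] [Group G]
  [LieGroup 𝓘(ℝ, EG) ∞ G]
  {EX : Type*} [NormedAddCommGroup EX] [NormedSpace ℝ EX] [FiniteDimensional ℝ EX]
  {H : Subgroup G} [ChartedSpace EX (G ⧸ H)] [IsManifold 𝓘(ℝ, EX) ∞ (G ⧸ H)]
  {F : GradedManifold.{u}} {E : GradedManifold.{v}}

namespace HomogeneousGPDE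

variable (S : HomogeneousGPDE EG EX H F E)

theorem isFormPull_zeroForm (g : G) (U : Opens E.carrier) (f : E.O U) :
    S.action.IsFormPull g U (PreForm.zeroForm f) (PreForm.zeroForm (S.action.pull g U f)) := by
  rintro (_ | p) v' v h
  · rfl
  · exact (map_zero _).symm

theorem action_pull_mem (g : G) {U : Opens E.carrier} {k : ℤ} {f : E.O U} (hf : f ∈ E.gr U k) :
    S.action.pull g U f ∈ E.gr (S.action.preimage g U) k :=
  S.action.act.pull_mem _ _ _ _ _ _ hf

theorem q_pull (g : G) {U : Opens E.carrier} {k : ℤ} {f : E.O U} (hf : f ∈ E.gr U k) :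
    S.q.D (S.action.preimage g U) (S.action.pull g U f) = S.action.pull g U (S.q.D U f) := by
  have h := S.Q_invariant g U k _ _ (isHorizontalForm_zeroForm _ hf)
    (isHorizontalForm_zeroForm _ (S.action_pull_mem g hf)) (S.isFormPull_zeroForm g U f) 0 Fin.elim0
    Fin.elim0 fun i => i.elim0
  rwa [totalQ_zero, totalQ_zero] at h

theorem cov_pull (g : G) {v v' : Vect EX (G ⧸ H)}
    (hv : ∀ x, v (g • x) = mfderiv 𝓘(ℝ, EX) 𝓘(ℝ, EX) (fun z : G ⧸ H => g • z) x (v' x))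
    {U : Opens E.carrier} {k : ℤ} {f : E.O U} (hf : f ∈ E.gr U k) :
    (S.nabla.cov v').D (S.action.preimage g U) (S.action.pull g U f) =
      S.action.pull g U ((S.nabla.cov v).D U f) := by
  have h := S.Q_invariant g U k _ _ (isHorizontalForm_zeroForm _ hf)
    (isHorizontalForm_zeroForm _ (S.action_pull_mem g hf)) (S.isFormPull_zeroForm g U f) 1 ![v'] ![v]
    fun i x => by fin_cases i; exact hv x
  rw [totalQ_one, totalQ_one] at h
  simp only [PreForm.zeroForm, map_zero, sub_zero] at h
  exact h

end HomogeneousGPDE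
end Invariance

/-! ### The pullback along the orbit map -/

namespace HomogeneousGPDE

open GradedManifold

variable {EG : Type w} {G : Type*} [NormedAddCommGroup EG] [NormedSpace ℝ EG]
  [FiniteDimensional ℝ EG] [TopologicalSpace G] [ChartedSpace EG G] [Group G]
  [LieGroup 𝓘(ℝ, EG) ∞ G]
  {EX : Type*} [NormedAddCommGroup EX] [NormedSpace ℝ EX] [FiniteDimensional ℝ EX]
  {H : Subgroup G} [ChartedSpace EX (G ⧸ H)] [IsManifold 𝓘(ℝ, EX) ∞ (G ⧸ H)]
  {F : GradedManifold.{u}} {E : GradedManifold.{v}}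
  (S : HomogeneousGPDE EG EX H F E) (T : LocalTriv F S.toGradedOver)
  (hT : (QuotientGroup.mk 1 : G ⧸ H) ∈ T.base)

theorem act_mem_dom (g : G) (b : E.carrier) : (g, b) ∈ S.action.act.dom := by
  rw [S.action.dom_eq]; trivial

/-- The pullback along the orbit map may be computed through any open set of `E` which contains
the image in the fibre over `[e]`. -/
theorem orbitPull_eq (g : G) {U U' : Opens E.carrier} {W : Opens F.carrier}
    (h : ∀ y ∈ W, S.orbit T (g, y) ∈ U) (h₁ : ∀ b ∈ U', S.action.act.toFun (g, b) ∈ U)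
    (h₂ : ∀ y ∈ W, S.fibre T y ∈ U') (f : E.O U) :
    S.orbitPull T hT g U W h f = S.fibrePull T hT U' W h₂
      (S.action.act.pull g U U' (fun b hb => ⟨S.act_mem_dom g b, h₁ b hb⟩) f) := by
  have hle : U' ≤ S.action.preimage g U := fun b hb => h₁ b hb
  have e := S.action.act.res_pull g U (S.action.preimage g U)
    (fun b hb => ⟨S.act_mem_dom g b, hb⟩) U' hle f
  exact ((congrArg (S.fibrePull T hT U' W h₂) e.symm).trans
    (T.map.pull_res _ _ _ _ _ _ _)).symm

theorem res_orbitPull (g : G) {U : Opens E.carrier} {W W' : Opens F.carrier} (hW : W' ≤ W)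
    (h : ∀ y ∈ W, S.orbit T (g, y) ∈ U) (f : E.O U) :
    F.res hW (S.orbitPull T hT g U W h f) =
      S.orbitPull T hT g U W' (fun y hy => h y (hW hy)) f :=
  T.map.res_pull _ _ _ _ _ _ _

theorem orbitPull_res (g : G) {U U' : Opens E.carrier} {W : Opens F.carrier} (hU : U' ≤ U)
    (h : ∀ y ∈ W, S.orbit T (g, y) ∈ U') (f : E.O U) :
    S.orbitPull T hT g U' W h (E.res hU f) =
      S.orbitPull T hT g U W (fun y hy => hU (h y hy)) f := by
  rw [S.orbitPull_eq T hT g (U' := S.action.preimage g U') h (fun b hb => hb) h,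
    S.orbitPull_eq T hT g (U' := S.action.preimage g U') (fun y hy => hU (h y hy))
      (fun b hb => hU hb) h]
  exact congrArg _ (S.action.act.pull_res _ _ _ _ _ _ _)

theorem orbitPull_mul (g g' : G) {U : Opens E.carrier} {W : Opens F.carrier}
    (h : ∀ y ∈ W, S.orbit T (g * g', y) ∈ U)
    (h' : ∀ y ∈ W, S.orbit T (g', y) ∈ S.action.preimage g U) (f : E.O U) :
    S.orbitPull T hT (g * g') U W h f =
      S.orbitPull T hT g' (S.action.preimage g U) W h' (S.action.pull g U f) := by
  rw [S.orbitPull_eq T hT (g * g') (U' := S.action.preimage g' (S.action.preimage g U)) h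
    (fun b hb => by rw [S.action.mul_act]; exact hb) h']
  exact congrArg _ (S.action.pull_mul g g' _ _ _ _ _ _ f)

theorem orbit_one (y : F.carrier) : S.orbit T (1, y) = S.fibre T y := S.action.one_act _

theorem orbitPull_one {U : Opens E.carrier} {W : Opens F.carrier}
    (h : ∀ y ∈ W, S.orbit T (1, y) ∈ U) (f : E.O U) :
    S.orbitPull T hT 1 U W h f =
      S.fibrePull T hT U W (fun y hy => S.orbit_one T y ▸ h y hy) f := by
  rw [S.orbitPull_eq T hT 1 (U' := U) h (fun b hb => by rw [S.action.one_act]; exact hb)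
    (fun y hy => S.orbit_one T y ▸ h y hy)]
  refine congrArg _ ?_
  rw [S.action.pull_one _ _ _ le_rfl]
  exact E.sheaf.res_self _ _

theorem proj_fibre (y : F.carrier) (hT : (QuotientGroup.mk 1 : G ⧸ H) ∈ T.base) :
    S.proj (S.fibre T y) = QuotientGroup.mk 1 := T.proj_map _ _ hT

theorem proj_orbit (g : G) (y : F.carrier) (hT : (QuotientGroup.mk 1 : G ⧸ H) ∈ T.base) :
    S.proj (S.orbit T (g, y)) = QuotientGroup.mk g := by
  refine (S.action.proj_act _ _).trans ?_
  rw [show S.proj (S.fibre T y) = _ from S.proj_fibre T y hT]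
  change QuotientGroup.mk (g * 1) = _
  rw [mul_one]

theorem orbitPull_fn (g : G) {U : Opens E.carrier} {W : Opens F.carrier}
    (h : ∀ y ∈ W, S.orbit T (g, y) ∈ U)
    (hsub : Manifold.IsSubmersion 𝓘(ℝ, EG) 𝓘(ℝ, EX) ∞ (QuotientGroup.mk : G → G ⧸ H))
    (φ : C^∞⟮𝓘(ℝ, EX), G ⧸ H; ℝ⟯) :
    S.orbitPull T hT g U W h (S.fn U φ) = algebraMap ℝ _ (φ (QuotientGroup.mk g)) := by
  let φ' : C^∞⟮𝓘(ℝ, EX), G ⧸ H; ℝ⟯ :=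
    ⟨fun x => φ (g • x), φ.contMDiff.comp (contMDiff_smul_left hsub g)⟩
  rw [S.orbitPull_eq T hT g (U' := S.action.preimage g U) h (fun b hb => hb) h]
  refine (congrArg _ (S.action.pull_fn g U _ _ φ φ' fun x => rfl)).trans ?_
  refine (T.pull_fn _ _ _ _ _ hT).trans ?_
  change algebraMap ℝ _ (φ (QuotientGroup.mk (g * 1))) = _
  rw [mul_one]

/-- The pullback of a function along the orbit map `G × F → E`. -/
def orbitFam (U : Opens E.carrier) (f : E.O U) : F.Fam (S.orbitOpens T hT U) :=
  fun g => S.orbitPull T hT g U (slice (S.orbitOpens T hT U) g) (fun _ hy => hy) f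

theorem le_orbitSlice {g : G} {U : Opens E.carrier} {W : Opens F.carrier}
    (h : ∀ y ∈ W, S.orbit T (g, y) ∈ U) : W ≤ slice (S.orbitOpens T hT U) g := h

theorem le_orbitSlice_one {U : Opens E.carrier} {W : Opens F.carrier}
    (h : ∀ y ∈ W, S.fibre T y ∈ U) : W ≤ slice (S.orbitOpens T hT U) 1 := fun y hy =>
  show S.orbit T (1, y) ∈ U from (S.orbit_one T y).symm ▸ h y hy

theorem actFam_smooth {U : Opens E.carrier} {k : ℤ} {f : E.O U} (hf : f ∈ E.gr U k) :
    IsSmoothFam 𝓘(ℝ, EG) (S.action.actOpens U) k (S.action.actFam U f) := by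
  have hs := isSmoothFam_const (N := G) (I := 𝓘(ℝ, EG)) hf
    (W := cylinder G U) (slice_cylinder_le U)
  have := S.action.act.smooth_pull hs (a := id) (b := id) (J := 𝓘(ℝ, EG)) (Ω := Set.univ)
    isOpen_univ contMDiffOn_id contMDiffOn_id (W' := S.action.actOpens U) (fun _ _ => trivial)
    (fun r y hy => ⟨S.act_mem_dom r y, hy⟩)
  convert this using 1
  funext g
  exact (S.action.act.pull_res _ _ _ _ _ _ _).symm

theorem orbitFam_smooth {U : Opens E.carrier} {k : ℤ} {f : E.O U} (hf : f ∈ E.gr U k) :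
    IsSmoothFam 𝓘(ℝ, EG) (S.orbitOpens T hT U) k (S.orbitFam T hT U f) := by
  have := (T.map.toLocalOp (QuotientGroup.mk 1)).smoothFam (W := S.action.actOpens U)
    (W' := S.orbitOpens T hT U) (fun g y hy => ⟨(T.mem_dom _ _).2 hT, hy⟩) (S.actFam_smooth hf)
  rwa [add_zero] at this

theorem fundamental_mem (t : GroupLieAlgebra 𝓘(ℝ, EG) G) {U : Opens E.carrier} {k : ℤ} {f : E.O U}
    (hf : f ∈ E.gr U k) : S.action.fundamental t U f ∈ E.gr U k :=
  E.sheaf.res_mem _ _ _ ((S.actFam_smooth hf).famDeriv_mem _ _)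

/-- The fundamental vector fields restricted to the fibre are the derivatives of the orbit map. -/
theorem fibrePull_fundamental (t : GroupLieAlgebra 𝓘(ℝ, EG) G) {U : Opens E.carrier} {k : ℤ}
    {f : E.O U} (hf : f ∈ E.gr U k) {W : Opens F.carrier} (h : ∀ y ∈ W, S.fibre T y ∈ U) :
    S.fibrePull T hT U W h (S.action.fundamental t U f) =
      F.res (S.le_orbitSlice_one T hT h)
        (famDeriv 𝓘(ℝ, EG) _ (S.orbitFam T hT U f) 1 (-t)) := by
  have hd := (S.actFam_smooth hf).hasFamDeriv (1 : G) (-t)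
  have := T.map.hasFamDeriv_pull (S.actFam_smooth hf) (QuotientGroup.mk 1)
    (W' := S.orbitOpens T hT U) (fun g y hy => ⟨(T.mem_dom _ _).2 hT, hy⟩) hd
  have e : famDeriv 𝓘(ℝ, EG) _ (S.orbitFam T hT U f) 1 (-t) = _ := this.famDeriv_eq
  rw [e]
  exact (T.map.pull_res _ _ _ _ _ _ _).trans (T.map.res_pull (QuotientGroup.mk 1)
    (slice (S.action.actOpens U) 1) (slice (S.orbitOpens T hT U) 1)
    (fun y hy => ⟨(T.mem_dom _ _).2 hT, hy⟩) W (S.le_orbitSlice_one T hT h) _).symm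

/-- Equivariance of the derivative of the orbit map: the derivative at `g` along `v` is the
derivative at the identity, along the Maurer–Cartan form of `v`, of the translated function. -/
theorem famDeriv_orbitFam (g : G) (v : TangentSpace 𝓘(ℝ, EG) g) {U : Opens E.carrier} {k : ℤ}
    {f : E.O U} (hf : f ∈ E.gr U k) {W : Opens F.carrier} (h : ∀ y ∈ W, S.orbit T (g, y) ∈ U)
    (h' : ∀ y ∈ W, S.fibre T y ∈ S.action.preimage g U) :
    F.res (S.le_orbitSlice T hT h)
        (famDeriv 𝓘(ℝ, EG) _ (S.orbitFam T hT U f) g v) =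
      F.res (S.le_orbitSlice_one T hT h')
        (famDeriv 𝓘(ℝ, EG) _ (S.orbitFam T hT (S.action.preimage g U) (S.action.pull g U f)) 1
          (maurerCartan g v)) := by
  have hs := S.orbitFam_smooth T hT (S.action_pull_mem g hf)
  have hφ : MDifferentiableAt 𝓘(ℝ, EG) 𝓘(ℝ, EG) (fun z : G => g⁻¹ * z) g :=
    (contMDiff_mul_left (I := 𝓘(ℝ, EG)) (n := ∞)).mdifferentiableAt (by simp)
  have hmem : ∀ q ∈ S.orbitOpens T hT U,
      (g⁻¹ * q.1, q.2) ∈ S.orbitOpens T hT (S.action.preimage g U) := fun q hq => by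
    change S.action.act.toFun (g, S.action.act.toFun (g⁻¹ * q.1, _)) ∈ U
    rw [← S.action.mul_act, mul_inv_cancel_left]
    exact hq
  -- the orbit map is the composition of the translation by `g` with the orbit map of the
  -- translated function, and the Maurer–Cartan form is the differential of the left translation by
  -- `g⁻¹`; the base point is kept as a variable `z`, as `g⁻¹ * g` is `1` only propositionally
  have key : ∀ z (hz : z = g⁻¹ * g), F.res (S.le_orbitSlice T hT h)
      (famDeriv 𝓘(ℝ, EG) _ (S.orbitFam T hT U f) g v) =
      F.res (show W ≤ slice (S.orbitOpens T hT (S.action.preimage g U)) z from fun y hy => by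
          subst hz; exact hmem (g, y) (h y hy))
        (famDeriv 𝓘(ℝ, EG) _ (S.orbitFam T hT (S.action.preimage g U) (S.action.pull g U f)) z
          (maurerCartan g v)) := by
    intro z hz
    subst hz
    have hd := HasFamDeriv.pb hs hφ hmem (hs.hasFamDeriv (g⁻¹ * g) (maurerCartan g v))
    have e : pbFam (fun z : G => g⁻¹ * z) hmem
        (S.orbitFam T hT (S.action.preimage g U) (S.action.pull g U f)) = S.orbitFam T hT U f := by
      funext z
      have hle : slice (S.orbitOpens T hT U) z ≤
        slice (S.orbitOpens T hT (S.action.preimage g U)) (g⁻¹ * z) := slice_le_slice hmem z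
      refine (S.res_orbitPull T hT _ hle _ _).trans ?_
      have : ∀ z', z' = g * (g⁻¹ * z) → ∀ h1,
        S.orbitPull T hT z' U (slice (S.orbitOpens T hT U) z) h1 f = S.orbitPull T hT (g⁻¹ * z)
          (S.action.preimage g U) (slice (S.orbitOpens T hT U) z) (fun y hy => hle hy)
            (S.action.pull g U f) := by
        intro z' h' h1
        subst h'
        exact S.orbitPull_mul T hT g _ _ _ f
      exact (this z (by simp) _).symm
    rw [e] at hd
    rw [hd.famDeriv_eq]
    exact F.sheaf.res_res _ _ _
  exact key 1 (by simp)

end HomogeneousGPDE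

/-! ### The infinitesimal action on the fibre -/

theorem Connection.cov_zero {EX X : Type*} [NormedAddCommGroup EX] [NormedSpace ℝ EX]
    [TopologicalSpace X] [ChartedSpace EX X] [IsManifold 𝓘(ℝ, EX) ∞ X] {E : GradedManifold.{v}}
    {π : GradedOver EX X E} (nabla : Connection π) (U : Opens E.carrier) (f : E.O U) :
    (nabla.cov 0).D U f = 0 := by
  have := nabla.cov_add 0 0 U f
  rwa [add_zero, left_eq_add] at this

theorem Connection.cov_neg {EX X : Type*} [NormedAddCommGroup EX] [NormedSpace ℝ EX]
    [TopologicalSpace X] [ChartedSpace EX X] [IsManifold 𝓘(ℝ, EX) ∞ X] {E : GradedManifold.{v}}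
    {π : GradedOver EX X E} (nabla : Connection π) (w : Vect EX X) (U : Opens E.carrier)
    (f : E.O U) : (nabla.cov (-w)).D U f = -(nabla.cov w).D U f := by
  have := nabla.cov_add w (-w) U f
  rw [add_neg_cancel, nabla.cov_zero] at this
  exact (neg_eq_of_add_eq_zero_right this.symm).symm

section HomogeneousSpace

variable {EG : Type w} {G : Type*} [NormedAddCommGroup EG] [NormedSpace ℝ EG]
  [FiniteDimensional ℝ EG] [TopologicalSpace G] [ChartedSpace EG G] [Group G]
  [LieGroup 𝓘(ℝ, EG) ∞ G]
  {EX : Type*} [NormedAddCommGroup EX] [NormedSpace ℝ EX] [FiniteDimensional ℝ EX]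
  {H : Subgroup G} [ChartedSpace EX (G ⧸ H)] [IsManifold 𝓘(ℝ, EX) ∞ (G ⧸ H)]

/-- Translations of the homogeneous space have injective differentials, since they are invertible.
-/
theorem mfderiv_smul_injective
    (hsub : Manifold.IsSubmersion 𝓘(ℝ, EG) 𝓘(ℝ, EX) ∞ (QuotientGroup.mk : G → G ⧸ H)) (g : G)
    (x : G ⧸ H) {a b : TangentSpace 𝓘(ℝ, EX) x}
    (h : mfderiv 𝓘(ℝ, EX) 𝓘(ℝ, EX) (fun z : G ⧸ H => g • z) x a =
      mfderiv 𝓘(ℝ, EX) 𝓘(ℝ, EX) (fun z : G ⧸ H => g • z) x b) : a = b := by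
  have hd := mfderiv_comp (I := 𝓘(ℝ, EX)) (I' := 𝓘(ℝ, EX)) (I'' := 𝓘(ℝ, EX))
    x (g := fun y : G ⧸ H => g⁻¹ • y) (f := fun y : G ⧸ H => g • y)
    ((contMDiff_smul_left hsub g⁻¹).mdifferentiableAt (by simp))
    ((contMDiff_smul_left hsub g).mdifferentiableAt (by simp))
  have hid : (fun y : G ⧸ H => g⁻¹ • y) ∘ (fun y : G ⧸ H => g • y) = id :=
    funext fun y => inv_smul_smul g y
  rw [hid, mfderiv_id] at hd
  have ha := congrArg (fun L => L a) hd
  have hb := congrArg (fun L => L b) hd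
  exact ha.trans ((congrArg (mfderiv 𝓘(ℝ, EX) 𝓘(ℝ, EX) (fun y : G ⧸ H => g⁻¹ • y) (g • x)) h).trans
    hb.symm)

namespace HomogeneousGPDE

open GradedManifold

variable {F : GradedManifold.{u}} {E : GradedManifold.{v}}
  (S : HomogeneousGPDE EG EX H F E) (T : LocalTriv F S.toGradedOver)
  (hT : (QuotientGroup.mk 1 : G ⧸ H) ∈ T.base)

include hT in
/-- The fibre coordinate of the trivialization provides a map from the body of `E` to that of `F`,
by translating points to the fibre over `[e]`. -/
theorem nonempty_fibreCoord : Nonempty (E.carrier → F.carrier) := by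
  refine ⟨fun b => ?_⟩
  let g : G := (S.proj b).out
  have hg : (QuotientGroup.mk g : G ⧸ H) = S.proj b := QuotientGroup.out_eq' _
  have hb : S.proj (S.action.act.toFun (g⁻¹, b)) = QuotientGroup.mk 1 := by
    rw [S.action.proj_act, ← hg]
    change QuotientGroup.mk (g⁻¹ * g) = _
    rw [inv_mul_cancel]
  exact (T.bijective (S.action.act.toFun (g⁻¹, b)) (hb ▸ hT)).choose

/-- Restriction of functions to the fibre over `[e]` is surjective. -/
theorem exists_fibrePull_eq (V : Opens F.carrier) :
    ∃ (U : Opens E.carrier) (h : ∀ y ∈ V, S.fibre T y ∈ U), ∀ k, ∀ f ∈ F.gr V k,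
      ∃ u ∈ E.gr U k, S.fibrePull T hT U V h u = f := by
  have := S.nonempty_fibreCoord T hT
  let U : Opens E.carrier := ⟨{b | S.proj b ∈ T.base ∧ T.snd b ∈ V},
    (T.continuousOn_fibreCoord).isOpen_inter_preimage
      (T.base.isOpen.preimage S.continuous_proj) V.isOpen⟩
  have hU : ∀ b ∈ U, S.proj b ∈ T.base ∧ T.snd b ∈ V := fun b hb => hb
  have h : ∀ y ∈ V, S.fibre T y ∈ U := fun y hy => by
    refine ⟨?_, ?_⟩
    · rw [S.proj_fibre T y hT]; exact hT
    · change T.snd (T.map.toFun (_, y)) ∈ V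
      rw [T.snd_map hT]; exact hy
  refine ⟨U, h, fun k f hf => ⟨T.extendMap U V hU f, T.extendMap_mem hU hf, ?_⟩⟩
  exact (T.pull_extendMap hU f _ V _).trans (F.sheaf.res_self _ _)

variable {S T hT}
variable {ρF : GroupLieAlgebra 𝓘(ℝ, EG) G → VField F 0}

/-- The defining property of the action on the fibre in terms of the orbit map. -/
theorem IsFibreAction.apply (hρ : S.IsFibreAction T hT ρF) (t : GroupLieAlgebra 𝓘(ℝ, EG) G)
    {U : Opens E.carrier} {W : Opens F.carrier} (h : ∀ y ∈ W, S.fibre T y ∈ U) {k : ℤ} {f : E.O U}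
    (hf : f ∈ E.gr U k) {w : Vect EX (G ⧸ H)}
    (hw : w (QuotientGroup.mk 1) =
      mfderiv 𝓘(ℝ, EG) 𝓘(ℝ, EX) (QuotientGroup.mk : G → G ⧸ H) 1 t) :
    (ρF t).D W (S.fibrePull T hT U W h f) =
      S.fibrePull T hT U W h ((S.nabla.cov w).D U f) -
      F.res (S.le_orbitSlice_one T hT h)
        (famDeriv 𝓘(ℝ, EG) _ (S.orbitFam T hT U f) 1 t) := by
  have hw' : (-w) (QuotientGroup.mk 1) =
      mfderiv 𝓘(ℝ, EG) 𝓘(ℝ, EX) (QuotientGroup.mk : G → G ⧸ H) 1 (-t) :=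
    ((congrArg Neg.neg hw).trans (map_neg _ _).symm)
  have hn : famDeriv 𝓘(ℝ, EG) _ (S.orbitFam T hT U f) 1 (-t) =
      -famDeriv 𝓘(ℝ, EG) _ (S.orbitFam T hT U f) 1 t := by
    have := ((S.orbitFam_smooth T hT hf).hasFamDeriv 1 t).smul_vec (-1)
    rw [neg_one_smul, neg_one_smul] at this
    exact this.famDeriv_eq
  rw [hρ t U W h k f hf (-w) hw', S.nabla.cov_neg, map_sub, map_neg,
    S.fibrePull_fundamental T hT t hf, hn, map_neg]
  abel

section Action

variable (hρ : S.IsFibreAction T hT ρF)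

/-- Additive operators on functions of the fibre agree if they agree on restrictions of functions
on the total space. -/
theorem eq_of_forall_fibrePull {V : Opens F.carrier} {A B : F.O V → F.O V}
    (hA : ∀ f g, A (f + g) = A f + A g) (hB : ∀ f g, B (f + g) = B f + B g)
    (h : ∀ (U : Opens E.carrier) (h : ∀ y ∈ V, S.fibre T y ∈ U) (k : ℤ), ∀ u ∈ E.gr U k,
      A (S.fibrePull T hT U V h u) = B (S.fibrePull T hT U V h u)) (f : F.O V) : A f = B f := by
  obtain ⟨U, hU, hs⟩ := S.exists_fibrePull_eq T hT V
  refine homogeneous_induction (P := fun f => A f = B f) f ?_ (fun f g hf hg => ?_)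
    fun k f hf => ?_
  · have hA0 := hA 0 0
    have hB0 := hB 0 0
    rw [add_zero, left_eq_add] at hA0 hB0
    rw [hA0, hB0]
  · rw [hA, hB, hf, hg]
  · obtain ⟨u, hu, rfl⟩ := hs k f hf
    exact h U hU k u hu

variable [T2Space (G ⧸ H)]

include hρ

/-- The vertical parts `ρF` are additive, although each `ρF s` is given separately: this holds for
the derivative along the orbits and for the connection, and both determine `ρF` on restrictions to
the fibre. -/
theorem IsFibreAction.add (s t : GroupLieAlgebra 𝓘(ℝ, EG) G) (V : Opens F.carrier) (f : F.O V) :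
    (ρF (s + t)).D V f = (ρF s).D V f + (ρF t).D V f := by
  refine eq_of_forall_fibrePull (S := S) (T := T) (hT := hT)
    (A := (ρF (s + t)).D V) (B := fun f => (ρF s).D V f + (ρF t).D V f)
    (fun f g => map_add _ _ _) (fun f g => ?_) (fun U h k u hu => ?_) f
  · simp only [map_add]; abel
  · obtain ⟨ws, hws⟩ := Vect.exists_apply_eq (EN := EX) (QuotientGroup.mk 1 : G ⧸ H)
      (mfderiv 𝓘(ℝ, EG) 𝓘(ℝ, EX) (QuotientGroup.mk : G → G ⧸ H) 1 s)
    obtain ⟨wt, hwt⟩ := Vect.exists_apply_eq (EN := EX) (QuotientGroup.mk 1 : G ⧸ H)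
      (mfderiv 𝓘(ℝ, EG) 𝓘(ℝ, EX) (QuotientGroup.mk : G → G ⧸ H) 1 t)
    have hst : (ws + wt) (QuotientGroup.mk 1) =
        mfderiv 𝓘(ℝ, EG) 𝓘(ℝ, EX) (QuotientGroup.mk : G → G ⧸ H) 1 (s + t) :=
      (congrArg₂ (· + ·) hws hwt).trans (map_add _ _ _).symm
    have hd := (((S.orbitFam_smooth T hT hu).hasFamDeriv 1 s).add_vec
      ((S.orbitFam_smooth T hT hu).hasFamDeriv 1 t)).famDeriv_eq
    rw [hρ.apply (s + t) h hu hst, hρ.apply s h hu hws, hρ.apply t h hu hwt, hd,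
      S.nabla.cov_add, map_add, map_add]
    abel

/-- The vertical parts `ρF` are homogeneous, for the same reason as they are additive. -/
theorem IsFibreAction.smul (c : ℝ) (t : GroupLieAlgebra 𝓘(ℝ, EG) G) (V : Opens F.carrier)
    (f : F.O V) : (ρF (c • t)).D V f = c • (ρF t).D V f := by
  refine eq_of_forall_fibrePull (S := S) (T := T) (hT := hT)
    (A := (ρF (c • t)).D V) (B := fun f => c • (ρF t).D V f)
    (fun f g => map_add _ _ _) (fun f g => ?_) (fun U h k u hu => ?_) f
  · simp only [map_add, smul_add]
  · obtain ⟨wt, hwt⟩ := Vect.exists_apply_eq (EN := EX) (QuotientGroup.mk 1 : G ⧸ H)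
      (mfderiv 𝓘(ℝ, EG) 𝓘(ℝ, EX) (QuotientGroup.mk : G → G ⧸ H) 1 t)
    have hct : (c • wt) (QuotientGroup.mk 1) =
        mfderiv 𝓘(ℝ, EG) 𝓘(ℝ, EX) (QuotientGroup.mk : G → G ⧸ H) 1 (c • t) :=
      (congrArg (c • ·) hwt).trans (map_smul _ _ _).symm
    have hd := (((S.orbitFam_smooth T hT hu).hasFamDeriv 1 t).smul_vec c).famDeriv_eq
    let cf : C^∞⟮𝓘(ℝ, EX), G ⧸ H; ℝ⟯ := ⟨fun _ => c, contMDiff_const⟩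
    have hc : cf = algebraMap ℝ C^∞⟮𝓘(ℝ, EX), G ⧸ H; ℝ⟯ c := by ext x; rfl
    have hfn : S.fn U cf = algebraMap ℝ _ c := by
      rw [hc]; unfold GradedOver.fn; rw [AlgHom.commutes, AlgHom.commutes]
    rw [hρ.apply (c • t) h hu hct, hρ.apply t h hu hwt, hd,
      S.nabla.cov_smul wt (c • wt) cf (fun x => rfl), hfn, ← Algebra.smul_def, map_smul, map_smul,
      smul_sub]

theorem IsFibreAction.sum {ι : Type*} (A : Finset ι) (c : ι → ℝ)
    (t : ι → GroupLieAlgebra 𝓘(ℝ, EG) G) (V : Opens F.carrier) (f : F.O V) :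
    (ρF (∑ i ∈ A, c i • t i)).D V f = ∑ i ∈ A, c i • (ρF (t i)).D V f := by
  classical
  induction A using Finset.induction_on with
  | empty =>
    have := hρ.smul 0 0 V f
    rw [zero_smul, zero_smul] at this
    simpa using this
  | insert a A ha ih => rw [Finset.sum_insert ha, Finset.sum_insert ha, hρ.add, hρ.smul, ih]

/-- The covariant derivative on `G × F` along a vector field that projects to `w`
computes the covariant derivative `∇_w` on `E`. -/
theorem IsFibreAction.orbitPull_cov
    (hsub : Manifold.IsSubmersion 𝓘(ℝ, EG) 𝓘(ℝ, EX) ∞ (QuotientGroup.mk : G → G ⧸ H)) {g : G}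
    {v : TangentSpace 𝓘(ℝ, EG) g} {w : Vect EX (G ⧸ H)}
    (hw : w (QuotientGroup.mk g) =
      mfderiv 𝓘(ℝ, EG) 𝓘(ℝ, EX) (QuotientGroup.mk : G → G ⧸ H) g v)
    {U : Opens E.carrier} {k : ℤ} {f : E.O U} (hf : f ∈ E.gr U k) {W : Opens F.carrier}
    (h : ∀ y ∈ W, S.orbit T (g, y) ∈ U) :
    S.orbitPull T hT g U W h ((S.nabla.cov w).D U f) =
      F.res (S.le_orbitSlice T hT h)
        (famDeriv 𝓘(ℝ, EG) _ (S.orbitFam T hT U f) g v) +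
      (ρF (maurerCartan g v)).D W (S.orbitPull T hT g U W h f) := by
  -- the translate of `w` by `g⁻¹`; invariance of the connection reduces the claim to the
  -- definition of `ρF` at the identity
  obtain ⟨w', hw'⟩ := exists_translate hsub g w
  have h1 : w' (QuotientGroup.mk 1) = mfderiv 𝓘(ℝ, EG) 𝓘(ℝ, EX)
      (QuotientGroup.mk : G → G ⧸ H) 1 (maurerCartan g v) := by
    refine mfderiv_smul_injective hsub g _ ?_
    have e1 := mfderiv_mk_leftInvariant hsub (maurerCartan g v) g
    rw [leftInvariant_maurerCartan] at e1
    refine (hw' (QuotientGroup.mk 1)).symm.trans (Eq.trans ?_ (hw.trans e1))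
    change w (QuotientGroup.mk (g * 1)) = _
    rw [mul_one]
  have h' : ∀ y ∈ W, S.fibre T y ∈ S.action.preimage g U := h
  have h2 := hρ.apply (maurerCartan g v) h' (S.action_pull_mem g hf) h1
  have h3 := S.famDeriv_orbitFam T hT g v hf h h'
  have h4 : S.orbitPull T hT g U W h ((S.nabla.cov w).D U f) =
      S.fibrePull T hT _ W h' ((S.nabla.cov w').D _ (S.action.pull g U f)) :=
    (congrArg (S.fibrePull T hT _ W h') (S.cov_pull g hw' hf)).symm
  rw [h3, h4]
  exact (sub_eq_iff_eq_add'.1 h2.symm)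

end Action

section FibreQ

variable {qF : VField F 1} (hq : S.IsFibreQ T hT qF)

include hq

theorem IsFibreQ.orbitPull_q (g : G) {U : Opens E.carrier} {k : ℤ} {f : E.O U} (hf : f ∈ E.gr U k)
    {W : Opens F.carrier} (h : ∀ y ∈ W, S.orbit T (g, y) ∈ U) :
    S.orbitPull T hT g U W h (S.q.D U f) = qF.D W (S.orbitPull T hT g U W h f) := by
  refine Eq.trans ?_ (hq (S.action.preimage g U) W h (S.action.pull g U f)).symm
  exact congrArg (S.fibrePull T hT _ W h) (S.q_pull g hf).symm

theorem IsFibreQ.sq_eq_zero (V : Opens F.carrier) (f : F.O V) : qF.D V (qF.D V f) = 0 := by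
  refine eq_of_forall_fibrePull (S := S) (T := T) (hT := hT)
    (A := fun f => qF.D V (qF.D V f)) (B := fun _ => 0)
    (fun f g => by simp) (fun f g => by simp) (fun U h k u hu => ?_) f
  rw [hq, hq, S.q_q_of_mem hu, map_zero]

/-- The vertical parts `ρF` commute with `q_F`, because both the action and the connection commute
with `q`. -/
theorem IsFibreQ.commute [T2Space (G ⧸ H)] (hρ : S.IsFibreAction T hT ρF)
    (t : GroupLieAlgebra 𝓘(ℝ, EG) G) (V : Opens F.carrier) (f : F.O V) :
    (ρF t).D V (qF.D V f) = qF.D V ((ρF t).D V f) := by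
  refine eq_of_forall_fibrePull (S := S) (T := T) (hT := hT)
    (A := fun f => (ρF t).D V (qF.D V f)) (B := fun f => qF.D V ((ρF t).D V f))
    (fun f g => by simp) (fun f g => by simp) (fun U h k u hu => ?_) f
  obtain ⟨w, hw⟩ := Vect.exists_apply_eq (EN := EX) (QuotientGroup.mk 1 : G ⧸ H)
    (mfderiv 𝓘(ℝ, EG) 𝓘(ℝ, EX) (QuotientGroup.mk : G → G ⧸ H) 1 t)
  rw [hq, hρ.apply t h (S.q.D_mem _ _ _ hu) hw, hρ.apply t h hu hw, map_sub, hq, S.cov_q w hu,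
    qF.D_res]
  have e : S.orbitFam T hT U (S.q.D U u) =
      fun g => qF.D _ (S.orbitFam T hT U u g) := by
    funext g
    exact hq.orbitPull_q g hu _
  have hd := qF.hasFamDeriv (S.orbitFam_smooth T hT hu)
    ((S.orbitFam_smooth T hT hu).hasFamDeriv 1 t)
  rw [e, hd.famDeriv_eq]

end FibreQ

end HomogeneousGPDE

end HomogeneousSpace

/-! ### The flat covariant derivative on `G × F` -/

namespace CovModule

variable {EN N : Type*} [NormedAddCommGroup EN] [NormedSpace ℝ EN] [FiniteDimensional ℝ EN]
  [TopologicalSpace N] [ChartedSpace EN N] [IsManifold 𝓘(ℝ, EN) ∞ N] {R : Type*} [AddCommGroup R]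
  (c : CovModule (EN := EN) N R) {d : ℤ}

/-- The curvature of the covariant derivative. -/
def curv (v w : Vect EN N) (r : R) : R := c.D v (c.D w r) - c.D w (c.D v r) - c.D (Vect.bracket v w) r

theorem D_zero_vec {r : R} (hr : r ∈ c.K d) : c.D 0 r = 0 := by
  have := c.D_add_vec 0 0 d r hr
  rwa [add_zero, left_eq_add] at this

theorem D_neg_vec (v : Vect EN N) {r : R} (hr : r ∈ c.K d) : c.D (-v) r = -c.D v r := by
  have := c.D_add_vec v (-v) d r hr
  rw [add_neg_cancel, c.D_zero_vec hr] at this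
  exact (neg_eq_of_add_eq_zero_right this.symm).symm

variable {c}

theorem curv_swap (v w : Vect EN N) {r : R} (hr : r ∈ c.K d) : c.curv v w r = -c.curv w v r := by
  unfold curv
  rw [Vect.bracket_swap v w, c.D_neg_vec _ hr]
  abel

theorem curv_add_right (v w w' : Vect EN N) {r : R} (hr : r ∈ c.K d) :
    c.curv v (w + w') r = c.curv v w r + c.curv v w' r := by
  unfold curv
  rw [c.D_add_vec w w' d r hr, c.D_add v d _ (c.D_mem w d r hr) _ (c.D_mem w' d r hr),
    c.D_add_vec w w' d _ (c.D_mem v d r hr), Vect.bracket_add_right, c.D_add_vec _ _ d r hr]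
  abel

theorem curv_fsmul_right (v w : Vect EN N) (f : C^∞⟮𝓘(ℝ, EN), N; ℝ⟯) {r : R} (hr : r ∈ c.K d) :
    c.curv v (Vect.fsmul f w) r = c.sm f (c.curv v w r) := by
  unfold curv
  rw [c.D_fsmul f w d r hr, c.D_sm v f d _ (c.D_mem w d r hr),
    c.D_fsmul f w d _ (c.D_mem v d r hr), Vect.bracket_fsmul_right, c.D_add_vec _ _ d r hr,
    c.D_fsmul _ w d r hr, c.D_fsmul _ _ d r hr, c.sm_sub, c.sm_sub]
  abel

theorem curv_sum_right {ι : Type*} (A : Finset ι) (v : Vect EN N) (f : ι → C^∞⟮𝓘(ℝ, EN), N; ℝ⟯)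
    (e : ι → Vect EN N) {r : R} (hr : r ∈ c.K d) :
    c.curv v (∑ i ∈ A, Vect.fsmul (f i) (e i)) r = ∑ i ∈ A, c.sm (f i) (c.curv v (e i) r) := by
  classical
  induction A using Finset.induction_on with
  | empty =>
    have := curv_add_right v 0 0 hr
    rwa [add_zero, left_eq_add] at this
  | insert a A ha ih =>
    rw [Finset.sum_insert ha, Finset.sum_insert ha, curv_add_right _ _ _ hr,
      curv_fsmul_right _ _ _ hr, ih]

/-- The curvature is a tensor: it is determined by its components with respect to a frame. -/
theorem curv_sum {ι : Type*} [Fintype ι] (f h : ι → C^∞⟮𝓘(ℝ, EN), N; ℝ⟯)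
    (e : ι → Vect EN N) {r : R} (hr : r ∈ c.K d) :
    c.curv (∑ i, Vect.fsmul (f i) (e i)) (∑ i, Vect.fsmul (h i) (e i)) r =
      ∑ j, c.sm (h j) (∑ i, c.sm (f i) (c.curv (e i) (e j) r)) := by
  rw [curv_sum_right _ _ _ _ hr]
  refine Finset.sum_congr rfl fun j _ => congrArg _ ?_
  rw [curv_swap _ _ hr, curv_sum_right _ _ _ _ hr, ← Finset.sum_neg_distrib]
  refine Finset.sum_congr rfl fun i _ => ?_
  rw [curv_swap (e i) (e j) hr, c.sm_neg]

theorem isFlat_of_curv (h : ∀ v w d, ∀ r ∈ c.K d, c.curv v w r = 0) : c.IsFlat :=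
  fun v w d r hr => sub_eq_zero.1 (h v w d r hr)

end CovModule

namespace GradedManifold

variable {M : GradedManifold.{u}} {EN N : Type*} [NormedAddCommGroup EN] [NormedSpace ℝ EN]
  [FiniteDimensional ℝ EN] [TopologicalSpace N] [ChartedSpace EN N] [IsManifold 𝓘(ℝ, EN) ∞ N]
  {k : ℤ}

/-- The commutator of the derivatives of a family along two vector fields of the parameter space is
the derivative along their bracket, coefficient by coefficient. -/
theorem IsSmoothFam.famDeriv_bracket {W : Opens (N × M.carrier)} {s : M.Fam W}
    (hs : IsSmoothFam 𝓘(ℝ, EN) W k s) (v w : Vect EN N) (n : N) :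
    GradedManifold.famDeriv 𝓘(ℝ, EN) W
        (fun n => GradedManifold.famDeriv 𝓘(ℝ, EN) W s n (w n)) n (v n) -
      GradedManifold.famDeriv 𝓘(ℝ, EN) W
        (fun n => GradedManifold.famDeriv 𝓘(ℝ, EN) W s n (v n)) n (w n) =
      GradedManifold.famDeriv 𝓘(ℝ, EN) W s n (Vect.bracket v w n) := by
  refine HasFamDeriv.unique (I := 𝓘(ℝ, EN)) (v := Vect.bracket v w n) (s := s) (fun c hc p hp hpc m => ?_)
    (hs.hasFamDeriv n _)
  have hΩ : IsOpen {n' : N | (n', p) ∈ W} := W.isOpen.preimage (by fun_prop)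
  have hφ : ContMDiffOn 𝓘(ℝ, EN) 𝓘(ℝ, ℝ) ∞ (fun n' => c.cf (slice W n') (s n') m p)
      {n' | (n', p) ∈ W} := fun n' hn' => (hs.contMDiffAt hc hn' hpc m).contMDiffWithinAt
  have hb := dirD_bracket hΩ hφ v w hp
  have hstep : ∀ a b : Vect EN N,
      c.cf (slice W n) (GradedManifold.famDeriv 𝓘(ℝ, EN) W
        (fun n => GradedManifold.famDeriv 𝓘(ℝ, EN) W s n (b n)) n (a n)) m p =
      dirD 𝓘(ℝ, EN) (fun y => dirD 𝓘(ℝ, EN) (fun n' => c.cf (slice W n') (s n') m p) y (b y)) n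
        (a n) := by
    intro a b
    rw [(IsSmoothFam.famDeriv hs b.contMDiff).hasFamDeriv n (a n) c hc p hp hpc m]
    refine dirD_congr (I := 𝓘(ℝ, EN)) (n := n) (Y := ℝ) ?_ (a n)
    filter_upwards [hΩ.mem_nhds hp] with y hy
    exact hs.hasFamDeriv y (b y) c hc p hy hpc m
  rw [c.cf_sub, hstep, hstep]
  exact hb.symm

end GradedManifold

namespace HomogeneousGPDE

open GradedManifold

variable {EG : Type w} {G : Type*} [NormedAddCommGroup EG] [NormedSpace ℝ EG]
  [FiniteDimensional ℝ EG] [TopologicalSpace G] [ChartedSpace EG G] [Group G]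
  [LieGroup 𝓘(ℝ, EG) ∞ G]
  {EX : Type*} [NormedAddCommGroup EX] [NormedSpace ℝ EX] [FiniteDimensional ℝ EX]
  {H : Subgroup G} [ChartedSpace EX (G ⧸ H)] [IsManifold 𝓘(ℝ, EX) ∞ (G ⧸ H)]
  {F : GradedManifold.{u}} {E : GradedManifold.{v}}
  {S : HomogeneousGPDE EG EX H F E} {T : LocalTriv F S.toGradedOver}
  {hT : (QuotientGroup.mk 1 : G ⧸ H) ∈ T.base}
  {ρF : GroupLieAlgebra 𝓘(ℝ, EG) G → VField F 0} [T2Space (G ⧸ H)]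

/-- The covariant derivative along `v` of functions on `G × F`, for the connection on the trivial
bundle `G × F → G` whose connection form is the Maurer–Cartan form acting by `ρF`. -/
def covDeriv (ρF : GroupLieAlgebra 𝓘(ℝ, EG) G → VField F 0) (W : Opens (G × F.carrier))
    (v : Vect EG G) (s : F.Fam W) : F.Fam W :=
  fun g => famDeriv 𝓘(ℝ, EG) W s g (v g) + (ρF (maurerCartan g (v g))).D (slice W g) (s g)

variable (hρ : S.IsFibreAction T hT ρF)

include hρ

/-- The action of the Maurer–Cartan form preserves smoothness: in the frame of left-invariant
vector fields, the components of a vector field are smooth functions. -/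
theorem IsFibreAction.smoothFam_action {W : Opens (G × F.carrier)} {k : ℤ} {s : F.Fam W}
    (hs : IsSmoothFam 𝓘(ℝ, EG) W k s) (v : Vect EG G) : IsSmoothFam 𝓘(ℝ, EG) W k
      fun g => (ρF (maurerCartan g (v g))).D (slice W g) (s g) := by
  obtain ⟨f, hf, -⟩ := exists_eq_sum_leftInvariant v
  have h : (fun g => (ρF (maurerCartan g (v g))).D (slice W g) (s g)) =
      ∑ i, fun g => f i g • (ρF (Module.finBasis ℝ EG i : EG)).D (slice W g) (s g) := by
    funext g
    rw [hf g, Finset.sum_apply]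
    exact hρ.sum _ _ _ _ _
  rw [h]
  refine IsSmoothFam.sum _ fun i _ => ?_
  have h1 := (ρF (Module.finBasis ℝ EG i : EG)).smoothFam hs
  rw [add_zero] at h1
  exact h1.smul isOpen_univ (f i).contMDiff.contMDiffOn fun _ _ => trivial

theorem IsFibreAction.covDeriv_mem {W : Opens (G × F.carrier)} {k : ℤ} {s : F.Fam W}
    (hs : IsSmoothFam 𝓘(ℝ, EG) W k s) (v : Vect EG G) :
    IsSmoothFam 𝓘(ℝ, EG) W k (covDeriv ρF W v s) :=
  (hs.famDeriv v.contMDiff).add (hρ.smoothFam_action hs v)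

/-- The functions on an open set of `G × F` as a module with covariant derivative. -/
def IsFibreAction.covModule (W : Opens (G × F.carrier)) : CovModule (EN := EG) G (F.Fam W) where
  K k := {
    carrier := {s | IsSmoothFam 𝓘(ℝ, EG) W k s}
    add_mem' := fun ha hb => IsSmoothFam.add ha hb
    zero_mem' := IsSmoothFam.zero k W
    neg_mem' := fun ha => IsSmoothFam.neg ha }
  sm f s := fun g => f g • s g
  D := covDeriv ρF W
  sm_mem f d r hr := IsSmoothFam.smul hr isOpen_univ f.contMDiff.contMDiffOn fun _ _ => trivial
  sm_add f r r' := funext fun g => smul_add _ _ _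
  D_mem v d r hr := hρ.covDeriv_mem hr v
  D_add v d r hr r' hr' := by
    funext g
    have h := (HasFamDeriv.add hr hr' (hr.hasFamDeriv g (v g)) (hr'.hasFamDeriv g (v g))).famDeriv_eq
    refine (congrArg₂ (· + ·) h (map_add ((ρF (maurerCartan g (v g))).D (slice W g)) (r g)
      (r' g))).trans ?_
    exact add_add_add_comm _ _ _ _
  D_add_vec v w d r hr := by
    funext g
    have h := ((hr.hasFamDeriv g (v g)).add_vec (hr.hasFamDeriv g (w g))).famDeriv_eq
    have h2 := hρ.add (maurerCartan g (v g)) (maurerCartan g (w g)) (slice W g) (r g)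
    rw [← maurerCartan_add] at h2
    refine (congrArg₂ (· + ·) h h2).trans ?_
    exact add_add_add_comm _ _ _ _
  D_fsmul f v d r hr := by
    funext g
    have h := ((hr.hasFamDeriv g (v g)).smul_vec (f g)).famDeriv_eq
    have h2 := hρ.smul (f g) (maurerCartan g (v g)) (slice W g) (r g)
    rw [← maurerCartan_smul] at h2
    exact (congrArg₂ (· + ·) h h2).trans (smul_add _ _ _).symm
  D_sm v f d r hr := by
    funext g
    have h := (HasFamDeriv.smul hr (f.contMDiff.mdifferentiableAt (by simp))
      (hr.hasFamDeriv g (v g))).famDeriv_eq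
    refine (congrArg₂ (· + ·) h (map_smul ((ρF (maurerCartan g (v g))).D (slice W g)) (f g)
      (r g))).trans ?_
    refine (add_assoc _ _ _).trans ?_
    exact congrArg _ (smul_add _ _ _).symm

/-- Functions pulled back from `E` are differentiated by the connection of `E`. -/
theorem IsFibreAction.covDeriv_orbitFam
    (hsub : Manifold.IsSubmersion 𝓘(ℝ, EG) 𝓘(ℝ, EX) ∞ (QuotientGroup.mk : G → G ⧸ H))
    {v : Vect EG G} {w : Vect EX (G ⧸ H)}
    (hw : ∀ g, w (QuotientGroup.mk g) =
      mfderiv 𝓘(ℝ, EG) 𝓘(ℝ, EX) (QuotientGroup.mk : G → G ⧸ H) g (v g))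
    {U : Opens E.carrier} {k : ℤ} {f : E.O U} (hf : f ∈ E.gr U k) :
    covDeriv ρF (S.orbitOpens T hT U) v (S.orbitFam T hT U f) =
      S.orbitFam T hT U ((S.nabla.cov w).D U f) := by
  funext g
  refine Eq.trans ?_ (hρ.orbitPull_cov hsub (hw g) hf _).symm
  refine congrArg₂ (· + ·) (F.sheaf.res_self _ _).symm rfl

theorem IsFibreAction.covDeriv_leftInvariant (t : GroupLieAlgebra 𝓘(ℝ, EG) G)
    {W : Opens (G × F.carrier)} (s : F.Fam W) (g : G) :
    covDeriv ρF W (leftInvariant t) s g =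
      famDeriv 𝓘(ℝ, EG) W s g (leftInvariant t g) + (ρF t).D (slice W g) (s g) := by
  unfold covDeriv
  rw [maurerCartan_leftInvariant]

/-- On left-invariant vector fields the curvature is the failure of `ρF` to be a
representation. -/
theorem IsFibreAction.curv_leftInvariant {s t r : GroupLieAlgebra 𝓘(ℝ, EG) G}
    (hr : Vect.bracket (leftInvariant s) (leftInvariant t) = leftInvariant r)
    {W : Opens (G × F.carrier)} {k : ℤ} {α : F.Fam W} (hα : IsSmoothFam 𝓘(ℝ, EG) W k α) (g : G) :
    (hρ.covModule W).curv (leftInvariant s) (leftInvariant t) α g =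
      (ρF s).D _ ((ρF t).D _ (α g)) - (ρF t).D _ ((ρF s).D _ (α g)) - (ρF r).D _ (α g) := by
  have hstep : ∀ a b : GroupLieAlgebra 𝓘(ℝ, EG) G,
      covDeriv ρF W (leftInvariant a) (covDeriv ρF W (leftInvariant b) α) g =
      famDeriv 𝓘(ℝ, EG) W (fun g => famDeriv 𝓘(ℝ, EG) W α g (leftInvariant b g)) g
        (leftInvariant a g) + (ρF b).D _ (famDeriv 𝓘(ℝ, EG) W α g (leftInvariant a g)) +
      ((ρF a).D _ (famDeriv 𝓘(ℝ, EG) W α g (leftInvariant b g)) +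
        (ρF a).D _ ((ρF b).D _ (α g))) := by
    intro a b
    have h1 := hα.famDeriv (leftInvariant b).contMDiff
    have h2 := (ρF b).smoothFam hα
    have hd := (HasFamDeriv.add h1 h2 (h1.hasFamDeriv g (leftInvariant a g))
      ((ρF b).hasFamDeriv hα (hα.hasFamDeriv g (leftInvariant a g)))).famDeriv_eq
    have e : covDeriv ρF W (leftInvariant b) α =
      (fun g => famDeriv 𝓘(ℝ, EG) W α g (leftInvariant b g)) +
        fun g => (ρF b).D (slice W g) (α g) :=
      funext fun g => hρ.covDeriv_leftInvariant b α g
    rw [hρ.covDeriv_leftInvariant, e, hd]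
    exact congrArg _ (map_add _ _ _)
  have hb := hα.famDeriv_bracket (leftInvariant s) (leftInvariant t) g
  rw [hr] at hb
  change covDeriv ρF W (leftInvariant s) (covDeriv ρF W (leftInvariant t) α) g -
    covDeriv ρF W (leftInvariant t) (covDeriv ρF W (leftInvariant s) α) g -
    covDeriv ρF W (Vect.bracket (leftInvariant s) (leftInvariant t)) α g = _
  rw [hr, hstep, hstep, hρ.covDeriv_leftInvariant, ← hb]
  abel

/-- The vector fields `ρF` represent the Lie algebra of left-invariant vector fields. This
expresses, in the fibre over `[e]`, that the connection of `E` is flat. -/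
theorem IsFibreAction.lie
    (hsub : Manifold.IsSubmersion 𝓘(ℝ, EG) 𝓘(ℝ, EX) ∞ (QuotientGroup.mk : G → G ⧸ H))
    (i j : Fin (Module.finrank ℝ EG)) {r : GroupLieAlgebra 𝓘(ℝ, EG) G}
    (hr : Vect.bracket (leftInvariant (G := G) (Module.finBasis ℝ EG i : EG))
      (leftInvariant (Module.finBasis ℝ EG j : EG)) = leftInvariant r)
    (V : Opens F.carrier) (f : F.O V) :
    (ρF (Module.finBasis ℝ EG i : EG)).D V ((ρF (Module.finBasis ℝ EG j : EG)).D V f) -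
      (ρF (Module.finBasis ℝ EG j : EG)).D V ((ρF (Module.finBasis ℝ EG i : EG)).D V f) -
        (ρF r).D V f = 0 := by
  let b : Fin (Module.finrank ℝ EG) → GroupLieAlgebra 𝓘(ℝ, EG) G := Module.finBasis ℝ EG
  refine eq_of_forall_fibrePull (S := S) (T := T) (hT := hT)
    (A := fun f => (ρF (b i)).D V ((ρF (b j)).D V f) - (ρF (b j)).D V ((ρF (b i)).D V f) -
        (ρF r).D V f) (B := fun _ => 0)
    (fun f g => by simp only [map_add]; abel) (fun f g => by simp) (fun U h k u hu => ?_) f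
  -- Lifts of vector fields of `G ⧸ H` whose values at `1` are basis vectors, and their components.
  have hlift : ∀ i, ∃ (w : Vect EX (G ⧸ H)) (v : Vect EG G)
      (a : Fin (Module.finrank ℝ EG) → C^∞⟮𝓘(ℝ, EG), G; ℝ⟯),
      (∀ g, w (QuotientGroup.mk g) =
        mfderiv 𝓘(ℝ, EG) 𝓘(ℝ, EX) (QuotientGroup.mk : G → G ⧸ H) g (v g)) ∧
      (∀ m, a m 1 = if m = i then 1 else 0) ∧
      v = ∑ m, Vect.fsmul (a m) (leftInvariant (b m)) := by
    intro i
    obtain ⟨w, hw⟩ := Vect.exists_apply_eq (EN := EX) (QuotientGroup.mk 1 : G ⧸ H)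
      (mfderiv 𝓘(ℝ, EG) 𝓘(ℝ, EX) (QuotientGroup.mk : G → G ⧸ H) 1 (leftInvariant (b i) 1))
    obtain ⟨v, hv1, hv⟩ := exists_lift_apply_eq hsub w 1 _ hw
    obtain ⟨a, ha, hsum⟩ := exists_eq_sum_leftInvariant v
    refine ⟨w, v, a, hv, fun m => ?_, hsum⟩
    have h1 := ha 1
    rw [hv1, maurerCartan_leftInvariant] at h1
    have h2 := congrArg (fun z : EG => (Module.finBasis ℝ EG).repr z m) h1
    simpa [b, Finsupp.single_apply, eq_comm] using h2.symm
  obtain ⟨w, v, a, hw, ha, hv⟩ := hlift i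
  obtain ⟨w', v', a', hw', ha', hv'⟩ := hlift j
  have hΦ := S.orbitFam_smooth T hT hu
  let c := hρ.covModule (S.orbitOpens T hT U)
  have h0 : c.curv v v' (S.orbitFam T hT U u) = 0 := by
    change covDeriv ρF _ v (covDeriv ρF _ v' _) - covDeriv ρF _ v' (covDeriv ρF _ v _) -
      covDeriv ρF _ (Vect.bracket v v') _ = 0
    have hu1 : ∀ w : Vect EX (G ⧸ H), (S.nabla.cov w).D U u ∈ E.gr U k := fun w => by
      have := (S.nabla.cov w).D_mem U k u hu
      rwa [add_zero] at this
    rw [hρ.covDeriv_orbitFam hsub hw' hu, hρ.covDeriv_orbitFam hsub hw hu,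
      hρ.covDeriv_orbitFam hsub hw (hu1 _), hρ.covDeriv_orbitFam hsub hw' (hu1 _),
      hρ.covDeriv_orbitFam hsub (bracket_related (contMDiff_mk hsub) hw hw') hu,
      ← S.cov_cov w w' hu]
    funext g
    refine sub_eq_zero.2 ?_
    exact (map_sub _ _ _).symm
  -- the curvature is bilinear over functions, and at `1` only the term of the two basis vectors
  -- remains
  rw [hv, hv', CovModule.curv_sum a a' _ hΦ] at h0
  have h1 := congrFun h0 1
  rw [Finset.sum_apply] at h1
  have h2 : ∀ m, (c.sm (a' m) (∑ i, c.sm (a i) (c.curv (leftInvariant (b i))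
      (leftInvariant (b m)) (S.orbitFam T hT U u)))) 1 =
      (if m = j then (1 : ℝ) else 0) • ∑ i', (if i' = i then (1 : ℝ) else 0) •
        c.curv (leftInvariant (b i')) (leftInvariant (b m)) (S.orbitFam T hT U u) 1 := by
    intro m
    rw [← ha' m]
    refine congrArg _ ?_
    rw [Finset.sum_apply]
    refine Finset.sum_congr rfl fun i' _ => ?_
    rw [← ha i']
    rfl
  rw [Finset.sum_congr rfl fun m _ => h2 m] at h1
  simp only [ite_smul, one_smul, zero_smul, Finset.sum_ite_eq', Finset.mem_univ, if_true] at h1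
  rw [hρ.curv_leftInvariant hr hΦ] at h1
  have h3 : F.res (S.le_orbitSlice_one T hT h) (S.orbitFam T hT U u 1) =
      S.fibrePull T hT U V h u :=
    (congrArg _ (S.orbitPull_one T hT _ u)).trans (T.map.res_pull _ _ _ _ _ _ _)
  have h4 : ∀ (s t r : GroupLieAlgebra 𝓘(ℝ, EG) G) (z : F.O (slice (S.orbitOpens T hT U) 1)),
      (ρF s).D V ((ρF t).D V (F.res (S.le_orbitSlice_one T hT h) z)) -
        (ρF t).D V ((ρF s).D V (F.res (S.le_orbitSlice_one T hT h) z)) -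
        (ρF r).D V (F.res (S.le_orbitSlice_one T hT h) z) =
      F.res (S.le_orbitSlice_one T hT h) ((ρF s).D _ ((ρF t).D _ z) -
        (ρF t).D _ ((ρF s).D _ z) - (ρF r).D _ z) := by
    intro s t r z
    simp only [map_sub, (ρF _).D_res]
  rw [← h3]
  exact (h4 _ _ _ _).trans ((congrArg _ h1).trans (map_zero _))

/-- The covariant derivative on `G × F` is flat. The curvature is tensorial, hence it is enough to
take left-invariant vector fields, where flatness is the commutation relation of the `ρF`. -/
theorem IsFibreAction.isFlat
    (hsub : Manifold.IsSubmersion 𝓘(ℝ, EG) 𝓘(ℝ, EX) ∞ (QuotientGroup.mk : G → G ⧸ H))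
    (W : Opens (G × F.carrier)) : (hρ.covModule W).IsFlat := by
  refine CovModule.isFlat_of_curv fun v v' d r hr => ?_
  obtain ⟨a, -, hv⟩ := exists_eq_sum_leftInvariant v
  obtain ⟨a', -, hv'⟩ := exists_eq_sum_leftInvariant v'
  rw [hv, hv', CovModule.curv_sum a a' _ hr]
  refine Finset.sum_eq_zero fun j _ => ?_
  rw [Finset.sum_eq_zero fun i _ => ?_, CovModule.sm_zero]
  have h0 : (hρ.covModule W).curv (leftInvariant (Module.finBasis ℝ EG i : EG))
      (leftInvariant (Module.finBasis ℝ EG j : EG)) r = 0 := by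
    obtain ⟨t, ht⟩ := bracket_leftInvariant (G := G) (Module.finBasis ℝ EG i : EG)
      (Module.finBasis ℝ EG j : EG)
    funext g
    rw [hρ.curv_leftInvariant ht hr]
    exact hρ.lie hsub i j ht _ _
  rw [h0, CovModule.sm_zero]

end HomogeneousGPDE

/-! ### The vector field `Q` on `T[1]G × F` -/

namespace HomogeneousGPDE

open GradedManifold

variable {EG : Type w} {G : Type*} [NormedAddCommGroup EG] [NormedSpace ℝ EG]
  [FiniteDimensional ℝ EG] [TopologicalSpace G] [ChartedSpace EG G] [Group G]
  [LieGroup 𝓘(ℝ, EG) ∞ G]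
  {EX : Type*} [NormedAddCommGroup EX] [NormedSpace ℝ EX] [FiniteDimensional ℝ EX]
  {H : Subgroup G} [ChartedSpace EX (G ⧸ H)] [IsManifold 𝓘(ℝ, EX) ∞ (G ⧸ H)]
  {F : GradedManifold.{u}} {E : GradedManifold.{v}}
  {S : HomogeneousGPDE EG EX H F E} {T : LocalTriv F S.toGradedOver}
  {hT : (QuotientGroup.mk 1 : G ⧸ H) ∈ T.base}
  {ρF : GroupLieAlgebra 𝓘(ℝ, EG) G → VField F 0} [T2Space (G ⧸ H)]

theorem IsFibreAction.isForm_iff (hρ : S.IsFibreAction T hT ρF) {W : Opens (G × F.carrier)} {d : ℤ}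
    {β : PreForm (Vect EG G) (F.Fam W)} : (hρ.covModule W).IsForm d β ↔ IsProdForm W d β := by
  constructor
  · intro h
    refine ⟨fun p => (h p).mem, fun p => (h p).add, fun p v i w w' f hw g => ?_, fun p => (h p).alt⟩
    rw [Vect.eq_fsmul hw]
    exact congrFun ((h p).fsmul v i w f) g
  · intro h p
    exact ⟨h.1 p, h.2.1 p, fun v i w f => funext fun g => h.2.2.1 p v i w _ f (fun x => rfl) g,
      h.2.2.2 p⟩

/-- The operator `qF` on functions on `G × F`. -/
def fibrewiseHom (qF : VField F 1) (W : Opens (G × F.carrier)) : F.Fam W →+ F.Fam W where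
  toFun := fibrewise qF.D W
  map_zero' := funext fun g => map_zero (qF.D (slice W g))
  map_add' s t := funext fun g => map_add (qF.D (slice W g)) (s g) (t g)

/-- The vector field `Q` is the exterior covariant derivative of `covDeriv` plus the extension of
`q_F`. -/
theorem prodQ_eq (qF : VField F 1) {W : Opens (G × F.carrier)} (β : PreForm (Vect EG G) (F.Fam W)) :
    prodQ ρF qF W β = PreForm.extDer Vect.bracket (covDeriv ρF W) β +
      PreForm.oddExt (fibrewiseHom qF W) β := by
  have h : PreForm.altSum (covDeriv ρF W) β = PreForm.altSum (dirDeriv W) β +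
      mcAction ρF W β := by
    funext p v
    cases p with
    | zero => exact (add_zero (0 : F.Fam W)).symm
    | succ n =>
      refine Eq.trans ?_ Finset.sum_add_distrib
      exact Finset.sum_congr rfl fun i _ => smul_add _ _ _
  unfold prodQ PreForm.extDer
  rw [h]
  change dG W β + mcAction ρF W β + _ = _
  unfold dG PreForm.extDer
  rw [add_right_comm (PreForm.altSum (dirDeriv W) β)]
  rfl

variable {qF : VField F 1} (hρ : S.IsFibreAction T hT ρF)

theorem fibrewiseHom_mem (W : Opens (G × F.carrier)) (d : ℤ) (r : F.Fam W)
    (hr : r ∈ (hρ.covModule W).K d) : fibrewiseHom qF W r ∈ (hρ.covModule W).K (d + 1) :=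
  qF.smoothFam hr

theorem fibrewiseHom_sm (W : Opens (G × F.carrier)) (f : C^∞⟮𝓘(ℝ, EG), G; ℝ⟯) (r : F.Fam W) :
    fibrewiseHom qF W ((hρ.covModule W).sm f r) = (hρ.covModule W).sm f (fibrewiseHom qF W r) :=
  funext fun g => map_smul (qF.D (slice W g)) (f g) (r g)

theorem IsFibreQ.fibrewiseHom_D (hq : S.IsFibreQ T hT qF) (W : Opens (G × F.carrier)) (v : Vect EG G) (d : ℤ) (r : F.Fam W)
    (hr : r ∈ (hρ.covModule W).K d) :
    fibrewiseHom qF W ((hρ.covModule W).D v r) = (hρ.covModule W).D v (fibrewiseHom qF W r) := by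
  funext g
  have h := (qF.hasFamDeriv hr (IsSmoothFam.hasFamDeriv hr g (v g))).famDeriv_eq
  refine (map_add (qF.D (slice W g)) _ _).trans ?_
  exact congrArg₂ (· + ·) h.symm (hq.commute hρ (maurerCartan g (v g)) _ (r g)).symm

theorem IsFibreAction.isProdForm_prodQ (hρ : S.IsFibreAction T hT ρF) (qF : VField F 1)
    {W : Opens (G × F.carrier)} {d : ℤ} {β : PreForm (Vect EG G) (F.Fam W)}
    (hβ : IsProdForm W d β) : IsProdForm W (d + 1) (prodQ ρF qF W β) := by
  rw [← hρ.isForm_iff, prodQ_eq]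
  exact CovModule.IsForm.extDer_add_oddExt (fibrewiseHom_mem hρ W) (fibrewiseHom_sm hρ W)
    (hρ.isForm_iff.2 hβ)

theorem IsFibreQ.prodQ_prodQ (hq : S.IsFibreQ T hT qF) (hρ : S.IsFibreAction T hT ρF)
    (hsub : Manifold.IsSubmersion 𝓘(ℝ, EG) 𝓘(ℝ, EX) ∞ (QuotientGroup.mk : G → G ⧸ H))
    {W : Opens (G × F.carrier)} {d : ℤ} {β : PreForm (Vect EG G) (F.Fam W)}
    (hβ : IsProdForm W d β) : prodQ ρF qF W (prodQ ρF qF W β) = 0 := by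
  rw [prodQ_eq, prodQ_eq]
  have h2 : ∀ d, ∀ r ∈ (hρ.covModule W).K d, fibrewiseHom qF W (fibrewiseHom qF W r) = 0 :=
    fun d r _ => funext fun g => hq.sq_eq_zero _ (r g)
  have h := CovModule.extDer_add_oddExt_sq (c := hρ.covModule W) (q := fibrewiseHom qF W)
    (fibrewiseHom_mem hρ W) (fibrewiseHom_sm hρ W)
    (hq.fibrewiseHom_D hρ W) (hρ.isFlat hsub W) h2 (hρ.isForm_iff.2 hβ)
  exact h

end HomogeneousGPDE

/-! ### The orbit map is a quotient map -/

namespace HomogeneousGPDE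

open GradedManifold

variable {EG : Type w} {G : Type*} [NormedAddCommGroup EG] [NormedSpace ℝ EG]
  [FiniteDimensional ℝ EG] [TopologicalSpace G] [ChartedSpace EG G] [Group G]
  [LieGroup 𝓘(ℝ, EG) ∞ G]
  {EX : Type*} [NormedAddCommGroup EX] [NormedSpace ℝ EX] [FiniteDimensional ℝ EX]
  {H : Subgroup G} [ChartedSpace EX (G ⧸ H)] [IsManifold 𝓘(ℝ, EX) ∞ (G ⧸ H)]
  {F : GradedManifold.{u}} {E : GradedManifold.{v}}
  (S : HomogeneousGPDE EG EX H F E) (T : LocalTriv F S.toGradedOver)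
  (hT : (QuotientGroup.mk 1 : G ⧸ H) ∈ T.base)
  (hsub : Manifold.IsSubmersion 𝓘(ℝ, EG) 𝓘(ℝ, EX) ∞ (QuotientGroup.mk : G → G ⧸ H))

theorem act_inv_act (g : G) (b : E.carrier) :
    S.action.act.toFun (g⁻¹, S.action.act.toFun (g, b)) = b := by
  rw [← S.action.mul_act, inv_mul_cancel, S.action.one_act]

theorem act_act_inv (g : G) (b : E.carrier) :
    S.action.act.toFun (g, S.action.act.toFun (g⁻¹, b)) = b := by
  rw [← S.action.mul_act, mul_inv_cancel, S.action.one_act]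

theorem proj_act_inv {g : G} {b : E.carrier} (hg : QuotientGroup.mk g = S.proj b) :
    S.proj (S.action.act.toFun (g⁻¹, b)) = QuotientGroup.mk 1 := by
  rw [S.action.proj_act, ← hg]
  change QuotientGroup.mk (g⁻¹ * g) = _
  rw [inv_mul_cancel]

include hT in
theorem fibre_snd [Nonempty (E.carrier → F.carrier)] {b : E.carrier}
    (hb : S.proj b = QuotientGroup.mk 1) : S.fibre T (T.snd b) = b := by
  unfold fibre
  rw [← hb]
  exact T.map_snd (by rw [hb]; exact hT)

include hT in
theorem orbit_snd [Nonempty (E.carrier → F.carrier)] {g : G} {b : E.carrier}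
    (hg : QuotientGroup.mk g = S.proj b) :
    S.orbit T (g, T.snd (S.action.act.toFun (g⁻¹, b))) = b := by
  unfold orbit
  rw [S.fibre_snd T hT (S.proj_act_inv hg), S.act_act_inv]

include hT hsub in
/-- The orbit map is a quotient map, since it is surjective and has continuous local sections. -/
theorem isQuotientMap_orbit : Topology.IsQuotientMap (S.orbit T) := by
  have hne := S.nonempty_fibreCoord T hT
  refine (Topology.isQuotientMap_iff _).2 ⟨Topology.isCoinducing_iff.2 fun U =>
    ⟨fun hU => ?_, fun hU => hU.preimage (S.continuous_orbit T hT)⟩, fun b =>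
      ⟨((S.proj b).out, _), S.orbit_snd T hT (QuotientGroup.out_eq' _)⟩⟩
  · refine isOpen_iff_mem_nhds.2 fun b hb => ?_
    obtain ⟨V, σ, hV, hσ, hσV, -⟩ := exists_section hsub (S.proj b).out
    rw [QuotientGroup.out_eq'] at hV
    -- a continuous local section of the orbit map
    let s : E.carrier → G × F.carrier := fun b' =>
      (σ (S.proj b'), T.snd (S.action.act.toFun ((σ (S.proj b'))⁻¹, b')))
    have hs : ∀ b', S.proj b' ∈ V → S.orbit T (s b') = b' := fun b' hb' =>
      S.orbit_snd T hT (hσV _ hb')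
    have hO : IsOpen (S.proj ⁻¹' V) := V.isOpen.preimage S.continuous_proj
    have : IsTopologicalGroup G := topologicalGroup_of_lieGroup 𝓘(ℝ, EG) ∞
    have hc : ContinuousOn s (S.proj ⁻¹' V) := by
      have h1 : ContinuousOn (fun b' => σ (S.proj b')) (S.proj ⁻¹' V) :=
        hσ.continuousOn.comp S.continuous_proj.continuousOn fun b' hb' => hb'
      refine h1.prodMk ((T.continuousOn_fibreCoord).comp
        (S.action.continuous_act.comp_continuousOn (h1.inv.prodMk continuousOn_id)) fun b' hb' => ?_)
      change S.proj (S.action.act.toFun ((σ (S.proj b'))⁻¹, b')) ∈ T.base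
      rw [S.proj_act_inv (hσV _ hb')]
      exact hT
    have h2 : IsOpen (S.proj ⁻¹' V ∩ s ⁻¹' (S.orbit T ⁻¹' U)) := hc.isOpen_inter_preimage hO hU
    refine Filter.mem_of_superset (h2.mem_nhds ⟨hV, ?_⟩) fun b' hb' => ?_
    · change S.orbit T (s b) ∈ U
      rw [hs b hV]; exact hb
    · have := hb'.2
      rwa [Set.mem_preimage, Set.mem_preimage, hs b' hb'.1] at this

include hT in
/-- The points of a fibre of the orbit map are related by the action of `H`. -/
theorem orbit_eq_orbit_iff (g g' : G) (y y' : F.carrier) :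
    S.orbit T (g, y) = S.orbit T (g', y') ↔
      ∃ h ∈ H, g' = g * h ∧ S.fibre T y = S.action.act.toFun (h, S.fibre T y') := by
  constructor
  · intro e
    have hp := congrArg S.proj e
    have h1 : (QuotientGroup.mk g : G ⧸ H) = QuotientGroup.mk g' :=
      (S.proj_orbit T g y hT).symm.trans (hp.trans (S.proj_orbit T g' y' hT))
    refine ⟨g⁻¹ * g', QuotientGroup.eq.1 h1, (mul_inv_cancel_left g g').symm, ?_⟩
    have h2 := congrArg (fun b => S.action.act.toFun (g⁻¹, b)) e
    rw [S.action.mul_act]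
    exact (S.act_inv_act g _).symm.trans h2
  · rintro ⟨h, -, rfl, e⟩
    change S.action.act.toFun (g, S.fibre T y) = S.action.act.toFun (g * h, S.fibre T y')
    rw [S.action.mul_act, e]

/-! ### Injectivity of the pullback -/

include hsub in
/-- An operator over `x` composed with the action of `g` is an operator over `g x`. -/
theorem isOver_comp_act {M' : GradedManifold.{u}} {d : ℤ} {P : LocalOp E M' d} {x : G ⧸ H}
    (hP : P.IsOver S.toGradedOver x) (g : G) :
    (P.comp (S.action.act.toLocalOp g)).IsOver S.toGradedOver (g • x) := by
  refine hP.comp (fun b hb => ?_) fun φ hφ => ?_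
  · exact (S.action.proj_act g b).trans (by rw [hb])
  · refine ⟨⟨fun z => φ (g • z), φ.contMDiff.comp (contMDiff_smul_left hsub g)⟩, hφ,
      fun U U' h f => ⟨S.action.act.pull g U U' h f, ?_⟩⟩
    refine (map_mul (S.action.act.pull g U U' h) _ _).trans ?_
    exact congrArg (· * _) (S.action.pull_fn g U U' h φ _ fun x => rfl)

variable [T2Space (G ⧸ H)]

include hsub in
/-- A function whose pullback to `{g} × F` vanishes is zero on the fibre over `[g]`, in any
trivialization. -/
theorem pull_eq_zero_of_orbitPull {g : G} (T' : LocalTriv F S.toGradedOver)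
    (hg : (QuotientGroup.mk g : G ⧸ H) ∈ T'.base) {U : Opens E.carrier} {k : ℤ} {f : E.O U}
    (hf : f ∈ E.gr U k) (h0 : ∀ W h, S.orbitPull T hT g U W h f = 0) (Y : Opens F.carrier)
    (hY : ∀ y ∈ Y, (QuotientGroup.mk g, y) ∈ T'.map.dom ∧
      T'.map.toFun (QuotientGroup.mk g, y) ∈ U) :
    T'.map.pull (QuotientGroup.mk g) U Y hY f = 0 := by
  -- the restriction to the fibre over `[g]` in `T'` is an operator over the identity coset, after
  -- translation by `g⁻¹`; such an operator kills functions that vanish on the fibre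
  have hP := S.isOver_comp_act hsub (LocalOp.isOver_toLocalOp T' hg) g⁻¹
  have hx : g⁻¹ • (QuotientGroup.mk g : G ⧸ H) = QuotientGroup.mk 1 := by
    change QuotientGroup.mk (g⁻¹ * g) = _
    rw [inv_mul_cancel]
  rw [hx] at hP
  have h1 := hP.D_eq_zero T hT (S.action_pull_mem g hf) (fun W hW => h0 W fun y hy => (hW y hy).2)
    Y fun y hy => ⟨⟨(hY y hy).1, S.act_mem_dom _ _⟩, by
      change S.action.act.toFun (g, S.action.act.toFun (g⁻¹, _)) ∈ U
      rw [S.act_act_inv]; exact (hY y hy).2⟩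
  refine Eq.trans ?_ h1
  let Z : Opens E.carrier := ⟨_ ∩ _ ⁻¹' (S.action.preimage g U),
    (S.action.act.toLocalOp g⁻¹).cont.isOpen_inter_preimage
      (S.action.act.toLocalOp g⁻¹).dom.isOpen (S.action.preimage g U).isOpen⟩
  have hZ : Z ≤ U := fun b hb => by
    have := hb.2
    change S.action.act.toFun (g, S.action.act.toFun (g⁻¹, b)) ∈ U at this
    rwa [S.act_act_inv] at this
  have h2 : ∀ z, z = g * g⁻¹ → ∀ h, S.action.act.pull z U Z h f =
      S.action.act.pull g⁻¹ (S.action.preimage g U) Z (fun b hb => hb) (S.action.pull g U f) := by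
    intro z hz h
    subst hz
    exact S.action.pull_mul g g⁻¹ _ _ _ _ _ _ f
  have h3 := (h2 1 (mul_inv_cancel g).symm fun b hb => ⟨S.act_mem_dom _ _, by
    rw [S.action.one_act]; exact hZ hb⟩).symm.trans (S.action.pull_one U Z _ hZ f)
  exact (((congrArg (T'.map.pull (QuotientGroup.mk g) Z Y fun y hy => ⟨(hY y hy).1,
    S.act_mem_dom _ _, by
      change S.action.act.toFun (g, S.action.act.toFun (g⁻¹, _)) ∈ U
      rw [S.act_act_inv]; exact (hY y hy).2⟩) h3)).trans (T'.map.pull_res _ _ _ _ _ _ _)).symm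

include hsub in
/-- A function that vanishes on the fibre over `[g]` in some trivialization is pulled back
to zero on `{g} × F`. -/
theorem orbitPull_eq_zero_of_pull {g : G} (T' : LocalTriv F S.toGradedOver)
    (hg : (QuotientGroup.mk g : G ⧸ H) ∈ T'.base) {U : Opens E.carrier} {k : ℤ} {f : E.O U}
    (hf : f ∈ E.gr U k) (h0 : ∀ Y hY, T'.map.pull (QuotientGroup.mk g) U Y hY f = 0)
    (W : Opens F.carrier) (h : ∀ y ∈ W, S.orbit T (g, y) ∈ U) :
    S.orbitPull T hT g U W h f = 0 := by
  have hP := S.isOver_comp_act hsub (LocalOp.isOver_toLocalOp T hT) g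
  have hx : g • (QuotientGroup.mk 1 : G ⧸ H) = QuotientGroup.mk g := by
    change QuotientGroup.mk (g * 1) = _
    rw [mul_one]
  rw [hx] at hP
  have h1 := hP.D_eq_zero T' hg hf h0 W fun y hy =>
    ⟨⟨(T.mem_dom _ _).2 hT, S.act_mem_dom _ _⟩, h y hy⟩
  refine Eq.trans ?_ h1
  exact S.orbitPull_eq T hT g (U' := ⟨_ ∩ (S.action.act.toLocalOp g).body ⁻¹' U,
    (S.action.act.toLocalOp g).cont.isOpen_inter_preimage
      (S.action.act.toLocalOp g).dom.isOpen U.isOpen⟩) h (fun b hb => hb.2)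
    (fun y hy => ⟨S.act_mem_dom _ _, h y hy⟩) f

include hsub in
/-- Functions on the total space are determined by their pullbacks along the orbit map. -/
theorem eq_of_orbitPull {U : Opens E.carrier} {k : ℤ} {f f' : E.O U}
    (hf : f ∈ E.gr U k) (hf' : f' ∈ E.gr U k)
    (h : ∀ g W h, S.orbitPull T hT g U W h f = S.orbitPull T hT g U W h f') : f = f' := by
  refine eq_of_local fun b hb => ?_
  obtain ⟨T', hT'⟩ := S.locally_trivial (S.proj b)
  let U' : Opens E.carrier := U ⊓ ⟨S.proj ⁻¹' T'.base, T'.base.isOpen.preimage S.continuous_proj⟩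
  refine ⟨U', inf_le_left, ⟨hb, hT'⟩, T'.ext_gr (U := U') (fun b hb => hb.2)
    (E.sheaf.res_mem _ _ _ hf) (E.sheaf.res_mem _ _ _ hf') fun x Y hY => ?_⟩
  by_cases hx : x ∈ T'.base
  · obtain ⟨g, rfl⟩ := QuotientGroup.mk_surjective x
    rw [← sub_eq_zero, ← map_sub, ← map_sub]
    refine (T'.map.pull_res _ _ _ _ _ _ _).trans ?_
    exact S.pull_eq_zero_of_orbitPull T hT hsub T' hx (sub_mem hf hf') (fun W hW => by
      rw [map_sub, h, sub_self]) _ _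
  · have hY0 : ∀ y, y ∉ Y := fun y hy => hx ((T'.mem_dom _ _).1 (hY y hy).1)
    exact eq_of_cf fun c hc p hp => absurd hp (hY0 p)

include hsub in
theorem injective_orbitPullback {U : Opens E.carrier} {d : ℤ}
    {α α' : PreForm (Vect EX (G ⧸ H)) (E.O U)}
    {β : PreForm (Vect EG G) (F.Fam (S.orbitOpens T hT U))}
    (hα : IsHorizontalForm S.toGradedOver U d α) (hα' : IsHorizontalForm S.toGradedOver U d α')
    (h : S.IsOrbitPullback T hT U α β) (h' : S.IsOrbitPullback T hT U α' β) : α = α' := by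
  funext p w
  refine S.eq_of_orbitPull T hT hsub (hα.1 p w) (hα'.1 p w) fun g W hW => ?_
  choose l hl using fun i => exists_lift hsub (w i)
  have e := (h p g l w fun i => hl i g).symm.trans (h' p g l w fun i => hl i g)
  have e' := congrArg (F.res (S.le_orbitSlice T hT hW)) e
  exact (S.res_orbitPull T hT g (S.le_orbitSlice T hT hW) _ _).symm.trans
    (e'.trans (S.res_orbitPull T hT g (S.le_orbitSlice T hT hW) _ _))

theorem IsOrbitPullback.mul {S : HomogeneousGPDE EG EX H F E} {T : LocalTriv F S.toGradedOver}
    {hT : (QuotientGroup.mk 1 : G ⧸ H) ∈ T.base} {U : Opens E.carrier} {d : ℤ}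
    {α α' : PreForm (Vect EX (G ⧸ H)) (E.O U)}
    {β β' : PreForm (Vect EG G) (F.Fam (S.orbitOpens T hT U))}
    (h : S.IsOrbitPullback T hT U α β) (h' : S.IsOrbitPullback T hT U α' β') :
    S.IsOrbitPullback T hT U (PreForm.mul d α α') (PreForm.mul d β β') := by
  intro p g v w hvw
  simp only [PreForm.mul, Finset.sum_apply, map_sum, Units.smul_def]
  refine Finset.sum_congr rfl fun r _ => ?_
  simp only [Pi.smul_apply, Finset.sum_apply, Pi.mul_apply, map_zsmul, map_smul, map_sum, map_mul]
  congr 2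
  refine Finset.sum_congr rfl fun τ _ => ?_
  rw [h _ g _ _ fun i => hvw _, h' _ g _ _ fun i => hvw _]

end HomogeneousGPDE

/-! ### Existence of the pullback of forms -/

/-- If changing one argument within a relation does not change the value of a function, neither
does changing all of them. -/
theorem eq_of_update {p : ℕ} {X Y : Type*} {L : (Fin p → X) → Y} {r : X → X → Prop}
    (hL : ∀ u i z z', r z z' → L (Function.update u i z) = L (Function.update u i z'))
    {w w' : Fin p → X} (hw : ∀ i, r (w i) (w' i)) : L w = L w' := by
  have hind : ∀ A : Finset (Fin p), L (A.piecewise w' w) = L w := by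
    intro A
    induction A using Finset.induction_on with
    | empty => rw [Finset.piecewise_empty]
    | insert a A ha ih =>
      rw [Finset.piecewise_insert, ← ih, ← hL _ a _ _ (hw a)]
      congr 1
      rw [← Finset.piecewise_eq_of_notMem A w' w ha, Function.update_eq_self]
  have := hind Finset.univ
  rw [Finset.piecewise_univ] at this
  exact this.symm

/-- A multilinear map whose arguments may be expanded in a frame depends only on the coefficients
of the expansions. -/
theorem multilinear_congr {p : ℕ} {X Y κ : Type*} [AddCommGroup X] [Module ℝ X] [AddCommGroup Y]
    [Module ℝ Y] [Fintype κ] {L : MultilinearMap ℝ (fun _ : Fin p => X) Y} {e : κ → X}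
    {c : κ → X → ℝ} (hL : ∀ u i z, L (Function.update u i z) =
      ∑ j, c j z • L (Function.update u i (e j)))
    {w w' : Fin p → X} (hw : ∀ i j, c j (w i) = c j (w' i)) : L w = L w' :=
  eq_of_update (L := L) (r := fun z z' => ∀ j, c j z = c j z') (fun u i z z' h => by
    rw [hL u i z, hL u i z']
    exact Finset.sum_congr rfl fun j _ => by rw [h j]) hw

namespace HomogeneousGPDE

open GradedManifold

variable {EG : Type w} {G : Type*} [NormedAddCommGroup EG] [NormedSpace ℝ EG]
  [FiniteDimensional ℝ EG] [TopologicalSpace G] [ChartedSpace EG G] [Group G]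
  [LieGroup 𝓘(ℝ, EG) ∞ G]
  {EX : Type*} [NormedAddCommGroup EX] [NormedSpace ℝ EX] [FiniteDimensional ℝ EX]
  {H : Subgroup G} [ChartedSpace EX (G ⧸ H)] [IsManifold 𝓘(ℝ, EX) ∞ (G ⧸ H)]
  {F : GradedManifold.{u}} {E : GradedManifold.{v}}
  (S : HomogeneousGPDE EG EX H F E) (T : LocalTriv F S.toGradedOver)
  (hT : (QuotientGroup.mk 1 : G ⧸ H) ∈ T.base)
  (hsub : Manifold.IsSubmersion 𝓘(ℝ, EG) 𝓘(ℝ, EX) ∞ (QuotientGroup.mk : G → G ⧸ H))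

include hsub in
theorem orbitPull_fn_mul (g : G) {U : Opens E.carrier} {W : Opens F.carrier}
    (h : ∀ y ∈ W, S.orbit T (g, y) ∈ U) (φ : C^∞⟮𝓘(ℝ, EX), G ⧸ H; ℝ⟯) (f : E.O U) :
    S.orbitPull T hT g U W h (S.fn U φ * f) =
      φ (QuotientGroup.mk g) • S.orbitPull T hT g U W h f := by
  rw [map_mul, S.orbitPull_fn T hT g h hsub, Algebra.smul_def]

/-- The components of the pullback of a horizontal form to `{g} × F`, as multilinear functions of
vector fields. -/
def orbitMultilinear {U : Opens E.carrier} {d : ℤ} {α : PreForm (Vect EX (G ⧸ H)) (E.O U)}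
    (hα : IsHorizontalForm S.toGradedOver U d α) (g : G) {W : Opens F.carrier}
    (h : ∀ y ∈ W, S.orbit T (g, y) ∈ U) (p : ℕ) :
    MultilinearMap ℝ (fun _ : Fin p => Vect EX (G ⧸ H)) (F.O W) where
  toFun w := S.orbitPull T hT g U W h (α p w)
  map_update_add' {inst} v i w w' := by
    rw [Subsingleton.elim inst (instDecidableEqFin p), hα.2.1, map_add]
  map_update_smul' {inst} v i c w := by
    let φ : C^∞⟮𝓘(ℝ, EX), G ⧸ H; ℝ⟯ := ⟨fun _ => c, contMDiff_const⟩
    rw [Subsingleton.elim inst (instDecidableEqFin p),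
      hα.2.2.1 p v i w (c • w) φ fun x => rfl]
    exact S.orbitPull_fn_mul T hT hsub g h φ _

variable [T2Space (G ⧸ H)] {S T hT}

include hsub in
/-- The pullback of a horizontal form to `{g} × F` depends only on the values of the vector fields
at `[g]`. -/
theorem orbitPull_congr {U : Opens E.carrier} {d : ℤ} {α : PreForm (Vect EX (G ⧸ H)) (E.O U)}
    (hα : IsHorizontalForm S.toGradedOver U d α) {g : G} {W : Opens F.carrier}
    (h : ∀ y ∈ W, S.orbit T (g, y) ∈ U) {p : ℕ} {w w' : Fin p → Vect EX (G ⧸ H)}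
    (hw : ∀ i, w i (QuotientGroup.mk g) = w' i (QuotientGroup.mk g)) :
    S.orbitPull T hT g U W h (α p w) = S.orbitPull T hT g U W h (α p w') := by
  obtain ⟨χ, e, c, hχ, hdec, hc⟩ := Vect.exists_decomposition (EN := EX)
    (QuotientGroup.mk g : G ⧸ H)
  let L := S.orbitMultilinear T hT hsub hα g h p
  have hL : ∀ (u : Fin p → Vect EX (G ⧸ H)) i (φ : C^∞⟮𝓘(ℝ, EX), G ⧸ H; ℝ⟯) z,
      L (Function.update u i (Vect.fsmul φ z)) =
        φ (QuotientGroup.mk g) • L (Function.update u i z) := by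
    intro u i φ z
    refine (congrArg (S.orbitPull T hT g U W h) (hα.2.2.1 p u i z (Vect.fsmul φ z) φ fun x => rfl)).trans ?_
    exact S.orbitPull_fn_mul T hT hsub g h φ _
  have hstep : ∀ (u : Fin p → Vect EX (G ⧸ H)) i z, L (Function.update u i z) =
      ∑ j, c j z (QuotientGroup.mk g) • L (Function.update u i (e j)) := by
    intro u i z
    have h1 := hL u i χ z
    rw [hχ, one_smul, hdec, MultilinearMap.map_update_sum] at h1
    rw [← h1]
    exact Finset.sum_congr rfl fun j _ => hL u i (c j z) (e j)
  exact multilinear_congr hstep fun i j => hc (w i) (w' i) (hw i) j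

theorem IsOrbitPullback.ext {U : Opens E.carrier} {α : PreForm (Vect EX (G ⧸ H)) (E.O U)}
    {β β' : PreForm (Vect EG G) (F.Fam (S.orbitOpens T hT U))}
    (h : S.IsOrbitPullback T hT U α β) (h' : S.IsOrbitPullback T hT U α β') : β = β' := by
  funext p v g
  choose w hw using fun i => Vect.exists_apply_eq (EN := EX) (QuotientGroup.mk g : G ⧸ H)
    (mfderiv 𝓘(ℝ, EG) 𝓘(ℝ, EX) (QuotientGroup.mk : G → G ⧸ H) g (v i g))
  rw [h p g v w hw, h' p g v w hw]

include hsub in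
/-- Near `g₀` the pullback of a form is a combination of pullbacks of functions, with smooth
coefficients that depend on the components of the vector fields in a frame of `G ⧸ H`. -/
theorem IsOrbitPullback.smooth {U : Opens E.carrier} {d : ℤ}
    {α : PreForm (Vect EX (G ⧸ H)) (E.O U)} (hα : IsHorizontalForm S.toGradedOver U d α)
    {β : PreForm (Vect EG G) (F.Fam (S.orbitOpens T hT U))}
    (h : S.IsOrbitPullback T hT U α β) (p : ℕ) (v : Fin p → Vect EG G) :
    IsSmoothFam 𝓘(ℝ, EG) (S.orbitOpens T hT U) (d - p) (β p v) := by
  refine isSmoothFam_of_local fun q hq => ?_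
  obtain ⟨V, e, C, hV, hqV, hC, he⟩ := exists_frame (EN := EX) (QuotientGroup.mk q.1 : G ⧸ H)
  let Ω : Set G := QuotientGroup.mk ⁻¹' V
  have hΩ : IsOpen Ω := hV.preimage (contMDiff_mk hsub).continuous
  let W' := restrictParam (S.orbitOpens T hT U) Ω hΩ
  have hW' : W' ≤ S.orbitOpens T hT U := fun q hq => hq.2
  refine ⟨W', hW', ⟨hqV, hq⟩, ?_⟩
  -- the components of the projected vector fields
  let a : Fin p → Fin (Module.finrank ℝ EX) → G → ℝ := fun i j g =>
    C j ⟨QuotientGroup.mk g, mfderiv 𝓘(ℝ, EG) 𝓘(ℝ, EX) (QuotientGroup.mk : G → G ⧸ H) g (v i g)⟩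
  have ha : ∀ i j, ContMDiffOn 𝓘(ℝ, EG) 𝓘(ℝ, ℝ) ∞ (a i j) Ω := by
    intro i j
    have h1 : ContMDiff 𝓘(ℝ, EG).tangent 𝓘(ℝ, EX).tangent ∞
        (tangentMap 𝓘(ℝ, EG) 𝓘(ℝ, EX) (QuotientGroup.mk : G → G ⧸ H)) :=
      (contMDiff_mk hsub).contMDiff_tangentMap (by simp)
    exact (hC j).comp (h1.comp (v i).contMDiff).contMDiffOn fun g hg => hg
  have hJ : ∀ J : Fin p → Fin (Module.finrank ℝ EX), IsSmoothFam 𝓘(ℝ, EG) W' (d - p)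
      fun g => (∏ i, a i (J i) g) • F.res (slice_mono hW' g)
        (S.orbitFam T hT U (α p fun i => e (J i)) g) := fun J =>
    ((S.orbitFam_smooth T hT (hα.1 p _)).res hW').smul hΩ
      (contMDiffOn_finsetProd fun i _ => ha i (J i)) fun q hq => hq.1
  convert IsSmoothFam.sum Finset.univ fun J _ => hJ J using 1
  funext g
  rw [Finset.sum_apply]
  by_cases hg : g ∈ Ω
  · have hw : ∀ i, (∑ j, a i j g • e j) (QuotientGroup.mk g) =
        mfderiv 𝓘(ℝ, EG) 𝓘(ℝ, EX) (QuotientGroup.mk : G → G ⧸ H) g (v i g) := fun i =>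
      (Vect.sum_apply _ _ _).trans (he _ hg _).symm
    have e1 := h p g v (fun i => ∑ j, a i j g • e j) hw
    have e2 := (S.orbitMultilinear T hT hsub hα g
      (S.le_orbitSlice T hT (W := slice (S.orbitOpens T hT U) g) fun y hy => hy) p).map_sum
      (fun i j => a i j g • e j)
    rw [e1]
    refine (congrArg (F.res (slice_mono hW' g)) e2).trans ?_
    rw [map_sum]
    refine Finset.sum_congr rfl fun J _ => ?_
    rw [MultilinearMap.map_smul_univ, map_smul]
    rfl
  · exact eq_of_cf fun c hc p hp => absurd hp.1 hg

include hsub in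
/-- Every horizontal form has a pullback: its value at `g` on vector fields of the group is the
pullback of the value of the form on vector fields of the base with the same projections at `[g]`.
-/
theorem exists_orbitPullback {U : Opens E.carrier} {d : ℤ}
    {α : PreForm (Vect EX (G ⧸ H)) (E.O U)} (hα : IsHorizontalForm S.toGradedOver U d α) :
    ∃ β, IsProdForm (S.orbitOpens T hT U) d β ∧ S.IsOrbitPullback T hT U α β := by
  classical
  choose l hl using fun g : G => fun z : TangentSpace 𝓘(ℝ, EG) g =>
    Vect.exists_apply_eq (EN := EX) (QuotientGroup.mk g : G ⧸ H)
      (mfderiv 𝓘(ℝ, EG) 𝓘(ℝ, EX) (QuotientGroup.mk : G → G ⧸ H) g z)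
  let β : PreForm (Vect EG G) (F.Fam (S.orbitOpens T hT U)) := fun p v g =>
    S.orbitFam T hT U (α p fun i => l g (v i g)) g
  have hβ : S.IsOrbitPullback T hT U α β := fun p g v w hw =>
    orbitPull_congr hsub hα _ fun i => (hl g _).trans (hw i).symm
  have hupd : ∀ {p : ℕ} (v : Fin p → Vect EG G) (i : Fin p) (g : G) (z : Vect EG G)
      (z' : Vect EX (G ⧸ H)), z' (QuotientGroup.mk g) =
        mfderiv 𝓘(ℝ, EG) 𝓘(ℝ, EX) (QuotientGroup.mk : G → G ⧸ H) g (z g) →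
      β p (Function.update v i z) g = S.orbitMultilinear T hT hsub hα g
        (S.le_orbitSlice T hT (W := slice (S.orbitOpens T hT U) g) fun y hy => hy) p
        (Function.update (fun i => l g (v i g)) i z') := by
    intro p v i g z z' hz
    refine hβ p g _ _ fun j => ?_
    by_cases hj : j = i
    · subst hj; rw [Function.update_self, Function.update_self, hz]
    · rw [Function.update_of_ne hj, Function.update_of_ne hj, hl]
  refine ⟨β, ⟨fun p v => hβ.smooth hsub hα p v, fun p v i w w' => ?_,
    fun p v i w w' f hf g => ?_, fun p v i j hij hv => ?_⟩, hβ⟩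
  · funext g
    have hz : (l g (w g) + l g (w' g)) (QuotientGroup.mk g) =
        mfderiv 𝓘(ℝ, EG) 𝓘(ℝ, EX) (QuotientGroup.mk : G → G ⧸ H) g ((w + w') g) :=
      (congrArg₂ (· + ·) (hl g _) (hl g _)).trans (map_add _ _ _).symm
    rw [hupd v i g _ _ hz, MultilinearMap.map_update_add]
    exact congrArg₂ (· + ·) (hupd v i g _ _ (hl g _)).symm (hupd v i g _ _ (hl g _)).symm
  · have hz : (f g • l g (w g)) (QuotientGroup.mk g) =
        mfderiv 𝓘(ℝ, EG) 𝓘(ℝ, EX) (QuotientGroup.mk : G → G ⧸ H) g (w' g) := by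
      rw [hf g]
      exact (congrArg (f g • ·) (hl g _)).trans (map_smul _ _ _).symm
    rw [hupd v i g _ _ hz, MultilinearMap.map_update_smul, hupd v i g _ _ (hl g _)]
  · funext g
    have := hα.2.2.2 p (fun i => l g (v i g)) i j hij (by simp only [hv])
    exact (congrArg (S.orbitPull T hT g U _ _) this).trans (map_zero _)

end HomogeneousGPDE

/-! ### The pullback intertwines the vector fields `Q` -/

open GradedManifold

section ProdForms

variable {EG : Type w} {G : Type*} [NormedAddCommGroup EG] [NormedSpace ℝ EG]
  [FiniteDimensional ℝ EG] [TopologicalSpace G] [ChartedSpace EG G] [Group G]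
  [LieGroup 𝓘(ℝ, EG) ∞ G] {F : GradedManifold.{u}} {W : Opens (G × F.carrier)} {d : ℤ}
  {β : PreForm (Vect EG G) (F.Fam W)}

/-- The value at `g` of a form on `T[1]G × F`, as a multilinear function of vector fields. -/
def IsProdForm.multilinear (hβ : IsProdForm W d β) (g : G) (p : ℕ) :
    MultilinearMap ℝ (fun _ : Fin p => Vect EG G) (F.O (slice W g)) where
  toFun v := β p v g
  map_update_add' {inst} v i w w' := by
    rw [Subsingleton.elim inst (instDecidableEqFin p), hβ.2.1]
    rfl
  map_update_smul' {inst} v i c w := by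
    let φ : C^∞⟮𝓘(ℝ, EG), G; ℝ⟯ := ⟨fun _ => c, contMDiff_const⟩
    rw [Subsingleton.elim inst (instDecidableEqFin p)]
    exact hβ.2.2.1 p v i w (c • w) φ (fun x => rfl) g

/-- The value at `g` of a form depends only on the values at `g` of the vector fields. -/
theorem IsProdForm.congr (hβ : IsProdForm W d β) {g : G} {p : ℕ} {v v' : Fin p → Vect EG G}
    (h : ∀ i, v i g = v' i g) : β p v g = β p v' g := by
  choose f hf hsum using exists_eq_sum_leftInvariant (EG := EG) (G := G)
  have hcoef : ∀ z i, f z i g = (Module.finBasis ℝ EG).repr (maurerCartan g (z g) : EG) i := by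
    intro z i
    have h1 := congrArg (fun t : EG => (Module.finBasis ℝ EG).repr t i) (hf z g)
    refine Eq.trans ?_ h1.symm
    rw [Module.Basis.repr_sum_self]
  refine multilinear_congr (L := hβ.multilinear g p)
    (e := fun i => leftInvariant (Module.finBasis ℝ EG i : EG)) (c := fun i z => f z i g)
    (fun u i z => ?_) fun i j => ?_
  · conv_lhs => rw [hsum z, MultilinearMap.map_update_sum]
    exact Finset.sum_congr rfl fun j _ => hβ.2.2.1 p u i _ _ (f z j) (fun x => rfl) g
  · rw [hcoef, hcoef, h i]

end ProdForms

namespace HomogeneousGPDE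

variable {EG : Type w} {G : Type*} [NormedAddCommGroup EG] [NormedSpace ℝ EG]
  [FiniteDimensional ℝ EG] [TopologicalSpace G] [ChartedSpace EG G] [Group G]
  [LieGroup 𝓘(ℝ, EG) ∞ G]
  {EX : Type*} [NormedAddCommGroup EX] [NormedSpace ℝ EX] [FiniteDimensional ℝ EX]
  {H : Subgroup G} [ChartedSpace EX (G ⧸ H)] [IsManifold 𝓘(ℝ, EX) ∞ (G ⧸ H)]
  {F : GradedManifold.{u}} {E : GradedManifold.{v}}
  (S : HomogeneousGPDE EG EX H F E) (T : LocalTriv F S.toGradedOver)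
  (hT : (QuotientGroup.mk 1 : G ⧸ H) ∈ T.base)
  (hsub : Manifold.IsSubmersion 𝓘(ℝ, EG) 𝓘(ℝ, EX) ∞ (QuotientGroup.mk : G → G ⧸ H))

/-- The pullback of functions along the orbit map as a homomorphism. -/
def orbitHom (U : Opens E.carrier) : E.O U →+ F.Fam (S.orbitOpens T hT U) where
  toFun := S.orbitFam T hT U
  map_zero' := funext fun _ => map_zero (S.orbitPull T hT _ _ _ _)
  map_add' f f' := funext fun _ => map_add (S.orbitPull T hT _ _ _ _) f f'

variable {S T hT} {U : Opens E.carrier} {d : ℤ} {α : PreForm (Vect EX (G ⧸ H)) (E.O U)}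
  {β : PreForm (Vect EG G) (F.Fam (S.orbitOpens T hT U))}

theorem IsOrbitPullback.apply (h : S.IsOrbitPullback T hT U α β) {p : ℕ} {v : Fin p → Vect EG G}
    {w : Fin p → Vect EX (G ⧸ H)} (hvw : ∀ i g, w i (QuotientGroup.mk g) =
      mfderiv 𝓘(ℝ, EG) 𝓘(ℝ, EX) (QuotientGroup.mk : G → G ⧸ H) g (v i g)) :
    β p v = S.orbitHom T hT U (α p w) :=
  funext fun g => h p g v w fun i => hvw i g

variable {ρF : GroupLieAlgebra 𝓘(ℝ, EG) G → VField F 0} {qF : VField F 1} [T2Space (G ⧸ H)]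

/-- The pullback intertwines the derivative terms of the exterior covariant derivatives, on
projectable vector fields. -/
theorem IsOrbitPullback.altSum (hρ : S.IsFibreAction T hT ρF)
    (hsub : Manifold.IsSubmersion 𝓘(ℝ, EG) 𝓘(ℝ, EX) ∞ (QuotientGroup.mk : G → G ⧸ H))
    (hα : IsHorizontalForm S.toGradedOver U d α) (h : S.IsOrbitPullback T hT U α β) {p : ℕ}
    {v : Fin p → Vect EG G} {w : Fin p → Vect EX (G ⧸ H)}
    (hvw : ∀ i g, w i (QuotientGroup.mk g) =
      mfderiv 𝓘(ℝ, EG) 𝓘(ℝ, EX) (QuotientGroup.mk : G → G ⧸ H) g (v i g)) :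
    PreForm.altSum (covDeriv ρF (S.orbitOpens T hT U)) β p v =
      S.orbitHom T hT U (PreForm.altSum (fun v => (S.nabla.cov v).D U) α p w) := by
  cases p with
  | zero => exact (map_zero _).symm
  | succ n =>
    refine Eq.trans ?_ (map_sum (S.orbitHom T hT U) _ _).symm
    refine Finset.sum_congr rfl fun i _ => ?_
    rw [map_zsmul, h.apply (v := i.removeNth v) (w := i.removeNth w) fun k => hvw (i.succAbove k)]
    exact congrArg _ (hρ.covDeriv_orbitFam hsub (hvw i) (hα.1 n _))

/-- The pullback intertwines the bracket terms of the exterior covariant derivatives, on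
projectable vector fields, since their brackets project to the brackets. -/
theorem IsOrbitPullback.bracketSum
    (hsub : Manifold.IsSubmersion 𝓘(ℝ, EG) 𝓘(ℝ, EX) ∞ (QuotientGroup.mk : G → G ⧸ H))
    (h : S.IsOrbitPullback T hT U α β) {p : ℕ}
    {v : Fin p → Vect EG G} {w : Fin p → Vect EX (G ⧸ H)}
    (hvw : ∀ i g, w i (QuotientGroup.mk g) =
      mfderiv 𝓘(ℝ, EG) 𝓘(ℝ, EX) (QuotientGroup.mk : G → G ⧸ H) g (v i g)) :
    PreForm.bracketSum Vect.bracket β p v =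
      S.orbitHom T hT U (PreForm.bracketSum Vect.bracket α p w) := by
  match p with
  | 0 => exact (map_zero _).symm
  | 1 => exact (map_zero _).symm
  | n + 2 =>
    refine Eq.trans ?_ (map_sum (S.orbitHom T hT U) _ _).symm
    refine Finset.sum_congr rfl fun j _ => ?_
    rw [map_sum]
    refine Finset.sum_congr rfl fun i _ => ?_
    split_ifs with hij
    · rw [map_zsmul]
      refine congrArg _ (h.apply fun k => ?_)
      refine Fin.cases ?_ (fun k => ?_) k
      · exact bracket_related (contMDiff_mk hsub) (hvw _) (hvw _)
      · exact hvw _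
    · exact (map_zero _).symm

/-- The pullback of forms intertwines the vector fields `Q`. -/
theorem IsOrbitPullback.totalQ (hρ : S.IsFibreAction T hT ρF) (hq : S.IsFibreQ T hT qF)
    (hsub : Manifold.IsSubmersion 𝓘(ℝ, EG) 𝓘(ℝ, EX) ∞ (QuotientGroup.mk : G → G ⧸ H))
    (hα : IsHorizontalForm S.toGradedOver U d α) (hβ : IsProdForm (S.orbitOpens T hT U) d β)
    (h : S.IsOrbitPullback T hT U α β) :
    S.IsOrbitPullback T hT U (GradedGeom.totalQ S.nabla S.q U α)
      (prodQ ρF qF (S.orbitOpens T hT U) β) := by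
  intro p g v w hvw
  -- Both sides depend only on the values at `g` of the vector fields, which may be extended to
  -- lifts of vector fields on `G ⧸ H`.
  choose v' hv' hvw' using fun i => exists_lift_apply_eq hsub (w i) g (v i g) (hvw i)
  rw [(hρ.isProdForm_prodQ qF hβ).congr fun i => (hv' i).symm, prodQ_eq]
  refine (congrFun (?_ : _ = S.orbitHom T hT U (GradedGeom.totalQ S.nabla S.q U α p w)) g)
  have h1 := h.altSum hρ hsub hα hvw'
  have h2 := h.bracketSum hsub hvw'
  have h3 : PreForm.oddExt (fibrewiseHom qF _) β p v' =
      S.orbitHom T hT U (PreForm.oddExt (S.q.D U) α p w) := by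
    unfold PreForm.oddExt
    rw [map_zsmul, h.apply hvw']
    refine congrArg _ (funext fun g => ?_)
    exact (hq.orbitPull_q g (hα.1 p w) _).symm
  refine (congrArg₂ (· + ·) (congrArg₂ (· + ·) h1 h2) h3).trans ?_
  rw [← map_add, ← map_add]
  rfl

end HomogeneousGPDE

/-! ### Parallel transport along the fibres of `G → G ⧸ H` -/

open GradedManifold

/-- A family over the real line with derivative zero is constant, since all its coefficients are.
-/
theorem GradedManifold.eq_of_hasFamDeriv_zero {M : GradedManifold.{u}} {k : ℤ} {Y : Opens M.carrier}
    {s : M.Fam (cylinder ℝ Y)} (hs : IsSmoothFam 𝓘(ℝ, ℝ) (cylinder ℝ Y) k s)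
    (h : ∀ r, HasFamDeriv 𝓘(ℝ, ℝ) (cylinder ℝ Y) s r (1 : ℝ) 0) (r r' : ℝ) :
    M.res (le_slice_cylinder Y r) (s r) = M.res (le_slice_cylinder Y r') (s r') := by
  refine eq_of_cf fun c hc p hp hpc m => ?_
  rw [c.cf_res _ _ _ hp, c.cf_res _ _ _ hp]
  refine is_const_of_deriv_eq_zero (f := fun r => c.cf (slice (cylinder ℝ Y) r) (s r) m p)
    (fun r => ?_) (fun r => ?_) r r'
  · exact mdifferentiableAt_iff_differentiableAt.1 (hs.mdifferentiableAt hc (n := r) hp hpc m)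
  · have h1 := h r c hc p hp hpc m
    rw [mfderiv_eq_fderiv, c.cf_zero] at h1
    exact h1.symm

section LieGroup

variable {EG : Type w} {G : Type*} [NormedAddCommGroup EG] [NormedSpace ℝ EG]
  [FiniteDimensional ℝ EG] [TopologicalSpace G] [ChartedSpace EG G] [Group G]
  [LieGroup 𝓘(ℝ, EG) ∞ G]

/-- When two mutually inverse curves pass through the identity, their velocities there are
opposite. -/
theorem mfderiv_add_eq_zero_of_mul_eq_one {c₁ c₂ : ℝ → G}
    (h₁ : ContMDiff 𝓘(ℝ, ℝ) 𝓘(ℝ, EG) ∞ c₁) (h₂ : ContMDiff 𝓘(ℝ, ℝ) 𝓘(ℝ, EG) ∞ c₂)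
    (hmul : ∀ r, c₁ r * c₂ r = 1) {r : ℝ} (e₁ : c₁ r = 1) (e₂ : c₂ r = 1) :
    ∀ a b : EG, a = mfderiv 𝓘(ℝ, ℝ) 𝓘(ℝ, EG) c₁ r (1 : ℝ) →
      b = mfderiv 𝓘(ℝ, ℝ) 𝓘(ℝ, EG) c₂ r (1 : ℝ) → a + b = 0 := by
  intro a b ha hb
  have d₁ : MDifferentiableAt 𝓘(ℝ, ℝ) 𝓘(ℝ, EG) c₁ r := h₁.mdifferentiableAt (by simp)
  have d₂ : MDifferentiableAt 𝓘(ℝ, ℝ) 𝓘(ℝ, EG) c₂ r := h₂.mdifferentiableAt (by simp)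
  have dm : MDifferentiableAt (𝓘(ℝ, EG).prod 𝓘(ℝ, EG)) 𝓘(ℝ, EG) (fun p : G × G => p.1 * p.2)
    (c₁ r, c₂ r) := (contMDiff_mul 𝓘(ℝ, EG) ∞).mdifferentiableAt (by simp)
  have hd := mfderiv_comp r (g := fun p : G × G => p.1 * p.2) (f := fun r => (c₁ r, c₂ r)) dm
    (d₁.prodMk d₂)
  have hc : (fun p : G × G => p.1 * p.2) ∘ (fun r => (c₁ r, c₂ r)) = fun _ => (1 : G) := funext hmul
  rw [hc, mfderiv_const] at hd
  have h0 := congrArg (fun L => L (1 : ℝ)) hd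
  have hp := mfderiv_prodMk d₁ d₂
  have h3 : mfderiv (𝓘(ℝ, EG).prod 𝓘(ℝ, EG)) 𝓘(ℝ, EG) (fun p : G × G => p.1 * p.2) (c₁ r, c₂ r)
      (mfderiv 𝓘(ℝ, ℝ) 𝓘(ℝ, EG) c₁ r (1 : ℝ), mfderiv 𝓘(ℝ, ℝ) 𝓘(ℝ, EG) c₂ r (1 : ℝ)) = 0 := by
    refine Eq.trans ?_ h0.symm
    exact (congrArg (fun L => mfderiv (𝓘(ℝ, EG).prod 𝓘(ℝ, EG)) 𝓘(ℝ, EG)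
      (fun p : G × G => p.1 * p.2) (c₁ r, c₂ r) (L (1 : ℝ))) hp).symm
  -- the partial differentials of the multiplication are those of translations, and the
  -- translations by `c₁ r` and `c₂ r` are the identity
  have h4 : (mfderiv 𝓘(ℝ, EG) 𝓘(ℝ, EG) (fun z : G => z * c₂ r) (c₁ r) a : EG) +
      mfderiv 𝓘(ℝ, EG) 𝓘(ℝ, EG) (fun z : G => c₁ r * z) (c₂ r) b = (0 : EG) := by
    rw [ha, hb]
    exact (mfderiv_prod_eq_add_apply dm).symm.trans h3
  have e3 : ∀ c : G, c = 1 → ∀ (p : G) (a : EG),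
      mfderiv 𝓘(ℝ, EG) 𝓘(ℝ, EG) (fun z : G => z * c) p a = a := by
    intro c hc p a
    subst hc
    have : (fun z : G => z * 1) = id := funext mul_one
    exact (congrArg (fun f : G → G => (mfderiv 𝓘(ℝ, EG) 𝓘(ℝ, EG) f p a : EG)) this).trans
      (by rw [mfderiv_id]; rfl)
  have e4 : ∀ c : G, c = 1 → ∀ (p : G) (a : EG),
      mfderiv 𝓘(ℝ, EG) 𝓘(ℝ, EG) (fun z : G => c * z) p a = a := by
    intro c hc p a
    subst hc
    have : (fun z : G => 1 * z) = id := funext one_mul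
    exact (congrArg (fun f : G → G => (mfderiv 𝓘(ℝ, EG) 𝓘(ℝ, EG) f p a : EG)) this).trans
      (by rw [mfderiv_id]; rfl)
  exact (congrArg₂ (· + ·) (e3 _ e₂ _ _) (e4 _ e₁ _ _)).symm.trans h4

end LieGroup

namespace HomogeneousGPDE

variable {EG : Type w} {G : Type*} [NormedAddCommGroup EG] [NormedSpace ℝ EG]
  [FiniteDimensional ℝ EG] [TopologicalSpace G] [ChartedSpace EG G] [Group G]
  [LieGroup 𝓘(ℝ, EG) ∞ G]
  {EX : Type*} [NormedAddCommGroup EX] [NormedSpace ℝ EX] [FiniteDimensional ℝ EX]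
  {H : Subgroup G} [ChartedSpace EX (G ⧸ H)] [IsManifold 𝓘(ℝ, EX) ∞ (G ⧸ H)]
  {F : GradedManifold.{u}} {E : GradedManifold.{v}}
  (S : HomogeneousGPDE EG EX H F E) (T : LocalTriv F S.toGradedOver)
  (hT : (QuotientGroup.mk 1 : G ⧸ H) ∈ T.base)

/-- The derivative of the orbit map at `k` in terms of fundamental vector fields of `E`, by right
translation to the identity. -/
theorem famDeriv_orbitFam_eq_fundamental (k : G) (ξ : TangentSpace 𝓘(ℝ, EG) k) {U : Opens E.carrier}
    {d : ℤ} {f : E.O U} (hf : f ∈ E.gr U d) {W : Opens F.carrier}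
    (h : ∀ y ∈ W, S.orbit T (k, y) ∈ U) (τ : GroupLieAlgebra 𝓘(ℝ, EG) G)
    (hτ : (mfderiv 𝓘(ℝ, EG) 𝓘(ℝ, EG) (fun z : G => z * k⁻¹) k ξ : EG) = -τ) :
    F.res (S.le_orbitSlice T hT h) (famDeriv 𝓘(ℝ, EG) _ (S.orbitFam T hT U f) k ξ) =
      S.orbitPull T hT k U W h (S.action.fundamental τ U f) := by
  have hA := S.actFam_smooth hf
  -- the family `z ↦ (z k)^* f` on the fibre, obtained from `z ↦ z^* f`
  let Z : Opens (G × E.carrier) :=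
    ⟨{q | S.action.act.toFun (q.1, S.action.act.toFun (k, q.2)) ∈ U}, U.isOpen.preimage
      (S.action.continuous_act.comp (continuous_fst.prodMk
        (S.action.continuous_act.comp (by fun_prop))))⟩
  let Y : Opens (G × F.carrier) := ⟨{q | (q.1, S.fibre T q.2) ∈ Z}, Z.isOpen.preimage
    (continuous_fst.prodMk ((S.continuous_fibre T hT).comp continuous_snd))⟩
  have h1 : ∀ r, ∀ b ∈ slice Z r, (k, b) ∈ S.action.act.dom ∧
      S.action.act.toFun (k, b) ∈ slice (S.action.actOpens U) r := fun r b hb =>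
    ⟨S.act_mem_dom k b, hb⟩
  have h2 : ∀ r, ∀ y ∈ slice Y r, (QuotientGroup.mk 1, y) ∈ T.map.dom ∧
      T.map.toFun (QuotientGroup.mk 1, y) ∈ slice Z r := fun r y hy => ⟨(T.mem_dom _ _).2 hT, hy⟩
  have hs1 := (S.action.act.toLocalOp k).smoothFam (W' := Z) h1 hA
  have hs2 := (T.map.toLocalOp (QuotientGroup.mk 1)).smoothFam (W' := Y) h2 hs1
  have hd : ∀ (z : G) (a : TangentSpace 𝓘(ℝ, EG) z), HasFamDeriv 𝓘(ℝ, EG) Y _ z a _ := fun z a =>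
    (T.map.toLocalOp (QuotientGroup.mk 1)).hasFamDeriv (W' := Y) h2 hs1
      ((S.action.act.toLocalOp k).hasFamDeriv (W' := Z) h1 hA (hA.hasFamDeriv z a))
  have hφ : MDifferentiableAt 𝓘(ℝ, EG) 𝓘(ℝ, EG) (fun z : G => z * k⁻¹) k :=
    (contMDiff_mul_right (I := 𝓘(ℝ, EG)) (n := ∞)).mdifferentiableAt (by simp)
  have hmem : ∀ q ∈ S.orbitOpens T hT U, (q.1 * k⁻¹, q.2) ∈ Y := fun q hq => by
    change S.action.act.toFun (q.1 * k⁻¹, S.action.act.toFun (k, _)) ∈ U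
    rw [← S.action.mul_act, inv_mul_cancel_right]
    exact hq
  have hpb := HasFamDeriv.pb (φ := fun z : G => z * k⁻¹) (W' := S.orbitOpens T hT U) (v := ξ) hs2 hφ hmem (hd (k * k⁻¹)
    (mfderiv 𝓘(ℝ, EG) 𝓘(ℝ, EG) (fun z : G => z * k⁻¹) k ξ))
  have e : pbFam (fun z : G => z * k⁻¹) hmem ((T.map.toLocalOp (QuotientGroup.mk 1)).fam h2
      ((S.action.act.toLocalOp k).fam h1 (S.action.actFam U f))) = S.orbitFam T hT U f := by
    funext z
    refine (T.map.res_pull (QuotientGroup.mk 1) _ _ (h2 _) _ (slice_le_slice (φ := fun z : G => z * k⁻¹) hmem z) _).trans ?_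
    have hle : slice Z (z * k⁻¹) ≤ S.action.preimage z U := fun b hb => by
      change S.action.act.toFun (z * k⁻¹, S.action.act.toFun (k, _)) ∈ U at hb
      rwa [← S.action.mul_act, inv_mul_cancel_right] at hb
    have h3 : ∀ z', z' = z * k⁻¹ * k → ∀ h', S.action.act.pull z' U (slice Z (z * k⁻¹)) h' f =
        S.action.act.pull k (S.action.preimage (z * k⁻¹) U) (slice Z (z * k⁻¹)) (h1 (z * k⁻¹))
          (S.action.pull (z * k⁻¹) U f) := by
      intro z' hz h'
      subst hz
      exact S.action.pull_mul _ _ _ _ _ _ _ _ f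
    have h4 := h3 z (by simp) fun b hb => ⟨S.act_mem_dom _ _, hle hb⟩
    refine Eq.trans (congrArg (T.map.pull (QuotientGroup.mk 1) (slice Z (z * k⁻¹))
      (slice (S.orbitOpens T hT U) z) fun y hy => ⟨(T.mem_dom _ _).2 hT,
        slice_le_slice (φ := fun z : G => z * k⁻¹) hmem z hy⟩) h4.symm) ?_
    exact (S.orbitPull_eq T hT z (U := U) (U' := slice Z (z * k⁻¹)) _ (fun b hb => hle hb)
      (fun y hy => slice_le_slice (φ := fun z : G => z * k⁻¹) hmem z hy) f).symm
  rw [e] at hpb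
  rw [hpb.famDeriv_eq]
  -- evaluation of the derivative of the action at `k k⁻¹ = 1`
  have key : ∀ z, z = 1 → ∀ (a : EG), a = -τ → ∀ (h3 : ∀ y ∈ W, y ∈ slice Y z),
      F.res h3 (T.map.pull (QuotientGroup.mk 1) (slice Z z) (slice Y z) (h2 z)
        (S.action.act.pull k (slice (S.action.actOpens U) z) (slice Z z) (h1 z)
          (famDeriv 𝓘(ℝ, EG) (S.action.actOpens U) (S.action.actFam U f) z a))) =
      S.orbitPull T hT k U W h (S.action.fundamental τ U f) := by
    intro z hz a ha h3
    subst hz ha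
    refine (T.map.res_pull (QuotientGroup.mk 1) _ _ (h2 1) _ h3 _).trans ?_
    have hU : U ≤ slice (S.action.actOpens U) 1 := fun b hb =>
      show S.action.act.toFun (1, b) ∈ U by rw [S.action.one_act]; exact hb
    refine Eq.trans ?_ (S.orbitPull_res T hT k hU h _).symm
    exact (S.orbitPull_eq T hT k (U' := slice Z 1) _ (fun b hb => hb) (fun y hy => h3 y hy) _).symm
  refine (F.sheaf.res_res _ _ _).trans ?_
  exact key _ (mul_inv_cancel k) _ hτ _

/-- The open set of all `((k, g), y)` with `(g, k ι(y)) ∈ Ω`. -/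
def transportOpens (Ω : Opens (G × E.carrier)) : Opens ((G × G) × F.carrier) :=
  ⟨{q | (q.1.2, S.orbit T (q.1.1, q.2)) ∈ Ω}, Ω.isOpen.preimage
    ((continuous_snd.comp continuous_fst).prodMk ((S.continuous_orbit T hT).comp (by fun_prop)))⟩

/-- A family of functions on `E` with parameter `g`, pulled back along `y ↦ k ι(y)`. -/
def transportFam {Ω : Opens (G × E.carrier)} (u : E.Fam Ω) : F.Fam (S.transportOpens T hT Ω) :=
  fun q => S.orbitPull T hT q.1 (slice Ω q.2) (slice (S.transportOpens T hT Ω) q)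
    (fun _ hy => hy) (u q.2)

section Transport

variable {Ω : Opens (G × E.carrier)} {d : ℤ} {u : E.Fam Ω} (hu : IsSmoothFam 𝓘(ℝ, EG) Ω d u)
include hu

/-- The pulled back family is smooth in both parameters. -/
theorem transportFam_smooth : IsSmoothFam (𝓘(ℝ, EG).prod 𝓘(ℝ, EG)) (S.transportOpens T hT Ω) d
    (S.transportFam T hT u) := by
  let Z : Opens ((G × G) × E.carrier) := ⟨{q | (q.1.2, S.action.act.toFun (q.1.1, q.2)) ∈ Ω},
    Ω.isOpen.preimage ((continuous_snd.comp continuous_fst).prodMk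
      (S.action.continuous_act.comp (by fun_prop)))⟩
  have h1 : ∀ r : G × G, ∀ b ∈ slice Z r, (r.1, b) ∈ S.action.act.dom ∧
      S.action.act.toFun (r.1, b) ∈ slice Ω r.2 := fun r b hb => ⟨S.act_mem_dom _ _, hb⟩
  have h2 : ∀ r, ∀ y ∈ slice (S.transportOpens T hT Ω) r, (QuotientGroup.mk 1, y) ∈ T.map.dom ∧
      T.map.toFun (QuotientGroup.mk 1, y) ∈ slice Z r := fun r y hy => ⟨(T.mem_dom _ _).2 hT, hy⟩
  have hs1 := S.action.act.smooth_pull (J := 𝓘(ℝ, EG).prod 𝓘(ℝ, EG)) hu isOpen_univ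
    (contMDiff_snd (M := G) (N := G)).contMDiffOn (contMDiff_fst (M := G) (N := G)).contMDiffOn
    (W' := Z) (fun _ _ => trivial) h1
  have hs2 := (T.map.toLocalOp (QuotientGroup.mk 1)).smoothFam
    (W' := S.transportOpens T hT Ω) h2 hs1
  have e : S.transportFam T hT u = (T.map.toLocalOp (QuotientGroup.mk 1)).fam h2 fun r =>
      S.action.act.pull r.1 (slice Ω r.2) (slice Z r) (h1 r) (u r.2) :=
    funext fun q => S.orbitPull_eq T hT q.1 (U := slice Ω q.2) (U' := slice Z q) _
      (fun _ hb => hb) (fun _ hy => hy) (u q.2)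
  rw [e]
  simpa using hs2

/-- The derivative in the direction of the second parameter: the pullback is a local operator, and
differentiates the family under it. -/
theorem hasFamDeriv_transportFam_right (k g : G) (η : EG) :
    HasFamDeriv (𝓘(ℝ, EG).prod 𝓘(ℝ, EG)) (S.transportOpens T hT Ω) (S.transportFam T hT u) (k, g)
      ((0, η) : EG × EG)
      (S.orbitPull T hT k (slice Ω g) (slice (S.transportOpens T hT Ω) (k, g)) (fun _ hy => hy)
        (famDeriv 𝓘(ℝ, EG) Ω u g η)) := by
  let W' : Opens (G × F.carrier) := ⟨{q | (q.1, S.orbit T (k, q.2)) ∈ Ω}, Ω.isOpen.preimage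
    (continuous_fst.prodMk ((S.continuous_orbit T hT).comp (by fun_prop)))⟩
  have hmem : ∀ q ∈ W', ((k, q.1), q.2) ∈ S.transportOpens T hT Ω := fun q hq => hq
  let R := S.action.act.toLocalOp k
  let P := (T.map.toLocalOp (QuotientGroup.mk 1)).comp R
  have hP : ∀ r, ∀ y ∈ slice W' r, y ∈ P.dom ∧ P.body y ∈ slice Ω r := fun r y hy =>
    ⟨⟨(T.mem_dom _ _).2 hT, S.act_mem_dom _ _⟩, hy⟩
  have hD : ∀ z f, S.orbitPull T hT k (slice Ω z) (slice W' z) (fun _ hy => hy) f =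
      P.D (slice Ω z) (slice W' z) (hP z) f := fun z f => S.orbitPull_eq T hT k (U := slice Ω z)
    (U' := ⟨R.dom ∩ R.body ⁻¹' slice Ω z,
      R.cont.isOpen_inter_preimage R.dom.isOpen (slice Ω z).isOpen⟩) _ (fun _ hb => hb.2)
    (fun y hy => ⟨S.act_mem_dom _ _, hy⟩) f
  have hd := P.hasFamDeriv hP hu (hu.hasFamDeriv g η)
  have hs := S.transportFam_smooth T hT hu
  have h0 := hs.hasFamDeriv (k, g) ((0, η) : EG × EG)
  have hpb := HasFamDeriv.pb (φ := fun z : G => (k, z)) (W' := W') (n' := g) (v := η)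
    (t := famDeriv _ _ (S.transportFam T hT u) (k, g) ((0, η) : EG × EG)) hs
    (contMDiff_const.prodMk (contMDiff_id (I := 𝓘(ℝ, EG)) (n := 1))|>.mdifferentiableAt
      (by simp)) hmem
    (by rw [mfderiv_prod_right]; exact h0)
  have e : pbFam (fun z : G => (k, z)) hmem (S.transportFam T hT u) = P.fam hP u := by
    funext z
    refine (res_self' _ _).trans ?_
    exact hD z _
  rw [e] at hpb
  have hX := ((res_self' (U := slice (S.transportOpens T hT Ω) (k, g)) le_rfl _).symm.trans
    (hpb.unique hd)).trans (hD g _).symm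
  exact hX ▸ h0

/-- The derivative in the direction of the first parameter is that of the orbit map, for a fixed
member of the family. -/
theorem hasFamDeriv_transportFam_left (k g : G) (ξ : EG) :
    HasFamDeriv (𝓘(ℝ, EG).prod 𝓘(ℝ, EG)) (S.transportOpens T hT Ω) (S.transportFam T hT u) (k, g)
      ((ξ, 0) : EG × EG)
      (F.res (S.le_orbitSlice T hT fun _ hy => hy)
        (famDeriv 𝓘(ℝ, EG) _ (S.orbitFam T hT (slice Ω g) (u g)) k ξ)) := by
  have hmem : ∀ q ∈ S.orbitOpens T hT (slice Ω g), ((q.1, g), q.2) ∈ S.transportOpens T hT Ω :=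
    fun q hq => hq
  have hs := S.transportFam_smooth T hT hu
  have h0 := hs.hasFamDeriv (k, g) ((ξ, 0) : EG × EG)
  have hpb := HasFamDeriv.pb (φ := fun z : G => (z, g)) (W' := S.orbitOpens T hT (slice Ω g))
    (n' := k) (v := ξ)
    (t := famDeriv _ _ (S.transportFam T hT u) (k, g) ((ξ, 0) : EG × EG)) hs
    ((contMDiff_id (I := 𝓘(ℝ, EG)) (n := 1)).prodMk contMDiff_const|>.mdifferentiableAt
      (by simp)) hmem
    (by rw [mfderiv_prod_left]; exact h0)
  have e : pbFam (fun z : G => (z, g)) hmem (S.transportFam T hT u) =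
      S.orbitFam T hT (slice Ω g) (u g) := by
    funext z
    exact (res_self' _ _)
  rw [e] at hpb
  have hX := (res_self' (U := slice (S.transportOpens T hT Ω) (k, g)) le_rfl _).symm.trans
    (hpb.famDeriv_eq.symm.trans (res_self' (U := slice (S.transportOpens T hT Ω) (k, g))
      le_rfl _).symm)
  exact hX ▸ h0

end Transport

end HomogeneousGPDE

open GradedManifold

namespace HomogeneousGPDE

variable {EG : Type w} {G : Type*} [NormedAddCommGroup EG] [NormedSpace ℝ EG]
  [FiniteDimensional ℝ EG] [TopologicalSpace G] [ChartedSpace EG G] [Group G]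
  [LieGroup 𝓘(ℝ, EG) ∞ G]
  {EX : Type*} [NormedAddCommGroup EX] [NormedSpace ℝ EX] [FiniteDimensional ℝ EX]
  {H : Subgroup G} [ChartedSpace EX (G ⧸ H)] [IsManifold 𝓘(ℝ, EX) ∞ (G ⧸ H)]
  {F : GradedManifold.{u}} {E : GradedManifold.{v}}
  (S : HomogeneousGPDE EG EX H F E) (T : LocalTriv F S.toGradedOver)
  (hT : (QuotientGroup.mk 1 : G ⧸ H) ∈ T.base) [Nonempty (E.carrier → F.carrier)]

/-- The open set of `(g, b)` whose fibre coordinate, in the trivialization, gives a point of `W`. -/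
def tubeOpens (W : Opens (G × F.carrier)) : Opens (G × E.carrier) :=
  ⟨{q | S.proj q.2 ∈ T.base} ∩ (fun q : G × E.carrier => (q.1, T.snd q.2)) ⁻¹' W,
    (continuousOn_fst.prodMk (T.continuousOn_fibreCoord.comp continuousOn_snd
      fun _ hq => hq)).isOpen_inter_preimage
      (T.base.isOpen.preimage (S.continuous_proj.comp continuous_snd)) W.isOpen⟩

theorem extend_compat (W : Opens (G × F.carrier)) : ∀ g, ∀ b ∈ slice (S.tubeOpens T W) g,
    b ∈ T.extend.dom ∧ T.extend.body b ∈ slice W g := fun _ _ hb => hb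

/-- The extension of a family of functions on `F` to a family on `E`, constant in the direction of
the base in the trivialization. -/
def extendFam {W : Opens (G × F.carrier)} (s : F.Fam W) : E.Fam (S.tubeOpens T W) :=
  T.extend.fam (S.extend_compat T W) s

theorem fibrePull_extend {g : G} {W : Opens (G × F.carrier)} (f : F.O (slice W g))
    {V : Opens F.carrier} (h : ∀ y ∈ V, S.fibre T y ∈ slice (S.tubeOpens T W) g)
    (hV : V ≤ slice W g) :
    S.fibrePull T hT (slice (S.tubeOpens T W) g) V h
      (T.extend.D (slice W g) (slice (S.tubeOpens T W) g) (S.extend_compat T W g) f) = F.res hV f :=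
  T.pull_extendMap (S.extend_compat T W g) f _ _ _

variable {S T hT} {ρF : GroupLieAlgebra 𝓘(ℝ, EG) G → VField F 0} [T2Space (G ⧸ H)]

/-- The action of the Lie algebra of `H` on the fibre agrees with the fundamental vector fields of
`E`, also after translation by elements of `H`. -/
theorem IsFibreAction.orbitPull_fundamental (hρ : S.IsFibreAction T hT ρF)
    (hsub : Manifold.IsSubmersion 𝓘(ℝ, EG) 𝓘(ℝ, EX) ∞ (QuotientGroup.mk : G → G ⧸ H))
    {W : Opens (G × F.carrier)} {d : ℤ} {g : G} {f : F.O (slice W g)} (hf : f ∈ F.gr (slice W g) d)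
    {t : GroupLieAlgebra 𝓘(ℝ, EG) G} (ht : t ∈ subgroupLie EG H) {k : G} (hk : k ∈ H)
    {V : Opens F.carrier} (h : ∀ y ∈ V, S.orbit T (k, y) ∈ slice (S.tubeOpens T W) g) :
    S.orbitPull T hT k (slice (S.tubeOpens T W) g) V h (S.action.fundamental t _
      (T.extend.D (slice W g) (slice (S.tubeOpens T W) g) (S.extend_compat T W g) f)) =
    S.orbitPull T hT k (slice (S.tubeOpens T W) g) V h
      (T.extend.D (slice W g) (slice (S.tubeOpens T W) g) (S.extend_compat T W g)
        ((ρF t).D (slice W g) f)) := by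
  have hk1 : (QuotientGroup.mk k : G ⧸ H) = QuotientGroup.mk 1 :=
    (QuotientGroup.eq.2 (by simpa using hk)).symm
  have hu : T.extend.D (slice W g) (slice (S.tubeOpens T W) g) (S.extend_compat T W g) f ∈ E.gr _ d :=
    T.extendMap_mem (S.extend_compat T W g) hf
  have hρf : (ρF t).D (slice W g) f ∈ F.gr _ d := by simpa using (ρF t).D_mem _ _ _ hf
  refine sub_eq_zero.1 ((map_sub _ _ _).symm.trans ?_)
  refine S.orbitPull_eq_zero_of_pull T hT hsub (g := k) T (by rwa [hk1])
    (Submodule.sub_mem _ (S.fundamental_mem t hu) (T.extendMap_mem (S.extend_compat T W g) hρf)) ?_ V h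
  rw [hk1]
  intro Y hY
  have hYW : Y ≤ slice W g := fun y hy => by
    have h1 := (hY y hy).2.2
    change (g, T.snd (T.map.toFun (_, y))) ∈ W at h1
    rwa [T.snd_map hT] at h1
  have hY' : ∀ y ∈ Y, S.fibre T y ∈ slice (S.tubeOpens T W) g := fun y hy => (hY y hy).2
  -- for `t` in the Lie algebra of `H` the connection does not contribute to the vertical part of
  -- the fundamental vector field
  have h0 := hρ t _ Y hY' d _ hu 0 (by
    have := mfderiv_mk_eq_zero_of_mem_subgroupLie hsub ht
    refine Eq.trans ?_ ((ContinuousLinearMap.map_neg _ _).trans (neg_eq_zero.2 this)).symm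
    rfl)
  rw [S.nabla.cov_zero, sub_zero, S.fibrePull_extend T hT f _ hYW, (ρF t).D_res] at h0
  refine (map_sub _ _ _).trans (sub_eq_zero.2 (h0.symm.trans ?_))
  exact (S.fibrePull_extend T hT _ hY' hYW).symm

/-- A family on `G × F` which is covariantly constant along `H` vanishes at `g` if it vanishes at
the end point of a curve in `g H` that starts at `g`. -/
theorem IsFibreAction.eq_zero_of_curve (hρ : S.IsFibreAction T hT ρF)
    (hsub : Manifold.IsSubmersion 𝓘(ℝ, EG) 𝓘(ℝ, EX) ∞ (QuotientGroup.mk : G → G ⧸ H))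
    {U : Opens E.carrier} {d : ℤ} {s : F.Fam (S.orbitOpens T hT U)}
    (hs : IsSmoothFam 𝓘(ℝ, EG) (S.orbitOpens T hT U) d s)
    (hflat : ∀ t ∈ subgroupLie EG H, covDeriv ρF _ (leftInvariant t) s = 0) {γ : ℝ → G}
    (hγ : ContMDiff 𝓘(ℝ, ℝ) 𝓘(ℝ, EG) ∞ γ) (hγ0 : γ 0 = 1) (hγH : ∀ r, γ r ∈ H) (g : G)
    (h1 : s (g * γ 1) = 0) : s g = 0 := by
  let W := S.orbitOpens T hT U
  -- the transported family `r ↦ (γ(r)⁻¹)^* s(g γ(r))` of functions on the fibre, where `s` is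
  -- first extended to `E`; it is `s g` at `r = 0` and the pullback of zero at `r = 1`
  let φ : ℝ → G × G := fun r => ((γ r)⁻¹, g * γ r)
  have hφ₁ : ContMDiff 𝓘(ℝ, ℝ) 𝓘(ℝ, EG) ∞ fun r => (γ r)⁻¹ := hγ.inv
  have hφ₂ : ContMDiff 𝓘(ℝ, ℝ) 𝓘(ℝ, EG) ∞ fun r => g * γ r := contMDiff_const.mul hγ
  have hφ : ContMDiff 𝓘(ℝ, ℝ) (𝓘(ℝ, EG).prod 𝓘(ℝ, EG)) ∞ φ := hφ₁.prodMk hφ₂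
  have hmk : ∀ r, (QuotientGroup.mk (γ r)⁻¹ : G ⧸ H) = QuotientGroup.mk 1 := fun r =>
    QuotientGroup.eq.2 (by simpa using hγH r)
  have hmem : ∀ q ∈ cylinder ℝ (slice W g), (φ q.1, q.2) ∈ S.transportOpens T hT (S.tubeOpens T W) := by
    rintro ⟨r, y⟩ hy
    have hp : S.proj (S.orbit T ((γ r)⁻¹, y)) = QuotientGroup.mk 1 :=
      (S.proj_orbit T _ y hT).trans (hmk r)
    refine ⟨show S.proj (S.orbit T ((γ r)⁻¹, y)) ∈ T.base by rw [hp]; exact hT, ?_⟩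
    change S.action.act.toFun (g * γ r, S.fibre T (T.snd (S.orbit T ((γ r)⁻¹, y)))) ∈ U
    rw [S.fibre_snd T hT hp]
    change S.action.act.toFun (g * γ r, S.action.act.toFun ((γ r)⁻¹, S.fibre T y)) ∈ U
    rw [← S.action.mul_act, mul_inv_cancel_right]
    exact hy
  have hu : IsSmoothFam 𝓘(ℝ, EG) (S.tubeOpens T W) d (S.extendFam T s) := by
    have := T.extend.smoothFam (S.extend_compat T W) hs
    rwa [add_zero] at this
  have hC := S.transportFam_smooth T hT hu
  have ha : IsSmoothFam 𝓘(ℝ, ℝ) (cylinder ℝ (slice W g)) d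
      (pbFam φ hmem (S.transportFam T hT (S.extendFam T s))) :=
    hC.pb isOpen_univ hφ.contMDiffOn (fun _ _ => trivial) hmem
  have hd : ∀ r, HasFamDeriv 𝓘(ℝ, ℝ) (cylinder ℝ (slice W g))
      (pbFam φ hmem (S.transportFam T hT (S.extendFam T s))) r (1 : ℝ) 0 := by
    intro r
    let ξ : EG := mfderiv 𝓘(ℝ, ℝ) 𝓘(ℝ, EG) (fun r => (γ r)⁻¹) r (1 : ℝ)
    let η : EG := mfderiv 𝓘(ℝ, ℝ) 𝓘(ℝ, EG) (fun r => g * γ r) r (1 : ℝ)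
    -- the velocity of the curve is `τ` in the left trivialization, and that of the inverse curve
    -- is `-τ` in the right trivialization
    let τ : GroupLieAlgebra 𝓘(ℝ, EG) G := maurerCartan (g * γ r) η
    have d₁ := hφ₁.mdifferentiableAt (x := r) (by simp)
    have d₂ := hφ₂.mdifferentiableAt (x := r) (by simp)
    have hlτ : leftInvariant τ (g * γ r) = η := leftInvariant_maurerCartan _ _
    have hτ : τ ∈ subgroupLie EG H := by
      refine (mem_subgroupLie_iff hsub).2 ((mfderiv_mk_eq_zero_iff hsub τ (g * γ r)).1 ?_)
      rw [hlτ]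
      have hc := mfderiv_comp r (((contMDiff_mk hsub).mdifferentiableAt (by simp))) d₂
      have hconst : (QuotientGroup.mk : G → G ⧸ H) ∘ (fun r => g * γ r) =
          fun _ => QuotientGroup.mk g :=
        funext fun r => QuotientGroup.eq.2 (by simpa using hγH r)
      rw [hconst, mfderiv_const] at hc
      exact (congrArg (fun L => L (1 : ℝ)) hc).symm
    have hξ : (mfderiv 𝓘(ℝ, EG) 𝓘(ℝ, EG) (fun z : G => z * ((γ r)⁻¹)⁻¹) (γ r)⁻¹ ξ : EG) = -τ := by
      refine eq_neg_of_add_eq_zero_left (mfderiv_add_eq_zero_of_mul_eq_one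
        (c₁ := fun r' => (γ r')⁻¹ * ((γ r)⁻¹)⁻¹) (c₂ := fun r' => (g * γ r)⁻¹ * (g * γ r'))
        (hφ₁.mul contMDiff_const) (contMDiff_const.mul hφ₂) (fun r' => by group) (r := r)
        (by group) (by group) _ _ ?_ ?_)
      · have hc := mfderiv_comp r (((contMDiff_mul_right (I := 𝓘(ℝ, EG)) (n := ∞)
          (a := ((γ r)⁻¹)⁻¹)).mdifferentiableAt (by simp))) d₁
        exact (congrArg (fun L => L (1 : ℝ)) hc).symm
      · have hc := mfderiv_comp r (((contMDiff_mul_left (I := 𝓘(ℝ, EG)) (n := ∞)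
          (a := (g * γ r)⁻¹)).mdifferentiableAt (by simp))) d₂
        exact (congrArg (fun L => L (1 : ℝ)) hc).symm
    have hk : (γ r)⁻¹ ∈ H := H.inv_mem (hγH r)
    have hη : famDeriv 𝓘(ℝ, EG) (S.tubeOpens T W) (S.extendFam T s) (g * γ r) η =
        T.extend.D (slice W (g * γ r)) (slice (S.tubeOpens T W) (g * γ r))
          (S.extend_compat T W _)
          (famDeriv 𝓘(ℝ, EG) W s (g * γ r) η) :=
      (T.extend.hasFamDeriv (S.extend_compat T W) hs
        (hs.hasFamDeriv (g * γ r) η)).famDeriv_eq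
    have hsη : famDeriv 𝓘(ℝ, EG) W s (g * γ r) η = -(ρF τ).D (slice W (g * γ r)) (s (g * γ r)) := by
      have := congrFun (hflat τ hτ) (g * γ r)
      rw [hρ.covDeriv_leftInvariant, hlτ] at this
      exact eq_neg_of_add_eq_zero_left this
    have hadd := (S.hasFamDeriv_transportFam_left T hT hu (γ r)⁻¹ (g * γ r) ξ).add_vec
      (S.hasFamDeriv_transportFam_right T hT hu (γ r)⁻¹ (g * γ r) η)
    -- the first parameter contributes the fundamental vector field of `τ`, which acts as `ρF τ`
    -- since `τ` is tangent to `H`; the second contributes `-ρF τ` by covariant constancy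
    have h0 : F.res (S.le_orbitSlice T hT fun _ hy => hy) (famDeriv 𝓘(ℝ, EG) _
          (S.orbitFam T hT (slice (S.tubeOpens T W) (g * γ r)) (S.extendFam T s (g * γ r)))
          (γ r)⁻¹ ξ) +
        S.orbitPull T hT (γ r)⁻¹ (slice (S.tubeOpens T W) (g * γ r))
          (slice (S.transportOpens T hT (S.tubeOpens T W)) ((γ r)⁻¹, g * γ r)) (fun _ hy => hy)
          (famDeriv 𝓘(ℝ, EG) (S.tubeOpens T W) (S.extendFam T s) (g * γ r) η) = 0 := by
      rw [S.famDeriv_orbitFam_eq_fundamental T hT (γ r)⁻¹ ξ (hu.1 _) _ τ hξ, hη, hsη, map_neg,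
        map_neg]
      refine add_neg_eq_zero.2 ?_
      exact hρ.orbitPull_fundamental hsub (hs.1 (g * γ r)) hτ hk _
    have hv : mfderiv 𝓘(ℝ, ℝ) (𝓘(ℝ, EG).prod 𝓘(ℝ, EG)) φ r (1 : ℝ) =
        ((ξ, 0) : EG × EG) + ((0, η) : EG × EG) := by
      refine (congrArg (fun L => L (1 : ℝ)) (mfderiv_prodMk d₁ d₂)).trans ?_
      exact (Prod.ext (add_zero _) (zero_add _) : ((ξ, 0) : EG × EG) + (0, η) = (ξ, η)).symm
    have hpb := HasFamDeriv.pb (v := (1 : ℝ)) (t := 0) hC (hφ.mdifferentiableAt (x := r) (by simp))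
      hmem (by rw [hv]; exact h0 ▸ hadd)
    exact (map_zero (F.res (slice_le_slice hmem r))) ▸ hpb
  have hconst := GradedManifold.eq_of_hasFamDeriv_zero ha hd 0 1
  have e1 : S.transportFam T hT (S.extendFam T s) (φ 1) = 0 := by
    have : S.extendFam T s (g * γ 1) = 0 := (congrArg _ h1).trans (map_zero _)
    exact (congrArg _ this).trans (map_zero _)
  have e0 : ∀ k g', k = 1 → g' = g →
      ∀ hle : slice W g ≤ slice (S.transportOpens T hT (S.tubeOpens T W)) (k, g'),
      F.res hle (S.transportFam T hT (S.extendFam T s) (k, g')) = s g := by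
    rintro k g' rfl rfl hle
    refine (S.res_orbitPull T hT _ _ _ _).trans ((S.orbitPull_one T hT _ _).trans ?_)
    exact (S.fibrePull_extend T hT _ _ le_rfl).trans (res_self' _ _)
  refine (e0 (γ 0)⁻¹ (g * γ 0) (by simp [hγ0]) (by simp [hγ0])
    (slice_le_slice (W' := cylinder ℝ (slice W g)) hmem 0)).symm.trans ?_
  refine (res_res' _ _ _).symm.trans (hconst.trans ?_)
  refine (congrArg _ (congrArg _ e1)).trans ?_
  simp only [map_zero]

/-- A family which is covariantly constant along `H` and vanishes at `g` vanishes on `g H`: the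
elements of `H` for which this holds form a subgroup, which contains the end points of curves by
parallel transport. -/
theorem IsFibreAction.eq_zero_mul (hρ : S.IsFibreAction T hT ρF)
    (hsub : Manifold.IsSubmersion 𝓘(ℝ, EG) 𝓘(ℝ, EX) ∞ (QuotientGroup.mk : G → G ⧸ H))
    (hH : IsConnected (H : Set G))
    {U : Opens E.carrier} {d : ℤ} {s : F.Fam (S.orbitOpens T hT U)}
    (hs : IsSmoothFam 𝓘(ℝ, EG) (S.orbitOpens T hT U) d s)
    (hflat : ∀ t ∈ subgroupLie EG H, covDeriv ρF _ (leftInvariant t) s = 0) {g : G}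
    (h0 : s g = 0) {h : G} (hh : h ∈ H) : s (g * h) = 0 := by
  -- the equivalence, instead of an implication, makes the closure under inverses immediate
  let K : Subgroup G :=
    { carrier := {h | ∀ g, s g = 0 ↔ s (g * h) = 0}
      mul_mem' := fun {a b} ha hb g => by rw [← mul_assoc, ← hb, ← ha]
      one_mem' := fun g => by rw [mul_one]
      inv_mem' := fun {a} ha g => by rw [ha (g * a⁻¹), inv_mul_cancel_right] }
  refine (le_of_smooth_curves hsub hH K (fun γ hγ hγ0 hγH g => ⟨fun h1 => ?_, fun h1 =>
    hρ.eq_zero_of_curve hsub hs hflat hγ hγ0 hγH g h1⟩) hh g).1 h0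
  -- for the other direction the curve is traversed backwards
  refine hρ.eq_zero_of_curve hsub hs hflat (γ := fun r => (γ 1)⁻¹ * γ (1 - r))
    (contMDiff_const.mul (hγ.comp ?_)) (by simp) (fun r => H.mul_mem (H.inv_mem (hγH 1)) (hγH _))
    (g * γ 1) ?_
  · exact contMDiff_iff_contDiff.2 (contDiff_const.sub contDiff_id)
  · have : ∀ g', g' = g → s g' = 0 := by
      rintro _ rfl
      exact h1
    exact this _ (by simp [hγ0])

end HomogeneousGPDE

/-! ### Descent of functions along the orbit map -/

open GradedManifold

namespace HomogeneousGPDE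

variable {EG : Type w} {G : Type*} [NormedAddCommGroup EG] [NormedSpace ℝ EG]
  [FiniteDimensional ℝ EG] [TopologicalSpace G] [ChartedSpace EG G] [Group G]
  [LieGroup 𝓘(ℝ, EG) ∞ G]
  {EX : Type*} [NormedAddCommGroup EX] [NormedSpace ℝ EX] [FiniteDimensional ℝ EX]
  {H : Subgroup G} [ChartedSpace EX (G ⧸ H)] [IsManifold 𝓘(ℝ, EX) ∞ (G ⧸ H)]
  {F : GradedManifold.{u}} {E : GradedManifold.{v}}
  (S : HomogeneousGPDE EG EX H F E) (T : LocalTriv F S.toGradedOver)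
  (hT : (QuotientGroup.mk 1 : G ⧸ H) ∈ T.base)

/-- The pullback along the orbit map at `g` undoes the translation by `g⁻¹`. -/
theorem orbitPull_pull_inv (g : G) {U Z : Opens E.carrier} {W : Opens F.carrier}
    (hZ : ∀ b ∈ Z, (g⁻¹, b) ∈ S.action.act.dom ∧ S.action.act.toFun (g⁻¹, b) ∈ U)
    (h : ∀ y ∈ W, S.orbit T (g, y) ∈ Z) (h' : ∀ y ∈ W, S.fibre T y ∈ U) (u : E.O U) :
    S.orbitPull T hT g Z W h (S.action.act.pull g⁻¹ U Z hZ u) = S.fibrePull T hT U W h' u := by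
  have hle : S.action.preimage g Z ≤ U := fun b hb => by
    have h1 := (hZ _ hb).2
    rwa [S.act_inv_act] at h1
  have key : ∀ k, k = 1 → ∀ hk, S.action.act.pull k U (S.action.preimage g Z) hk u =
      E.res hle u := by
    rintro k rfl hk
    exact S.action.pull_one _ _ _ _ _
  have h2 := key (g⁻¹ * g) (inv_mul_cancel g) (fun b hb => ⟨S.act_mem_dom _ _, by
    rw [inv_mul_cancel, S.action.one_act]
    exact hle hb⟩)
  rw [S.action.pull_mul g⁻¹ g U Z (S.action.preimage g Z) _ (fun b hb => ⟨S.act_mem_dom _ _, hb⟩)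
    hZ u] at h2
  exact (congrArg (S.fibrePull T hT (S.action.preimage g Z) W h) h2).trans
    (T.map.pull_res _ _ _ _ _ _ _)

theorem res_orbitFam {U U' : Opens E.carrier} (hU : U' ≤ U) (f : E.O U) (g : G)
    (hle : slice (S.orbitOpens T hT U') g ≤ slice (S.orbitOpens T hT U) g) :
    F.res hle (S.orbitFam T hT U f g) = S.orbitFam T hT U' (E.res hU f) g :=
  (S.res_orbitPull T hT g hle _ f).trans (S.orbitPull_res T hT g hU _ f).symm

theorem orbitOpens_mono {U U' : Opens E.carrier} (hU : U' ≤ U) :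
    S.orbitOpens T hT U' ≤ S.orbitOpens T hT U := fun _ hq => hU hq

variable {S T hT} {ρF : GroupLieAlgebra 𝓘(ℝ, EG) G → VField F 0} [T2Space (G ⧸ H)]

/-- Pullbacks of functions are covariantly constant along `H`, because `l(t)` projects to zero. -/
theorem IsFibreAction.covDeriv_orbitFam_eq_zero (hρ : S.IsFibreAction T hT ρF)
    (hsub : Manifold.IsSubmersion 𝓘(ℝ, EG) 𝓘(ℝ, EX) ∞ (QuotientGroup.mk : G → G ⧸ H))
    {U : Opens E.carrier} {d : ℤ} {f : E.O U} (hf : f ∈ E.gr U d)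
    {t : GroupLieAlgebra 𝓘(ℝ, EG) G} (ht : t ∈ subgroupLie EG H) :
    covDeriv ρF (S.orbitOpens T hT U) (leftInvariant t) (S.orbitFam T hT U f) = 0 := by
  refine (hρ.covDeriv_orbitFam hsub (w := 0) (fun g => ((mfderiv_mk_eq_zero_iff hsub t g).2
    (mfderiv_mk_eq_zero_of_mem_subgroupLie hsub ht)).symm) hf).trans ?_
  rw [S.nabla.cov_zero]
  exact funext fun g => map_zero _

theorem covDeriv_res {W W' : Opens (G × F.carrier)}
    {d : ℤ} {s : F.Fam W} (hs : IsSmoothFam 𝓘(ℝ, EG) W d s) (hW : W' ≤ W) (v : Vect EG G) :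
    covDeriv ρF W' v (fun g => F.res (slice_mono hW g) (s g)) =
      fun g => F.res (slice_mono hW g) (covDeriv ρF W v s g) :=
  funext fun g => (congrArg₂ _ ((hs.hasFamDeriv g (v g)).res hW).famDeriv_eq
    ((ρF _).D_res _ _)).trans (map_add _ _ _).symm

variable [Nonempty (E.carrier → F.carrier)]

/-- Along a local section `σ` of `G → G ⧸ H`, every family of functions on `F` is the pullback of a
function on `E`, since `(x, y) ↦ σ(x) ι(y)` is an isomorphism. -/
theorem exists_orbitFam_section
    (hsub : Manifold.IsSubmersion 𝓘(ℝ, EG) 𝓘(ℝ, EX) ∞ (QuotientGroup.mk : G → G ⧸ H))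
    {U : Opens E.carrier} {d : ℤ} {s : F.Fam (S.orbitOpens T hT U)}
    (hs : IsSmoothFam 𝓘(ℝ, EG) (S.orbitOpens T hT U) d s) (T' : LocalTriv F S.toGradedOver)
    {V : Opens (G ⧸ H)} {σ : G ⧸ H → G} (hσ : ContMDiffOn 𝓘(ℝ, EX) 𝓘(ℝ, EG) ∞ σ V)
    (hσV : ∀ x ∈ V, (QuotientGroup.mk (σ x) : G ⧸ H) = x) {U' : Opens E.carrier} (hU : U' ≤ U)
    (hV : ∀ b ∈ U', S.proj b ∈ V ∧ S.proj b ∈ T'.base) :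
    ∃ f ∈ E.gr U' d, ∀ x ∈ V, x ∈ T'.base → S.orbitFam T hT U' f (σ x) =
      F.res (slice_mono (S.orbitOpens_mono T hT hU) (σ x)) (s (σ x)) := by
  let W := S.orbitOpens T hT U
  have hu : IsSmoothFam 𝓘(ℝ, EG) (S.tubeOpens T W) d (S.extendFam T s) := by
    have := T.extend.smoothFam (S.extend_compat T W) hs
    rwa [add_zero] at this
  -- the family `x ↦ (σ(x)⁻¹)^* s(σ(x))` of functions on `E`
  let Z : Opens ((G ⧸ H) × E.carrier) := ⟨{q | q.1 ∈ V} ∩ (fun q : (G ⧸ H) × E.carrier =>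
    (σ q.1, S.action.act.toFun ((σ q.1)⁻¹, q.2))) ⁻¹' S.tubeOpens T W, by
      have h1 : ContinuousOn (fun q : (G ⧸ H) × E.carrier => σ q.1) {q | q.1 ∈ V} :=
        hσ.continuousOn.comp continuousOn_fst fun q hq => hq
      have : IsTopologicalGroup G := topologicalGroup_of_lieGroup 𝓘(ℝ, EG) ∞
      exact (h1.prodMk (S.action.continuous_act.comp_continuousOn
        (h1.inv.prodMk continuousOn_snd))).isOpen_inter_preimage
        (V.isOpen.preimage continuous_fst) (S.tubeOpens T W).isOpen⟩
  have hZ : ∀ x, ∀ b ∈ slice Z x, ((σ x)⁻¹, b) ∈ S.action.act.dom ∧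
      S.action.act.toFun ((σ x)⁻¹, b) ∈ slice (S.tubeOpens T W) (σ x) :=
    fun x b hb => ⟨S.act_mem_dom _ _, hb.2⟩
  have hs3 := S.action.act.smooth_pull (J := 𝓘(ℝ, EX)) hu V.isOpen hσ hσ.inv (W' := Z)
    (fun _ hq => hq.1) hZ
  have hmemZ : ∀ x ∈ V, ∀ b ∈ U', S.proj b = x → (x, b) ∈ Z := by
    rintro x hx b hb rfl
    have hp := S.proj_act_inv (hσV _ hx)
    refine ⟨hx, show S.proj _ ∈ T.base by rw [hp]; exact hT, ?_⟩
    change S.orbit T (σ (S.proj b), T.snd (S.action.act.toFun ((σ (S.proj b))⁻¹, b))) ∈ U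
    rw [S.orbit_snd T hT (hσV _ hx)]
    exact hU hb
  -- the same family in the trivialization `T'`
  let Y : Opens ((G ⧸ H) × F.carrier) := ⟨T'.map.dom ∩ (fun q => (q.1, T'.map.toFun q)) ⁻¹' Z,
    (continuousOn_fst.prodMk T'.map.cont).isOpen_inter_preimage T'.map.dom.isOpen Z.isOpen⟩
  have hY : ∀ x, ∀ y ∈ slice Y x, (x, y) ∈ T'.map.dom ∧ T'.map.toFun (x, y) ∈ slice Z x :=
    fun x y hy => hy
  have hs4 := T'.map.smooth_pull (J := 𝓘(ℝ, EX)) hs3 isOpen_univ contMDiffOn_id contMDiffOn_id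
    (W' := Y) (fun _ _ => trivial) hY
  obtain ⟨f, hf, hfY⟩ := T'.exists_fn (U := U') (fun b hb => (hV b hb).2) (W := Y)
    (fun q hq => ⟨hq.1, by
      have h1 := T'.proj_map q.1 q.2 ((T'.mem_dom _ _).1 hq.1)
      exact hmemZ q.1 (h1 ▸ (hV _ hq.2).1) _ hq.2 h1⟩) hs4
  refine ⟨f, hf, fun x hxV hxT => ?_⟩
  let Ux : Opens E.carrier := U' ⊓ slice Z x
  have hU1 : Ux ≤ U' := inf_le_left
  have hU2 : Ux ≤ slice Z x := inf_le_right
  have hmemU : ∀ y ∈ slice (S.orbitOpens T hT U') (σ x), S.orbit T (σ x, y) ∈ Ux := fun y hy =>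
    ⟨hy, hmemZ x hxV (S.orbit T (σ x, y)) hy ((S.proj_orbit T _ y hT).trans (hσV x hxV))⟩
  have h0 := S.orbitPull_eq_zero_of_pull T hT hsub (g := σ x) T' (by rwa [hσV x hxV])
    (Submodule.sub_mem _ (E.sheaf.res_mem hU1 _ _ hf) (E.sheaf.res_mem hU2 _ _ (hs3.1 x))) (by
      rw [hσV x hxV]
      intro Y' hY'
      refine (map_sub _ _ _).trans (sub_eq_zero.2 ?_)
      refine (T'.map.pull_res x _ _ _ _ _ _).trans ((hfY x Y' fun y hy =>
        ⟨(hY' y hy).1, hU1 (hY' y hy).2⟩).trans ?_)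
      exact (T'.map.res_pull x _ _ _ _ _ _).trans (T'.map.pull_res x _ _ _ _ _ _).symm)
    (slice (S.orbitOpens T hT U') (σ x)) hmemU
  have h1 := sub_eq_zero.1 ((map_sub _ _ _).symm.trans h0)
  refine (S.orbitPull_res T hT (σ x) hU1 hmemU f).symm.trans (h1.trans ?_)
  have hfib : ∀ y ∈ slice (S.orbitOpens T hT U') (σ x),
      S.fibre T y ∈ slice (S.tubeOpens T W) (σ x) := fun y hy => by
    have h2 : (σ x, S.action.act.toFun ((σ x)⁻¹, S.orbit T (σ x, y))) ∈ S.tubeOpens T W :=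
      (hmemU y hy).2.2
    change (σ x, S.action.act.toFun ((σ x)⁻¹, S.action.act.toFun (σ x, S.fibre T y))) ∈
      S.tubeOpens T W at h2
    rwa [S.act_inv_act] at h2
  exact (S.orbitPull_res T hT (σ x) hU2 hmemU _).trans
    ((S.orbitPull_pull_inv T hT (σ x) (hZ x) _ hfib _).trans (S.fibrePull_extend T hT _ hfib _))

/-- A family on the preimage of `U` in `G × F` which is covariantly constant along `H` is the
pullback of a function on `U`. -/
theorem IsFibreAction.exists_orbitFam_eq (hρ : S.IsFibreAction T hT ρF)
    (hsub : Manifold.IsSubmersion 𝓘(ℝ, EG) 𝓘(ℝ, EX) ∞ (QuotientGroup.mk : G → G ⧸ H))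
    (hH : IsConnected (H : Set G))
    {U : Opens E.carrier} {d : ℤ} {s : F.Fam (S.orbitOpens T hT U)}
    (hs : IsSmoothFam 𝓘(ℝ, EG) (S.orbitOpens T hT U) d s)
    (hflat : ∀ t ∈ subgroupLie EG H, covDeriv ρF _ (leftInvariant t) s = 0) :
    ∃ f ∈ E.gr U d, S.orbitFam T hT U f = s := by
  -- locally the function is the one with the right pullback along a section; covariant constancy
  -- extends the equality from the section to all of `g H`
  have hloc : ∀ b : U, ∃ (U' : Opens E.carrier) (hU : U' ≤ U), b.1 ∈ U' ∧ ∃ f ∈ E.gr U' d,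
      ∀ g, S.orbitFam T hT U' f g = F.res (slice_mono (S.orbitOpens_mono T hT hU) g) (s g) := by
    rintro ⟨b, hb⟩
    obtain ⟨g₀, hg₀⟩ := QuotientGroup.mk_surjective (S.proj b)
    obtain ⟨T', hT'⟩ := S.locally_trivial (S.proj b)
    obtain ⟨V, σ, hV, hσ, hσV, -⟩ := exists_section hsub g₀
    rw [hg₀] at hV
    let U' : Opens E.carrier := U ⊓ ⟨S.proj ⁻¹' (V ⊓ T'.base),
      (V ⊓ T'.base).isOpen.preimage S.continuous_proj⟩
    have hU : U' ≤ U := inf_le_left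
    obtain ⟨f, hf, hfσ⟩ := exists_orbitFam_section hsub hs T' hσ hσV hU fun b hb => hb.2
    refine ⟨U', hU, ⟨hb, hV, hT'⟩, f, hf, fun g => ?_⟩
    let hle := S.orbitOpens_mono T hT hU
    have hs' := hs.res hle
    have hfs := S.orbitFam_smooth T hT hf
    by_cases hg : (QuotientGroup.mk g : G ⧸ H) ∈ V ⊓ T'.base
    · -- the difference is covariantly constant along `H` and vanishes at a point of `g H`
      have hδ : ∀ t ∈ subgroupLie EG H, covDeriv ρF (S.orbitOpens T hT U') (leftInvariant t)
          (S.orbitFam T hT U' f - fun g => F.res (slice_mono hle g) (s g)) = 0 := by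
        intro t ht
        refine ((hρ.covModule _).D_sub _ hfs hs').trans ?_
        refine (congrArg₂ _ (hρ.covDeriv_orbitFam_eq_zero hsub hf ht)
          (covDeriv_res hs hle _)).trans ?_
        rw [hflat t ht]
        funext g
        exact (congrArg _ (map_zero _)).trans (sub_zero _)
      have h0 := hρ.eq_zero_mul hsub hH (hfs.sub hs') hδ (g := σ (QuotientGroup.mk g))
        (sub_eq_zero.2 (hfσ _ hg.1 hg.2)) (h := (σ (QuotientGroup.mk g))⁻¹ * g)
        (QuotientGroup.eq.1 (hσV _ hg.1))
      have : ∀ g', g' = g → (S.orbitFam T hT U' f - fun g => F.res (slice_mono hle g) (s g)) g' = 0 →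
          S.orbitFam T hT U' f g = F.res (slice_mono hle g) (s g) := by
        rintro _ rfl h
        exact sub_eq_zero.1 h
      exact this _ (mul_inv_cancel_left _ _) h0
    · refine eq_of_local fun y hy => absurd ?_ hg
      have h1 := hy.2
      change S.proj (S.orbit T (g, y)) ∈ V ⊓ T'.base at h1
      rwa [S.proj_orbit T g y hT] at h1
  choose U' hU hmem f hf hfs using hloc
  -- the local functions agree on overlaps, as they have the same pullbacks
  obtain ⟨f₀, hf₀, hres⟩ := E.sheaf.gluing U U' hU hmem d f hf fun p q =>
    S.eq_of_orbitPull T hT hsub (E.sheaf.res_mem _ _ _ (hf p)) (E.sheaf.res_mem _ _ _ (hf q))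
      fun g W h => by
        have key : ∀ (p : U) (h : ∀ y ∈ W, S.orbit T (g, y) ∈ U' p)
            (hW : W ≤ slice (S.orbitOpens T hT U) g),
            S.orbitPull T hT g (U' p) W h (f p) = F.res hW (s g) := fun p h hW =>
          (S.res_orbitPull T hT g (S.le_orbitSlice T hT h) (fun _ hy => hy) _).symm.trans
            ((congrArg _ (hfs p g)).trans (res_res' _ _ _))
        have hp : ∀ y ∈ W, S.orbit T (g, y) ∈ U' p := fun y hy => (h y hy).1
        have hq : ∀ y ∈ W, S.orbit T (g, y) ∈ U' q := fun y hy => (h y hy).2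
        exact (S.orbitPull_res T hT g inf_le_left h _).trans ((key p hp fun y hy =>
          hU p (hp y hy)).trans ((S.orbitPull_res T hT g inf_le_right h _).trans
            (key q hq _)).symm)
  refine ⟨f₀, hf₀, funext fun g => eq_of_local fun y hy => ?_⟩
  let p : U := ⟨S.orbit T (g, y), hy⟩
  refine ⟨slice (S.orbitOpens T hT (U' p)) g, slice_mono (S.orbitOpens_mono T hT (hU p)) g,
    hmem p, ?_⟩
  rw [S.res_orbitFam T hT (hU p), hres p]
  exact hfs p g

end HomogeneousGPDE

/-! ### Basic forms -/

open GradedManifold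

theorem Vect.bracket_zero_left {EN N : Type*} [NormedAddCommGroup EN] [NormedSpace ℝ EN]
    [FiniteDimensional ℝ EN] [TopologicalSpace N] [ChartedSpace EN N] [IsManifold 𝓘(ℝ, EN) ∞ N]
    (w : Vect EN N) : bracket 0 w = 0 := by
  have := bracket_add_left 0 0 w
  rwa [add_zero, left_eq_add] at this

namespace HomogeneousGPDE

variable {EG : Type w} {G : Type*} [NormedAddCommGroup EG] [NormedSpace ℝ EG]
  [FiniteDimensional ℝ EG] [TopologicalSpace G] [ChartedSpace EG G] [Group G]
  [LieGroup 𝓘(ℝ, EG) ∞ G]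
  {EX : Type*} [NormedAddCommGroup EX] [NormedSpace ℝ EX] [FiniteDimensional ℝ EX]
  {H : Subgroup G} [ChartedSpace EX (G ⧸ H)] [IsManifold 𝓘(ℝ, EX) ∞ (G ⧸ H)]
  {F : GradedManifold.{u}} {E : GradedManifold.{v}}
  {S : HomogeneousGPDE EG EX H F E} {T : LocalTriv F S.toGradedOver}
  {hT : (QuotientGroup.mk 1 : G ⧸ H) ∈ T.base}
  {ρF : GroupLieAlgebra 𝓘(ℝ, EG) G → VField F 0} [T2Space (G ⧸ H)]

/-- The bracket of a projectable vector field with `l(t)`, for `t` in the Lie algebra of `H`, is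
vertical for `G → G ⧸ H`. -/
theorem mfderiv_mk_bracket_leftInvariant
    (hsub : Manifold.IsSubmersion 𝓘(ℝ, EG) 𝓘(ℝ, EX) ∞ (QuotientGroup.mk : G → G ⧸ H))
    {t : GroupLieAlgebra 𝓘(ℝ, EG) G} (ht : t ∈ subgroupLie EG H) {v : Vect EG G}
    {w : Vect EX (G ⧸ H)} (hw : ∀ g, w (QuotientGroup.mk g) =
      mfderiv 𝓘(ℝ, EG) 𝓘(ℝ, EX) (QuotientGroup.mk : G → G ⧸ H) g (v g)) (g : G) :
    mfderiv 𝓘(ℝ, EG) 𝓘(ℝ, EX) (QuotientGroup.mk : G → G ⧸ H) g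
      (Vect.bracket (leftInvariant t) v g) = 0 := by
  refine (bracket_related (contMDiff_mk hsub) (v' := 0) (fun g => ?_) hw g).symm.trans ?_
  · exact ((mfderiv_mk_eq_zero_iff hsub t g).2
      (mfderiv_mk_eq_zero_of_mem_subgroupLie hsub ht)).symm
  · rw [Vect.bracket_zero_left]
    rfl

/-- The lift of `l(t)` to `T[1]G` plus `ρ_F(t)` is the Lie derivative along `l(t)` of the covariant
derivative on `G × F`, as the Maurer–Cartan form has the constant value `t` on `l(t)`. -/
theorem IsFibreAction.lieDer_add_evenExt (hρ : S.IsFibreAction T hT ρF)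
    (t : GroupLieAlgebra 𝓘(ℝ, EG) G) {W : Opens (G × F.carrier)}
    (β : PreForm (Vect EG G) (F.Fam W)) :
    PreForm.lieDer Vect.bracket (dirDeriv W) (leftInvariant t) β +
      PreForm.evenExt (fibrewise (ρF t).D W) β =
    PreForm.lieDer Vect.bracket (covDeriv ρF W) (leftInvariant t) β := by
  funext p v g
  have h1 := hρ.covDeriv_leftInvariant t (β p v) g
  exact (sub_add_eq_add_sub _ _ _).trans (congrArg (fun z => z - (∑ i, β p (Function.update v i
    (Vect.bracket (leftInvariant t) (v i)))) g) h1).symm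

section Pullback

variable {U : Opens E.carrier} {d : ℤ} {α : PreForm (Vect EX (G ⧸ H)) (E.O U)}
  {β : PreForm (Vect EG G) (F.Fam (S.orbitOpens T hT U))}

/-- The pullback of a form vanishes on vertical vector fields. -/
theorem IsOrbitPullback.eq_zero_of_vertical (hα : IsHorizontalForm S.toGradedOver U d α)
    (h : S.IsOrbitPullback T hT U α β) {p : ℕ} {v : Fin p → Vect EG G} {g : G} (i : Fin p)
    (hi : mfderiv 𝓘(ℝ, EG) 𝓘(ℝ, EX) (QuotientGroup.mk : G → G ⧸ H) g (v i g) = 0) :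
    β p v g = 0 := by
  choose w hw using fun j => Vect.exists_apply_eq (QuotientGroup.mk g : G ⧸ H)
    (mfderiv 𝓘(ℝ, EG) 𝓘(ℝ, EX) (QuotientGroup.mk : G → G ⧸ H) g (v j g))
  have h0 : α p (Function.update w i 0) = 0 := by
    have := hα.2.1 p w i 0 0
    rwa [add_zero, left_eq_add] at this
  refine (h p g v (Function.update w i 0) fun j => ?_).trans ((congrArg _ h0).trans (map_zero _))
  by_cases hj : j = i
  · subst hj
    rw [Function.update_self, hi]
    rfl
  · rw [Function.update_of_ne hj, hw]

/-- Pullbacks are basic: on projectable vector fields the values of the pullback are pullbacks of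
functions, which are covariantly constant along `H`, and brackets with `l(t)` are vertical. -/
theorem IsOrbitPullback.isBasic (hρ : S.IsFibreAction T hT ρF)
    (hsub : Manifold.IsSubmersion 𝓘(ℝ, EG) 𝓘(ℝ, EX) ∞ (QuotientGroup.mk : G → G ⧸ H))
    (hα : IsHorizontalForm S.toGradedOver U d α) (hβ : IsProdForm (S.orbitOpens T hT U) d β)
    (h : S.IsOrbitPullback T hT U α β) : IsBasic H ρF (S.orbitOpens T hT U) β := by
  intro t ht
  have hv : ∀ g, mfderiv 𝓘(ℝ, EG) 𝓘(ℝ, EX) (QuotientGroup.mk : G → G ⧸ H) g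
      (leftInvariant t g) = 0 := fun g =>
    (mfderiv_mk_eq_zero_iff hsub t g).2 (mfderiv_mk_eq_zero_of_mem_subgroupLie hsub ht)
  refine ⟨?_, ?_⟩
  · rw [hρ.lieDer_add_evenExt]
    have hL : IsProdForm (S.orbitOpens T hT U) d
        (PreForm.lieDer Vect.bracket (covDeriv ρF _) (leftInvariant t) β) :=
      hρ.isForm_iff.1 (CovModule.IsForm.lieDer _ (hρ.isForm_iff.2 hβ))
    funext p v g
    -- both sides depend on the values at `g` only, so the fields may be taken projectable
    choose w hw using fun j => Vect.exists_apply_eq (QuotientGroup.mk g : G ⧸ H)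
      (mfderiv 𝓘(ℝ, EG) 𝓘(ℝ, EX) (QuotientGroup.mk : G → G ⧸ H) g (v j g))
    choose v' hv' hproj using fun j => exists_lift_apply_eq hsub (w j) g (v j g) (hw j)
    refine (hL.congr fun j => (hv' j).symm).trans ?_
    have h1 : covDeriv ρF (S.orbitOpens T hT U) (leftInvariant t) (β p v') = 0 := by
      rw [h.apply hproj]
      exact hρ.covDeriv_orbitFam_eq_zero hsub (hα.1 p w) ht
    have h2 : ∀ i, β p (Function.update v' i (Vect.bracket (leftInvariant t) (v' i))) = 0 :=
      fun i => funext fun g => h.eq_zero_of_vertical hα i (by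
        rw [Function.update_self]
        exact mfderiv_mk_bracket_leftInvariant hsub ht (hproj i) g)
    have h3 : PreForm.lieDer Vect.bracket (covDeriv ρF (S.orbitOpens T hT U)) (leftInvariant t)
        β p v' = 0 := by
      simp only [PreForm.lieDer, h1, h2, Finset.sum_const_zero, sub_zero]
    exact congrFun h3 g
  · funext p v g
    exact h.eq_zero_of_vertical hα 0 (hv g)

end Pullback

section Basic

variable {W : Opens (G × F.carrier)} {d : ℤ} {β : PreForm (Vect EG G) (F.Fam W)}

/-- The value of a basic form depends only on the projections of the vector fields to `G ⧸ H`. -/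
theorem IsBasic.congr (hρ : S.IsFibreAction T hT ρF)
    (hsub : Manifold.IsSubmersion 𝓘(ℝ, EG) 𝓘(ℝ, EX) ∞ (QuotientGroup.mk : G → G ⧸ H))
    (hβ : IsProdForm W d β) (hb : IsBasic H ρF W β) {g : G} {p : ℕ} {v v' : Fin p → Vect EG G}
    (h : ∀ i, mfderiv 𝓘(ℝ, EG) 𝓘(ℝ, EX) (QuotientGroup.mk : G → G ⧸ H) g (v i g) =
      mfderiv 𝓘(ℝ, EG) 𝓘(ℝ, EX) (QuotientGroup.mk : G → G ⧸ H) g (v' i g)) :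
    β p v g = β p v' g := by
  refine eq_of_update (L := fun v => β p v g) (r := fun z z' =>
    mfderiv 𝓘(ℝ, EG) 𝓘(ℝ, EX) (QuotientGroup.mk : G → G ⧸ H) g (z g) =
      mfderiv 𝓘(ℝ, EG) 𝓘(ℝ, EX) (QuotientGroup.mk : G → G ⧸ H) g (z' g))
    (fun u i z z' hz => ?_) h
  have hsplit := congrFun (hβ.2.1 p u i z' (z - z')) g
  rw [add_sub_cancel] at hsplit
  refine hsplit.trans ((congrArg (fun a => β p (Function.update u i z') g + a) ?_).trans
    (add_zero _))
  let τ : GroupLieAlgebra 𝓘(ℝ, EG) G := maurerCartan g ((z - z') g)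
  have hτ : leftInvariant τ g = (z - z') g := leftInvariant_maurerCartan _ _
  have hmem : τ ∈ subgroupLie EG H := by
    refine (mem_subgroupLie_iff hsub).2 ((mfderiv_mk_eq_zero_iff hsub τ g).1 ?_)
    rw [hτ]
    exact (ContinuousLinearMap.map_sub _ _ _).trans (sub_eq_zero.2 hz)
  refine (hβ.congr (v' := Function.update u i (leftInvariant τ)) fun j => ?_).trans ?_
  · by_cases hj : j = i
    · subst hj
      rw [Function.update_self, Function.update_self, hτ]
    · rw [Function.update_of_ne hj, Function.update_of_ne hj]
  · match p, u, i with
    | p + 1, u, i =>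
      have h1 := (hρ.isForm_iff.2 hβ).isAntisymm.cons_removeNth (leftInvariant τ) u i
      have h2 : β (p + 1) (Fin.cons (leftInvariant τ) (i.removeNth u)) = 0 :=
        congrFun (congrFun (hb τ hmem).2 p) (i.removeNth u)
      rw [h2] at h1
      have h3 : β (p + 1) (Function.update u i (leftInvariant τ)) = 0 := by
        rcases neg_one_pow_eq_or ℤ (i : ℕ) with hs | hs
        · rw [hs, one_smul] at h1
          exact h1.symm
        · rw [hs, neg_one_smul] at h1
          exact neg_eq_zero.1 h1.symm
      exact congrFun h3 g

/-- The values of a basic form on projectable vector fields are covariantly constant along `H`. -/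
theorem IsBasic.covDeriv_eq_zero (hρ : S.IsFibreAction T hT ρF)
    (hsub : Manifold.IsSubmersion 𝓘(ℝ, EG) 𝓘(ℝ, EX) ∞ (QuotientGroup.mk : G → G ⧸ H))
    (hβ : IsProdForm W d β) (hb : IsBasic H ρF W β) {p : ℕ} {v : Fin p → Vect EG G}
    {w : Fin p → Vect EX (G ⧸ H)} (hvw : ∀ i g, w i (QuotientGroup.mk g) =
      mfderiv 𝓘(ℝ, EG) 𝓘(ℝ, EX) (QuotientGroup.mk : G → G ⧸ H) g (v i g))
    {t : GroupLieAlgebra 𝓘(ℝ, EG) G} (ht : t ∈ subgroupLie EG H) :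
    covDeriv ρF W (leftInvariant t) (β p v) = 0 := by
  have h0 := congrFun (congrFun (hb t ht).1 p) v
  rw [hρ.lieDer_add_evenExt] at h0
  have h1 : ∀ i, β p (Function.update v i (Vect.bracket (leftInvariant t) (v i))) = 0 := by
    intro i
    have h2 : β p (Function.update v i 0) = 0 := by
      have := hβ.2.1 p v i 0 0
      rwa [add_zero, left_eq_add] at this
    refine Eq.trans (funext fun g => IsBasic.congr hρ hsub hβ hb fun j => ?_) h2
    by_cases hj : j = i
    · subst hj
      rw [Function.update_self, Function.update_self]
      exact (mfderiv_mk_bracket_leftInvariant hsub ht (hvw j) g).trans (map_zero _).symm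
    · rw [Function.update_of_ne hj, Function.update_of_ne hj]
  simp only [PreForm.lieDer, h1, Finset.sum_const_zero, sub_zero] at h0
  exact h0

end Basic

section Descent

variable {U : Opens E.carrier} {d : ℤ}
  {β : PreForm (Vect EG G) (F.Fam (S.orbitOpens T hT U))}

theorem eq_of_orbitFam
    (hsub : Manifold.IsSubmersion 𝓘(ℝ, EG) 𝓘(ℝ, EX) ∞ (QuotientGroup.mk : G → G ⧸ H))
    {f f' : E.O U} (hf : f ∈ E.gr U d) (hf' : f' ∈ E.gr U d)
    (h : ∀ g, S.orbitFam T hT U f g = S.orbitFam T hT U f' g) : f = f' :=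
  S.eq_of_orbitPull T hT hsub hf hf' fun g _ hW =>
    (S.res_orbitPull T hT g (S.le_orbitSlice T hT hW) (fun _ hy => hy) f).symm.trans
      ((congrArg _ (h g)).trans (S.res_orbitPull T hT g _ _ f'))

/-- Basic forms are pullbacks: their values on lifts of vector fields of the base descend, and do
not depend on the lifts. -/
theorem IsBasic.exists_isOrbitPullback [Nonempty (E.carrier → F.carrier)]
    (hρ : S.IsFibreAction T hT ρF)
    (hsub : Manifold.IsSubmersion 𝓘(ℝ, EG) 𝓘(ℝ, EX) ∞ (QuotientGroup.mk : G → G ⧸ H))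
    (hH : IsConnected (H : Set G)) (hβ : IsProdForm (S.orbitOpens T hT U) d β)
    (hb : IsBasic H ρF (S.orbitOpens T hT U) β) :
    ∃ α, IsHorizontalForm S.toGradedOver U d α ∧ S.IsOrbitPullback T hT U α β := by
  choose l hl using fun w : Vect EX (G ⧸ H) => exists_lift (EG := EG) hsub w
  choose α hα hαβ using fun p (w : Fin p → Vect EX (G ⧸ H)) =>
    hρ.exists_orbitFam_eq hsub hH (hβ.1 p fun i => l (w i)) fun t ht =>
      IsBasic.covDeriv_eq_zero hρ hsub hβ hb (w := w) (fun i => hl (w i)) ht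
  have hpb : ∀ (p : ℕ) (g : G) (v : Fin p → Vect EG G) (w : Fin p → Vect EX (G ⧸ H)),
      (∀ i, w i (QuotientGroup.mk g) =
        mfderiv 𝓘(ℝ, EG) 𝓘(ℝ, EX) (QuotientGroup.mk : G → G ⧸ H) g (v i g)) →
      β p v g = S.orbitFam T hT U (α p w) g := fun p g v w h =>
    (IsBasic.congr hρ hsub hβ hb fun i => (h i).symm.trans (hl (w i) g)).trans
      (congrFun (hαβ p w) g).symm
  -- lifts compatible with the replacement of one of the vector fields
  have hup : ∀ {p : ℕ} (w : Fin p → Vect EX (G ⧸ H)) (i : Fin p) (z : Vect EX (G ⧸ H))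
      (z' : Vect EG G) (g : G), z (QuotientGroup.mk g) =
        mfderiv 𝓘(ℝ, EG) 𝓘(ℝ, EX) (QuotientGroup.mk : G → G ⧸ H) g (z' g) →
      β p (Function.update (fun i => l (w i)) i z') g =
        S.orbitFam T hT U (α p (Function.update w i z)) g := fun w i z z' g h =>
    hpb _ g _ _ fun j => by
      by_cases hj : j = i
      · subst hj
        rw [Function.update_self, Function.update_self, h]
      · rw [Function.update_of_ne hj, Function.update_of_ne hj, hl]
  refine ⟨α, ⟨hα, fun p w i z z' => ?_, fun p w i z z' f hf => ?_, fun p w i j hij hw => ?_⟩, hpb⟩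
  · refine eq_of_orbitFam (T := T) (hT := hT) hsub (hα _ _) (Submodule.add_mem _ (hα _ _) (hα _ _)) fun g => ?_
    refine (hup w i (z + z') (l z + l z') g ?_).symm.trans ?_
    · exact (congrArg₂ (· + ·) (hl z g) (hl z' g)).trans (ContinuousLinearMap.map_add _ _ _).symm
    · refine (congrFun (hβ.2.1 p _ i (l z) (l z')) g).trans ?_
      exact (congrArg₂ (· + ·) (hup w i z (l z) g (hl z g)) (hup w i z' (l z') g (hl z' g))).trans
        (map_add _ _ _).symm
  · have hfm : S.fn U f * α p (Function.update w i z) ∈ E.gr U (d - p) := by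
      have := E.sheaf.mul_mem _ _ _ _ _ (S.fn_mem U f) (hα p (Function.update w i z))
      rwa [zero_add] at this
    refine eq_of_orbitFam (T := T) (hT := hT) hsub (hα _ _) hfm fun g => ?_
    let f' : C^∞⟮𝓘(ℝ, EG), G; ℝ⟯ := ⟨fun g => f (QuotientGroup.mk g),
      f.contMDiff.comp (contMDiff_mk hsub)⟩
    refine (hup w i z' (Vect.fsmul f' (l z)) g ?_).symm.trans ?_
    · refine (hf _).trans ((congrArg (fun a => f (QuotientGroup.mk g) • a) (hl z g)).trans ?_)
      exact (ContinuousLinearMap.map_smul _ _ _).symm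
    · refine (hβ.2.2.1 p _ i (l z) _ f' (fun _ => rfl) g).trans ?_
      refine (congrArg (fun a => f (QuotientGroup.mk g) • a) (hup w i z (l z) g (hl z g))).trans ?_
      exact (S.orbitPull_fn_mul T hT hsub g _ f _).symm
  · refine eq_of_orbitFam (T := T) (hT := hT) hsub (hα _ _) (Submodule.zero_mem _) fun g => ?_
    refine (congrFun (hαβ p w) g).trans ?_
    rw [hβ.2.2.2 p _ i j hij (congrArg l hw)]
    exact (map_zero _).symm

end Descent

end HomogeneousGPDE

end GradedGeom

end

theorem mainTheorem6
    {EG G : Type*} [NormedAddCommGroup EG] [NormedSpace ℝ EG] [FiniteDimensional ℝ EG]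
    [TopologicalSpace G] [T2Space G] [SecondCountableTopology G] [ChartedSpace EG G] [Group G]
    [LieGroup 𝓘(ℝ, EG) ∞ G]
    (H : Subgroup G) (hH_closed : IsClosed (H : Set G)) (hH_conn : IsConnected (H : Set G))
    {EX : Type*} [NormedAddCommGroup EX] [NormedSpace ℝ EX] [FiniteDimensional ℝ EX]
    [ChartedSpace EX (G ⧸ H)] [IsManifold 𝓘(ℝ, EX) ∞ (G ⧸ H)]
    (h_subm : Manifold.IsSubmersion 𝓘(ℝ, EG) 𝓘(ℝ, EX) ∞ (QuotientGroup.mk : G → G ⧸ H))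
    (F : GradedGeom.GradedManifold.{u}) (E : GradedGeom.GradedManifold.{v})
    (S : GradedGeom.HomogeneousGPDE EG EX H F E)
    (T : GradedGeom.LocalTriv F S.toGradedOver)
    (hT : (QuotientGroup.mk 1 : G ⧸ H) ∈ T.base)
    (ρF : GroupLieAlgebra 𝓘(ℝ, EG) G → GradedGeom.VField F 0)
    (hρ : S.IsFibreAction T hT ρF)
    (hMC : S.HasMaurerCartanForm T hT ρF) :
    ∃ qF : GradedGeom.VField F 1, S.IsFibreQ T hT qF ∧
      (∀ U f, qF.D U (qF.D U f) = 0) ∧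
      (∀ (W : TopologicalSpace.Opens (G × F.carrier)) d β, GradedGeom.IsProdForm W d β →
        GradedGeom.IsProdForm W (d + 1) (GradedGeom.prodQ ρF qF W β) ∧
        GradedGeom.prodQ ρF qF W (GradedGeom.prodQ ρF qF W β) = 0) ∧
      S.IsQuotient T hT ρF qF := by
  have := GradedGeom.t2Space_quotient EG hH_closed
  have := S.nonempty_fibreCoord T hT
  obtain ⟨qF, hq'⟩ := T.exists_restrict hT S.q S.q_vertical
  have hq : S.IsFibreQ T hT qF := fun U W h f =>
    hq' U W (fun y hy => ⟨(T.mem_dom _ _).2 hT, h y hy⟩) f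
  refine ⟨qF, hq, hq.sq_eq_zero, fun W d β hβ =>
    ⟨hρ.isProdForm_prodQ qF hβ, hq.prodQ_prodQ hρ h_subm hβ⟩, ?_⟩
  exact
    { isQuotientMap := S.isQuotientMap_orbit T hT h_subm
      orbit_eq_iff := S.orbit_eq_orbit_iff T hT
      exists_pullback := fun U d α hα => by
        obtain ⟨β, hβ, h⟩ := GradedGeom.HomogeneousGPDE.exists_orbitPullback h_subm hα
        exact ⟨β, ⟨hβ, h⟩, fun β' h' => h'.2.ext h⟩
      injective := fun U d α α' β hα hα' h h' => S.injective_orbitPullback T hT h_subm hα hα' h h'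
      range_eq := fun U d β hβ => ⟨fun ⟨α, hα, h⟩ => h.isBasic hρ h_subm hα hβ, fun hb =>
        GradedGeom.HomogeneousGPDE.IsBasic.exists_isOrbitPullback hρ h_subm hH_conn hβ hb⟩
      map_mul := fun U d d' α α' β β' _ _ _ _ h h' => h.mul h'
      map_Q := fun U d α β hα hβ h => h.totalQ hρ hq h_subm hα hβ }
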